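/- Let $n\ge 1$, let $\kappa\in\mathbb R$, and let $(X_1,g_1)$, $(X_2,g_2)$ be smooth Riemannian $n$-manifolds with boundary (Hausdorff, second countable, not necessarily compact, complete or connected) whose scalar curvatures satisfy $scal(g_1)>\kappa$ and $scal(g_2)>\kappa$ everywhere. Let $\gamma:\partial X_1\to\partial X_2$ be a diffeomorphism that is an isometry for the induced Riemannian metrics, and suppose that $$mn.curv_{\partial X_1}(y)+mn.curv_{\partial X_2}(\gamma(y))\ \ge\ 0\qquad\text{for all } y\in\partial X_1,$$ where the mean curvature is the trace of the second fundamental form with respect to the outward unit normal (so that the boundary of the unit ball in $\mathbb R^n$ has mean curvature $n-1$). Let $X=X_1\cup_\gamma X_2$ be the space obtained from $X_1\sqcup X_2$ by identifying every $y\in\partial X_1$ with $\gamma(y)\in\partial X_2$, let $S\subset X$ be the common image of the two boundaries (the seam), and let $X$ carry a smooth structure for which the inclusions $X_1\to X$ and $X_2\to X$ are smooth and for which $g_1$ and $g_2$ fit together to a continuous Riemannian metric $g$ on $X$ (that is, $g$ pulls back to $g_i$ on $X_i$). Then $g$ can be approximated by smooth Riemannian metrics of scalar curvature $>\kappa$ that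 agree with $g$ away from an arbitrarily small neighbourhood of the seam: for every open set $U\supset S$ and every $\varepsilon>0$ there is a smooth Riemannian metric $g_{app}$ on $X$ such that (1) $scal(g_{app})>\kappa$ everywhere on $X$; (2) $g_{app}=g$ on $X\setminus U$; (3) $|g_{app}(v,v)-g(v,v)|\le\varepsilon\, g(v,v)$ for all tangent vectors $v$ of $X$. In particular, for $\kappa=0$: positive scalar curvature of $X_1$ and $X_2$ is inherited by $X$, after a perturbation of $g$ near the seam. -/

import Mathlib

open scoped Manifold ContDiff Topology Matrix

noncomputable section

namespace Gluing

/-! ### Curvature of a metric tensor in coordinates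

`G x` is the matrix `(g_{ij}(x))` of a Riemannian metric in coordinates ranging over `s`, where `s`
is the whole of `ℝⁿ` or a half-space (derivatives at boundary points are taken within `s`). -/

section Coordinates

variable {n : ℕ}

/-- The partial derivative `∂ₖ f` at `x`, within `s`. -/
def pderivWithin (s : Set (EuclideanSpace ℝ (Fin n))) (k : Fin n)
    (f : EuclideanSpace ℝ (Fin n) → ℝ) (x : EuclideanSpace ℝ (Fin n)) : ℝ :=
  fderivWithin ℝ f s x (EuclideanSpace.single k 1)

/-- The Christoffel symbols
`Γᵏᵢⱼ = ½ ∑ₗ gᵏˡ (∂ᵢ gⱼₗ + ∂ⱼ gᵢₗ - ∂ₗ gᵢⱼ)` of the Levi-Civita connection. -/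
def christoffel (s : Set (EuclideanSpace ℝ (Fin n)))
    (G : EuclideanSpace ℝ (Fin n) → Matrix (Fin n) (Fin n) ℝ) (k i j : Fin n)
    (x : EuclideanSpace ℝ (Fin n)) : ℝ :=
  (1 / 2 : ℝ) * ∑ l, (G x)⁻¹ k l *
    (pderivWithin s i (fun z => G z j l) x + pderivWithin s j (fun z => G z i l) x
      - pderivWithin s l (fun z => G z i j) x)

/-- The Ricci tensor
`Ricᵢⱼ = ∑ₖ (∂ₖ Γᵏᵢⱼ - ∂ⱼ Γᵏᵢₖ) + ∑ₖ ∑ₗ (Γᵏₖₗ Γˡᵢⱼ - Γᵏⱼₗ Γˡᵢₖ)`. -/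
def ricci (s : Set (EuclideanSpace ℝ (Fin n)))
    (G : EuclideanSpace ℝ (Fin n) → Matrix (Fin n) (Fin n) ℝ) (i j : Fin n)
    (x : EuclideanSpace ℝ (Fin n)) : ℝ :=
  (∑ k, (pderivWithin s k (christoffel s G k i j) x - pderivWithin s j (christoffel s G k i k) x))
    + ∑ k, ∑ l, (christoffel s G k k l x * christoffel s G l i j x
        - christoffel s G k j l x * christoffel s G l i k x)

/-- The scalar curvature `∑ᵢⱼ gⁱʲ Ricᵢⱼ` (twice the Gauss curvature in dimension two). -/
def scalCoord (s : Set (EuclideanSpace ℝ (Fin n)))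
    (G : EuclideanSpace ℝ (Fin n) → Matrix (Fin n) (Fin n) ℝ)
    (x : EuclideanSpace ℝ (Fin n)) : ℝ :=
  ∑ i, ∑ j, (G x)⁻¹ i j * ricci s G i j x

/-- The mean curvature at `x` of the hypersurface `{x₀ = 0}`, as the boundary of the half-space
`{x₀ ≥ 0}`. The outward unit normal is the covector `ν = - dx₀ / √g⁰⁰`, the second fundamental form
is `A(eᵢ, eⱼ) = g(∇ᵢ ν, eⱼ) = - ν(∇ᵢ eⱼ) = Γ⁰ᵢⱼ / √g⁰⁰` for `i, j ≥ 1`, and the mean curvature is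
the trace of `A` with respect to the metric induced on the hypersurface. -/
def meanCurvCoord {m : ℕ} (s : Set (EuclideanSpace ℝ (Fin (m + 1))))
    (G : EuclideanSpace ℝ (Fin (m + 1)) → Matrix (Fin (m + 1)) (Fin (m + 1)) ℝ)
    (x : EuclideanSpace ℝ (Fin (m + 1))) : ℝ :=
  ∑ i : Fin m, ∑ j : Fin m, ((G x).submatrix Fin.succ Fin.succ)⁻¹ i j *
    (christoffel s G 0 i.succ j.succ x / Real.sqrt ((G x)⁻¹ 0 0))

end Coordinates

/-! ### Curvature on manifolds, possibly with boundary -/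

section Manifold

/-- Smooth Riemannian metrics on a manifold modelled on `ℝⁿ` through `I`. -/
abbrev SmoothMetric {n : ℕ} {H : Type*} [TopologicalSpace H]
    (I : ModelWithCorners ℝ (EuclideanSpace ℝ (Fin n)) H)
    (X : Type*) [TopologicalSpace X] [ChartedSpace H X] [IsManifold I ∞ X] :=
  Bundle.ContMDiffRiemannianMetric I ∞ (EuclideanSpace ℝ (Fin n))
    (fun x : X => TangentSpace I x)

/-- Continuous Riemannian metrics on a manifold modelled on `ℝⁿ` through `I`. -/
abbrev ContinuousMetric {n : ℕ} {H : Type*} [TopologicalSpace H]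
    (I : ModelWithCorners ℝ (EuclideanSpace ℝ (Fin n)) H)
    (X : Type*) [TopologicalSpace X] [ChartedSpace H X] [IsManifold I ∞ X] :=
  Bundle.ContinuousRiemannianMetric (EuclideanSpace ℝ (Fin n))
    (fun x : X => TangentSpace I x)

variable {n : ℕ} {H : Type*} [TopologicalSpace H]
  {I : ModelWithCorners ℝ (EuclideanSpace ℝ (Fin n)) H}
  {X : Type*} [TopologicalSpace X] [ChartedSpace H X] [IsManifold I ∞ X]

/-- The matrix of the metric `g` in the preferred chart at `p`, at the coordinate point `x`. -/
def metricInChart (g : SmoothMetric I X) (p : X) (x : EuclideanSpace ℝ (Fin n)) :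
    Matrix (Fin n) (Fin n) ℝ :=
  Matrix.of fun i j =>
    g.inner ((extChartAt I p).symm x)
      (mfderivWithin 𝓘(ℝ, EuclideanSpace ℝ (Fin n)) I (extChartAt I p).symm (Set.range I) x
        (EuclideanSpace.single i (1 : ℝ) : EuclideanSpace ℝ (Fin n)))
      (mfderivWithin 𝓘(ℝ, EuclideanSpace ℝ (Fin n)) I (extChartAt I p).symm (Set.range I) x
        (EuclideanSpace.single j (1 : ℝ) : EuclideanSpace ℝ (Fin n)))

/-- The scalar curvature of `g` at `p`. -/
def scal (g : SmoothMetric I X) (p : X) : ℝ :=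
  scalCoord (Set.range I) (metricInChart g p) (extChartAt I p p)

/-- The mean curvature at a boundary point `p` of the boundary of `X`: the trace of the second
fundamental form with respect to the outward unit normal, so that the boundary of the unit ball in
`ℝᵐ⁺¹` has mean curvature `m`. -/
def meanCurv {m : ℕ} {X : Type*} [TopologicalSpace X]
    [ChartedSpace (EuclideanHalfSpace (m + 1)) X] [IsManifold (𝓡∂ (m + 1)) ∞ X]
    (g : SmoothMetric (𝓡∂ (m + 1)) X) (p : X) : ℝ :=
  meanCurvCoord (Set.range (𝓡∂ (m + 1))) (metricInChart g p) (extChartAt (𝓡∂ (m + 1)) p p)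

/-- `j : Y → X` exhibits the `m`-manifold `Y` as the boundary of the `(m+1)`-manifold `X`. -/
structure IsBoundaryInclusion (m : ℕ) {Y X : Type*}
    [TopologicalSpace Y] [ChartedSpace (EuclideanSpace ℝ (Fin m)) Y]
    [TopologicalSpace X] [ChartedSpace (EuclideanHalfSpace (m + 1)) X] (j : Y → X) : Prop where
  isSmoothEmbedding : Manifold.IsSmoothEmbedding (𝓡 m) (𝓡∂ (m + 1)) ∞ j
  range_eq : Set.range j = (𝓡∂ (m + 1)).boundary X

/-- `γ : Y₁ → Y₂` preserves the Riemannian metrics induced from `g₁` on `Y₁ = ∂X₁` and from `g₂` on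
`Y₂ = ∂X₂`. -/
def IsBoundaryIsometry {m : ℕ} {Y₁ Y₂ X₁ X₂ : Type*}
    [TopologicalSpace Y₁] [ChartedSpace (EuclideanSpace ℝ (Fin m)) Y₁]
    [TopologicalSpace Y₂] [ChartedSpace (EuclideanSpace ℝ (Fin m)) Y₂]
    [TopologicalSpace X₁] [ChartedSpace (EuclideanHalfSpace (m + 1)) X₁]
    [IsManifold (𝓡∂ (m + 1)) ∞ X₁]
    [TopologicalSpace X₂] [ChartedSpace (EuclideanHalfSpace (m + 1)) X₂]
    [IsManifold (𝓡∂ (m + 1)) ∞ X₂]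
    (g₁ : SmoothMetric (𝓡∂ (m + 1)) X₁) (g₂ : SmoothMetric (𝓡∂ (m + 1)) X₂)
    (j₁ : Y₁ → X₁) (j₂ : Y₂ → X₂) (γ : Y₁ → Y₂) : Prop :=
  ∀ (y : Y₁) (v w : TangentSpace (𝓡 m) y),
    g₂.inner (j₂ (γ y))
      (mfderiv (𝓡 m) (𝓡∂ (m + 1)) j₂ (γ y) (mfderiv (𝓡 m) (𝓡 m) γ y v))
      (mfderiv (𝓡 m) (𝓡∂ (m + 1)) j₂ (γ y) (mfderiv (𝓡 m) (𝓡 m) γ y w)) =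
    g₁.inner (j₁ y) (mfderiv (𝓡 m) (𝓡∂ (m + 1)) j₁ y v) (mfderiv (𝓡 m) (𝓡∂ (m + 1)) j₁ y w)

end Manifold

/-! ### Gluing two spaces along their boundaries -/

section Glued

variable {Y₁ Y₂ X₁ X₂ : Type*}

/-- The relation on `X₁ ⊔ X₂` that identifies the boundary point `y` of `X₁` with the boundary
point `γ y` of `X₂`. -/
inductive GlueRel (j₁ : Y₁ → X₁) (j₂ : Y₂ → X₂) (γ : Y₁ → Y₂) : X₁ ⊕ X₂ → X₁ ⊕ X₂ → Prop
  | glue (y : Y₁) : GlueRel j₁ j₂ γ (Sum.inl (j₁ y)) (Sum.inr (j₂ (γ y)))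

/-- The glued space `X₁ ∪_γ X₂`, with the quotient topology. -/
def Glued (j₁ : Y₁ → X₁) (j₂ : Y₂ → X₂) (γ : Y₁ → Y₂) : Type _ :=
  Quot (GlueRel j₁ j₂ γ)

instance [TopologicalSpace X₁] [TopologicalSpace X₂]
    (j₁ : Y₁ → X₁) (j₂ : Y₂ → X₂) (γ : Y₁ → Y₂) : TopologicalSpace (Glued j₁ j₂ γ) :=
  inferInstanceAs (TopologicalSpace (Quot (GlueRel j₁ j₂ γ)))

/-- The canonical map `X₁ → X₁ ∪_γ X₂`. -/
def Glued.inl (j₁ : Y₁ → X₁) (j₂ : Y₂ → X₂) (γ : Y₁ → Y₂) (x : X₁) : Glued j₁ j₂ γ :=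
  Quot.mk _ (Sum.inl x)

/-- The canonical map `X₂ → X₁ ∪_γ X₂`. -/
def Glued.inr (j₁ : Y₁ → X₁) (j₂ : Y₂ → X₂) (γ : Y₁ → Y₂) (x : X₂) : Glued j₁ j₂ γ :=
  Quot.mk _ (Sum.inr x)

/-- The common image in `X₁ ∪_γ X₂` of the two boundaries. -/
def Glued.seam (j₁ : Y₁ → X₁) (j₂ : Y₂ → X₂) (γ : Y₁ → Y₂) : Set (Glued j₁ j₂ γ) :=
  Set.range fun y => Glued.inl j₁ j₂ γ (j₁ y)

/-- The smooth map `ι : X → M` between manifolds of the same dimension pulls the continuous metric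
`g` on `M` back to the smooth metric `gX` on `X`. -/
def RestrictsTo {n : ℕ} {H : Type*} [TopologicalSpace H]
    {I : ModelWithCorners ℝ (EuclideanSpace ℝ (Fin n)) H}
    {X : Type*} [TopologicalSpace X] [ChartedSpace H X] [IsManifold I ∞ X]
    {M : Type*} [TopologicalSpace M] [ChartedSpace (EuclideanSpace ℝ (Fin n)) M]
    [IsManifold (𝓡 n) ∞ M]
    (g : ContinuousMetric (𝓡 n) M) (ι : X → M) (gX : SmoothMetric I X) : Prop :=
  ∀ (x : X) (v w : TangentSpace I x),
    g.inner (ι x) (mfderiv I (𝓡 n) ι x v) (mfderiv I (𝓡 n) ι x w) = gX.inner x v w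

end Glued

end Gluing

end

/-! Along the seam `g` is continuous, but its normal derivative jumps. The sum of the two mean
curvatures is a negative multiple of the trace of this jump over the seam, so the hypothesis says
that the trace is `≤ 0` (`IsBoundaryUnion.jumpTrace_nonpos`). Heuristically, the scalar curvature of
`g` contains a nonnegative measure concentrated on the seam; smoothing spreads this measure over a
thin layer, where it can only help. Two `C⁰`-small perturbations supported in `U` make this precise.

The first one folds the metric (`PiecewiseMetric.exists_neg_jump`). Multiply `g` by `1 - |F|`, where
`F` is a small smooth function, `≤ 0` on one side, `≥ 0` on the other, and with positive transverse
derivative along the seam. On either side this is a small smooth conformal change, which preserves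
scalar curvature `> κ` (`eventually_lt_scalCoord_add`), while the trace of the jump drops by `2 m
∂₀F` (`jumpTrace_fold`) and becomes strictly negative. For `m = 0` nothing drops, but in dimension
one the scalar curvature vanishes identically and the jump is irrelevant; this explains the
condition `m = 0 ∨ j < 0`.

The second one smooths the edge (`PiecewiseMetric.exists_smooth`). In a chart with seam `{y₀ = 0}`,
replace `G` by `G(a) + G(b) - G(0)`, where only the height coordinate is displayed, `a = δ φ(y₀/δ) ≥
0`, `b = y₀ - a ≤ 0`, and `φ` is a convex smoothing of the positive part. Each term uses `G` only on
a side where it is smooth, and the result is `G` for `|y₀| ≥ δ`. Its second derivatives are bounded,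
except for the term `(φ''(y₀/δ)/δ)` times the jump times `dy₀²`. Scalar curvature is affine in the
second derivatives (`scalJet_add`), with value `-g⁰⁰ tr K` on `dy₀² ⊗ K`, the trace being taken over
the seam (`scalSymbol_normal`). So a negative jump contributes positively, and at order `1/δ`
wherever the slope `φ'` stays away from `0` and `1`. Where the slope tends to `0` or `1`, the
`2`-jet tends to that of one of the sides, whose scalar curvature exceeds `κ`. The dichotomy is
carried out along ultrafilters in `RampedMetric.eventually_lt_scalCoord_of_ultrafilter`, which
replaces quantitative estimates.

Smoothings in different charts, on different scales, are averaged with a partition of unity;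
therefore the local analysis treats weighted sums of interpolated metrics with several functions `t
i` that vanish on the seam. As nothing is compact, the scales are made locally small enough by
`exists_scales`.

It remains to know that scalar curvature does not depend on coordinates
(`IsMetricPullback.scalCoord_eq`), that `g` is smooth up to the seam from either side in charts of
`X` (`IsMetricEmbedding.smoothMatrixOn_coordMat`), and that charts of `X` straightening the seam
exist (`IsBoundaryUnion.exists_isSeamChart`). -/

noncomputable section

namespace Gluing

/-! ### Matrix-valued functions and the Levi-Civita connection in coordinates -/

section MatrixCalculus

variable {n : ℕ}

theorem pderivWithin_congr {s : Set (EuclideanSpace ℝ (Fin n))} {k : Fin n}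
    {f g : EuclideanSpace ℝ (Fin n) → ℝ} (h : Set.EqOn f g s) {x : EuclideanSpace ℝ (Fin n)}
    (hx : x ∈ s) : pderivWithin s k f x = pderivWithin s k g x := by
  unfold pderivWithin
  rw [fderivWithin_congr h (h hx)]

theorem pderivWithin_inter {s O : Set (EuclideanSpace ℝ (Fin n))} {k : Fin n}
    {f : EuclideanSpace ℝ (Fin n) → ℝ} {x : EuclideanSpace ℝ (Fin n)} (hO : O ∈ 𝓝 x) :
    pderivWithin (s ∩ O) k f x = pderivWithin s k f x := by
  unfold pderivWithin
  rw [fderivWithin_inter hO]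

theorem pderivWithin_add {s : Set (EuclideanSpace ℝ (Fin n))} {k : Fin n}
    {f g : EuclideanSpace ℝ (Fin n) → ℝ} {x : EuclideanSpace ℝ (Fin n)}
    (hs : UniqueDiffWithinAt ℝ s x) (hf : DifferentiableWithinAt ℝ f s x)
    (hg : DifferentiableWithinAt ℝ g s x) :
    pderivWithin s k (fun z => f z + g z) x = pderivWithin s k f x + pderivWithin s k g x := by
  unfold pderivWithin
  rw [fderivWithin_fun_add hs hf hg]; rfl

theorem pderivWithin_mul {s : Set (EuclideanSpace ℝ (Fin n))} {k : Fin n}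
    {f g : EuclideanSpace ℝ (Fin n) → ℝ} {x : EuclideanSpace ℝ (Fin n)}
    (hs : UniqueDiffWithinAt ℝ s x) (hf : DifferentiableWithinAt ℝ f s x)
    (hg : DifferentiableWithinAt ℝ g s x) :
    pderivWithin s k (fun z => f z * g z) x =
      pderivWithin s k f x * g x + f x * pderivWithin s k g x := by
  unfold pderivWithin
  rw [fderivWithin_fun_mul hs hf hg]
  simp; ring

theorem pderivWithin_const_mul {s : Set (EuclideanSpace ℝ (Fin n))} {k : Fin n}
    {f : EuclideanSpace ℝ (Fin n) → ℝ} {x : EuclideanSpace ℝ (Fin n)} (c : ℝ)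
    (hs : UniqueDiffWithinAt ℝ s x) (hf : DifferentiableWithinAt ℝ f s x) :
    pderivWithin s k (fun z => c * f z) x = c * pderivWithin s k f x := by
  unfold pderivWithin
  rw [fderivWithin_const_mul hs hf]
  simp

theorem pderivWithin_sum {ι : Type*} {s : Set (EuclideanSpace ℝ (Fin n))} {k : Fin n}
    {u : Finset ι} {f : ι → EuclideanSpace ℝ (Fin n) → ℝ} {x : EuclideanSpace ℝ (Fin n)}
    (hs : UniqueDiffWithinAt ℝ s x) (hf : ∀ i ∈ u, DifferentiableWithinAt ℝ (f i) s x) :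
    pderivWithin s k (fun z => ∑ i ∈ u, f i z) x = ∑ i ∈ u, pderivWithin s k (f i) x := by
  unfold pderivWithin
  rw [fderivWithin_fun_sum hs hf]
  simp

theorem pderivWithin_sub {s : Set (EuclideanSpace ℝ (Fin n))} {k : Fin n}
    {f g : EuclideanSpace ℝ (Fin n) → ℝ} {x : EuclideanSpace ℝ (Fin n)}
    (hs : UniqueDiffWithinAt ℝ s x) (hf : DifferentiableWithinAt ℝ f s x)
    (hg : DifferentiableWithinAt ℝ g s x) :
    pderivWithin s k (fun z => f z - g z) x = pderivWithin s k f x - pderivWithin s k g x := by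
  unfold pderivWithin
  rw [fderivWithin_fun_sub hs hf hg]; rfl

theorem pderivWithin_const {s : Set (EuclideanSpace ℝ (Fin n))} {k : Fin n} (c : ℝ)
    {x : EuclideanSpace ℝ (Fin n)} : pderivWithin s k (fun _ => c) x = 0 := by
  unfold pderivWithin
  simp

theorem contDiffOn_pderivWithin {s : Set (EuclideanSpace ℝ (Fin n))} {k : Fin n}
    {f : EuclideanSpace ℝ (Fin n) → ℝ} (hs : UniqueDiffOn ℝ s) (hf : ContDiffOn ℝ ∞ f s) :
    ContDiffOn ℝ ∞ (pderivWithin s k f) s :=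
  (hf.fderivWithin hs (by simp)).clm_apply contDiffOn_const

/-- Second derivatives remain symmetric at a boundary point because it is a limit of interior
points; this is why `IsMetricPullback` contains `subset_closure`. -/
theorem pderivWithin_comm {s : Set (EuclideanSpace ℝ (Fin n))} {k l : Fin n}
    {f : EuclideanSpace ℝ (Fin n) → ℝ} (hs : UniqueDiffOn ℝ s) (hf : ContDiffOn ℝ ∞ f s)
    {x : EuclideanSpace ℝ (Fin n)} (hx : x ∈ s) (hx' : x ∈ closure (interior s)) :
    pderivWithin s k (pderivWithin s l f) x = pderivWithin s l (pderivWithin s k f) x := by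
  have key : ∀ a b : Fin n, pderivWithin s a (pderivWithin s b f) x =
      fderivWithin ℝ (fderivWithin ℝ f s) s x (EuclideanSpace.single a 1)
        (EuclideanSpace.single b 1) := by
    intro a b
    have hd : DifferentiableWithinAt ℝ (fderivWithin ℝ f s) s x :=
      (hf.fderivWithin hs (m := ∞) (by simp)).differentiableOn (by simp) x hx
    unfold pderivWithin
    rw [fderivWithin_clm_apply (hs x hx) hd (differentiableWithinAt_const _)]
    simp
  rw [key, key]
  have h2 : minSmoothness ℝ 2 ≤ (∞ : WithTop ℕ∞) := by
    rw [minSmoothness_of_isRCLikeNormedField]; exact WithTop.coe_le_coe.2 (le_top : (2 : ℕ∞) ≤ ⊤)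
  exact (hf x hx).isSymmSndFDerivWithinAt h2 hs hx' hx _ _

/-- Expansion of a derivative along a vector in partial derivatives. -/
theorem fderivWithin_eq_sum_pderivWithin {s : Set (EuclideanSpace ℝ (Fin n))}
    {f : EuclideanSpace ℝ (Fin n) → ℝ} {x v : EuclideanSpace ℝ (Fin n)} :
    fderivWithin ℝ f s x v = ∑ a, v a * pderivWithin s a f x := by
  unfold pderivWithin
  conv_lhs => rw [← (EuclideanSpace.basisFun (Fin n) ℝ).sum_repr v]
  simp

/-- The Jacobian matrix `∂ᵢ ψᵃ` of a map, within `s`. -/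
def jacobian (s : Set (EuclideanSpace ℝ (Fin n)))
    (ψ : EuclideanSpace ℝ (Fin n) → EuclideanSpace ℝ (Fin n)) (x : EuclideanSpace ℝ (Fin n)) :
    Matrix (Fin n) (Fin n) ℝ :=
  Matrix.of fun a i => pderivWithin s i (fun z => ψ z a) x

theorem jacobian_apply_eq {s : Set (EuclideanSpace ℝ (Fin n))}
    {ψ : EuclideanSpace ℝ (Fin n) → EuclideanSpace ℝ (Fin n)} {x : EuclideanSpace ℝ (Fin n)}
    (hs : UniqueDiffWithinAt ℝ s x) (hψ : DifferentiableWithinAt ℝ ψ s x) (a i : Fin n) :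
    jacobian s ψ x a i = fderivWithin ℝ ψ s x (EuclideanSpace.single i 1) a := by
  have h : HasFDerivWithinAt (fun z => ψ z a)
      ((EuclideanSpace.proj (𝕜 := ℝ) a).comp (fderivWithin ℝ ψ s x)) s x :=
    (EuclideanSpace.proj (𝕜 := ℝ) a).hasFDerivAt.comp_hasFDerivWithinAt x hψ.hasFDerivWithinAt
  simp only [jacobian, Matrix.of_apply, pderivWithin]
  rw [h.fderivWithin hs]; rfl

theorem pderivWithin_comp {s s' : Set (EuclideanSpace ℝ (Fin n))} {k : Fin n}
    {f : EuclideanSpace ℝ (Fin n) → ℝ} {ψ : EuclideanSpace ℝ (Fin n) → EuclideanSpace ℝ (Fin n)}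
    {x : EuclideanSpace ℝ (Fin n)} (hs : UniqueDiffWithinAt ℝ s x)
    (hf : DifferentiableWithinAt ℝ f s' (ψ x)) (hψ : DifferentiableWithinAt ℝ ψ s x)
    (hm : Set.MapsTo ψ s s') :
    pderivWithin s k (fun z => f (ψ z)) x =
      ∑ a, jacobian s ψ x a k * pderivWithin s' a f (ψ x) := by
  have := fderivWithin_comp x hf hψ hm hs
  rw [pderivWithin, show (fun z => f (ψ z)) = f ∘ ψ from rfl, this, ContinuousLinearMap.comp_apply,
    fderivWithin_eq_sum_pderivWithin]
  exact Finset.sum_congr rfl fun a _ => by rw [jacobian_apply_eq hs hψ]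

/-- Entrywise partial derivative of a matrix-valued function. -/
def mpderiv (s : Set (EuclideanSpace ℝ (Fin n))) (k : Fin n)
    (M : EuclideanSpace ℝ (Fin n) → Matrix (Fin n) (Fin n) ℝ) (x : EuclideanSpace ℝ (Fin n)) :
    Matrix (Fin n) (Fin n) ℝ :=
  Matrix.of fun a b => pderivWithin s k (fun z => M z a b) x

/-- Smoothness of all entries of a matrix-valued function. -/
def SmoothMatrixOn (s : Set (EuclideanSpace ℝ (Fin n)))
    (M : EuclideanSpace ℝ (Fin n) → Matrix (Fin n) (Fin n) ℝ) : Prop :=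
  ∀ a b, ContDiffOn ℝ ∞ (fun z => M z a b) s

variable {s s' : Set (EuclideanSpace ℝ (Fin n))} {x : EuclideanSpace ℝ (Fin n)}
  {M N : EuclideanSpace ℝ (Fin n) → Matrix (Fin n) (Fin n) ℝ}

theorem SmoothMatrixOn.diff (h : SmoothMatrixOn s M) (a b : Fin n) (hx : x ∈ s) :
    DifferentiableWithinAt ℝ (fun z => M z a b) s x :=
  (h a b).differentiableOn (by simp) x hx

theorem SmoothMatrixOn.mono (h : SmoothMatrixOn s M) (hs : s' ⊆ s) : SmoothMatrixOn s' M :=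
  fun a b => (h a b).mono hs

theorem SmoothMatrixOn.congr (h : SmoothMatrixOn s M) (hMN : Set.EqOn N M s) :
    SmoothMatrixOn s N :=
  fun a b => (h a b).congr fun z hz => by rw [hMN hz]

theorem SmoothMatrixOn.mul (hM : SmoothMatrixOn s M) (hN : SmoothMatrixOn s N) :
    SmoothMatrixOn s (fun z => M z * N z) := by
  intro a b
  simp only [Matrix.mul_apply]
  exact ContDiffOn.sum fun c _ => (hM a c).mul (hN c b)

theorem SmoothMatrixOn.add (hM : SmoothMatrixOn s M) (hN : SmoothMatrixOn s N) :
    SmoothMatrixOn s (fun z => M z + N z) := fun a b => (hM a b).add (hN a b)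

theorem SmoothMatrixOn.transpose (hM : SmoothMatrixOn s M) :
    SmoothMatrixOn s (fun z => (M z)ᵀ) := fun a b => hM b a

theorem SmoothMatrixOn.mpderiv (hs : UniqueDiffOn ℝ s) (hM : SmoothMatrixOn s M) (k : Fin n) :
    SmoothMatrixOn s (mpderiv s k M) := fun a b => contDiffOn_pderivWithin hs (hM a b)

theorem SmoothMatrixOn.det (hM : SmoothMatrixOn s M) :
    ContDiffOn ℝ ∞ (fun z => (M z).det) s := by
  simp only [Matrix.det_apply]
  exact ContDiffOn.sum fun σ _ => (contDiffOn_prod fun i _ => hM _ _).const_smul _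

/-- Cramer's rule: an entry of the adjugate is the determinant of the matrix with one row replaced
by a basis vector. -/
theorem SmoothMatrixOn.inv (hM : SmoothMatrixOn s M) (hdet : ∀ z ∈ s, (M z).det ≠ 0) :
    SmoothMatrixOn s (fun z => (M z)⁻¹) := by
  intro a b
  simp only [Matrix.inv_def, Ring.inverse_eq_inv', Matrix.smul_apply, smul_eq_mul,
    Matrix.adjugate_apply]
  refine (hM.det.inv hdet).mul ?_
  refine SmoothMatrixOn.det (M := fun z => (M z).updateRow b (Pi.single a 1)) fun i j => ?_
  by_cases hi : i = b
  · subst hi; simpa using contDiffOn_const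
  · simpa [Matrix.updateRow_ne hi] using hM i j

theorem mpderiv_congr (h : Set.EqOn M N s) (hx : x ∈ s) (k : Fin n) :
    mpderiv s k M x = mpderiv s k N x := by
  ext a b
  exact pderivWithin_congr (fun z hz => by rw [h hz]) hx

theorem mpderiv_mul (hs : UniqueDiffOn ℝ s) (hM : SmoothMatrixOn s M) (hN : SmoothMatrixOn s N)
    (hx : x ∈ s) (k : Fin n) :
    mpderiv s k (fun z => M z * N z) x = mpderiv s k M x * N x + M x * mpderiv s k N x := by
  ext a b
  simp only [mpderiv, Matrix.of_apply, Matrix.mul_apply, Matrix.add_apply]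
  rw [pderivWithin_sum (f := fun c z => M z a c * N z c b) (hs x hx)
      fun c _ => (hM.diff a c hx).mul (hN.diff c b hx),
    ← Finset.sum_add_distrib]
  exact Finset.sum_congr rfl fun c _ =>
    pderivWithin_mul (hs x hx) (hM.diff a c hx) (hN.diff c b hx)

theorem mpderiv_add (hs : UniqueDiffOn ℝ s) (hM : SmoothMatrixOn s M) (hN : SmoothMatrixOn s N)
    (hx : x ∈ s) (k : Fin n) :
    mpderiv s k (fun z => M z + N z) x = mpderiv s k M x + mpderiv s k N x := by
  ext a b
  exact pderivWithin_add (hs x hx) (hM.diff a b hx) (hN.diff a b hx)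

theorem mpderiv_transpose (k : Fin n) :
    mpderiv s k (fun z => (M z)ᵀ) x = (mpderiv s k M x)ᵀ := rfl

theorem mpderiv_comm (hs : UniqueDiffOn ℝ s) (hM : SmoothMatrixOn s M) (hx : x ∈ s)
    (hx' : x ∈ closure (interior s)) (k l : Fin n) :
    mpderiv s k (mpderiv s l M) x = mpderiv s l (mpderiv s k M) x := by
  ext a b
  exact pderivWithin_comm hs (hM a b) hx hx'

/-- The Christoffel symbols with fixed direction of differentiation, as a matrix. -/
def chrMatrix (s : Set (EuclideanSpace ℝ (Fin n)))
    (G : EuclideanSpace ℝ (Fin n) → Matrix (Fin n) (Fin n) ℝ) (i : Fin n)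
    (x : EuclideanSpace ℝ (Fin n)) : Matrix (Fin n) (Fin n) ℝ :=
  Matrix.of fun k j => christoffel s G k i j x

variable {G : EuclideanSpace ℝ (Fin n) → Matrix (Fin n) (Fin n) ℝ}

theorem SmoothMatrixOn.chrMatrix (hs : UniqueDiffOn ℝ s) (hG : SmoothMatrixOn s G)
    (hdet : ∀ z ∈ s, (G z).det ≠ 0) (i : Fin n) : SmoothMatrixOn s (chrMatrix s G i) := by
  intro k j
  refine contDiffOn_const.mul (ContDiffOn.sum fun l _ => ((hG.inv hdet) k l).mul ?_)
  exact ((contDiffOn_pderivWithin hs (hG j l)).add (contDiffOn_pderivWithin hs (hG i l))).sub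
    (contDiffOn_pderivWithin hs (hG i j))

/-- Lowering the index gives the Christoffel symbols of the first kind, in which the inverse of `G`
no longer appears. -/
theorem mul_chrMatrix (hdet : (G x).det ≠ 0) (i a j : Fin n) :
    (G x * Gluing.chrMatrix s G i x) a j = 1 / 2 * (pderivWithin s i (fun z => G z j a) x
      + pderivWithin s j (fun z => G z i a) x - pderivWithin s a (fun z => G z i j) x) := by
  have h1 : Gluing.chrMatrix s G i x = (G x)⁻¹ * Matrix.of fun l j =>
      1 / 2 * (pderivWithin s i (fun z => G z j l) x + pderivWithin s j (fun z => G z i l) x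
      - pderivWithin s l (fun z => G z i j) x) := by
    ext k j
    simp only [Gluing.chrMatrix, christoffel, Matrix.of_apply, Matrix.mul_apply, Finset.mul_sum]
    exact Finset.sum_congr rfl fun l _ => by ring
  rw [h1, ← Matrix.mul_assoc, Matrix.mul_nonsing_inv _ (isUnit_iff_ne_zero.2 hdet), one_mul]
  rfl

/-- This is `∇g = 0`. -/
theorem mpderiv_metric (hsym : Set.EqOn (fun z => (G z)ᵀ) G s) (hx : x ∈ s)
    (hdet : (G x).det ≠ 0) (k : Fin n) :
    mpderiv s k G x = (Gluing.chrMatrix s G k x)ᵀ * G x + G x * Gluing.chrMatrix s G k x := by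
  have hs' : ∀ a b c, pderivWithin s c (fun z => G z a b) x = pderivWithin s c (fun z => G z b a) x :=
    fun a b c => pderivWithin_congr (fun z hz => by
      have := congrFun (congrFun (hsym hz) a) b
      simpa [Matrix.transpose_apply] using this.symm) hx
  have h1 : (Gluing.chrMatrix s G k x)ᵀ * G x = (G x * Gluing.chrMatrix s G k x)ᵀ := by
    rw [Matrix.transpose_mul, show (G x)ᵀ = G x from hsym hx]
  rw [h1]
  ext a b
  rw [Matrix.add_apply, Matrix.transpose_apply, mul_chrMatrix hdet, mul_chrMatrix hdet]
  simp only [mpderiv, Matrix.of_apply]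
  rw [hs' b a k, hs' k b a, hs' k a b]
  ring

/-- Koszul's argument. It allows the transformation law of the connection to be proved by checking
torsion-freeness and compatibility of a candidate, without differentiating an inverse matrix. -/
theorem chrMatrix_unique (hsym : Set.EqOn (fun z => (G z)ᵀ) G s) (hx : x ∈ s)
    (hdet : (G x).det ≠ 0) (C : Fin n → Matrix (Fin n) (Fin n) ℝ)
    (hC : ∀ i j k, C i k j = C j k i)
    (hcompat : ∀ k, mpderiv s k G x = (C k)ᵀ * G x + G x * C k) (i : Fin n) :
    C i = Gluing.chrMatrix s G i x := by
  have hGs : (G x)ᵀ = G x := hsym hx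
  have hcan : G x * C i = G x * Gluing.chrMatrix s G i x := by
    have h1 : ∀ k a b, pderivWithin s k (fun z => G z a b) x =
        (G x * C k) b a + (G x * C k) a b := by
      intro k a b
      have := congrFun (congrFun (hcompat k) a) b
      rw [show (C k)ᵀ * G x = (G x * C k)ᵀ by rw [Matrix.transpose_mul, hGs], Matrix.add_apply,
        Matrix.transpose_apply] at this
      exact this
    have h2 : ∀ a k b, (G x * C k) a b = (G x * C b) a k := by
      intro a k b
      simp only [Matrix.mul_apply]
      exact Finset.sum_congr rfl fun l _ => by rw [hC]
    ext a j
    -- The alternating sum of the three compatibility equations: by symmetry of `C`, four of the six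
    -- terms cancel and the other two agree.
    rw [mul_chrMatrix hdet, h1, h1, h1, h2 j i a, h2 i j a, h2 a j i]
    ring
  have := congrArg (fun A => (G x)⁻¹ * A) hcan
  simpa only [← Matrix.mul_assoc, Matrix.nonsing_inv_mul _ (isUnit_iff_ne_zero.2 hdet),
    one_mul] using this

end MatrixCalculus

end Gluing

namespace Gluing

/-! ### Invariance of the scalar curvature under changes of coordinates -/

section Transformation

variable {n : ℕ}

/-- The metric `G` on `s` is the pull-back of the metric `G'` on `s'` under the immersion `ψ`. -/
structure IsMetricPullback (s s' : Set (EuclideanSpace ℝ (Fin n)))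
    (ψ : EuclideanSpace ℝ (Fin n) → EuclideanSpace ℝ (Fin n))
    (G G' : EuclideanSpace ℝ (Fin n) → Matrix (Fin n) (Fin n) ℝ) : Prop where
  uniqueDiffOn : UniqueDiffOn ℝ s
  uniqueDiffOn' : UniqueDiffOn ℝ s'
  subset_closure : s ⊆ closure (interior s)
  contDiffOn : ContDiffOn ℝ ∞ ψ s
  mapsTo : Set.MapsTo ψ s s'
  smooth' : SmoothMatrixOn s' G'
  symm' : Set.EqOn (fun z => (G' z)ᵀ) G' s'
  det_ne' : ∀ z ∈ s', (G' z).det ≠ 0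
  det_jacobian_ne : ∀ z ∈ s, (jacobian s ψ z).det ≠ 0
  eq : Set.EqOn G (fun z => (jacobian s ψ z)ᵀ * G' (ψ z) * jacobian s ψ z) s

variable {s s' : Set (EuclideanSpace ℝ (Fin n))}
  {ψ : EuclideanSpace ℝ (Fin n) → EuclideanSpace ℝ (Fin n)}
  {G G' : EuclideanSpace ℝ (Fin n) → Matrix (Fin n) (Fin n) ℝ} {x : EuclideanSpace ℝ (Fin n)}

theorem contDiffOn_coord (hψ : ContDiffOn ℝ ∞ ψ s) (a : Fin n) :
    ContDiffOn ℝ ∞ (fun z => ψ z a) s :=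
  (EuclideanSpace.proj (𝕜 := ℝ) a).contDiff.comp_contDiffOn hψ

theorem smoothMatrixOn_jacobian (hs : UniqueDiffOn ℝ s) (hψ : ContDiffOn ℝ ∞ ψ s) :
    SmoothMatrixOn s (jacobian s ψ) := fun a _ =>
  contDiffOn_pderivWithin hs (contDiffOn_coord hψ a)

theorem SmoothMatrixOn.comp {M : EuclideanSpace ℝ (Fin n) → Matrix (Fin n) (Fin n) ℝ}
    (hM : SmoothMatrixOn s' M) (hψ : ContDiffOn ℝ ∞ ψ s) (hm : Set.MapsTo ψ s s') :
    SmoothMatrixOn s (fun z => M (ψ z)) := fun a b => (hM a b).comp hψ hm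

theorem mpderiv_jacobian (hs : UniqueDiffOn ℝ s) (hψ : ContDiffOn ℝ ∞ ψ s) (hx : x ∈ s)
    (hx' : x ∈ closure (interior s)) (a i j : Fin n) :
    mpderiv s i (jacobian s ψ) x a j = mpderiv s j (jacobian s ψ) x a i :=
  pderivWithin_comm hs (contDiffOn_coord hψ a) hx hx'

theorem mpderiv_comp {M : EuclideanSpace ℝ (Fin n) → Matrix (Fin n) (Fin n) ℝ}
    (hs : UniqueDiffOn ℝ s) (hM : SmoothMatrixOn s' M) (hψ : ContDiffOn ℝ ∞ ψ s)
    (hm : Set.MapsTo ψ s s') (hx : x ∈ s) (k : Fin n) :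
    mpderiv s k (fun z => M (ψ z)) x = ∑ b, jacobian s ψ x b k • mpderiv s' b M (ψ x) := by
  ext p q
  simp only [Matrix.sum_apply, Matrix.smul_apply, smul_eq_mul]
  exact pderivWithin_comp (hs x hx) (hM.diff p q (hm hx)) (hψ.differentiableOn (by simp) x hx) hm

theorem SmoothMatrixOn.smul_sum {ι : Type*} [Fintype ι] {f : ι → EuclideanSpace ℝ (Fin n) → ℝ}
    {M : ι → EuclideanSpace ℝ (Fin n) → Matrix (Fin n) (Fin n) ℝ}
    (hf : ∀ i, ContDiffOn ℝ ∞ (f i) s) (hM : ∀ i, SmoothMatrixOn s (M i)) :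
    SmoothMatrixOn s (fun z => ∑ i, f i z • M i z) := by
  intro a b
  simp only [Matrix.sum_apply, Matrix.smul_apply, smul_eq_mul]
  exact ContDiffOn.sum fun i _ => (hf i).mul (hM i a b)

theorem mpderiv_smul_sum {ι : Type*} [Fintype ι] {f : ι → EuclideanSpace ℝ (Fin n) → ℝ}
    {M : ι → EuclideanSpace ℝ (Fin n) → Matrix (Fin n) (Fin n) ℝ} (hs : UniqueDiffOn ℝ s)
    (hf : ∀ i, ContDiffOn ℝ ∞ (f i) s) (hM : ∀ i, SmoothMatrixOn s (M i)) (hx : x ∈ s)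
    (k : Fin n) :
    mpderiv s k (fun z => ∑ i, f i z • M i z) x =
      ∑ i, (pderivWithin s k (f i) x • M i x + f i x • mpderiv s k (M i) x) := by
  ext a b
  simp only [mpderiv, Matrix.of_apply, Matrix.sum_apply, Matrix.add_apply, Matrix.smul_apply,
    smul_eq_mul]
  rw [pderivWithin_sum (f := fun i z => f i z * M i z a b) (hs x hx) fun i _ =>
    ((hf i).differentiableOn (by simp) x hx).mul ((hM i).diff a b hx)]
  exact Finset.sum_congr rfl fun i _ => pderivWithin_mul (hs x hx)
    ((hf i).differentiableOn (by simp) x hx) ((hM i).diff a b hx)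

/-- The pull-back of the connection matrices. -/
def pullbackConnection (s s' : Set (EuclideanSpace ℝ (Fin n)))
    (ψ : EuclideanSpace ℝ (Fin n) → EuclideanSpace ℝ (Fin n))
    (G' : EuclideanSpace ℝ (Fin n) → Matrix (Fin n) (Fin n) ℝ) (i : Fin n)
    (x : EuclideanSpace ℝ (Fin n)) : Matrix (Fin n) (Fin n) ℝ :=
  ∑ b, jacobian s ψ x b i • chrMatrix s' G' b (ψ x)

theorem christoffel_symm (hsym : Set.EqOn (fun z => (G z)ᵀ) G s) (hx : x ∈ s) (k i j : Fin n) :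
    christoffel s G k i j x = christoffel s G k j i x := by
  unfold christoffel
  congr 1
  refine Finset.sum_congr rfl fun l _ => ?_
  rw [pderivWithin_congr (k := l) (f := fun z => G z i j) (g := fun z => G z j i) (fun z hz => by
    have := congrFun (congrFun (hsym hz) j) i
    simpa [Matrix.transpose_apply] using this) hx]
  ring

theorem IsMetricPullback.symm (h : IsMetricPullback s s' ψ G G') :
    Set.EqOn (fun z => (G z)ᵀ) G s := by
  intro z hz
  simp only [h.eq hz, Matrix.transpose_mul, Matrix.transpose_transpose, Matrix.mul_assoc]
  rw [show (G' (ψ z))ᵀ = G' (ψ z) from h.symm' (h.mapsTo hz)]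

theorem IsMetricPullback.det_ne (h : IsMetricPullback s s' ψ G G') (z) (hz : z ∈ s) :
    (G z).det ≠ 0 := by
  rw [h.eq hz]
  simp only [Matrix.det_mul, Matrix.det_transpose]
  exact mul_ne_zero (mul_ne_zero (h.det_jacobian_ne z hz) (h.det_ne' _ (h.mapsTo hz)))
    (h.det_jacobian_ne z hz)

theorem IsMetricPullback.smoothJ (h : IsMetricPullback s s' ψ G G') :
    SmoothMatrixOn s (jacobian s ψ) := smoothMatrixOn_jacobian h.uniqueDiffOn h.contDiffOn

theorem IsMetricPullback.smooth (h : IsMetricPullback s s' ψ G G') : SmoothMatrixOn s G :=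
  ((h.smoothJ.transpose.mul (h.smooth'.comp h.contDiffOn h.mapsTo)).mul h.smoothJ).congr h.eq

theorem IsMetricPullback.smooth_pullbackConnection (h : IsMetricPullback s s' ψ G G') (i : Fin n) :
    SmoothMatrixOn s (pullbackConnection s s' ψ G' i) :=
  SmoothMatrixOn.smul_sum (fun b => h.smoothJ b i) fun b =>
    (SmoothMatrixOn.chrMatrix h.uniqueDiffOn' h.smooth' h.det_ne' b).comp h.contDiffOn h.mapsTo

/-- The transformation law of the Levi-Civita connection. -/
theorem IsMetricPullback.jacobian_mul_chrMatrix (h : IsMetricPullback s s' ψ G G') (hx : x ∈ s)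
    (i : Fin n) :
    jacobian s ψ x * chrMatrix s G i x =
      pullbackConnection s s' ψ G' i x * jacobian s ψ x + mpderiv s i (jacobian s ψ) x := by
  set J := jacobian s ψ x with hJ
  have hJu : IsUnit J.det := isUnit_iff_ne_zero.2 (h.det_jacobian_ne x hx)
  have hinv : J * J⁻¹ = 1 := Matrix.mul_nonsing_inv _ hJu
  have hinvT : (J⁻¹)ᵀ * Jᵀ = 1 := by rw [← Matrix.transpose_mul, hinv, Matrix.transpose_one]
  have hinvT' : Jᵀ * (J⁻¹)ᵀ = 1 := by
    rw [← Matrix.transpose_mul, Matrix.nonsing_inv_mul _ hJu, Matrix.transpose_one]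
  -- `J⁻¹ * T k` is the candidate for the connection upstairs. It is symmetric because `ψ` has
  -- symmetric second derivatives and the connection downstairs has no torsion.
  let T : Fin n → Matrix (Fin n) (Fin n) ℝ := fun k =>
    pullbackConnection s s' ψ G' k x * J + mpderiv s k (jacobian s ψ) x
  have hTsymm : ∀ a k j, T k a j = T j a k := by
    intro a k j
    simp only [T, Matrix.add_apply, mpderiv_jacobian h.uniqueDiffOn h.contDiffOn hx
      (h.subset_closure hx) a k j]
    congr 1
    simp only [pullbackConnection, Matrix.mul_apply, Matrix.sum_apply, Matrix.smul_apply,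
      smul_eq_mul, Finset.sum_mul]
    rw [Finset.sum_comm]
    refine Finset.sum_congr rfl fun b _ => Finset.sum_congr rfl fun c _ => ?_
    rw [show chrMatrix s' G' c (ψ x) a b = chrMatrix s' G' b (ψ x) a c from
      christoffel_symm h.symm' (h.mapsTo hx) _ _ _]
    ring
  have hmain := chrMatrix_unique h.symm hx (h.det_ne x hx) (fun k => J⁻¹ * T k) ?_ ?_ i
  · rw [← hmain, ← Matrix.mul_assoc, hinv, one_mul]
  · intro k a j
    simp only [Matrix.mul_apply]
    exact Finset.sum_congr rfl fun l _ => by rw [hTsymm]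
  · intro k
    rw [mpderiv_congr h.eq hx, mpderiv_mul h.uniqueDiffOn
      (h.smoothJ.transpose.mul (h.smooth'.comp h.contDiffOn h.mapsTo)) h.smoothJ hx,
      mpderiv_mul h.uniqueDiffOn h.smoothJ.transpose (h.smooth'.comp h.contDiffOn h.mapsTo) hx,
      mpderiv_transpose, mpderiv_comp h.uniqueDiffOn h.smooth' h.contDiffOn h.mapsTo hx, h.eq hx]
    have hω : ∑ b, jacobian s ψ x b k • mpderiv s' b G' (ψ x) =
        (pullbackConnection s s' ψ G' k x)ᵀ * G' (ψ x) +
          G' (ψ x) * pullbackConnection s s' ψ G' k x := by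
      simp only [pullbackConnection, Matrix.transpose_sum, Matrix.transpose_smul, Finset.sum_mul,
        Finset.mul_sum, ← Finset.sum_add_distrib]
      refine Finset.sum_congr rfl fun b _ => ?_
      rw [mpderiv_metric h.symm' (h.mapsTo hx) (h.det_ne' _ (h.mapsTo hx)), smul_add,
        Matrix.smul_mul, Matrix.mul_smul]
    rw [hω, ← hJ]
    simp only [T]
    generalize pullbackConnection s s' ψ G' k x = W
    generalize mpderiv s k (jacobian s ψ) x = D
    generalize G' (ψ x) = g
    rw [Matrix.transpose_mul]
    have e1 : (W * J + D)ᵀ * (J⁻¹)ᵀ * (Jᵀ * g * J) = (W * J + D)ᵀ * (g * J) := by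
      rw [Matrix.mul_assoc, ← Matrix.mul_assoc (J⁻¹)ᵀ, ← Matrix.mul_assoc (J⁻¹)ᵀ, hinvT, one_mul]
    have e2 : (Jᵀ * g * J) * (J⁻¹ * (W * J + D)) = Jᵀ * g * (W * J + D) := by
      rw [Matrix.mul_assoc, ← Matrix.mul_assoc J, hinv, one_mul]
    rw [e1, e2, Matrix.transpose_add, Matrix.transpose_mul]
    noncomm_ring

/-- The curvature matrices of the Levi-Civita connection. -/
def curvMatrix (s : Set (EuclideanSpace ℝ (Fin n)))
    (G : EuclideanSpace ℝ (Fin n) → Matrix (Fin n) (Fin n) ℝ) (i j : Fin n)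
    (x : EuclideanSpace ℝ (Fin n)) : Matrix (Fin n) (Fin n) ℝ :=
  mpderiv s i (chrMatrix s G j) x - mpderiv s j (chrMatrix s G i) x
    + chrMatrix s G i x * chrMatrix s G j x - chrMatrix s G j x * chrMatrix s G i x

/-- Ricci is the contraction of the first direction of the curvature with its upper index; symmetry
of `Γ` in the lower indices reconciles the two orders of indices. -/
theorem ricci_eq_sum_curvMatrix (hsym : Set.EqOn (fun z => (G z)ᵀ) G s) (hx : x ∈ s)
    (i j : Fin n) : ricci s G i j x = ∑ k, curvMatrix s G k j x k i := by
  unfold ricci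
  rw [← Finset.sum_add_distrib]
  refine Finset.sum_congr rfl fun k _ => ?_
  simp only [curvMatrix, Matrix.sub_apply, Matrix.add_apply, Matrix.mul_apply, mpderiv,
    Matrix.of_apply, chrMatrix, Finset.sum_sub_distrib]
  rw [pderivWithin_congr (k := k) (f := christoffel s G k i j) (g := christoffel s G k j i)
    (fun z hz => christoffel_symm hsym hz _ _ _) hx,
    pderivWithin_congr (k := j) (f := christoffel s G k i k) (g := christoffel s G k k i)
    (fun z hz => christoffel_symm hsym hz _ _ _) hx]
  have e1 : ∀ l, christoffel s G l i j x = christoffel s G l j i x :=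
    fun l => christoffel_symm hsym hx _ _ _
  have e2 : ∀ l, christoffel s G l i k x = christoffel s G l k i x :=
    fun l => christoffel_symm hsym hx _ _ _
  simp only [e1, e2]
  ring

/-- Curvature is a tensor: write the law of the connection as `J Γ = ω J + ∂J`, differentiate it and
antisymmetrise. The second derivatives of `J` cancel, and the first derivatives disappear on
substituting the law itself. -/
theorem IsMetricPullback.jacobian_mul_curvMatrix (h : IsMetricPullback s s' ψ G G') (hx : x ∈ s)
    (i j : Fin n) :
    jacobian s ψ x * curvMatrix s G i j x =
      (∑ b, ∑ c, (jacobian s ψ x b i * jacobian s ψ x c j) • curvMatrix s' G' b c (ψ x))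
        * jacobian s ψ x := by
  have hd : ∀ i j, mpderiv s i (jacobian s ψ) x * chrMatrix s G j x
      + jacobian s ψ x * mpderiv s i (chrMatrix s G j) x =
      mpderiv s i (pullbackConnection s s' ψ G' j) x * jacobian s ψ x
      + pullbackConnection s s' ψ G' j x * mpderiv s i (jacobian s ψ) x
      + mpderiv s i (mpderiv s j (jacobian s ψ)) x := by
    intro i j
    have h1 := mpderiv_congr (M := fun z => jacobian s ψ z * chrMatrix s G j z)
      (N := fun z => pullbackConnection s s' ψ G' j z * jacobian s ψ z
        + mpderiv s j (jacobian s ψ) z) (fun z hz => h.jacobian_mul_chrMatrix hz j) hx i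
    rwa [mpderiv_mul h.uniqueDiffOn h.smoothJ
      (SmoothMatrixOn.chrMatrix h.uniqueDiffOn h.smooth h.det_ne j) hx,
      mpderiv_add h.uniqueDiffOn ((h.smooth_pullbackConnection j).mul h.smoothJ)
        (h.smoothJ.mpderiv h.uniqueDiffOn j) hx,
      mpderiv_mul h.uniqueDiffOn (h.smooth_pullbackConnection j) h.smoothJ hx] at h1
  have hω : ∀ i j, mpderiv s i (pullbackConnection s s' ψ G' j) x =
      (∑ b, mpderiv s i (jacobian s ψ) x b j • chrMatrix s' G' b (ψ x))
      + ∑ b, ∑ c, (jacobian s ψ x b i * jacobian s ψ x c j) •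
          mpderiv s' b (chrMatrix s' G' c) (ψ x) := by
    intro i j
    rw [show pullbackConnection s s' ψ G' j = fun z => ∑ b, jacobian s ψ z b j •
      (fun z => chrMatrix s' G' b (ψ z)) z from rfl, mpderiv_smul_sum h.uniqueDiffOn
      (fun b => h.smoothJ b j) (fun b => (SmoothMatrixOn.chrMatrix h.uniqueDiffOn' h.smooth'
        h.det_ne' b).comp h.contDiffOn h.mapsTo) hx, Finset.sum_add_distrib]
    congr 1
    rw [Finset.sum_comm]
    refine Finset.sum_congr rfl fun b _ => ?_
    rw [mpderiv_comp h.uniqueDiffOn (SmoothMatrixOn.chrMatrix h.uniqueDiffOn' h.smooth'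
        h.det_ne' b) h.contDiffOn h.mapsTo hx, Finset.smul_sum]
    exact Finset.sum_congr rfl fun c _ => by rw [smul_smul, mul_comm]
  -- The curvature of the pulled-back connection is the pulled-back curvature: the terms with
  -- derivatives of the Jacobian are symmetric in `i`, `j`.
  have hΩ : mpderiv s i (pullbackConnection s s' ψ G' j) x
      - mpderiv s j (pullbackConnection s s' ψ G' i) x
      + pullbackConnection s s' ψ G' i x * pullbackConnection s s' ψ G' j x
      - pullbackConnection s s' ψ G' j x * pullbackConnection s s' ψ G' i x =
      ∑ b, ∑ c, (jacobian s ψ x b i * jacobian s ψ x c j) • curvMatrix s' G' b c (ψ x) := by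
    have e1 : (∑ b, mpderiv s i (jacobian s ψ) x b j • chrMatrix s' G' b (ψ x)) =
        ∑ b, mpderiv s j (jacobian s ψ) x b i • chrMatrix s' G' b (ψ x) :=
      Finset.sum_congr rfl fun b _ => by
        rw [mpderiv_jacobian h.uniqueDiffOn h.contDiffOn hx (h.subset_closure hx) b i j]
    have e2 : ∀ (i j : Fin n) (f : Fin n → Fin n → Matrix (Fin n) (Fin n) ℝ),
        ∑ b, ∑ c, (jacobian s ψ x b j * jacobian s ψ x c i) • f b c =
        ∑ b, ∑ c, (jacobian s ψ x b i * jacobian s ψ x c j) • f c b := by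
      intro i j f
      rw [Finset.sum_comm]
      exact Finset.sum_congr rfl fun b _ => Finset.sum_congr rfl fun c _ => by rw [mul_comm]
    have e3 : ∀ i j, pullbackConnection s s' ψ G' i x * pullbackConnection s s' ψ G' j x =
        ∑ b, ∑ c, (jacobian s ψ x b i * jacobian s ψ x c j) •
          (chrMatrix s' G' b (ψ x) * chrMatrix s' G' c (ψ x)) := by
      intro i j
      simp only [pullbackConnection, Finset.sum_mul, Finset.mul_sum, Matrix.smul_mul,
        Matrix.mul_smul, smul_smul]
      rw [Finset.sum_comm]
      exact Finset.sum_congr rfl fun b _ => Finset.sum_congr rfl fun c _ => by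
        rw [mul_comm]
    rw [hω, hω, e1, e3, e3, e2 i j, e2 i j]
    simp only [curvMatrix, smul_sub, smul_add, Finset.sum_add_distrib, Finset.sum_sub_distrib]
    abel
  rw [← hΩ]
  have hc := mpderiv_comm h.uniqueDiffOn h.smoothJ hx (h.subset_closure hx) i j
  have h1 := hd i j
  have h2 := hd j i
  rw [hc] at h1
  have g1 := h.jacobian_mul_chrMatrix hx i
  have g2 := h.jacobian_mul_chrMatrix hx j
  simp only [curvMatrix]
  generalize mpderiv s i (pullbackConnection s s' ψ G' j) x = A at *
  generalize mpderiv s j (pullbackConnection s s' ψ G' i) x = B at *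
  generalize pullbackConnection s s' ψ G' i x = P at *
  generalize pullbackConnection s s' ψ G' j x = Q at *
  generalize mpderiv s j (mpderiv s i (jacobian s ψ)) x = DD at *
  generalize mpderiv s i (jacobian s ψ) x = D1 at *
  generalize mpderiv s j (jacobian s ψ) x = D2 at *
  generalize jacobian s ψ x = J at *
  generalize chrMatrix s G i x = K1 at *
  generalize chrMatrix s G j x = K2 at *
  generalize mpderiv s i (chrMatrix s G j) x = R at *
  generalize mpderiv s j (chrMatrix s G i) x = S at *
  -- What is left is an identity between polynomials in noncommuting matrices, obtained by
  -- eliminating `R`, `S`, `D1` and `D2`; `DD` occurs twice with opposite signs.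
  have hR : J * R = A * J + Q * D1 + DD - D1 * K2 := eq_sub_of_add_eq' h1
  have hS : J * S = B * J + P * D2 + DD - D2 * K1 := eq_sub_of_add_eq' h2
  have hD1 : D1 = J * K1 - P * J := eq_sub_of_add_eq' g1.symm
  have hD2 : D2 = J * K2 - Q * J := eq_sub_of_add_eq' g2.symm
  have : J * (R - S + K1 * K2 - K2 * K1) = J * R - J * S + J * K1 * K2 - J * K2 * K1 := by
    noncomm_ring
  rw [this, hR, hS, hD1, hD2]
  noncomm_ring

theorem IsMetricPullback.ricci_eq (h : IsMetricPullback s s' ψ G G') (hx : x ∈ s) :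
    (Matrix.of fun i j => ricci s G i j x) =
      (jacobian s ψ x)ᵀ * (Matrix.of fun i j => ricci s' G' i j (ψ x)) * jacobian s ψ x := by
  set J := jacobian s ψ x with hJ
  have hJu : IsUnit J.det := isUnit_iff_ne_zero.2 (h.det_jacobian_ne x hx)
  have hinv : J * J⁻¹ = 1 := Matrix.mul_nonsing_inv _ hJu
  have hc : ∀ k j, curvMatrix s G k j x = J⁻¹ * ((∑ b, ∑ c, (J b k * J c j) •
      curvMatrix s' G' b c (ψ x)) * J) := by
    intro k j
    rw [← h.jacobian_mul_curvMatrix hx, ← hJ, ← Matrix.mul_assoc, Matrix.nonsing_inv_mul _ hJu,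
      one_mul]
  ext i j
  rw [Matrix.of_apply, ricci_eq_sum_curvMatrix h.symm hx]
  have step : ∀ k, curvMatrix s G k j x k i = ∑ b, ∑ c, ∑ a, ∑ d,
      (J b k * J⁻¹ k a) * (J c j * J d i * curvMatrix s' G' b c (ψ x) a d) := by
    intro k
    rw [hc]
    simp only [Matrix.mul_apply, Matrix.sum_apply, Matrix.smul_apply, smul_eq_mul,
      Finset.mul_sum, Finset.sum_mul]
    rw [Finset.sum_comm]
    refine Finset.sum_congr rfl fun b _ => ?_
    rw [Finset.sum_comm]
    refine Finset.sum_congr rfl fun c _ =>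
      Finset.sum_congr rfl fun a _ => Finset.sum_congr rfl fun d _ => by ring
  -- The contraction over `k` pairs a Jacobian with its inverse, leaving the two Jacobians of a
  -- bilinear form.
  have hδ : ∀ b a, ∑ k, J b k * J⁻¹ k a = if b = a then 1 else 0 := by
    intro b a
    rw [← Matrix.mul_apply, hinv, Matrix.one_apply]
  calc ∑ k, curvMatrix s G k j x k i
      = ∑ b, ∑ c, ∑ a, ∑ d, (∑ k, J b k * J⁻¹ k a) *
          (J c j * J d i * curvMatrix s' G' b c (ψ x) a d) := by
        simp only [step, Finset.sum_mul]
        rw [Finset.sum_comm]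
        refine Finset.sum_congr rfl fun b _ => ?_
        rw [Finset.sum_comm]
        refine Finset.sum_congr rfl fun c _ => ?_
        rw [Finset.sum_comm]
        refine Finset.sum_congr rfl fun a _ => ?_
        rw [Finset.sum_comm]
    _ = ∑ c, ∑ d, J c j * J d i * ricci s' G' d c (ψ x) := by
        simp only [hδ, ite_mul, one_mul, zero_mul, Finset.sum_ite_irrel, Finset.sum_const_zero]
        simp only [Finset.sum_ite_eq, Finset.mem_univ, if_true]
        rw [Finset.sum_comm]
        refine Finset.sum_congr rfl fun c _ => ?_
        rw [Finset.sum_comm]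
        refine Finset.sum_congr rfl fun d _ => ?_
        rw [ricci_eq_sum_curvMatrix h.symm' (h.mapsTo hx), Finset.mul_sum]
    _ = _ := by
        simp only [Matrix.mul_apply, Matrix.of_apply, Matrix.transpose_apply, Finset.sum_mul]
        refine Finset.sum_congr rfl fun c _ => Finset.sum_congr rfl fun d _ => by ring

/-- The scalar curvature does not depend on the choice of coordinates. -/
theorem IsMetricPullback.scalCoord_eq (h : IsMetricPullback s s' ψ G G') (hx : x ∈ s) :
    scalCoord s G x = scalCoord s' G' (ψ x) := by
  have key : ∀ (A R : Matrix (Fin n) (Fin n) ℝ), ∑ i, ∑ j, A i j * R i j = (A * Rᵀ).trace := by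
    intro A R
    simp [Matrix.trace, Matrix.mul_apply, Matrix.transpose_apply]
  have hJu : IsUnit (jacobian s ψ x).det := isUnit_iff_ne_zero.2 (h.det_jacobian_ne x hx)
  have hJuT : IsUnit (jacobian s ψ x)ᵀ.det := by rwa [Matrix.det_transpose]
  have h1 : scalCoord s G x = ((G x)⁻¹ * (Matrix.of fun i j => ricci s G i j x)ᵀ).trace := key _ _
  have h2 : scalCoord s' G' (ψ x) =
    ((G' (ψ x))⁻¹ * (Matrix.of fun i j => ricci s' G' i j (ψ x))ᵀ).trace := key _ _
  rw [h1, h2, h.ricci_eq hx, h.eq hx]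
  simp only [Matrix.transpose_mul, Matrix.transpose_transpose, Matrix.mul_inv_rev]
  generalize jacobian s ψ x = J at *
  generalize (Matrix.of fun i j => ricci s' G' i j (ψ x))ᵀ = R
  have : J⁻¹ * ((G' (ψ x))⁻¹ * Jᵀ⁻¹) * (Jᵀ * (R * J)) = J⁻¹ * ((G' (ψ x))⁻¹ * R * J) := by
    have hT : Jᵀ⁻¹ * Jᵀ = 1 := Matrix.nonsing_inv_mul _ hJuT
    calc _ = J⁻¹ * ((G' (ψ x))⁻¹ * (Jᵀ⁻¹ * Jᵀ) * (R * J)) := by simp only [Matrix.mul_assoc]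
      _ = _ := by rw [hT]; simp only [Matrix.mul_assoc, one_mul]
  rw [this, Matrix.trace_mul_comm, Matrix.mul_assoc, Matrix.mul_nonsing_inv _ hJu, mul_one]

end Transformation

end Gluing

namespace Gluing

/-! ### Mean curvature of the hyperplane and the jump of the normal derivative -/

section MeanCurvature

variable {m : ℕ}

/-- Coordinate lines through `y` in the directions `1, …, m` stay in `s` for a short time. -/
def TangentiallyOpenAt (s : Set (EuclideanSpace ℝ (Fin (m + 1))))
    (y : EuclideanSpace ℝ (Fin (m + 1))) : Prop :=
  ∀ i : Fin m, ∀ᶠ τ in 𝓝 (0 : ℝ), y + τ • EuclideanSpace.single i.succ (1 : ℝ) ∈ s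

variable {s s' : Set (EuclideanSpace ℝ (Fin (m + 1)))}
  {y : EuclideanSpace ℝ (Fin (m + 1))}

/-- A tangential derivative only sees values along a line that stays in `s` in both directions. It
is therefore an ordinary derivative, and the same for every such `s`; in particular tangential
derivatives do not jump across the seam. -/
theorem pderivWithin_succ_eq_deriv {f : EuclideanSpace ℝ (Fin (m + 1)) → ℝ}
    (hf : DifferentiableWithinAt ℝ f s y) (hs : TangentiallyOpenAt s y) (i : Fin m) :
    pderivWithin s i.succ f y =
      deriv (fun τ : ℝ => f (y + τ • EuclideanSpace.single i.succ (1 : ℝ))) 0 := by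
  have hγ : HasDerivAt (fun τ : ℝ => y + τ • EuclideanSpace.single i.succ (1 : ℝ))
      (EuclideanSpace.single i.succ (1 : ℝ)) 0 := by
    simpa using ((hasDerivAt_id (0 : ℝ)).smul_const
      (EuclideanSpace.single i.succ (1 : ℝ))).const_add y
  have hf' : HasFDerivWithinAt f (fderivWithin ℝ f s y) s
      ((fun τ : ℝ => y + τ • EuclideanSpace.single i.succ (1 : ℝ)) 0) := by
    simpa using hf.hasFDerivWithinAt
  have hc := HasFDerivWithinAt.comp_hasDerivAt_of_eq (x := (0 : ℝ)) (t := s)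
    (f := fun τ : ℝ => y + τ • EuclideanSpace.single i.succ (1 : ℝ)) hf' hγ (hs i) rfl
  exact hc.deriv.symm

theorem pderivWithin_succ_eq_zero {f : EuclideanSpace ℝ (Fin (m + 1)) → ℝ}
    (hf : DifferentiableWithinAt ℝ f s y) (hs : TangentiallyOpenAt s y) (hy : y 0 = 0)
    (h0 : ∀ z ∈ s, z 0 = 0 → f z = 0) (i : Fin m) : pderivWithin s i.succ f y = 0 := by
  rw [pderivWithin_succ_eq_deriv hf hs i]
  have : (fun τ : ℝ => f (y + τ • EuclideanSpace.single i.succ (1 : ℝ))) =ᶠ[𝓝 0] fun _ => 0 := by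
    filter_upwards [hs i] with τ hτ
    exact h0 _ hτ (by simp [hy])
  rw [this.deriv_eq, deriv_const]

theorem pderivWithin_succ_congr_set {f : EuclideanSpace ℝ (Fin (m + 1)) → ℝ}
    (hf : DifferentiableWithinAt ℝ f s y) (hs : TangentiallyOpenAt s y)
    (hf' : DifferentiableWithinAt ℝ f s' y) (hs' : TangentiallyOpenAt s' y) (i : Fin m) :
    pderivWithin s i.succ f y = pderivWithin s' i.succ f y := by
  rw [pderivWithin_succ_eq_deriv hf hs, pderivWithin_succ_eq_deriv hf' hs']

/-- The trace of one bilinear form with respect to another does not depend on the basis. -/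
theorem trace_inv_mul_congr {m : ℕ} {K A N : Matrix (Fin m) (Fin m) ℝ} (hK : IsUnit K.det) :
    ((Kᵀ * A * K)⁻¹ * (Kᵀ * N * K)).trace = (A⁻¹ * N).trace := by
  have hKT : Kᵀ⁻¹ * Kᵀ = 1 := Matrix.nonsing_inv_mul _ (by rwa [Matrix.det_transpose])
  rw [Matrix.mul_inv_rev, Matrix.mul_inv_rev]
  calc (K⁻¹ * (A⁻¹ * Kᵀ⁻¹) * (Kᵀ * N * K)).trace
      = (K⁻¹ * (A⁻¹ * (Kᵀ⁻¹ * Kᵀ) * N * K)).trace := by simp only [Matrix.mul_assoc]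
    _ = _ := by
      rw [hKT, Matrix.mul_one, Matrix.trace_mul_comm, Matrix.mul_assoc,
        Matrix.mul_nonsing_inv _ hK, Matrix.mul_one]

variable {ψ : EuclideanSpace ℝ (Fin (m + 1)) → EuclideanSpace ℝ (Fin (m + 1))}
  {G G' : EuclideanSpace ℝ (Fin (m + 1)) → Matrix (Fin (m + 1)) (Fin (m + 1)) ℝ}

theorem meanCurvCoord_eq_trace (x : EuclideanSpace ℝ (Fin (m + 1))) (hG : (G x)ᵀ = G x) :
    meanCurvCoord s G x = (((G x).submatrix Fin.succ Fin.succ)⁻¹ *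
      (Matrix.of fun i j : Fin m => christoffel s G 0 i.succ j.succ x)).trace
        / Real.sqrt ((G x)⁻¹ 0 0) := by
  have hsub : (((G x).submatrix Fin.succ Fin.succ : Matrix (Fin m) (Fin m) ℝ)⁻¹)ᵀ =
      ((G x).submatrix Fin.succ Fin.succ)⁻¹ := by
    rw [Matrix.transpose_nonsing_inv, Matrix.transpose_submatrix, hG]
  simp only [meanCurvCoord, Matrix.trace, Matrix.diag, Matrix.mul_apply, Matrix.of_apply,
    Finset.sum_div]
  rw [Finset.sum_comm]
  refine Finset.sum_congr rfl fun i _ => Finset.sum_congr rfl fun j _ => ?_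
  rw [mul_div_assoc]
  congr 1
  exact congrFun (congrFun hsub i) j

/-- The mean curvature of a hypersurface depends only on its co-orientation. -/
theorem IsMetricPullback.meanCurvCoord_eq (h : IsMetricPullback s s' ψ G G') (hy : y ∈ s)
    (hy0 : y 0 = 0) (hs : ∀ z ∈ s, z 0 = 0 → TangentiallyOpenAt s z)
    (hψ : ∀ z ∈ s, z 0 = 0 → ψ z 0 = 0) :
    meanCurvCoord s G y * |jacobian s ψ y 0 0| =
      jacobian s ψ y 0 0 * meanCurvCoord s' G' (ψ y) := by
  set J := jacobian s ψ y with hJ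
  have hψ0 := contDiffOn_coord h.contDiffOn 0
  -- Since `ψ` preserves the hyperplane, row `0` of its Jacobian is `(J₀₀, 0, …, 0)` along it, and
  -- the tangential derivatives of the zeros vanish as well.
  have hJ0 : ∀ z ∈ s, z 0 = 0 → ∀ i : Fin m, jacobian s ψ z 0 i.succ = 0 := fun z hz hz0 i =>
    pderivWithin_succ_eq_zero (hψ0.differentiableOn (by simp) z hz) (hs z hz hz0) hz0 hψ i
  have hD0 : ∀ i j : Fin m, mpderiv s i.succ (jacobian s ψ) y 0 j.succ = 0 := fun i j =>
    pderivWithin_succ_eq_zero (h.smoothJ.diff 0 j.succ hy) (hs y hy hy0) hy0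
      (fun z hz hz0 => hJ0 z hz hz0 j) i
  have hJy : ∀ i : Fin m, J 0 i.succ = 0 := hJ0 y hy hy0
  set K := J.submatrix (Fin.succ : Fin m → Fin (m + 1)) Fin.succ with hK
  have hdet : J.det = J 0 0 * K.det := by
    rw [Matrix.det_succ_row_zero, Fin.sum_univ_succ]
    simp [hJy, hK]
  have hJdet : J.det ≠ 0 := h.det_jacobian_ne y hy
  have hc : J 0 0 ≠ 0 := fun h0 => hJdet (by rw [hdet, h0, zero_mul])
  have hKdet : IsUnit K.det := isUnit_iff_ne_zero.2 fun h0 => hJdet (by rw [hdet, h0, mul_zero])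
  have hsub : (G y).submatrix (Fin.succ : Fin m → Fin (m + 1)) Fin.succ =
      Kᵀ * (G' (ψ y)).submatrix Fin.succ Fin.succ * K := by
    rw [h.eq hy]
    ext i j
    simp only [Matrix.submatrix_apply, Matrix.mul_apply, Matrix.transpose_apply, hK]
    rw [Fin.sum_univ_succ]
    simp only [← hJ, hJy, mul_zero, zero_add, Fin.sum_univ_succ, zero_mul]
  -- Row `0` of the law of the connection, for tangential indices: the inhomogeneous term is one of
  -- the vanishing derivatives, so `Γ⁰` behaves like a bilinear form up to the factor `J₀₀`.
  have hN : J 0 0 • (Matrix.of fun i j : Fin m => christoffel s G 0 i.succ j.succ y) =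
      Kᵀ * (Matrix.of fun i j : Fin m => christoffel s' G' 0 i.succ j.succ (ψ y)) * K := by
    ext i j
    have h1 := congrFun (congrFun (h.jacobian_mul_chrMatrix hy i.succ) 0) j.succ
    rw [Matrix.add_apply, hD0, add_zero, Matrix.mul_apply, Matrix.mul_apply, ← hJ,
      Fin.sum_univ_succ, Fin.sum_univ_succ] at h1
    simp only [hJy, zero_mul, Finset.sum_const_zero, add_zero, mul_zero, zero_add] at h1
    simp only [Matrix.smul_apply, smul_eq_mul, Matrix.of_apply]
    refine Eq.trans (show _ = _ from h1) ?_
    simp only [Matrix.mul_apply, pullbackConnection, Matrix.sum_apply, Matrix.smul_apply,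
      smul_eq_mul, Matrix.transpose_apply, Matrix.of_apply]
    refine Finset.sum_congr rfl fun k _ => ?_
    rw [Fin.sum_univ_succ, ← hJ]
    simp only [hJy, zero_mul, zero_add]
    rfl
  have h00 : (G' (ψ y))⁻¹ 0 0 = J 0 0 ^ 2 * (G y)⁻¹ 0 0 := by
    have hJu : IsUnit J.det := isUnit_iff_ne_zero.2 hJdet
    have e : (G' (ψ y))⁻¹ = J * (G y)⁻¹ * Jᵀ := by
      rw [h.eq hy]
      simp only [Matrix.mul_inv_rev, ← hJ]
      rw [← Matrix.mul_assoc, Matrix.mul_nonsing_inv _ hJu, one_mul, Matrix.mul_assoc,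
        Matrix.nonsing_inv_mul _ (by rwa [Matrix.det_transpose]), mul_one]
    rw [e]
    simp only [Matrix.mul_apply, Matrix.transpose_apply]
    rw [Fin.sum_univ_succ, Fin.sum_univ_succ]
    simp only [hJy, mul_zero, zero_mul, Finset.sum_const_zero, add_zero]
    ring
  rw [meanCurvCoord_eq_trace y (h.symm hy), meanCurvCoord_eq_trace (ψ y) (h.symm' (h.mapsTo hy)),
    h00, Real.sqrt_mul (sq_nonneg _), Real.sqrt_sq_eq_abs]
  have hN' : (Matrix.of fun i j : Fin m => christoffel s G 0 i.succ j.succ y) =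
      (J 0 0)⁻¹ • (Kᵀ * (Matrix.of fun i j : Fin m => christoffel s' G' 0 i.succ j.succ (ψ y)) * K) := by
    rw [← hN, smul_smul, inv_mul_cancel₀ hc, one_smul]
  rw [hN', hsub, Matrix.mul_smul, Matrix.trace_smul, trace_inv_mul_congr hKdet, smul_eq_mul]
  generalize (((G' (ψ y)).submatrix Fin.succ Fin.succ)⁻¹ *
    (Matrix.of fun i j : Fin m => christoffel s' G' 0 i.succ j.succ (ψ y))).trace = T
  -- `G` need not be positive definite here. If the root is `0`, both mean curvatures are `0` by the
  -- convention for division by zero.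
  by_cases hq : √((G y)⁻¹ 0 0) = 0
  · simp [hq]
  · have hca : |J 0 0| ≠ 0 := abs_ne_zero.2 hc
    have : |J 0 0| * |J 0 0| = J 0 0 * J 0 0 := abs_mul_abs_self _
    field_simp
    rw [pow_two, this]; ring

/-- The trace, over the hypersurface `{x₀ = 0}`, of the jump of the normal derivative of a metric
which is smooth on both sides of it. -/
def jumpTrace (L U : Set (EuclideanSpace ℝ (Fin (m + 1))))
    (G : EuclideanSpace ℝ (Fin (m + 1)) → Matrix (Fin (m + 1)) (Fin (m + 1)) ℝ)
    (y : EuclideanSpace ℝ (Fin (m + 1))) : ℝ :=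
  ∑ i : Fin m, ∑ j : Fin m, ((G y).submatrix Fin.succ Fin.succ)⁻¹ i j *
    (pderivWithin U 0 (fun z => G z i.succ j.succ) y
      - pderivWithin L 0 (fun z => G z i.succ j.succ) y)

/-- Only normal derivatives jump, and in `Γ⁰ᵢⱼ` the normal derivative occurs just once, as `-½ g⁰⁰
∂₀gᵢⱼ`. `meanCurvCoord` uses the normal pointing out of `{x₀ ≥ 0}` on both sides, so the difference
here becomes the sum of the two outward mean curvatures. -/
theorem meanCurvCoord_sub (hs : TangentiallyOpenAt s y) (hs' : TangentiallyOpenAt s' y)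
    (hG : SmoothMatrixOn s G) (hG' : SmoothMatrixOn s' G) (hy : y ∈ s) (hy' : y ∈ s')
    (h0 : 0 < (G y)⁻¹ 0 0) :
    meanCurvCoord s' G y - meanCurvCoord s G y =
      -(1 / 2) * √((G y)⁻¹ 0 0) * jumpTrace s s' G y := by
  have hchr : ∀ i j : Fin m, christoffel s' G 0 i.succ j.succ y - christoffel s G 0 i.succ j.succ y
      = -(1 / 2) * (G y)⁻¹ 0 0 * (pderivWithin s' 0 (fun z => G z i.succ j.succ) y
      - pderivWithin s 0 (fun z => G z i.succ j.succ) y) := by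
    intro i j
    have ht : ∀ (k : Fin m) (a b : Fin (m + 1)), pderivWithin s' k.succ (fun z => G z a b) y =
        pderivWithin s k.succ (fun z => G z a b) y := fun k a b =>
      pderivWithin_succ_congr_set (hG'.diff a b hy') hs' (hG.diff a b hy) hs k
    simp only [christoffel]
    rw [← mul_sub, ← Finset.sum_sub_distrib, Fin.sum_univ_succ]
    simp only [ht, sub_self, Finset.sum_const_zero, add_zero]
    ring
  have hq : √((G y)⁻¹ 0 0) ≠ 0 := (Real.sqrt_pos.2 h0).ne'
  have hq2 : √((G y)⁻¹ 0 0) * √((G y)⁻¹ 0 0) = (G y)⁻¹ 0 0 := Real.mul_self_sqrt h0.le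
  simp only [meanCurvCoord, jumpTrace, Finset.mul_sum]
  rw [← Finset.sum_sub_distrib]
  refine Finset.sum_congr rfl fun i _ => ?_
  rw [← Finset.sum_sub_distrib]
  refine Finset.sum_congr rfl fun j _ => ?_
  rw [← mul_sub, ← sub_div, hchr]
  generalize √((G y)⁻¹ 0 0) = q at *
  rw [← hq2]
  field_simp

end MeanCurvature

end Gluing

namespace Gluing

/-! ### Scalar curvature as a function of the 2-jet, and its symbol -/

section Jets

variable {n : ℕ}

/-- The Christoffel symbols as a function of the `1`-jet of the metric. -/
def chrJet (A : Matrix (Fin n) (Fin n) ℝ) (B : Fin n → Matrix (Fin n) (Fin n) ℝ)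
    (k i j : Fin n) : ℝ :=
  (1 / 2 : ℝ) * ∑ l, A⁻¹ k l * (B i j l + B j i l - B l i j)

/-- The derivatives of the Christoffel symbols as a function of the `2`-jet of the metric. -/
def dchrJet (A : Matrix (Fin n) (Fin n) ℝ) (B : Fin n → Matrix (Fin n) (Fin n) ℝ)
    (C : Fin n → Fin n → Matrix (Fin n) (Fin n) ℝ) (p k i j : Fin n) : ℝ :=
  (1 / 2 : ℝ) * ∑ l, (-(A⁻¹ * B p * A⁻¹) k l * (B i j l + B j i l - B l i j)
    + A⁻¹ k l * (C p i j l + C p j i l - C p l i j))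

/-- The scalar curvature as a function of the `2`-jet of the metric. -/
def scalJet (A : Matrix (Fin n) (Fin n) ℝ) (B : Fin n → Matrix (Fin n) (Fin n) ℝ)
    (C : Fin n → Fin n → Matrix (Fin n) (Fin n) ℝ) : ℝ :=
  ∑ i, ∑ j, A⁻¹ i j * ((∑ k, (dchrJet A B C k k i j - dchrJet A B C j k i k))
    + ∑ k, ∑ l, (chrJet A B k k l * chrJet A B l i j - chrJet A B k j l * chrJet A B l i k))

variable {s : Set (EuclideanSpace ℝ (Fin n))} {x : EuclideanSpace ℝ (Fin n)}
  {G : EuclideanSpace ℝ (Fin n) → Matrix (Fin n) (Fin n) ℝ}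

theorem mpderiv_inv (hs : UniqueDiffOn ℝ s) (hG : SmoothMatrixOn s G)
    (hdet : ∀ z ∈ s, (G z).det ≠ 0) (hx : x ∈ s) (k : Fin n) :
    mpderiv s k (fun z => (G z)⁻¹) x = -((G x)⁻¹ * mpderiv s k G x * (G x)⁻¹) := by
  have hu : IsUnit (G x).det := isUnit_iff_ne_zero.2 (hdet x hx)
  have h1 := mpderiv_congr (M := fun z => G z * (G z)⁻¹) (N := fun _ => 1)
    (fun z hz => Matrix.mul_nonsing_inv _ (isUnit_iff_ne_zero.2 (hdet z hz))) hx k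
  have h2 : mpderiv s k (fun _ => (1 : Matrix (Fin n) (Fin n) ℝ)) x = 0 := by
    ext a b
    exact pderivWithin_const _
  rw [mpderiv_mul hs hG (hG.inv hdet) hx, h2] at h1
  have h3 : G x * mpderiv s k (fun z => (G z)⁻¹) x = -(mpderiv s k G x * (G x)⁻¹) :=
    eq_neg_of_add_eq_zero_right h1
  calc mpderiv s k (fun z => (G z)⁻¹) x
      = (G x)⁻¹ * (G x * mpderiv s k (fun z => (G z)⁻¹) x) := by
        rw [← Matrix.mul_assoc, Matrix.nonsing_inv_mul _ hu, one_mul]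
    _ = _ := by rw [h3, Matrix.mul_neg, Matrix.mul_assoc]

/-- Limits of scalar curvatures thereby reduce to limits of `2`-jets, as `scalJet` is continuous
where the metric is invertible. -/
theorem scalCoord_eq_scalJet (hs : UniqueDiffOn ℝ s) (hG : SmoothMatrixOn s G)
    (hdet : ∀ z ∈ s, (G z).det ≠ 0) (hx : x ∈ s) :
    scalCoord s G x = scalJet (G x) (fun k => mpderiv s k G x)
      (fun l k => mpderiv s l (mpderiv s k G) x) := by
  have hchr : ∀ k i j, christoffel s G k i j x =
      chrJet (G x) (fun k => mpderiv s k G x) k i j := fun k i j => rfl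
  have hdchr : ∀ p k i j, pderivWithin s p (christoffel s G k i j) x = dchrJet (G x)
      (fun k => mpderiv s k G x) (fun l k => mpderiv s l (mpderiv s k G) x) p k i j := by
    intro p k i j
    have hd : ∀ a b c, ContDiffOn ℝ ∞ (fun z => mpderiv s a G z b c) s := fun a b c =>
      hG.mpderiv hs a b c
    have hdd : ∀ a b c, DifferentiableWithinAt ℝ (fun z => mpderiv s a G z b c) s x :=
      fun a b c => (hd a b c).differentiableOn (by simp) x hx
    have hi : ∀ a b, DifferentiableWithinAt ℝ (fun z => (G z)⁻¹ a b) s x := fun a b =>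
      (hG.inv hdet).diff a b hx
    have hm : ∀ a b, pderivWithin s p (fun z => (G z)⁻¹ a b) x =
        -((G x)⁻¹ * mpderiv s p G x * (G x)⁻¹) a b := fun a b =>
      congrFun (congrFun (mpderiv_inv hs hG hdet hx p) a) b
    have hu := hs x hx
    have hq : ∀ l, DifferentiableWithinAt ℝ (fun z =>
        mpderiv s i G z j l + mpderiv s j G z i l - mpderiv s l G z i j) s x := fun l =>
      ((hdd _ _ _).add (hdd _ _ _)).sub (hdd _ _ _)
    have hterm : ∀ l, DifferentiableWithinAt ℝ (fun z => (G z)⁻¹ k l *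
        (mpderiv s i G z j l + mpderiv s j G z i l - mpderiv s l G z i j)) s x := fun l =>
      (hi k l).mul (hq l)
    have e1 := pderivWithin_const_mul (k := p) (1 / 2 : ℝ) hu
      (DifferentiableWithinAt.fun_sum (u := Finset.univ) fun l _ => hterm l)
    have e2 := pderivWithin_sum (k := p) (u := Finset.univ) hu (fun l _ => hterm l)
    refine e1.trans ?_
    rw [e2, dchrJet]
    congr 1
    refine Finset.sum_congr rfl fun l _ => ?_
    refine (pderivWithin_mul hu (hi k l) (hq l)).trans ?_
    rw [hm]
    congr 2
    refine (pderivWithin_sub hu ((hdd _ _ _).add (hdd _ _ _)) (hdd _ _ _)).trans ?_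
    congr 1
    exact pderivWithin_add hu (hdd _ _ _) (hdd _ _ _)
  unfold scalCoord ricci scalJet
  simp only [hchr, hdchr]

theorem continuousAt_matrix_inv_apply {A : Matrix (Fin n) (Fin n) ℝ} (hA : A.det ≠ 0)
    (i j : Fin n) : ContinuousAt (fun A : Matrix (Fin n) (Fin n) ℝ => A⁻¹ i j) A := by
  simp only [Matrix.inv_def, Ring.inverse_eq_inv', Matrix.smul_apply, smul_eq_mul]
  exact (Continuous.continuousAt (by fun_prop)).inv₀ hA |>.mul
    (Continuous.continuousAt (f := fun A : Matrix (Fin n) (Fin n) ℝ => A.adjugate i j)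
      (by exact (continuous_id.matrix_adjugate).matrix_elem i j))

theorem continuousAt_scalJet {A : Matrix (Fin n) (Fin n) ℝ} (hA : A.det ≠ 0)
    (B : Fin n → Matrix (Fin n) (Fin n) ℝ) (C : Fin n → Fin n → Matrix (Fin n) (Fin n) ℝ) :
    ContinuousAt (fun q : Matrix (Fin n) (Fin n) ℝ × (Fin n → Matrix (Fin n) (Fin n) ℝ) ×
      (Fin n → Fin n → Matrix (Fin n) (Fin n) ℝ) => scalJet q.1 q.2.1 q.2.2) (A, B, C) := by
  have hI : ∀ i j, ContinuousAt (fun q : Matrix (Fin n) (Fin n) ℝ ×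
      (Fin n → Matrix (Fin n) (Fin n) ℝ) × (Fin n → Fin n → Matrix (Fin n) (Fin n) ℝ) =>
      q.1⁻¹ i j) (A, B, C) := fun i j =>
    ContinuousAt.comp (g := fun A : Matrix (Fin n) (Fin n) ℝ => A⁻¹ i j)
      (continuousAt_matrix_inv_apply hA i j) continuousAt_fst
  have hB : ∀ p i j, ContinuousAt (fun q : Matrix (Fin n) (Fin n) ℝ ×
      (Fin n → Matrix (Fin n) (Fin n) ℝ) × (Fin n → Fin n → Matrix (Fin n) (Fin n) ℝ) =>
      q.2.1 p i j) (A, B, C) := fun p i j =>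
    (((continuous_apply p).comp (continuous_fst.comp continuous_snd)).matrix_elem i j).continuousAt
  have hC : ∀ p r i j, ContinuousAt (fun q : Matrix (Fin n) (Fin n) ℝ ×
      (Fin n → Matrix (Fin n) (Fin n) ℝ) × (Fin n → Fin n → Matrix (Fin n) (Fin n) ℝ) =>
      q.2.2 p r i j) (A, B, C) := fun p r i j =>
    (((continuous_apply r).comp ((continuous_apply p).comp
      (continuous_snd.comp continuous_snd))).matrix_elem i j).continuousAt
  have hchr : ∀ k i j, ContinuousAt (fun q : Matrix (Fin n) (Fin n) ℝ ×
      (Fin n → Matrix (Fin n) (Fin n) ℝ) × (Fin n → Fin n → Matrix (Fin n) (Fin n) ℝ) =>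
      chrJet q.1 q.2.1 k i j) (A, B, C) := fun k i j =>
    continuousAt_const.mul (tendsto_finsetSum _ fun l _ =>
      (hI k l).mul (((hB _ _ _).add (hB _ _ _)).sub (hB _ _ _)))
  have hdchr : ∀ p k i j, ContinuousAt (fun q : Matrix (Fin n) (Fin n) ℝ ×
      (Fin n → Matrix (Fin n) (Fin n) ℝ) × (Fin n → Fin n → Matrix (Fin n) (Fin n) ℝ) =>
      dchrJet q.1 q.2.1 q.2.2 p k i j) (A, B, C) := by
    intro p k i j
    refine continuousAt_const.mul (tendsto_finsetSum _ fun l _ => Filter.Tendsto.add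
      (ContinuousAt.mul ?_ (((hB _ _ _).add (hB _ _ _)).sub (hB _ _ _)))
      ((hI k l).mul (((hC _ _ _ _).add (hC _ _ _ _)).sub (hC _ _ _ _))))
    simp only [Matrix.mul_apply]
    exact (tendsto_finsetSum _ fun a _ => (ContinuousAt.mul
      (tendsto_finsetSum _ fun b _ => (hI k b).mul (hB p b a)) (hI a l))).neg
  exact tendsto_finsetSum _ fun i _ => tendsto_finsetSum _ fun j _ => (hI i j).mul
    (Filter.Tendsto.add (tendsto_finsetSum _ fun k _ => (hdchr _ _ _ _).sub (hdchr _ _ _ _))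
      (tendsto_finsetSum _ fun k _ => tendsto_finsetSum _ fun l _ =>
        ((hchr _ _ _).mul (hchr _ _ _)).sub ((hchr _ _ _).mul (hchr _ _ _))))

/-- The linear dependence of the scalar curvature on the second derivatives of the metric. -/
def scalSymbol (A : Matrix (Fin n) (Fin n) ℝ) (C : Fin n → Fin n → Matrix (Fin n) (Fin n) ℝ) : ℝ :=
  ∑ i, ∑ j, A⁻¹ i j * ∑ k, (1 / 2 : ℝ) * ∑ l, A⁻¹ k l *
    ((C k i j l + C k j i l - C k l i j) - (C j i k l + C j k i l - C j l i k))

/-- Second derivatives enter only through `dchrJet`, and linearly. The unbounded part of the second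
derivatives of a smoothed metric can thus be split off. -/
theorem scalJet_add (A : Matrix (Fin n) (Fin n) ℝ) (B : Fin n → Matrix (Fin n) (Fin n) ℝ)
    (C D : Fin n → Fin n → Matrix (Fin n) (Fin n) ℝ) :
    scalJet A B (fun p q => C p q + D p q) = scalJet A B C + scalSymbol A D := by
  have hd : ∀ p k i j, dchrJet A B (fun p q => C p q + D p q) p k i j = dchrJet A B C p k i j +
      (1 / 2 : ℝ) * ∑ l, A⁻¹ k l * (D p i j l + D p j i l - D p l i j) := by
    intro p k i j
    simp only [dchrJet, Matrix.add_apply]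
    rw [← mul_add, ← Finset.sum_add_distrib]
    congr 1
    exact Finset.sum_congr rfl fun l _ => by ring
  simp only [scalJet, scalSymbol, hd]
  rw [← Finset.sum_add_distrib]
  refine Finset.sum_congr rfl fun i _ => ?_
  rw [← Finset.sum_add_distrib]
  refine Finset.sum_congr rfl fun j _ => ?_
  rw [← mul_add]
  congr 1
  rw [add_right_comm]
  congr 1
  rw [← Finset.sum_add_distrib]
  refine Finset.sum_congr rfl fun k _ => ?_
  rw [show ∀ a b c d : ℝ, a + b - (c + d) = (a - c) + (b - d) by intros; ring]
  congr 1
  rw [← mul_sub, ← Finset.sum_sub_distrib]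
  congr 1
  exact Finset.sum_congr rfl fun l _ => by ring

theorem scalSymbol_sum_smul {ι : Type*} (u : Finset ι) (A : Matrix (Fin n) (Fin n) ℝ) (c : ι → ℝ)
    (C : ι → Fin n → Fin n → Matrix (Fin n) (Fin n) ℝ) :
    scalSymbol A (fun p q => ∑ a ∈ u, c a • C a p q) = ∑ a ∈ u, c a * scalSymbol A (C a) := by
  simp only [scalSymbol, Matrix.sum_apply, Matrix.smul_apply, smul_eq_mul,
    ← Finset.sum_add_distrib, ← Finset.sum_sub_distrib, Finset.mul_sum]
  rw [Finset.sum_comm]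
  rw [Finset.sum_comm (s := u)]
  rw [Finset.sum_comm]
  refine Finset.sum_congr rfl fun i _ => ?_
  rw [Finset.sum_comm (s := u)]
  refine Finset.sum_congr rfl fun j _ => ?_
  rw [Finset.sum_comm (s := u)]
  refine Finset.sum_congr rfl fun k _ => ?_
  rw [Finset.sum_comm (s := u)]
  refine Finset.sum_congr rfl fun l _ => ?_
  refine Finset.sum_congr rfl fun a _ => by ring

theorem continuousAt_scalSymbol {A : Matrix (Fin n) (Fin n) ℝ} (hA : A.det ≠ 0)
    (C : Fin n → Fin n → Matrix (Fin n) (Fin n) ℝ) :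
    ContinuousAt (fun q : Matrix (Fin n) (Fin n) ℝ ×
      (Fin n → Fin n → Matrix (Fin n) (Fin n) ℝ) => scalSymbol q.1 q.2) (A, C) := by
  have hI : ∀ i j, ContinuousAt (fun q : Matrix (Fin n) (Fin n) ℝ ×
      (Fin n → Fin n → Matrix (Fin n) (Fin n) ℝ) => q.1⁻¹ i j) (A, C) := fun i j =>
    ContinuousAt.comp (g := fun A : Matrix (Fin n) (Fin n) ℝ => A⁻¹ i j)
      (continuousAt_matrix_inv_apply hA i j) continuousAt_fst
  have hC : ∀ p r i j, ContinuousAt (fun q : Matrix (Fin n) (Fin n) ℝ ×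
      (Fin n → Fin n → Matrix (Fin n) (Fin n) ℝ) => q.2 p r i j) (A, C) := fun p r i j =>
    (((continuous_apply r).comp ((continuous_apply p).comp continuous_snd)).matrix_elem
      i j).continuousAt
  exact tendsto_finsetSum _ fun i _ => tendsto_finsetSum _ fun j _ => (hI i j).mul
    (tendsto_finsetSum _ fun k _ => continuousAt_const.mul (tendsto_finsetSum _ fun l _ =>
      (hI k l).mul ((((hC _ _ _ _).add (hC _ _ _ _)).sub (hC _ _ _ _)).sub
        (((hC _ _ _ _).add (hC _ _ _ _)).sub (hC _ _ _ _)))))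

/-- With a single index all terms of the Ricci tensor cancel. In dimension one the curvature
hypothesis therefore amounts to `κ < 0`, and no condition on the jump is needed. -/
theorem scalCoord_eq_zero_of_one {s : Set (EuclideanSpace ℝ (Fin 1))}
    (G : EuclideanSpace ℝ (Fin 1) → Matrix (Fin 1) (Fin 1) ℝ) (x : EuclideanSpace ℝ (Fin 1)) :
    scalCoord s G x = 0 := by
  simp [scalCoord, ricci]

/-- Schur complement: inverting the induced metric on the hyperplane is not the same as restricting
the inverse metric. -/
theorem inv_submatrix_succ_apply {m : ℕ} {A : Matrix (Fin (m + 1)) (Fin (m + 1)) ℝ}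
    (hA : A.det ≠ 0) (h0 : A⁻¹ 0 0 ≠ 0) (i j : Fin m) :
    (A.submatrix Fin.succ Fin.succ)⁻¹ i j =
      A⁻¹ i.succ j.succ - A⁻¹ i.succ 0 * A⁻¹ 0 j.succ / A⁻¹ 0 0 := by
  have hmul : ∀ a b, ∑ k, A a k * A⁻¹ k b = if a = b then 1 else 0 := fun a b => by
    rw [← Matrix.mul_apply, Matrix.mul_nonsing_inv _ (isUnit_iff_ne_zero.2 hA), Matrix.one_apply]
  have h : A.submatrix Fin.succ Fin.succ * (Matrix.of fun i j : Fin m =>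
      A⁻¹ i.succ j.succ - A⁻¹ i.succ 0 * A⁻¹ 0 j.succ / A⁻¹ 0 0) = 1 := by
    ext i j
    simp only [Matrix.mul_apply, Matrix.submatrix_apply, Matrix.of_apply, Matrix.one_apply]
    have h1 := hmul i.succ j.succ
    have h2 := hmul i.succ 0
    rw [Fin.sum_univ_succ] at h1 h2
    simp only [Fin.succ_inj, Fin.succ_ne_zero, if_false] at h1 h2
    have h3 : ∑ k : Fin m, A i.succ k.succ * (A⁻¹ k.succ j.succ -
        A⁻¹ k.succ 0 * A⁻¹ 0 j.succ / A⁻¹ 0 0) =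
        ∑ k : Fin m, A i.succ k.succ * A⁻¹ k.succ j.succ -
        (∑ k : Fin m, A i.succ k.succ * A⁻¹ k.succ 0) * (A⁻¹ 0 j.succ / A⁻¹ 0 0) := by
      rw [Finset.sum_mul, ← Finset.sum_sub_distrib]
      exact Finset.sum_congr rfl fun k _ => by ring
    rw [h3, ← h1, eq_neg_of_add_eq_zero_right h2]
    field_simp
    ring
  rw [Matrix.inv_eq_right_inv h, Matrix.of_apply]

/-- On `c ⊗ c ⊗ K` the symbol is `K(c♯, c♯) - |c|² tr K`. For `c` conormal to the hyperplane, the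
components of `K` in the normal direction cancel and `-|c|²` times the trace over the hyperplane
remains, by the Schur complement. -/
theorem scalSymbol_normal {m : ℕ} {A K : Matrix (Fin (m + 1)) (Fin (m + 1)) ℝ} (hA : A.det ≠ 0)
    (hAs : Aᵀ = A) (hKs : Kᵀ = K) (h0 : A⁻¹ 0 0 ≠ 0) (c : Fin (m + 1) → ℝ)
    (hc : ∀ i : Fin m, c i.succ = 0) :
    scalSymbol A (fun p q => (c p * c q) • K) =
      -(c 0 ^ 2 * A⁻¹ 0 0 * ∑ i : Fin m, ∑ j : Fin m,
        (A.submatrix Fin.succ Fin.succ)⁻¹ i j * K i.succ j.succ) := by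
  have hI : ∀ i j, A⁻¹ i j = A⁻¹ j i := fun i j => by
    conv_lhs => rw [← hAs, ← Matrix.transpose_nonsing_inv, Matrix.transpose_apply]
  have hK : ∀ i j, K i j = K j i := fun i j => congrFun (congrFun hKs.symm i) j
  set a := A⁻¹ with ha
  -- The four terms of the symbol agree in pairs, after exchanging the names of the indices.
  have key : scalSymbol A (fun p q => (c p * c q) • K) =
      ∑ i, ∑ j, ∑ k, ∑ l, a i j * a k l * (c k * c i * K j l)
      - ∑ i, ∑ j, ∑ k, ∑ l, a i j * a k l * (c k * c l * K i j) := by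
    have e1 : scalSymbol A (fun p q => (c p * c q) • K) =
      ∑ i, ∑ j, ∑ k, ∑ l, (1 / 2 : ℝ) * (a i j * a k l * (c k * c i * K j l)
        - a i j * a k l * (c k * c l * K i j) - a i j * a k l * (c j * c i * K k l)
        + a i j * a k l * (c j * c l * K i k)) := by
      simp only [scalSymbol, Finset.mul_sum, Matrix.smul_apply, smul_eq_mul, ← ha]
      refine Finset.sum_congr rfl fun i _ => Finset.sum_congr rfl fun j _ =>
        Finset.sum_congr rfl fun k _ => Finset.sum_congr rfl fun l _ => by ring
    have e2 : ∑ i, ∑ j, ∑ k, ∑ l, a i j * a k l * (c j * c i * K k l) =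
        ∑ i, ∑ j, ∑ k, ∑ l, a i j * a k l * (c k * c l * K i j) := by
      have : ∑ p : Fin (m+1) × Fin (m+1), ∑ q : Fin (m+1) × Fin (m+1),
          a p.1 p.2 * a q.1 q.2 * (c p.2 * c p.1 * K q.1 q.2) =
          ∑ q : Fin (m+1) × Fin (m+1), ∑ p : Fin (m+1) × Fin (m+1),
          a p.1 p.2 * a q.1 q.2 * (c p.2 * c p.1 * K q.1 q.2) := Finset.sum_comm
      simp only [Fintype.sum_prod_type] at this
      rw [this]
      refine Finset.sum_congr rfl fun i _ => Finset.sum_congr rfl fun j _ =>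
        Finset.sum_congr rfl fun k _ => Finset.sum_congr rfl fun l _ => by ring
    have e3 : ∑ i, ∑ j, ∑ k, ∑ l, a i j * a k l * (c j * c l * K i k) =
        ∑ i, ∑ j, ∑ k, ∑ l, a i j * a k l * (c k * c i * K j l) := by
      rw [Finset.sum_comm]
      refine Finset.sum_congr rfl fun j _ => Finset.sum_congr rfl fun i _ => ?_
      rw [Finset.sum_comm]
      refine Finset.sum_congr rfl fun l _ => Finset.sum_congr rfl fun k _ => ?_
      rw [hI i j, hI k l]; ring
    rw [e1]
    simp only [← Finset.mul_sum, Finset.sum_add_distrib, Finset.sum_sub_distrib]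
    rw [e2, e3]
    ring
  rw [key]
  have s1 : ∑ i, ∑ j, ∑ k, ∑ l, a i j * a k l * (c k * c i * K j l) =
      c 0 ^ 2 * ∑ j, ∑ l, a 0 j * a 0 l * K j l := by
    rw [Fin.sum_univ_succ]
    simp only [hc, mul_zero, zero_mul, Finset.sum_const_zero, add_zero]
    rw [Finset.mul_sum]
    refine Finset.sum_congr rfl fun j _ => ?_
    rw [Fin.sum_univ_succ]
    simp only [hc, mul_zero, zero_mul, Finset.sum_const_zero, add_zero]
    rw [Finset.mul_sum]
    exact Finset.sum_congr rfl fun l _ => by ring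
  have s2 : ∑ i, ∑ j, ∑ k, ∑ l, a i j * a k l * (c k * c l * K i j) =
      c 0 ^ 2 * ∑ i, ∑ j, a i j * a 0 0 * K i j := by
    rw [Finset.mul_sum]
    refine Finset.sum_congr rfl fun i _ => ?_
    rw [Finset.mul_sum]
    refine Finset.sum_congr rfl fun j _ => ?_
    rw [Fin.sum_univ_succ, Fin.sum_univ_succ]
    simp only [hc, mul_zero, zero_mul, Finset.sum_const_zero, add_zero]
    ring
  rw [s1, s2, ← mul_sub, mul_assoc (c 0 ^ 2), ← mul_neg]
  congr 1
  rw [← Finset.sum_sub_distrib, Fin.sum_univ_succ]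
  have z : ∑ j, a 0 j * a 0 0 * K 0 j = ∑ l, a 0 0 * a 0 l * K 0 l :=
    Finset.sum_congr rfl fun j _ => by ring
  rw [z, sub_self, zero_add, Finset.mul_sum, ← Finset.sum_neg_distrib]
  refine Finset.sum_congr rfl fun i _ => ?_
  rw [← Finset.sum_sub_distrib, Fin.sum_univ_succ, hI i.succ 0]
  have z : a 0 i.succ * a 0 0 * K i.succ 0 - a 0 i.succ * a 0 0 * K i.succ 0 = 0 := sub_self _
  rw [z, zero_add, Finset.mul_sum, ← Finset.sum_neg_distrib]
  refine Finset.sum_congr rfl fun j _ => ?_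
  rw [inv_submatrix_succ_apply hA h0, ← ha, hI i.succ 0]
  field_simp
  ring

end Jets

end Gluing

namespace Gluing

/-! ### A convex smoothing of the positive part -/

section Ramp

/-- A convex smoothing `φ` of the positive part, with its first two derivatives `θ` and `ψ`. -/
structure SmoothRamp (φ θ ψ : ℝ → ℝ) : Prop where
  contDiff : ContDiff ℝ ∞ φ
  hasDerivAt : ∀ s, HasDerivAt φ (θ s) s
  hasDerivAt' : ∀ s, HasDerivAt θ (ψ s) s
  continuous_snd : Continuous ψ
  eq_zero : ∀ s ≤ -1, φ s = 0
  eq_self : ∀ s, 1 ≤ s → φ s = s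
  θ_eq_zero : ∀ s ≤ -1, θ s = 0
  θ_eq_one : ∀ s, 1 ≤ s → θ s = 1
  θ_nonneg : ∀ s, 0 ≤ θ s
  θ_le_one : ∀ s, θ s ≤ 1
  ψ_nonneg : ∀ s, 0 ≤ ψ s
  ψ_pos : ∀ s, -1 < s → s < 1 → 0 < ψ s

/-- `φ` is the second primitive of a normalised even bump on `[-1, 1]`. Evenness makes the first
moment of the bump vanish, so that `φ s` equals `s` exactly, with no additive constant, for `s ≥ 1`.
-/
theorem exists_smoothRamp : ∃ φ θ ψ : ℝ → ℝ, SmoothRamp φ θ ψ := by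
  let ρ : ℝ → ℝ := fun u => expNegInvGlue (1 - u ^ 2)
  have hρ : ContDiff ℝ ∞ ρ := expNegInvGlue.contDiff.comp (by fun_prop)
  have hρ0 : ∀ u, 0 ≤ ρ u := fun u => expNegInvGlue.nonneg _
  have hρp : ∀ u, -1 < u → u < 1 → 0 < ρ u := fun u h1 h2 =>
    expNegInvGlue.pos_of_pos (by nlinarith)
  have hρz : ∀ u, u ≤ -1 ∨ 1 ≤ u → ρ u = 0 := fun u h =>
    expNegInvGlue.zero_of_nonpos (by rcases h with h | h <;> nlinarith)
  have hρe : ∀ u, ρ (-u) = ρ u := fun u => by simp [ρ]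
  have hii : ∀ a b, IntervalIntegrable ρ MeasureTheory.volume a b := fun a b =>
    hρ.continuous.intervalIntegrable a b
  set Z := ∫ u in (-1 : ℝ)..1, ρ u with hZ
  have hZp : 0 < Z := intervalIntegral.intervalIntegral_pos_of_pos_on (hii _ _)
    (fun u hu => hρp u hu.1 hu.2) (by norm_num)
  have hυ : Continuous fun u => u * ρ u := continuous_id.mul hρ.continuous
  let P : ℝ → ℝ := fun s => ∫ u in (-1 : ℝ)..s, ρ u
  let Q : ℝ → ℝ := fun s => ∫ u in (-1 : ℝ)..s, u * ρ u
  have hP : ∀ s, HasDerivAt P (ρ s) s := fun s => intervalIntegral.integral_hasDerivAt_right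
    (hii _ _) (hρ.continuous.stronglyMeasurableAtFilter _ _) hρ.continuous.continuousAt
  have hQ : ∀ s, HasDerivAt Q (s * ρ s) s := fun s => intervalIntegral.integral_hasDerivAt_right
    (hυ.intervalIntegrable _ _) (hυ.stronglyMeasurableAtFilter _ _) hυ.continuousAt
  have hPl : ∀ s ≤ -1, P s = 0 := fun s hs => by
    have : P s = ∫ u in (-1 : ℝ)..s, (0 : ℝ) := intervalIntegral.integral_congr fun u hu => by
      rw [Set.uIcc_of_ge hs] at hu; exact hρz u (Or.inl hu.2)
    rw [this]; simp
  have hQl : ∀ s ≤ -1, Q s = 0 := fun s hs => by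
    have : Q s = ∫ u in (-1 : ℝ)..s, (0 : ℝ) := intervalIntegral.integral_congr fun u hu => by
      rw [Set.uIcc_of_ge hs] at hu; simp [hρz u (Or.inl hu.2)]
    rw [this]; simp
  have hPr : ∀ s, 1 ≤ s → P s = Z := fun s hs => by
    have h1 : P s = Z + ∫ u in (1 : ℝ)..s, ρ u :=
      (intervalIntegral.integral_add_adjacent_intervals (hii _ _) (hii _ _)).symm
    have : ∫ u in (1 : ℝ)..s, ρ u = ∫ u in (1 : ℝ)..s, (0 : ℝ) :=
      intervalIntegral.integral_congr fun u hu => by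
        rw [Set.uIcc_of_le hs] at hu; exact hρz u (Or.inr hu.1)
    rw [h1, this]; simp
  have hQr : ∀ s, 1 ≤ s → Q s = 0 := fun s hs => by
    have h1 : Q s = (∫ u in (-1 : ℝ)..1, u * ρ u) + ∫ u in (1 : ℝ)..s, u * ρ u :=
      (intervalIntegral.integral_add_adjacent_intervals (hυ.intervalIntegrable _ _)
        (hυ.intervalIntegrable _ _)).symm
    have h2 : ∫ u in (1 : ℝ)..s, u * ρ u = ∫ u in (1 : ℝ)..s, (0 : ℝ) :=
      intervalIntegral.integral_congr fun u hu => by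
        rw [Set.uIcc_of_le hs] at hu; simp [hρz u (Or.inr hu.1)]
    -- The integrand is odd.
    have h3 : ∫ u in (-1 : ℝ)..1, u * ρ u = -∫ u in (-1 : ℝ)..1, u * ρ u := by
      have := intervalIntegral.integral_comp_neg (a := (-1 : ℝ)) (b := 1) fun u => u * ρ u
      simp only [hρe, neg_neg] at this
      rw [← intervalIntegral.integral_neg, ← this]
      exact intervalIntegral.integral_congr fun u _ => neg_mul _ _
    rw [h1, h2]
    simp only [intervalIntegral.integral_zero, add_zero]
    linarith
  have hPmono : Monotone P := monotone_of_hasDerivAt_nonneg hP hρ0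
  have hPn : ∀ s, 0 ≤ P s := fun s => by
    rw [← hPl (min s (-1)) (min_le_right _ _)]; exact hPmono (min_le_left _ _)
  have hPu : ∀ s, P s ≤ Z := fun s => by
    rw [← hPr (max s 1) (le_max_right _ _)]; exact hPmono (le_max_left _ _)
  -- The repeated integral `∫ (s - u) ρ u du` as a combination of the two moments; in its derivative
  -- the terms with `s ρ s` cancel.
  let φ : ℝ → ℝ := fun s => (s * P s - Q s) / Z
  have hφ : ∀ s, HasDerivAt φ (P s / Z) s := fun s => by
    have := (((hasDerivAt_id s).mul (hP s)).sub (hQ s)).div_const Z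
    refine this.congr_deriv ?_
    simp
  have hPc : ContDiff ℝ ∞ P := by
    rw [contDiff_infty_iff_deriv]
    exact ⟨fun s => (hP s).differentiableAt, by rwa [show deriv P = ρ from funext fun s => (hP s).deriv]⟩
  refine ⟨φ, fun s => P s / Z, fun s => ρ s / Z, ?_, hφ, fun s => (hP s).div_const Z,
    hρ.continuous.div_const _, ?_, ?_, ?_, ?_, fun s => div_nonneg (hPn s) hZp.le,
    fun s => (div_le_one hZp).2 (hPu s), fun s => div_nonneg (hρ0 s) hZp.le,
    fun s h1 h2 => div_pos (hρp s h1 h2) hZp⟩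
  · rw [contDiff_infty_iff_deriv]
    refine ⟨fun s => (hφ s).differentiableAt, ?_⟩
    rw [show deriv φ = fun s => P s / Z from funext fun s => (hφ s).deriv]
    exact hPc.div_const _
  · intro s hs; simp [φ, hPl s hs, hQl s hs]
  · intro s hs; simp only [φ, hPr s hs, hQr s hs, sub_zero]; field_simp
  · intro s hs; simp [hPl s hs]
  · intro s hs; simp only [hPr s hs]; exact div_self hZp.ne'

variable {φ θ ψ : ℝ → ℝ}

theorem SmoothRamp.monotone (h : SmoothRamp φ θ ψ) : Monotone φ := monotone_of_hasDerivAt_nonneg h.hasDerivAt h.θ_nonneg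

theorem SmoothRamp.nonneg (h : SmoothRamp φ θ ψ) (s : ℝ) : 0 ≤ φ s := by
  rw [← h.eq_zero (min s (-1)) (min_le_right _ _)]; exact h.monotone (min_le_left _ _)

theorem SmoothRamp.self_le (h : SmoothRamp φ θ ψ) (s : ℝ) : s ≤ φ s := by
  have hm : Monotone fun s => s - φ s := monotone_of_hasDerivAt_nonneg
    (fun s => (hasDerivAt_id s).sub (h.hasDerivAt s)) fun s => by
      simpa using h.θ_le_one s
  have := hm (le_max_left s 1)
  simp only [h.eq_self _ (le_max_right s 1), sub_self] at this
  linarith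

theorem SmoothRamp.le_abs_add_one (h : SmoothRamp φ θ ψ) (s : ℝ) : φ s ≤ |s| + 1 := by
  have h1 := h.monotone (le_max_left s 1)
  rw [h.eq_self _ (le_max_right s 1)] at h1
  exact h1.trans (max_le (by linarith [le_abs_self s]) (by linarith [abs_nonneg s]))

theorem SmoothRamp.θ_mono (h : SmoothRamp φ θ ψ) : Monotone θ := monotone_of_hasDerivAt_nonneg h.hasDerivAt' h.ψ_nonneg

theorem SmoothRamp.θ_continuous (h : SmoothRamp φ θ ψ) : Continuous θ :=
  continuous_iff_continuousAt.2 fun s => (h.hasDerivAt' s).continuousAt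

/-- Both inequalities are strict so that a slope close to `0`, or close to `1`, reveals on which
side of the seam the point lies. -/
theorem SmoothRamp.θ_zero_mem (h : SmoothRamp φ θ ψ) : 0 < θ 0 ∧ θ 0 < 1 := by
  have hst : StrictMonoOn θ (Set.Icc (-1) 1) := by
    refine strictMonoOn_of_deriv_pos (convex_Icc _ _) h.θ_continuous.continuousOn fun s hs => ?_
    rw [interior_Icc] at hs
    rw [(h.hasDerivAt' s).deriv]
    exact h.ψ_pos s hs.1 hs.2
  constructor
  · refine (h.θ_nonneg (-1)).trans_lt ?_
    exact hst (Set.mem_Icc.2 ⟨by norm_num, by norm_num⟩) (Set.mem_Icc.2 ⟨by norm_num, by norm_num⟩)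
      (by norm_num)
  · refine lt_of_lt_of_le ?_ (h.θ_le_one 1)
    exact hst (Set.mem_Icc.2 ⟨by norm_num, by norm_num⟩) (Set.mem_Icc.2 ⟨by norm_num, by norm_num⟩)
      (by norm_num)

/-- Where the slope of the ramp stays away from `0` and `1`, its second derivative is bounded
below. -/
theorem SmoothRamp.exists_le_ψ (h : SmoothRamp φ θ ψ) {a b : ℝ} (ha : 0 < a) (hb : b < 1) :
    ∃ c > 0, ∀ s, a ≤ θ s → θ s ≤ b → c ≤ ψ s := by
  let K : Set ℝ := {s | a ≤ θ s ∧ θ s ≤ b}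
  have hK : K ⊆ Set.Ioo (-1) 1 := by
    intro s hs
    constructor
    · by_contra hlt
      have := h.θ_eq_zero s (not_lt.1 hlt)
      linarith [hs.1]
    · by_contra hlt
      have := h.θ_eq_one s (not_lt.1 hlt)
      linarith [hs.2]
  have hKc : IsCompact K := by
    refine (isCompact_Icc (a := (-1 : ℝ)) (b := 1)).of_isClosed_subset ?_
      (hK.trans Set.Ioo_subset_Icc_self)
    exact (isClosed_le continuous_const h.θ_continuous).inter
      (isClosed_le h.θ_continuous continuous_const)
  rcases K.eq_empty_or_nonempty with he | hne
  · refine ⟨1, one_pos, fun s h1 h2 => ?_⟩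
    have : s ∈ K := ⟨h1, h2⟩
    simp [he] at this
  · obtain ⟨s₀, hs₀, hmin⟩ := hKc.exists_isMinOn hne h.continuous_snd.continuousOn
    exact ⟨ψ s₀, h.ψ_pos s₀ (hK hs₀).1 (hK hs₀).2, fun s h1 h2 => hmin (show s ∈ K from ⟨h1, h2⟩)⟩

end Ramp

end Gluing

namespace Gluing

/-! ### Scalar curvature is local -/

section Localization

variable {n : ℕ} {s : Set (EuclideanSpace ℝ (Fin n))} {x : EuclideanSpace ℝ (Fin n)}
  {G G' : EuclideanSpace ℝ (Fin n) → Matrix (Fin n) (Fin n) ℝ}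

theorem christoffel_congr (h : Set.EqOn G G' s) (hx : x ∈ s) (k i j : Fin n) :
    christoffel s G k i j x = christoffel s G' k i j x := by
  have e : ∀ a b c, pderivWithin s a (fun z => G z b c) x = pderivWithin s a (fun z => G' z b c) x :=
    fun a b c => pderivWithin_congr (fun z hz => by rw [h hz]) hx
  simp only [christoffel, e, h hx]

theorem scalCoord_congr (h : Set.EqOn G G' s) (hx : x ∈ s) :
    scalCoord s G x = scalCoord s G' x := by
  have e : ∀ a b c, christoffel s G a b c x = christoffel s G' a b c x := christoffel_congr h hx
  have e' : ∀ p a b c, pderivWithin s p (christoffel s G a b c) x =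
      pderivWithin s p (christoffel s G' a b c) x := fun p a b c =>
    pderivWithin_congr (fun z hz => christoffel_congr h hz a b c) hx
  simp only [scalCoord, ricci, e, e', h hx]

theorem christoffel_inter {V : Set (EuclideanSpace ℝ (Fin n))} (hV : V ∈ 𝓝 x) (k i j : Fin n) :
    christoffel (s ∩ V) G k i j x = christoffel s G k i j x := by
  simp only [christoffel, pderivWithin_inter hV]

theorem scalCoord_inter {V : Set (EuclideanSpace ℝ (Fin n))} (hV : IsOpen V) (hxV : x ∈ V)
    (hx : x ∈ s) : scalCoord (s ∩ V) G x = scalCoord s G x := by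
  have e : ∀ z ∈ V, ∀ a b c, christoffel (s ∩ V) G a b c z = christoffel s G a b c z :=
    fun z hz => christoffel_inter (hV.mem_nhds hz)
  have e' : ∀ p a b c, pderivWithin (s ∩ V) p (christoffel (s ∩ V) G a b c) x =
      pderivWithin s p (christoffel s G a b c) x := fun p a b c => by
    rw [pderivWithin_congr (fun z hz => e z hz.2 a b c) (show x ∈ s ∩ V from ⟨hx, hxV⟩),
      pderivWithin_inter (hV.mem_nhds hxV)]
  simp only [scalCoord, ricci, e x hxV, e']

theorem mpderiv_mpderiv_inter {V : Set (EuclideanSpace ℝ (Fin n))} (hV : IsOpen V) (hxV : x ∈ V)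
    (hx : x ∈ s) (k l : Fin n) :
    mpderiv (s ∩ V) l (mpderiv (s ∩ V) k G) x = mpderiv s l (mpderiv s k G) x := by
  ext a b
  simp only [mpderiv, Matrix.of_apply]
  rw [pderivWithin_congr (g := fun z => pderivWithin s k (fun z => G z a b) z)
    (fun z hz => pderivWithin_inter (hV.mem_nhds hz.2)) (show x ∈ s ∩ V from ⟨hx, hxV⟩),
    pderivWithin_inter (hV.mem_nhds hxV)]

theorem SmoothMatrixOn.exists_det_ne (hG : SmoothMatrixOn s G) (hx : x ∈ s) (hdet : (G x).det ≠ 0) :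
    ∃ V, IsOpen V ∧ x ∈ V ∧ ∀ z ∈ s ∩ V, (G z).det ≠ 0 := by
  have h1 : ∀ᶠ z in 𝓝[s] x, (G z).det ≠ 0 :=
    (hG.det.continuousOn x hx).eventually_ne hdet
  obtain ⟨V, hVo, hxV, hV⟩ := mem_nhdsWithin.1 h1
  exact ⟨V, hVo, hxV, fun z hz => hV ⟨hz.2, hz.1⟩⟩

theorem scalCoord_eq_scalJet_of_det_ne (hs : UniqueDiffOn ℝ s) (hG : SmoothMatrixOn s G)
    (hx : x ∈ s) (hdet : (G x).det ≠ 0) :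
    scalCoord s G x = scalJet (G x) (fun k => mpderiv s k G x)
      (fun l k => mpderiv s l (mpderiv s k G) x) := by
  obtain ⟨V, hVo, hxV, hV⟩ := hG.exists_det_ne hx hdet
  rw [← scalCoord_inter hVo hxV hx, scalCoord_eq_scalJet (hs.inter hVo)
    (hG.mono Set.inter_subset_left) hV ⟨hx, hxV⟩]
  congr 1
  · funext k
    ext a b
    exact pderivWithin_inter (hVo.mem_nhds hxV)
  · funext l k
    exact mpderiv_mpderiv_inter hVo hxV hx k l

end Localization

/-! ### Derivatives of `B (y, α y, β y)` -/

section RampCalculus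

variable {n : ℕ}

/-- Partial derivatives on the whole space. -/
def pd (k : Fin n) (f : EuclideanSpace ℝ (Fin n) → ℝ) (y : EuclideanSpace ℝ (Fin n)) : ℝ :=
  fderiv ℝ f y (EuclideanSpace.single k 1)

theorem contDiffOn_pd {O : Set (EuclideanSpace ℝ (Fin n))} (hO : IsOpen O)
    {f : EuclideanSpace ℝ (Fin n) → ℝ} (hf : ContDiffOn ℝ ∞ f O) (k : Fin n) :
    ContDiffOn ℝ ∞ (pd k f) O :=
  (hf.fderiv_of_isOpen hO (m := ∞) (by simp)).clm_apply contDiffOn_const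

theorem pderivWithin_eq_pd {O s : Set (EuclideanSpace ℝ (Fin n))} (hO : IsOpen O)
    {f : EuclideanSpace ℝ (Fin n) → ℝ} (hf : ContDiffOn ℝ ∞ f O)
    {y : EuclideanSpace ℝ (Fin n)} (hy : y ∈ O) (hs : UniqueDiffWithinAt ℝ s y) (k : Fin n) :
    pderivWithin s k f y = pd k f y := by
  have hd : DifferentiableAt ℝ f y :=
    (hf.contDiffAt (hO.mem_nhds hy)).differentiableAt (by simp)
  rw [pderivWithin, hd.fderivWithin hs, pd]

/-- The domain `O × [0, ∞) × (-∞, 0]`. -/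
def rampDomain (O : Set (EuclideanSpace ℝ (Fin n))) : Set (EuclideanSpace ℝ (Fin n) × ℝ × ℝ) :=
  O ×ˢ (Set.Ici 0 ×ˢ Set.Iic 0)

theorem uniqueDiffOn_rampDomain {O : Set (EuclideanSpace ℝ (Fin n))} (hO : IsOpen O) :
    UniqueDiffOn ℝ (rampDomain O) :=
  hO.uniqueDiffOn.prod ((uniqueDiffOn_Ici 0).prod (uniqueDiffOn_Iic 0))

/-- Directional derivative within the domain `rampDomain O`. -/
def rampDeriv (O : Set (EuclideanSpace ℝ (Fin n))) (v : EuclideanSpace ℝ (Fin n) × ℝ × ℝ)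
    (B : EuclideanSpace ℝ (Fin n) × ℝ × ℝ → ℝ) (p : EuclideanSpace ℝ (Fin n) × ℝ × ℝ) : ℝ :=
  fderivWithin ℝ B (rampDomain O) p v

theorem contDiffOn_rampDeriv {O : Set (EuclideanSpace ℝ (Fin n))} (hO : IsOpen O)
    {B : EuclideanSpace ℝ (Fin n) × ℝ × ℝ → ℝ} (hB : ContDiffOn ℝ ∞ B (rampDomain O))
    (v : EuclideanSpace ℝ (Fin n) × ℝ × ℝ) : ContDiffOn ℝ ∞ (rampDeriv O v B) (rampDomain O) :=
  (hB.fderivWithin (uniqueDiffOn_rampDomain hO) (m := ∞) (by simp)).clm_apply contDiffOn_const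

/-- The functions `α ≥ 0` and `β ≤ 0` have sum `t` up to a constant and slopes `θ` and `1 - θ`
in terms of `t`; the slope of `θ` is `μ`. -/
structure RampFunctions (s : Set (EuclideanSpace ℝ (Fin n)))
    (t α β θ μ : EuclideanSpace ℝ (Fin n) → ℝ) : Prop where
  contDiffOn_fst : ContDiffOn ℝ ∞ α s
  contDiffOn_snd : ContDiffOn ℝ ∞ β s
  nonneg : ∀ y ∈ s, 0 ≤ α y
  nonpos : ∀ y ∈ s, β y ≤ 0
  deriv_fst : ∀ y ∈ s, HasFDerivWithinAt α (θ y • fderiv ℝ t y) s y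
  deriv_snd : ∀ y ∈ s, HasFDerivWithinAt β ((1 - θ y) • fderiv ℝ t y) s y
  deriv_slope : ∀ y ∈ s, HasFDerivWithinAt θ (μ y • fderiv ℝ t y) s y

/-- The first derivatives of `B (y, α y, β y)`. -/
def rampJet₁ (O : Set (EuclideanSpace ℝ (Fin n))) (t : EuclideanSpace ℝ (Fin n) → ℝ)
    (B : EuclideanSpace ℝ (Fin n) × ℝ × ℝ → ℝ) (k : Fin n)
    (p : EuclideanSpace ℝ (Fin n) × ℝ × ℝ) (θ : ℝ) : ℝ :=
  rampDeriv O (EuclideanSpace.single k 1, 0, 0) B p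
    + θ * (pd k t p.1 * rampDeriv O (0, 1, 0) B p)
    + (1 - θ) * (pd k t p.1 * rampDeriv O (0, 0, 1) B p)

/-- The bounded part of the second derivatives of `B (y, α y, β y)`. -/
def rampJet₂ (O : Set (EuclideanSpace ℝ (Fin n))) (t : EuclideanSpace ℝ (Fin n) → ℝ)
    (B : EuclideanSpace ℝ (Fin n) × ℝ × ℝ → ℝ) (l k : Fin n)
    (p : EuclideanSpace ℝ (Fin n) × ℝ × ℝ) (θ : ℝ) : ℝ :=
  rampJet₁ O t (rampDeriv O (EuclideanSpace.single k 1, 0, 0) B) l p θ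
    + θ * (pd l (pd k t) p.1 * rampDeriv O (0, 1, 0) B p
        + pd k t p.1 * rampJet₁ O t (rampDeriv O (0, 1, 0) B) l p θ)
    + (1 - θ) * (pd l (pd k t) p.1 * rampDeriv O (0, 0, 1) B p
        + pd k t p.1 * rampJet₁ O t (rampDeriv O (0, 0, 1) B) l p θ)

variable {O s : Set (EuclideanSpace ℝ (Fin n))} {t α β θ μ : EuclideanSpace ℝ (Fin n) → ℝ}
  {B : EuclideanSpace ℝ (Fin n) × ℝ × ℝ → ℝ} {y : EuclideanSpace ℝ (Fin n)}

theorem RampFunctions.mapsTo (h : RampFunctions s t α β θ μ) (hsO : s ⊆ O) :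
    Set.MapsTo (fun z => (z, α z, β z)) s (rampDomain O) := fun z hz =>
  ⟨hsO hz, h.nonneg z hz, h.nonpos z hz⟩

theorem RampFunctions.contDiffOn_comp (h : RampFunctions s t α β θ μ) (hsO : s ⊆ O)
    (hB : ContDiffOn ℝ ∞ B (rampDomain O)) : ContDiffOn ℝ ∞ (fun z => B (z, α z, β z)) s :=
  hB.comp (contDiffOn_id.prodMk (h.contDiffOn_fst.prodMk h.contDiffOn_snd)) (h.mapsTo hsO)

theorem RampFunctions.pderivWithin_comp (h : RampFunctions s t α β θ μ) (hsO : s ⊆ O)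
    (hs : UniqueDiffOn ℝ s) (hB : ContDiffOn ℝ ∞ B (rampDomain O)) (hy : y ∈ s) (k : Fin n) :
    pderivWithin s k (fun z => B (z, α z, β z)) y = rampJet₁ O t B k (y, α y, β y) (θ y) := by
  have hc : HasFDerivWithinAt (fun z => (z, α z, β z)) ((ContinuousLinearMap.id ℝ _).prod
      ((θ y • fderiv ℝ t y).prod ((1 - θ y) • fderiv ℝ t y))) s y :=
    (hasFDerivWithinAt_id y s).prodMk ((h.deriv_fst y hy).prodMk (h.deriv_snd y hy))
  have hB' : HasFDerivWithinAt B (fderivWithin ℝ B (rampDomain O) (y, α y, β y)) (rampDomain O)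
      (y, α y, β y) :=
    (hB.differentiableOn (by simp) _ (h.mapsTo hsO hy)).hasFDerivWithinAt
  have := (hB'.comp y hc (h.mapsTo hsO)).fderivWithin (hs y hy)
  rw [pderivWithin, show (fun z => B (z, α z, β z)) = B ∘ fun z => (z, α z, β z) from rfl, this]
  simp only [ContinuousLinearMap.comp_apply, ContinuousLinearMap.prod_apply,
    ContinuousLinearMap.id_apply, _root_.smul_apply, smul_eq_mul]
  have hv : ((EuclideanSpace.single k (1 : ℝ) : EuclideanSpace ℝ (Fin n)), θ y * pd k t y,
      (1 - θ y) * pd k t y) = (EuclideanSpace.single k (1 : ℝ), (0 : ℝ), (0 : ℝ))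
      + (θ y * pd k t y) • ((0 : EuclideanSpace ℝ (Fin n)), (1 : ℝ), (0 : ℝ))
      + ((1 - θ y) * pd k t y) • ((0 : EuclideanSpace ℝ (Fin n)), (0 : ℝ), (1 : ℝ)) := by
    simp
  have hv' : fderivWithin ℝ B (rampDomain O) (y, α y, β y)
      ((EuclideanSpace.single k (1 : ℝ) : EuclideanSpace ℝ (Fin n)), θ y * pd k t y,
      (1 - θ y) * pd k t y) = rampJet₁ O t B k (y, α y, β y) (θ y) := by
    rw [hv, map_add, map_add, map_smul, map_smul]
    simp only [smul_eq_mul, rampJet₁, rampDeriv]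
    ring
  exact hv'

/-- The factor `μ` arises only when the slopes `θ` and `1 - θ` are differentiated. Their derivatives
are opposite, which produces the difference of the two transverse derivatives of `B`. -/
theorem RampFunctions.pderivWithin_pderivWithin_comp (h : RampFunctions s t α β θ μ)
    (hO : IsOpen O) (ht : ContDiffOn ℝ ∞ t O) (hsO : s ⊆ O) (hs : UniqueDiffOn ℝ s)
    (hB : ContDiffOn ℝ ∞ B (rampDomain O)) (hy : y ∈ s) (l k : Fin n) :
    pderivWithin s l (pderivWithin s k (fun z => B (z, α z, β z))) y =
      rampJet₂ O t B l k (y, α y, β y) (θ y) + μ y * (pd l t y * pd k t y *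
        (rampDeriv O (0, 1, 0) B (y, α y, β y) - rampDeriv O (0, 0, 1) B (y, α y, β y))) := by
  have hBk := contDiffOn_rampDeriv hO hB (EuclideanSpace.single k 1, 0, 0)
  have hBa := contDiffOn_rampDeriv hO hB (0, 1, 0)
  have hBb := contDiffOn_rampDeriv hO hB (0, 0, 1)
  have hu := hs y hy
  have htk := contDiffOn_pd hO ht k
  have dk : ∀ {C : EuclideanSpace ℝ (Fin n) × ℝ × ℝ → ℝ}, ContDiffOn ℝ ∞ C (rampDomain O) →
      DifferentiableWithinAt ℝ (fun z => C (z, α z, β z)) s y := fun hC =>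
    (h.contDiffOn_comp hsO hC).differentiableOn (by simp) y hy
  have dt : DifferentiableWithinAt ℝ (pd k t) s y :=
    (htk.mono hsO).differentiableOn (by simp) y hy
  have dθ : DifferentiableWithinAt ℝ θ s y := (h.deriv_slope y hy).differentiableWithinAt
  have hθ : pderivWithin s l θ y = μ y * pd l t y := by
    rw [pderivWithin, (h.deriv_slope y hy).fderivWithin hu]; rfl
  have hθ' : pderivWithin s l (fun z => 1 - θ z) y = -(μ y * pd l t y) := by
    rw [pderivWithin_sub hu (differentiableWithinAt_const _) dθ, pderivWithin_const, hθ, zero_sub]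
  rw [pderivWithin_congr (fun z hz => h.pderivWithin_comp hsO hs hB hz k) hy]
  simp only [rampJet₁]
  have da := dt.fun_mul (dk hBa)
  have db := dt.fun_mul (dk hBb)
  have dθ' : DifferentiableWithinAt ℝ (fun z => 1 - θ z) s y :=
    (differentiableWithinAt_const _).sub dθ
  have E1 := pderivWithin_add (k := l) hu ((dk hBk).fun_add (dθ.fun_mul da)) (dθ'.fun_mul db)
  have E2 := pderivWithin_add (k := l) hu (dk hBk) (dθ.fun_mul da)
  have E3 := pderivWithin_mul (k := l) hu dθ da
  have E4 := pderivWithin_mul (k := l) hu dθ' db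
  have E5 := pderivWithin_mul (k := l) hu dt (dk hBa)
  have E6 := pderivWithin_mul (k := l) hu dt (dk hBb)
  rw [E1, E2, E3, E4, E5, E6, hθ, hθ', h.pderivWithin_comp hsO hs hBk hy,
    h.pderivWithin_comp hsO hs hBa hy, h.pderivWithin_comp hsO hs hBb hy,
    pderivWithin_eq_pd hO htk (hsO hy) hu]
  simp only [rampJet₂]
  ring

theorem continuousOn_rampJet₁ (hO : IsOpen O) (ht : ContDiffOn ℝ ∞ t O)
    (hB : ContDiffOn ℝ ∞ B (rampDomain O)) (k : Fin n) :
    ContinuousOn (fun q : (EuclideanSpace ℝ (Fin n) × ℝ × ℝ) × ℝ => rampJet₁ O t B k q.1 q.2)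
      (rampDomain O ×ˢ Set.univ) := by
  have h1 : ∀ {C : EuclideanSpace ℝ (Fin n) × ℝ × ℝ → ℝ}, ContDiffOn ℝ ∞ C (rampDomain O) →
      ContinuousOn (fun q : (EuclideanSpace ℝ (Fin n) × ℝ × ℝ) × ℝ => C q.1)
      (rampDomain O ×ˢ Set.univ) := fun hC =>
    hC.continuousOn.comp continuousOn_fst fun q hq => hq.1
  have h2 : ContinuousOn (fun q : (EuclideanSpace ℝ (Fin n) × ℝ × ℝ) × ℝ => pd k t q.1.1)
      (rampDomain O ×ˢ Set.univ) := (contDiffOn_pd hO ht k).continuousOn.comp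
    (continuous_fst.comp continuous_fst).continuousOn fun q hq => hq.1.1
  exact ((h1 (contDiffOn_rampDeriv hO hB _)).add (continuousOn_snd.mul
    (h2.mul (h1 (contDiffOn_rampDeriv hO hB _))))).add ((continuousOn_const.sub
    continuousOn_snd).mul (h2.mul (h1 (contDiffOn_rampDeriv hO hB _))))

theorem continuousOn_rampJet₂ (hO : IsOpen O) (ht : ContDiffOn ℝ ∞ t O)
    (hB : ContDiffOn ℝ ∞ B (rampDomain O)) (l k : Fin n) :
    ContinuousOn (fun q : (EuclideanSpace ℝ (Fin n) × ℝ × ℝ) × ℝ => rampJet₂ O t B l k q.1 q.2)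
      (rampDomain O ×ˢ Set.univ) := by
  have h1 : ∀ {C : EuclideanSpace ℝ (Fin n) × ℝ × ℝ → ℝ}, ContDiffOn ℝ ∞ C (rampDomain O) →
      ContinuousOn (fun q : (EuclideanSpace ℝ (Fin n) × ℝ × ℝ) × ℝ => C q.1)
      (rampDomain O ×ˢ Set.univ) := fun hC =>
    hC.continuousOn.comp continuousOn_fst fun q hq => hq.1
  have h2 : ∀ {f : EuclideanSpace ℝ (Fin n) → ℝ}, ContDiffOn ℝ ∞ f O →
      ContinuousOn (fun q : (EuclideanSpace ℝ (Fin n) × ℝ × ℝ) × ℝ => f q.1.1)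
      (rampDomain O ×ˢ Set.univ) := fun hf => hf.continuousOn.comp
    (continuous_fst.comp continuous_fst).continuousOn fun q hq => hq.1.1
  have htk := contDiffOn_pd hO ht k
  have htlk := contDiffOn_pd hO htk l
  have hBd := fun v => contDiffOn_rampDeriv hO hB v
  exact ((continuousOn_rampJet₁ hO ht (hBd _) l).add (continuousOn_snd.mul
    (((h2 htlk).mul (h1 (hBd _))).add ((h2 htk).mul (continuousOn_rampJet₁ hO ht (hBd _) l))))).add
    ((continuousOn_const.sub continuousOn_snd).mul
    (((h2 htlk).mul (h1 (hBd _))).add ((h2 htk).mul (continuousOn_rampJet₁ hO ht (hBd _) l))))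

/-- Together with `rampFunctions_upper`, the degenerate case that recovers the original metric on
one side. Its scalar curvature then obeys the same formulas as the smoothed one, with slope `0` or
`1` and `μ = 0`. -/
theorem rampFunctions_lower (hO : IsOpen O) (ht : ContDiffOn ℝ ∞ t O) (hsO : s ⊆ O)
    (hneg : ∀ y ∈ s, t y ≤ 0) : RampFunctions s t (fun _ => 0) t (fun _ => 0) (fun _ => 0) where
  contDiffOn_fst := contDiffOn_const
  contDiffOn_snd := ht.mono hsO
  nonneg _ _ := le_rfl
  nonpos := hneg
  deriv_fst y _ := by simpa using hasFDerivWithinAt_const (0 : ℝ) y s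
  deriv_snd y hy := by
    simpa using ((ht.contDiffAt (hO.mem_nhds (hsO hy))).differentiableAt
      (by simp)).hasFDerivAt.hasFDerivWithinAt
  deriv_slope y _ := by simpa using hasFDerivWithinAt_const (0 : ℝ) y s

theorem rampFunctions_upper (hO : IsOpen O) (ht : ContDiffOn ℝ ∞ t O) (hsO : s ⊆ O)
    (hpos : ∀ y ∈ s, 0 ≤ t y) : RampFunctions s t t (fun _ => 0) (fun _ => 1) (fun _ => 0) where
  contDiffOn_fst := ht.mono hsO
  contDiffOn_snd := contDiffOn_const
  nonneg := hpos
  nonpos _ _ := le_rfl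
  deriv_fst y hy := by
    simpa using ((ht.contDiffAt (hO.mem_nhds (hsO hy))).differentiableAt
      (by simp)).hasFDerivAt.hasFDerivWithinAt
  deriv_snd y _ := by simpa using hasFDerivWithinAt_const (0 : ℝ) y s
  deriv_slope y _ := by simpa using hasFDerivWithinAt_const (1 : ℝ) y s

/-- The scaling leaves `α` small and the slope in `[0, 1]`, but divides the second derivative by
`δ`. The sign of `β` is `s ≤ φ s`. -/
theorem rampFunctions_smoothing {φ ϑ ψ : ℝ → ℝ} (h : SmoothRamp φ ϑ ψ) (hO : IsOpen O)
    (ht : ContDiffOn ℝ ∞ t O) {δ : ℝ} (hδ : 0 < δ) :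
    RampFunctions O t (fun z => δ * φ (t z / δ)) (fun z => t z - δ * φ (t z / δ))
      (fun z => ϑ (t z / δ)) (fun z => ψ (t z / δ) / δ) := by
  have hd : ∀ y ∈ O, HasFDerivAt t (fderiv ℝ t y) y := fun y hy =>
    ((ht.contDiffAt (hO.mem_nhds hy)).differentiableAt (by simp)).hasFDerivAt
  have hd' : ∀ y ∈ O, HasFDerivAt (fun z => t z / δ) (δ⁻¹ • fderiv ℝ t y) y := fun y hy => by
    simpa [div_eq_inv_mul] using (hd y hy).const_mul δ⁻¹
  have hα : ContDiffOn ℝ ∞ (fun z => δ * φ (t z / δ)) O :=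
    contDiffOn_const.mul (h.contDiff.comp_contDiffOn (ht.div_const δ))
  have hα' : ∀ y ∈ O, HasFDerivWithinAt (fun z => δ * φ (t z / δ))
      (ϑ (t y / δ) • fderiv ℝ t y) O y := by
    intro y hy
    have := (((h.hasDerivAt (t y / δ)).comp_hasFDerivAt y (hd' y hy)).const_mul δ).hasFDerivWithinAt
      (s := O)
    refine this.congr_fderiv ?_
    rw [smul_smul, smul_smul]
    congr 1
    field_simp
  refine ⟨hα, ht.sub hα, fun y _ => mul_nonneg hδ.le (h.nonneg _), fun y _ => ?_, hα',
    fun y hy => ?_, fun y hy => ?_⟩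
  · have := mul_le_mul_of_nonneg_left (h.self_le (t y / δ)) hδ.le
    rw [mul_div_cancel₀ _ hδ.ne'] at this
    linarith
  · have := (hd y hy).hasFDerivWithinAt.sub (hα' y hy)
    refine this.congr_fderiv ?_
    rw [sub_smul, one_smul]
  · have := ((h.hasDerivAt' (t y / δ)).comp_hasFDerivAt y (hd' y hy)).hasFDerivWithinAt (s := O)
    refine this.congr_fderiv ?_
    rw [smul_smul]; rfl

end RampCalculus

end Gluing

namespace Gluing

/-! ### Weighted sums of interpolated metrics -/

section TotalJet

variable {n : ℕ} {ι : Type*} [Fintype ι]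

/-- The value of a weighted sum of metrics `B i (y, αᵢ y, βᵢ y)`. -/
def totalJet₀ (r : ι → EuclideanSpace ℝ (Fin n) → ℝ)
    (B : ι → EuclideanSpace ℝ (Fin n) × ℝ × ℝ → Matrix (Fin n) (Fin n) ℝ)
    (y : EuclideanSpace ℝ (Fin n)) (c : ι → EuclideanSpace ℝ (Fin n) × ℝ × ℝ) :
    Matrix (Fin n) (Fin n) ℝ :=
  ∑ i, r i y • B i (c i)

/-- The first derivatives of a weighted sum of metrics `B i (y, αᵢ y, βᵢ y)`. -/
def totalJet₁ (O : Set (EuclideanSpace ℝ (Fin n))) (t r : ι → EuclideanSpace ℝ (Fin n) → ℝ)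
    (B : ι → EuclideanSpace ℝ (Fin n) × ℝ × ℝ → Matrix (Fin n) (Fin n) ℝ)
    (y : EuclideanSpace ℝ (Fin n)) (c : ι → EuclideanSpace ℝ (Fin n) × ℝ × ℝ) (θ : ι → ℝ)
    (k : Fin n) : Matrix (Fin n) (Fin n) ℝ :=
  Matrix.of fun p q => ∑ i, (pd k (r i) y * B i (c i) p q
    + r i y * rampJet₁ O (t i) (fun z => B i z p q) k (c i) (θ i))

/-- The bounded part of the second derivatives of a weighted sum of metrics
`B i (y, αᵢ y, βᵢ y)`. -/
def totalJet₂ (O : Set (EuclideanSpace ℝ (Fin n))) (t r : ι → EuclideanSpace ℝ (Fin n) → ℝ)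
    (B : ι → EuclideanSpace ℝ (Fin n) × ℝ × ℝ → Matrix (Fin n) (Fin n) ℝ)
    (y : EuclideanSpace ℝ (Fin n)) (c : ι → EuclideanSpace ℝ (Fin n) × ℝ × ℝ) (θ : ι → ℝ)
    (l k : Fin n) : Matrix (Fin n) (Fin n) ℝ :=
  Matrix.of fun p q => ∑ i, (pd l (pd k (r i)) y * B i (c i) p q
    + pd k (r i) y * rampJet₁ O (t i) (fun z => B i z p q) l (c i) (θ i)
    + pd l (r i) y * rampJet₁ O (t i) (fun z => B i z p q) k (c i) (θ i)
    + r i y * rampJet₂ O (t i) (fun z => B i z p q) l k (c i) (θ i))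

/-- The jump of the transversal derivative of `B`. -/
def rampJump (O : Set (EuclideanSpace ℝ (Fin n)))
    (B : EuclideanSpace ℝ (Fin n) × ℝ × ℝ → Matrix (Fin n) (Fin n) ℝ)
    (p : EuclideanSpace ℝ (Fin n) × ℝ × ℝ) : Matrix (Fin n) (Fin n) ℝ :=
  Matrix.of fun a b => rampDeriv O (0, 1, 0) (fun z => B z a b) p
    - rampDeriv O (0, 0, 1) (fun z => B z a b) p

variable {O s : Set (EuclideanSpace ℝ (Fin n))} {t r : ι → EuclideanSpace ℝ (Fin n) → ℝ}
  {B : ι → EuclideanSpace ℝ (Fin n) × ℝ × ℝ → Matrix (Fin n) (Fin n) ℝ}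
  {α β θ μ : ι → EuclideanSpace ℝ (Fin n) → ℝ} {y : EuclideanSpace ℝ (Fin n)}

theorem smoothMatrixOn_ramp (hB : ∀ i p q, ContDiffOn ℝ ∞ (fun z => B i z p q) (rampDomain O))
    (hr : ∀ i, ContDiffOn ℝ ∞ (r i) O) (hsO : s ⊆ O)
    (h : ∀ i, RampFunctions s (t i) (α i) (β i) (θ i) (μ i)) :
    SmoothMatrixOn s (fun z => ∑ i, r i z • B i (z, α i z, β i z)) :=
  SmoothMatrixOn.smul_sum (fun i => (hr i).mono hsO) fun i p q =>
    (h i).contDiffOn_comp hsO (hB i p q)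

theorem mpderiv_ramp (hO : IsOpen O)
    (hB : ∀ i p q, ContDiffOn ℝ ∞ (fun z => B i z p q) (rampDomain O))
    (hr : ∀ i, ContDiffOn ℝ ∞ (r i) O) (hsO : s ⊆ O) (hs : UniqueDiffOn ℝ s)
    (h : ∀ i, RampFunctions s (t i) (α i) (β i) (θ i) (μ i)) (hy : y ∈ s) (k : Fin n) :
    mpderiv s k (fun z => ∑ i, r i z • B i (z, α i z, β i z)) y =
      totalJet₁ O t r B y (fun i => (y, α i y, β i y)) (fun i => θ i y) k := by
  rw [mpderiv_smul_sum (M := fun i z => B i (z, α i z, β i z)) hs (fun i => (hr i).mono hsO)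
    (fun i p q => (h i).contDiffOn_comp hsO (hB i p q)) hy]
  ext p q
  simp only [totalJet₁, Matrix.of_apply, Matrix.sum_apply, Matrix.add_apply, Matrix.smul_apply,
    smul_eq_mul]
  refine Finset.sum_congr rfl fun i _ => ?_
  rw [pderivWithin_eq_pd hO (hr i) (hsO hy) (hs y hy)]
  congr 2
  exact (h i).pderivWithin_comp hsO hs (hB i p q) hy k

theorem mpderiv_mpderiv_ramp (hO : IsOpen O)
    (hB : ∀ i p q, ContDiffOn ℝ ∞ (fun z => B i z p q) (rampDomain O))
    (hr : ∀ i, ContDiffOn ℝ ∞ (r i) O) (ht : ∀ i, ContDiffOn ℝ ∞ (t i) O) (hsO : s ⊆ O)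
    (hs : UniqueDiffOn ℝ s)
    (h : ∀ i, RampFunctions s (t i) (α i) (β i) (θ i) (μ i)) (hy : y ∈ s) (l k : Fin n) :
    mpderiv s l (mpderiv s k (fun z => ∑ i, r i z • B i (z, α i z, β i z))) y =
      totalJet₂ O t r B y (fun i => (y, α i y, β i y)) (fun i => θ i y) l k
      + ∑ i, (μ i y * r i y) • (pd l (t i) y * pd k (t i) y) • rampJump O (B i) (y, α i y, β i y) := by
  have hsm : ∀ i, SmoothMatrixOn s (fun z => B i (z, α i z, β i z)) := fun i p q =>
    (h i).contDiffOn_comp hsO (hB i p q)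
  have hu := hs y hy
  rw [mpderiv_congr (N := fun z => ∑ i, pderivWithin s k (r i) z • B i (z, α i z, β i z) +
      ∑ i, r i z • mpderiv s k (fun z => B i (z, α i z, β i z)) z) (fun z hz => by
    rw [mpderiv_smul_sum (M := fun i z => B i (z, α i z, β i z)) hs (fun i => (hr i).mono hsO)
      hsm hz, Finset.sum_add_distrib]) hy]
  have hrk : ∀ i, ContDiffOn ℝ ∞ (pderivWithin s k (r i)) s := fun i =>
    contDiffOn_pderivWithin hs ((hr i).mono hsO)
  rw [mpderiv_add hs (SmoothMatrixOn.smul_sum hrk hsm) (SmoothMatrixOn.smul_sum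
    (fun i => (hr i).mono hsO) (fun i => (hsm i).mpderiv hs k)) hy,
    mpderiv_smul_sum (M := fun i z => B i (z, α i z, β i z)) hs hrk hsm hy,
    mpderiv_smul_sum (M := fun i => mpderiv s k (fun z => B i (z, α i z, β i z))) hs
      (fun i => (hr i).mono hsO) (fun i => (hsm i).mpderiv hs k) hy]
  ext p q
  simp only [totalJet₂, Matrix.of_apply, Matrix.sum_apply, Matrix.add_apply, Matrix.smul_apply,
    smul_eq_mul]
  rw [← Finset.sum_add_distrib, ← Finset.sum_add_distrib]
  refine Finset.sum_congr rfl fun i _ => ?_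
  have e1 : ∀ a, pderivWithin s a (r i) y = pd a (r i) y := fun a =>
    pderivWithin_eq_pd hO (hr i) (hsO hy) hu a
  have e2 : pderivWithin s l (pderivWithin s k (r i)) y = pd l (pd k (r i)) y := by
    rw [pderivWithin_congr (fun z hz => pderivWithin_eq_pd hO (hr i) (hsO hz) (hs z hz) k) hy,
      pderivWithin_eq_pd hO (contDiffOn_pd hO (hr i) k) (hsO hy) hu]
  have e3 : ∀ a, mpderiv s a (fun z => B i (z, α i z, β i z)) y p q =
      rampJet₁ O (t i) (fun z => B i z p q) a (y, α i y, β i y) (θ i y) := fun a =>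
    (h i).pderivWithin_comp hsO hs (hB i p q) hy a
  have e4 : mpderiv s l (mpderiv s k (fun z => B i (z, α i z, β i z))) y p q = _ :=
    (h i).pderivWithin_pderivWithin_comp hO (ht i) hsO hs (hB i p q) hy l k
  rw [e1, e1, e2, e3, e3, e4]
  simp only [rampJump, Matrix.of_apply]
  ring

/-- The first term is a continuous function of the point, the heights and the slopes; everything
that blows up as the scales shrink is in the last sum. -/
theorem scalCoord_ramp (hO : IsOpen O)
    (hB : ∀ i p q, ContDiffOn ℝ ∞ (fun z => B i z p q) (rampDomain O))
    (hr : ∀ i, ContDiffOn ℝ ∞ (r i) O) (ht : ∀ i, ContDiffOn ℝ ∞ (t i) O) (hsO : s ⊆ O)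
    (hs : UniqueDiffOn ℝ s)
    (h : ∀ i, RampFunctions s (t i) (α i) (β i) (θ i) (μ i)) (hy : y ∈ s)
    (hdet : (totalJet₀ r B y fun i => (y, α i y, β i y)).det ≠ 0) :
    scalCoord s (fun z => ∑ i, r i z • B i (z, α i z, β i z)) y =
      scalJet (totalJet₀ r B y fun i => (y, α i y, β i y))
        (totalJet₁ O t r B y (fun i => (y, α i y, β i y)) fun i => θ i y)
        (totalJet₂ O t r B y (fun i => (y, α i y, β i y)) fun i => θ i y)
      + ∑ i, (μ i y * r i y) * scalSymbol (totalJet₀ r B y fun i => (y, α i y, β i y))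
          (fun l k => (pd l (t i) y * pd k (t i) y) • rampJump O (B i) (y, α i y, β i y)) := by
  rw [scalCoord_eq_scalJet_of_det_ne hs (smoothMatrixOn_ramp hB hr hsO h) hy hdet]
  simp only [mpderiv_ramp hO hB hr hsO hs h hy, mpderiv_mpderiv_ramp hO hB hr ht hsO hs h hy]
  rw [scalJet_add, scalSymbol_sum_smul]
  rfl

theorem tendsto_scalJet_of_tendsto {X : Type*} {F : Filter X}
    {A : X → Matrix (Fin n) (Fin n) ℝ} {B : X → Fin n → Matrix (Fin n) (Fin n) ℝ}
    {C : X → Fin n → Fin n → Matrix (Fin n) (Fin n) ℝ} {A₀ : Matrix (Fin n) (Fin n) ℝ}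
    {B₀ : Fin n → Matrix (Fin n) (Fin n) ℝ} {C₀ : Fin n → Fin n → Matrix (Fin n) (Fin n) ℝ}
    (hA : Filter.Tendsto A F (𝓝 A₀)) (hB : Filter.Tendsto B F (𝓝 B₀))
    (hC : Filter.Tendsto C F (𝓝 C₀)) (hdet : A₀.det ≠ 0) :
    Filter.Tendsto (fun a => scalJet (A a) (B a) (C a)) F (𝓝 (scalJet A₀ B₀ C₀)) := by
  have h1 := (continuousAt_scalJet hdet B₀ C₀).tendsto
  have h2 := hA.prodMk_nhds (hB.prodMk_nhds hC)
  have h3 := h1.comp h2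
  exact h3

theorem tendsto_scalSymbol_of_tendsto {X : Type*} {F : Filter X}
    {A : X → Matrix (Fin n) (Fin n) ℝ}
    {C : X → Fin n → Fin n → Matrix (Fin n) (Fin n) ℝ} {A₀ : Matrix (Fin n) (Fin n) ℝ}
    {C₀ : Fin n → Fin n → Matrix (Fin n) (Fin n) ℝ}
    (hA : Filter.Tendsto A F (𝓝 A₀))
    (hC : Filter.Tendsto C F (𝓝 C₀)) (hdet : A₀.det ≠ 0) :
    Filter.Tendsto (fun a => scalSymbol (A a) (C a)) F (𝓝 (scalSymbol A₀ C₀)) := by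
  have h1 := (continuousAt_scalSymbol hdet C₀).tendsto
  have h2 := hA.prodMk_nhds hC
  have h3 := h1.comp h2
  exact h3

/-! ### Limits of the jets when the heights tend to zero -/

section Limits

variable {X : Type*} {F : Filter X} {y : X → EuclideanSpace ℝ (Fin n)}
  {c : ι → X → EuclideanSpace ℝ (Fin n) × ℝ × ℝ} {ϑ : ι → X → ℝ} {y₀ : EuclideanSpace ℝ (Fin n)}
  {ϑ₀ : ι → ℝ}

theorem tendsto_totalJet₀ (hO : IsOpen O) (hy₀ : y₀ ∈ O)
    (hB : ∀ i p q, ContDiffOn ℝ ∞ (fun z => B i z p q) (rampDomain O))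
    (hr : ∀ i, ContDiffOn ℝ ∞ (r i) O) (hy : Filter.Tendsto y F (𝓝 y₀))
    (hc : ∀ i, Filter.Tendsto (c i) F (𝓝[rampDomain O] (y₀, 0, 0))) :
    Filter.Tendsto (fun a => totalJet₀ r B (y a) fun i => c i a) F
      (𝓝 (totalJet₀ r B y₀ fun _ => (y₀, 0, 0))) := by
  have hm : (y₀, (0 : ℝ), (0 : ℝ)) ∈ rampDomain O := ⟨hy₀, Set.self_mem_Ici, Set.self_mem_Iic⟩
  refine tendsto_pi_nhds.2 fun p => tendsto_pi_nhds.2 fun q => ?_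
  simp only [totalJet₀, Matrix.sum_apply, Matrix.smul_apply, smul_eq_mul]
  exact tendsto_finsetSum _ fun i _ =>
    (((hr i).continuousOn.continuousAt (hO.mem_nhds hy₀)).tendsto.comp hy).mul
    (((hB i p q).continuousOn _ hm).tendsto.comp (hc i))

theorem tendsto_rampJet₁ {b : EuclideanSpace ℝ (Fin n) × ℝ × ℝ → ℝ}
    {τ : EuclideanSpace ℝ (Fin n) → ℝ} {d : X → EuclideanSpace ℝ (Fin n) × ℝ × ℝ} {η : X → ℝ}
    {η₀ : ℝ} (hO : IsOpen O) (hy₀ : y₀ ∈ O) (hb : ContDiffOn ℝ ∞ b (rampDomain O))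
    (hτ : ContDiffOn ℝ ∞ τ O) (hd : Filter.Tendsto d F (𝓝[rampDomain O] (y₀, 0, 0)))
    (hη : Filter.Tendsto η F (𝓝 η₀)) (k : Fin n) :
    Filter.Tendsto (fun a => rampJet₁ O τ b k (d a) (η a)) F
      (𝓝 (rampJet₁ O τ b k (y₀, 0, 0) η₀)) := by
  have hm : (y₀, (0 : ℝ), (0 : ℝ)) ∈ rampDomain O := ⟨hy₀, Set.self_mem_Ici, Set.self_mem_Iic⟩
  have hct : Filter.Tendsto (fun a => (d a, η a)) F
      (𝓝[rampDomain O ×ˢ Set.univ] ((y₀, 0, 0), η₀)) := by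
    rw [nhdsWithin_prod_eq, nhdsWithin_univ]
    exact hd.prodMk hη
  have h := (continuousOn_rampJet₁ hO hτ hb k ((y₀, 0, 0), η₀) ⟨hm, trivial⟩).tendsto
  have h' := h.comp hct
  exact h'

theorem tendsto_rampJet₂ {b : EuclideanSpace ℝ (Fin n) × ℝ × ℝ → ℝ}
    {τ : EuclideanSpace ℝ (Fin n) → ℝ} {d : X → EuclideanSpace ℝ (Fin n) × ℝ × ℝ} {η : X → ℝ}
    {η₀ : ℝ} (hO : IsOpen O) (hy₀ : y₀ ∈ O) (hb : ContDiffOn ℝ ∞ b (rampDomain O))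
    (hτ : ContDiffOn ℝ ∞ τ O) (hd : Filter.Tendsto d F (𝓝[rampDomain O] (y₀, 0, 0)))
    (hη : Filter.Tendsto η F (𝓝 η₀)) (l k : Fin n) :
    Filter.Tendsto (fun a => rampJet₂ O τ b l k (d a) (η a)) F
      (𝓝 (rampJet₂ O τ b l k (y₀, 0, 0) η₀)) := by
  have hm : (y₀, (0 : ℝ), (0 : ℝ)) ∈ rampDomain O := ⟨hy₀, Set.self_mem_Ici, Set.self_mem_Iic⟩
  have hct : Filter.Tendsto (fun a => (d a, η a)) F
      (𝓝[rampDomain O ×ˢ Set.univ] ((y₀, 0, 0), η₀)) := by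
    rw [nhdsWithin_prod_eq, nhdsWithin_univ]
    exact hd.prodMk hη
  have h := (continuousOn_rampJet₂ hO hτ hb l k ((y₀, 0, 0), η₀) ⟨hm, trivial⟩).tendsto
  have h' := h.comp hct
  exact h'

theorem tendsto_totalJet₁ (hO : IsOpen O) (hy₀ : y₀ ∈ O)
    (hB : ∀ i p q, ContDiffOn ℝ ∞ (fun z => B i z p q) (rampDomain O))
    (hr : ∀ i, ContDiffOn ℝ ∞ (r i) O) (ht : ∀ i, ContDiffOn ℝ ∞ (t i) O)
    (hy : Filter.Tendsto y F (𝓝 y₀))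
    (hc : ∀ i, Filter.Tendsto (c i) F (𝓝[rampDomain O] (y₀, 0, 0)))
    (hθ : ∀ i, Filter.Tendsto (ϑ i) F (𝓝 (ϑ₀ i))) :
    Filter.Tendsto (fun a => totalJet₁ O t r B (y a) (fun i => c i a) fun i => ϑ i a) F
      (𝓝 (totalJet₁ O t r B y₀ (fun _ => (y₀, 0, 0)) ϑ₀)) := by
  have hm : (y₀, (0 : ℝ), (0 : ℝ)) ∈ rampDomain O := ⟨hy₀, Set.self_mem_Ici, Set.self_mem_Iic⟩
  have hct : ∀ i, Filter.Tendsto (fun a => (c i a, ϑ i a)) F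
      (𝓝[rampDomain O ×ˢ Set.univ] ((y₀, 0, 0), ϑ₀ i)) := fun i => by
    rw [nhdsWithin_prod_eq, nhdsWithin_univ]
    exact (hc i).prodMk (hθ i)
  have hf : ∀ {f : EuclideanSpace ℝ (Fin n) → ℝ}, ContDiffOn ℝ ∞ f O →
      Filter.Tendsto (fun a => f (y a)) F (𝓝 (f y₀)) := fun hf =>
    (hf.continuousOn.continuousAt (hO.mem_nhds hy₀)).tendsto.comp hy
  refine tendsto_pi_nhds.2 fun k => tendsto_pi_nhds.2 fun p => tendsto_pi_nhds.2 fun q => ?_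
  simp only [totalJet₁, Matrix.of_apply]
  exact tendsto_finsetSum _ fun i _ => ((hf (contDiffOn_pd hO (hr i) k)).mul
    (((hB i p q).continuousOn _ hm).tendsto.comp (hc i))).add ((hf (hr i)).mul
    ((continuousOn_rampJet₁ hO (ht i) (hB i p q) k ((y₀, 0, 0), ϑ₀ i)
      ⟨hm, trivial⟩).tendsto.comp (hct i)))

theorem tendsto_totalJet₂ (hO : IsOpen O) (hy₀ : y₀ ∈ O)
    (hB : ∀ i p q, ContDiffOn ℝ ∞ (fun z => B i z p q) (rampDomain O))
    (hr : ∀ i, ContDiffOn ℝ ∞ (r i) O) (ht : ∀ i, ContDiffOn ℝ ∞ (t i) O)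
    (hy : Filter.Tendsto y F (𝓝 y₀))
    (hc : ∀ i, Filter.Tendsto (c i) F (𝓝[rampDomain O] (y₀, 0, 0)))
    (hθ : ∀ i, Filter.Tendsto (ϑ i) F (𝓝 (ϑ₀ i))) :
    Filter.Tendsto (fun a => totalJet₂ O t r B (y a) (fun i => c i a) fun i => ϑ i a) F
      (𝓝 (totalJet₂ O t r B y₀ (fun _ => (y₀, 0, 0)) ϑ₀)) := by
  have hm : (y₀, (0 : ℝ), (0 : ℝ)) ∈ rampDomain O := ⟨hy₀, Set.self_mem_Ici, Set.self_mem_Iic⟩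
  have hf : ∀ {f : EuclideanSpace ℝ (Fin n) → ℝ}, ContDiffOn ℝ ∞ f O →
      Filter.Tendsto (fun a => f (y a)) F (𝓝 (f y₀)) := fun hf =>
    (hf.continuousOn.continuousAt (hO.mem_nhds hy₀)).tendsto.comp hy
  refine tendsto_pi_nhds.2 fun l => tendsto_pi_nhds.2 fun k => tendsto_pi_nhds.2 fun p =>
    tendsto_pi_nhds.2 fun q => ?_
  simp only [totalJet₂, Matrix.of_apply]
  have h1 : ∀ i k, Filter.Tendsto (fun a => rampJet₁ O (t i) (fun z => B i z p q) k (c i a) (ϑ i a))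
      F (𝓝 (rampJet₁ O (t i) (fun z => B i z p q) k (y₀, 0, 0) (ϑ₀ i))) := fun i k =>
    tendsto_rampJet₁ hO hy₀ (hB i p q) (ht i) (hc i) (hθ i) k
  have h0 : ∀ i, Filter.Tendsto (fun a => B i (c i a) p q) F (𝓝 (B i (y₀, 0, 0) p q)) := fun i =>
    ((hB i p q).continuousOn _ hm).tendsto.comp (hc i)
  have h2 : ∀ i, Filter.Tendsto (fun a => rampJet₂ O (t i) (fun z => B i z p q) l k (c i a) (ϑ i a))
      F (𝓝 (rampJet₂ O (t i) (fun z => B i z p q) l k (y₀, 0, 0) (ϑ₀ i))) := fun i =>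
    tendsto_rampJet₂ hO hy₀ (hB i p q) (ht i) (hc i) (hθ i) l k
  have hrk := fun i k => hf (contDiffOn_pd hO (hr i) k)
  have hrlk := fun i => hf (contDiffOn_pd hO (contDiffOn_pd hO (hr i) k) l)
  have hr' := fun i => hf (hr i)
  refine tendsto_finsetSum _ fun i _ => ?_
  have e1 := ((hrlk i).mul (h0 i)).add ((hrk i k).mul (h1 i l))
  have e2 := e1.add ((hrk i l).mul (h1 i k))
  have e3 := e2.add ((hr' i).mul (h2 i))
  exact e3

theorem tendsto_symbol (hO : IsOpen O) (hy₀ : y₀ ∈ O)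
    (hB : ∀ i p q, ContDiffOn ℝ ∞ (fun z => B i z p q) (rampDomain O))
    (hr : ∀ i, ContDiffOn ℝ ∞ (r i) O) (ht : ∀ i, ContDiffOn ℝ ∞ (t i) O)
    (hy : Filter.Tendsto y F (𝓝 y₀))
    (hc : ∀ i, Filter.Tendsto (c i) F (𝓝[rampDomain O] (y₀, 0, 0)))
    (hdet : (totalJet₀ r B y₀ fun _ => (y₀, 0, 0)).det ≠ 0) (i : ι) :
    Filter.Tendsto (fun a => scalSymbol (totalJet₀ r B (y a) fun i => c i a)
      (fun l k => (pd l (t i) (y a) * pd k (t i) (y a)) • rampJump O (B i) (c i a))) F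
      (𝓝 (scalSymbol (totalJet₀ r B y₀ fun _ => (y₀, 0, 0))
        (fun l k => (pd l (t i) y₀ * pd k (t i) y₀) • rampJump O (B i) (y₀, 0, 0)))) := by
  have hm : (y₀, (0 : ℝ), (0 : ℝ)) ∈ rampDomain O := ⟨hy₀, Set.self_mem_Ici, Set.self_mem_Iic⟩
  have hf : ∀ {f : EuclideanSpace ℝ (Fin n) → ℝ}, ContDiffOn ℝ ∞ f O →
      Filter.Tendsto (fun a => f (y a)) F (𝓝 (f y₀)) := fun hf =>
    (hf.continuousOn.continuousAt (hO.mem_nhds hy₀)).tendsto.comp hy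
  have hC : Filter.Tendsto (fun a => fun l k => (pd l (t i) (y a) * pd k (t i) (y a)) •
      rampJump O (B i) (c i a)) F
      (𝓝 fun l k => (pd l (t i) y₀ * pd k (t i) y₀) • rampJump O (B i) (y₀, 0, 0)) := by
    refine tendsto_pi_nhds.2 fun l => tendsto_pi_nhds.2 fun k => tendsto_pi_nhds.2 fun p =>
      tendsto_pi_nhds.2 fun q => ?_
    simp only [rampJump, Matrix.smul_apply, Matrix.of_apply, smul_eq_mul]
    exact ((hf (contDiffOn_pd hO (ht i) l)).mul (hf (contDiffOn_pd hO (ht i) k))).mul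
      ((((contDiffOn_rampDeriv hO (hB i p q) _).continuousOn _ hm).tendsto.comp (hc i)).sub
      (((contDiffOn_rampDeriv hO (hB i p q) _).continuousOn _ hm).tendsto.comp (hc i)))
  exact tendsto_scalSymbol_of_tendsto (tendsto_totalJet₀ hO hy₀ hB hr hy hc) hC hdet

theorem tendsto_scalJet (hO : IsOpen O) (hy₀ : y₀ ∈ O)
    (hB : ∀ i p q, ContDiffOn ℝ ∞ (fun z => B i z p q) (rampDomain O))
    (hr : ∀ i, ContDiffOn ℝ ∞ (r i) O) (ht : ∀ i, ContDiffOn ℝ ∞ (t i) O)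
    (hy : Filter.Tendsto y F (𝓝 y₀))
    (hc : ∀ i, Filter.Tendsto (c i) F (𝓝[rampDomain O] (y₀, 0, 0)))
    (hθ : ∀ i, Filter.Tendsto (ϑ i) F (𝓝 (ϑ₀ i)))
    (hdet : (totalJet₀ r B y₀ fun _ => (y₀, 0, 0)).det ≠ 0) :
    Filter.Tendsto (fun a => scalJet (totalJet₀ r B (y a) fun i => c i a)
      (totalJet₁ O t r B (y a) (fun i => c i a) fun i => ϑ i a)
      (totalJet₂ O t r B (y a) (fun i => c i a) fun i => ϑ i a)) F
      (𝓝 (scalJet (totalJet₀ r B y₀ fun _ => (y₀, 0, 0))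
        (totalJet₁ O t r B y₀ (fun _ => (y₀, 0, 0)) ϑ₀)
        (totalJet₂ O t r B y₀ (fun _ => (y₀, 0, 0)) ϑ₀))) :=
  tendsto_scalJet_of_tendsto (tendsto_totalJet₀ hO hy₀ hB hr hy hc)
    (tendsto_totalJet₁ hO hy₀ hB hr ht hy hc hθ) (tendsto_totalJet₂ hO hy₀ hB hr ht hy hc hθ) hdet

end Limits

end TotalJet

end Gluing

namespace Gluing

/-! ### The two half-spaces -/

section HalfSpaces

variable {m : ℕ}

/-- The closed half-space `{y₀ ≤ 0}`. -/
def lowerHalf (m : ℕ) : Set (EuclideanSpace ℝ (Fin (m + 1))) := {y | y 0 ≤ 0}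

/-- The closed half-space `{0 ≤ y₀}`. -/
def upperHalf (m : ℕ) : Set (EuclideanSpace ℝ (Fin (m + 1))) := {y | 0 ≤ y 0}

theorem continuous_coord_zero : Continuous fun y : EuclideanSpace ℝ (Fin (m + 1)) => y 0 := by
  fun_prop

theorem isOpen_lower : IsOpen {y : EuclideanSpace ℝ (Fin (m + 1)) | y 0 < 0} :=
  isOpen_lt continuous_coord_zero continuous_const

theorem isOpen_upper : IsOpen {y : EuclideanSpace ℝ (Fin (m + 1)) | 0 < y 0} :=
  isOpen_lt continuous_const continuous_coord_zero

theorem uniqueDiffOn_lowerHalf : UniqueDiffOn ℝ (lowerHalf m) := by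
  refine uniqueDiffOn_convex (fun x hx y hy a b ha hb _ => ?_) ⟨-EuclideanSpace.single 0 1,
    mem_interior.2 ⟨{y | y 0 < 0}, fun y (hy : y 0 < 0) => hy.le, isOpen_lower, by simp⟩⟩
  simp only [lowerHalf, Set.mem_ofPred_eq, PiLp.add_apply, PiLp.smul_apply, smul_eq_mul] at *
  nlinarith

theorem uniqueDiffOn_upperHalf : UniqueDiffOn ℝ (upperHalf m) := by
  refine uniqueDiffOn_convex (fun x hx y hy a b ha hb _ => ?_) ⟨EuclideanSpace.single 0 1,
    mem_interior.2 ⟨{y | 0 < y 0}, fun y (hy : 0 < y 0) => hy.le, isOpen_upper, by simp⟩⟩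
  simp only [upperHalf, Set.mem_ofPred_eq, PiLp.add_apply, PiLp.smul_apply, smul_eq_mul] at *
  positivity

theorem tangentiallyOpenAt_lowerHalf {y : EuclideanSpace ℝ (Fin (m + 1))} (hy : y 0 = 0) :
    TangentiallyOpenAt (lowerHalf m) y := fun i => by simp [lowerHalf, hy]

theorem tangentiallyOpenAt_upperHalf {y : EuclideanSpace ℝ (Fin (m + 1))} (hy : y 0 = 0) :
    TangentiallyOpenAt (upperHalf m) y := fun i => by simp [upperHalf, hy]

theorem TangentiallyOpenAt.inter {s O : Set (EuclideanSpace ℝ (Fin (m + 1)))}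
    {y : EuclideanSpace ℝ (Fin (m + 1))} (h : TangentiallyOpenAt s y) (hO : O ∈ 𝓝 y) :
    TangentiallyOpenAt (s ∩ O) y := fun i => by
  have hc : ContinuousAt (fun τ : ℝ => y + τ • EuclideanSpace.single i.succ (1 : ℝ)) 0 := by
    fun_prop
  have := hc.preimage_mem_nhds (by simpa using hO)
  filter_upwards [h i, this] with τ h1 h2
  exact ⟨h1, h2⟩

end HalfSpaces

/-! ### Interpolated metrics near a point of the seam -/

section Smoothing

variable {m : ℕ} {ι : Type*} [Fintype ι]

/-- A metric `G`, smooth on both sides of the hypersurface `{y₀ = 0}`, is interpolated by metrics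
`B i`, where `B i` depends on a function `t i` which vanishes on the hypersurface. -/
structure RampedMetric (O : Set (EuclideanSpace ℝ (Fin (m + 1))))
    (y₀ : EuclideanSpace ℝ (Fin (m + 1)))
    (G : EuclideanSpace ℝ (Fin (m + 1)) → Matrix (Fin (m + 1)) (Fin (m + 1)) ℝ)
    (t r : ι → EuclideanSpace ℝ (Fin (m + 1)) → ℝ)
    (B : ι → EuclideanSpace ℝ (Fin (m + 1)) × ℝ × ℝ → Matrix (Fin (m + 1)) (Fin (m + 1)) ℝ) :
    Prop where
  isOpen : IsOpen O
  mem : y₀ ∈ O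
  coord_zero : y₀ 0 = 0
  contDiffOn_t : ∀ i, ContDiffOn ℝ ∞ (t i) O
  contDiffOn_r : ∀ i, ContDiffOn ℝ ∞ (r i) O
  contDiffOn_B : ∀ i p q, ContDiffOn ℝ ∞ (fun z => B i z p q) (rampDomain O)
  t_pos : ∀ i, ∀ y ∈ O, 0 < t i y ↔ 0 < y 0
  t_neg : ∀ i, ∀ y ∈ O, t i y < 0 ↔ y 0 < 0
  t_deriv : ∀ i, 0 < pd 0 (t i) y₀
  r_nonneg : ∀ i, ∀ y ∈ O, 0 ≤ r i y
  r_sum : ∀ y ∈ O, ∑ i, r i y = 1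
  upper : ∀ i, ∀ y ∈ O, 0 ≤ y 0 → B i (y, t i y, 0) = G y
  lower : ∀ i, ∀ y ∈ O, y 0 ≤ 0 → B i (y, 0, t i y) = G y
  symm : ∀ y ∈ O, (G y)ᵀ = G y
  det_ne : (G y₀).det ≠ 0
  inv_pos : 0 < (G y₀)⁻¹ 0 0

namespace RampedMetric

variable {O : Set (EuclideanSpace ℝ (Fin (m + 1)))} {y₀ : EuclideanSpace ℝ (Fin (m + 1))}
  {G : EuclideanSpace ℝ (Fin (m + 1)) → Matrix (Fin (m + 1)) (Fin (m + 1)) ℝ}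
  {t r : ι → EuclideanSpace ℝ (Fin (m + 1)) → ℝ}
  {B : ι → EuclideanSpace ℝ (Fin (m + 1)) × ℝ × ℝ → Matrix (Fin (m + 1)) (Fin (m + 1)) ℝ}

theorem t_eq_zero (h : RampedMetric O y₀ G t r B) (i : ι) {y : EuclideanSpace ℝ (Fin (m + 1))}
    (hy : y ∈ O) (h0 : y 0 = 0) : t i y = 0 := by
  have h1 := h.t_pos i y hy
  have h2 := h.t_neg i y hy
  rw [h0] at h1 h2
  simp only [lt_irrefl, iff_false, not_lt] at h1 h2
  exact le_antisymm h1 h2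

theorem pd_succ (h : RampedMetric O y₀ G t r B) (i : ι) (j : Fin m) :
    pd j.succ (t i) y₀ = 0 := by
  rw [← pderivWithin_eq_pd h.isOpen (h.contDiffOn_t i) h.mem (h.isOpen.uniqueDiffOn _ h.mem)]
  refine pderivWithin_succ_eq_zero ((h.contDiffOn_t i).differentiableOn (by simp) _ h.mem) ?_
    h.coord_zero (fun z hz hz0 => h.t_eq_zero i hz hz0) j
  have := (tangentiallyOpenAt_lowerHalf h.coord_zero).inter (h.isOpen.mem_nhds h.mem)
  exact fun i => (this i).mono fun _ hx => hx.2

theorem rampFunctions_lower (h : RampedMetric O y₀ G t r B) (i : ι) :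
    RampFunctions (lowerHalf m ∩ O) (t i) (fun _ => 0) (t i) (fun _ => 0) (fun _ => 0) :=
  Gluing.rampFunctions_lower h.isOpen (h.contDiffOn_t i) Set.inter_subset_right fun y hy =>
    not_lt.1 fun hlt => not_lt.2 hy.1 ((h.t_pos i y hy.2).1 hlt)

theorem rampFunctions_upper (h : RampedMetric O y₀ G t r B) (i : ι) :
    RampFunctions (upperHalf m ∩ O) (t i) (t i) (fun _ => 0) (fun _ => 1) (fun _ => 0) :=
  Gluing.rampFunctions_upper h.isOpen (h.contDiffOn_t i) Set.inter_subset_right fun y hy =>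
    not_lt.1 fun hlt => not_lt.2 hy.1 ((h.t_neg i y hy.2).1 hlt)

theorem mem_lower (h : RampedMetric O y₀ G t r B) : y₀ ∈ lowerHalf m ∩ O :=
  ⟨h.coord_zero.le, h.mem⟩

theorem mem_upper (h : RampedMetric O y₀ G t r B) : y₀ ∈ upperHalf m ∩ O :=
  ⟨h.coord_zero.ge, h.mem⟩

/-- The chain rule with slope `1` above and slope `0` below; all but the transverse terms cancel. So
the jump of `∂₀G` does not depend on the interpolation chosen. -/
theorem pd_mul_rampJump (h : RampedMetric O y₀ G t r B) (i : ι) (p q : Fin (m + 1)) :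
    pd 0 (t i) y₀ * rampJump O (B i) (y₀, 0, 0) p q =
      pderivWithin (upperHalf m) 0 (fun z => G z p q) y₀
      - pderivWithin (lowerHalf m) 0 (fun z => G z p q) y₀ := by
  have hn := h.isOpen.mem_nhds h.mem
  have e1 := (h.rampFunctions_lower i).pderivWithin_comp Set.inter_subset_right
    (uniqueDiffOn_lowerHalf.inter h.isOpen) (h.contDiffOn_B i p q) h.mem_lower 0
  have e2 := (h.rampFunctions_upper i).pderivWithin_comp Set.inter_subset_right
    (uniqueDiffOn_upperHalf.inter h.isOpen) (h.contDiffOn_B i p q) h.mem_upper 0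
  rw [pderivWithin_congr (g := fun z => G z p q) (fun z hz => by rw [h.lower i z hz.2 hz.1])
    h.mem_lower, pderivWithin_inter hn] at e1
  rw [pderivWithin_congr (g := fun z => G z p q) (fun z hz => by rw [h.upper i z hz.2 hz.1])
    h.mem_upper, pderivWithin_inter hn] at e2
  rw [e1, e2, h.t_eq_zero i h.mem h.coord_zero]
  simp only [rampJet₁, rampJump, Matrix.of_apply]
  ring

/-- `B i` itself is not assumed symmetric. Its jump is, because it is a positive multiple of the
jump of `∂₀G`. -/
theorem rampJump_transpose (h : RampedMetric O y₀ G t r B) (i : ι) :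
    (rampJump O (B i) (y₀, 0, 0))ᵀ = rampJump O (B i) (y₀, 0, 0) := by
  ext p q
  rw [Matrix.transpose_apply]
  refine mul_left_cancel₀ (h.t_deriv i).ne' ?_
  rw [h.pd_mul_rampJump, h.pd_mul_rampJump]
  have hn := h.isOpen.mem_nhds h.mem
  have hs : ∀ z ∈ O, G z q p = G z p q := fun z hz => congrFun (congrFun (h.symm z hz) p) q
  have e : ∀ s : Set (EuclideanSpace ℝ (Fin (m + 1))), y₀ ∈ s →
      pderivWithin s 0 (fun z => G z q p) y₀ = pderivWithin s 0 (fun z => G z p q) y₀ :=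
    fun s hys => by
    rw [← pderivWithin_inter hn, pderivWithin_congr (g := fun z => G z p q)
      (fun z hz => hs z hz.2) (show y₀ ∈ s ∩ O from ⟨hys, h.mem⟩), pderivWithin_inter hn]
  rw [e _ h.mem_upper.1, e _ h.mem_lower.1]

theorem totalJet₀_eq (h : RampedMetric O y₀ G t r B) :
    totalJet₀ r B y₀ (fun _ => (y₀, 0, 0)) = G y₀ := by
  have : ∀ i, B i (y₀, 0, 0) = G y₀ := fun i => by
    rw [← h.upper i y₀ h.mem h.coord_zero.ge, h.t_eq_zero i h.mem h.coord_zero]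
  simp only [totalJet₀, this]
  rw [← Finset.sum_smul, h.r_sum _ h.mem, one_smul]

/-- The sign on which everything rests: `dt i` is a positive multiple of `dy₀` at `y₀`, so the
symbol is `-g⁰⁰ ∂₀(t i)` times the trace of the jump. -/
theorem scalSymbol_pos (h : RampedMetric O y₀ G t r B)
    (hjump : jumpTrace (lowerHalf m) (upperHalf m) G y₀ < 0) (i : ι) :
    0 < scalSymbol (totalJet₀ r B y₀ fun _ => (y₀, 0, 0))
      (fun l k => (pd l (t i) y₀ * pd k (t i) y₀) • rampJump O (B i) (y₀, 0, 0)) := by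
  rw [h.totalJet₀_eq, scalSymbol_normal h.det_ne (h.symm _ h.mem) (h.rampJump_transpose i)
    h.inv_pos.ne' (fun l => pd l (t i) y₀) (h.pd_succ i)]
  have e : pd 0 (t i) y₀ * (∑ a : Fin m, ∑ b : Fin m, ((G y₀).submatrix Fin.succ Fin.succ)⁻¹ a b *
      rampJump O (B i) (y₀, 0, 0) a.succ b.succ) = jumpTrace (lowerHalf m) (upperHalf m) G y₀ := by
    simp only [jumpTrace, Finset.mul_sum, ← h.pd_mul_rampJump i]
    refine Finset.sum_congr rfl fun a _ => Finset.sum_congr rfl fun b _ => by ring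
  rw [pow_two, mul_right_comm, mul_assoc (pd 0 (t i) y₀), mul_assoc (pd 0 (t i) y₀),
    mul_left_comm, ← mul_assoc]
  rw [← e] at hjump
  have := mul_pos (mul_pos (h.t_deriv i) h.inv_pos) (neg_pos.2 hjump)
  nlinarith [this]

/-- A nonnegative weight has a minimum where it vanishes. Hence the slopes that belong to vanishing
weights do not influence the `2`-jet at `y₀`. -/
theorem pd_r_eq_zero (h : RampedMetric O y₀ G t r B) {i : ι} (hi : r i y₀ = 0)
    (k : Fin (m + 1)) : pd k (r i) y₀ = 0 := by
  have : IsLocalMin (r i) y₀ := by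
    filter_upwards [h.isOpen.mem_nhds h.mem] with y hy
    rw [hi]; exact h.r_nonneg i y hy
  rw [pd, this.fderiv_eq_zero]; rfl

theorem totalJet₁_congr (h : RampedMetric O y₀ G t r B) {ϑ ϑ' : ι → ℝ}
    (he : ∀ i, 0 < r i y₀ → ϑ i = ϑ' i) :
    totalJet₁ O t r B y₀ (fun _ => (y₀, 0, 0)) ϑ = totalJet₁ O t r B y₀ (fun _ => (y₀, 0, 0)) ϑ' := by
  funext k
  ext p q
  simp only [totalJet₁, Matrix.of_apply]
  refine Finset.sum_congr rfl fun i _ => ?_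
  rcases (h.r_nonneg i y₀ h.mem).eq_or_lt with hi | hi
  · simp [← hi]
  · rw [he i hi]

theorem totalJet₂_congr (h : RampedMetric O y₀ G t r B) {ϑ ϑ' : ι → ℝ}
    (he : ∀ i, 0 < r i y₀ → ϑ i = ϑ' i) :
    totalJet₂ O t r B y₀ (fun _ => (y₀, 0, 0)) ϑ = totalJet₂ O t r B y₀ (fun _ => (y₀, 0, 0)) ϑ' := by
  funext l k
  ext p q
  simp only [totalJet₂, Matrix.of_apply]
  refine Finset.sum_congr rfl fun i _ => ?_
  rcases (h.r_nonneg i y₀ h.mem).eq_or_lt with hi | hi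
  · simp [← hi, h.pd_r_eq_zero hi.symm]
  · rw [he i hi]

/-- With all slopes `0` the interpolated metrics equal `G` on the lower side, and the weights sum to
`1`. -/
theorem scalJet_lower (h : RampedMetric O y₀ G t r B) :
    scalJet (totalJet₀ r B y₀ fun _ => (y₀, 0, 0))
      (totalJet₁ O t r B y₀ (fun _ => (y₀, 0, 0)) fun _ => 0)
      (totalJet₂ O t r B y₀ (fun _ => (y₀, 0, 0)) fun _ => 0) = scalCoord (lowerHalf m) G y₀ := by
  have h0 : ∀ i, t i y₀ = 0 := fun i => h.t_eq_zero i h.mem h.coord_zero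
  have e := scalCoord_ramp h.isOpen h.contDiffOn_B h.contDiffOn_r h.contDiffOn_t
    Set.inter_subset_right (uniqueDiffOn_lowerHalf.inter h.isOpen) h.rampFunctions_lower h.mem_lower
    (by simp only [h0]; rw [h.totalJet₀_eq]; exact h.det_ne)
  rw [scalCoord_congr (G' := G) (fun z hz => by
    simp only [h.lower _ z hz.2 hz.1]
    rw [← Finset.sum_smul, h.r_sum _ hz.2, one_smul]) h.mem_lower,
    scalCoord_inter h.isOpen h.mem h.mem_lower.1] at e
  rw [e]
  simp only [h0, zero_mul, Finset.sum_const_zero, add_zero]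

theorem scalJet_upper (h : RampedMetric O y₀ G t r B) :
    scalJet (totalJet₀ r B y₀ fun _ => (y₀, 0, 0))
      (totalJet₁ O t r B y₀ (fun _ => (y₀, 0, 0)) fun _ => 1)
      (totalJet₂ O t r B y₀ (fun _ => (y₀, 0, 0)) fun _ => 1) = scalCoord (upperHalf m) G y₀ := by
  have h0 : ∀ i, t i y₀ = 0 := fun i => h.t_eq_zero i h.mem h.coord_zero
  have e := scalCoord_ramp h.isOpen h.contDiffOn_B h.contDiffOn_r h.contDiffOn_t
    Set.inter_subset_right (uniqueDiffOn_upperHalf.inter h.isOpen) h.rampFunctions_upper h.mem_upper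
    (by simp only [h0]; rw [h.totalJet₀_eq]; exact h.det_ne)
  rw [scalCoord_congr (G' := G) (fun z hz => by
    simp only [h.upper _ z hz.2 hz.1]
    rw [← Finset.sum_smul, h.r_sum _ hz.2, one_smul]) h.mem_upper,
    scalCoord_inter h.isOpen h.mem h.mem_upper.1] at e
  rw [e]
  simp only [h0, zero_mul, Finset.sum_const_zero, add_zero]

end RampedMetric

end Smoothing

end Gluing

namespace Gluing

/-! ### The smoothed metrics as the scales tend to zero -/

namespace RampedMetric

variable {m : ℕ} {ι : Type*} {y₀ : EuclideanSpace ℝ (Fin (m + 1))}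

/-- Points near `y₀` and small positive scales. -/
def smallScales (ι : Type*) (y₀ : EuclideanSpace ℝ (Fin (m + 1))) :
    Filter (EuclideanSpace ℝ (Fin (m + 1)) × (ι → ℝ)) :=
  𝓝 y₀ ×ˢ 𝓝[{δ | ∀ i, 0 < δ i}] 0

theorem tendsto_fst_smallScales {F : Filter (EuclideanSpace ℝ (Fin (m + 1)) × (ι → ℝ))}
    (hF : F ≤ smallScales ι y₀) : Filter.Tendsto Prod.fst F (𝓝 y₀) :=
  Filter.tendsto_fst.mono_left hF

theorem tendsto_snd_smallScales {F : Filter (EuclideanSpace ℝ (Fin (m + 1)) × (ι → ℝ))}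
    (hF : F ≤ smallScales ι y₀) (i : ι) : Filter.Tendsto (fun q => q.2 i) F (𝓝[>] 0) := by
  have h1 : Filter.Tendsto (Prod.snd : EuclideanSpace ℝ (Fin (m + 1)) × (ι → ℝ) → _) F
      (𝓝[{δ | ∀ i, 0 < δ i}] 0) := Filter.tendsto_snd.mono_left hF
  refine tendsto_nhdsWithin_iff.2 ⟨?_, ?_⟩
  · exact ((continuous_apply i).tendsto (0 : ι → ℝ)).comp (h1.mono_right nhdsWithin_le_nhds)
  · exact (h1.eventually self_mem_nhdsWithin).mono fun q hq => hq i

variable [Fintype ι] {O : Set (EuclideanSpace ℝ (Fin (m + 1)))}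
  {G : EuclideanSpace ℝ (Fin (m + 1)) → Matrix (Fin (m + 1)) (Fin (m + 1)) ℝ}
  {t r : ι → EuclideanSpace ℝ (Fin (m + 1)) → ℝ}
  {B : ι → EuclideanSpace ℝ (Fin (m + 1)) × ℝ × ℝ → Matrix (Fin (m + 1)) (Fin (m + 1)) ℝ}
  {φ θ ψ : ℝ → ℝ}

/-- The point at which `B i` is evaluated to smooth the metric on the scale `δ`. -/
def smoothingPoint (t : ι → EuclideanSpace ℝ (Fin (m + 1)) → ℝ) (φ : ℝ → ℝ) (δ : ι → ℝ) (i : ι)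
    (z : EuclideanSpace ℝ (Fin (m + 1))) : EuclideanSpace ℝ (Fin (m + 1)) × ℝ × ℝ :=
  (z, δ i * φ (t i z / δ i), t i z - δ i * φ (t i z / δ i))

/-- The metric smoothed on the scales `δ`. -/
def smoothedMetric (t r : ι → EuclideanSpace ℝ (Fin (m + 1)) → ℝ)
    (B : ι → EuclideanSpace ℝ (Fin (m + 1)) × ℝ × ℝ → Matrix (Fin (m + 1)) (Fin (m + 1)) ℝ)
    (φ : ℝ → ℝ) (δ : ι → ℝ) (z : EuclideanSpace ℝ (Fin (m + 1))) :
    Matrix (Fin (m + 1)) (Fin (m + 1)) ℝ :=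
  ∑ i, r i z • B i (smoothingPoint t φ δ i z)

/-- `0 ≤ δ φ(t/δ) ≤ |t| + δ`, whatever the ratio `t/δ`. Only this ratio, hence only the slopes, is
left uncontrolled. -/
theorem tendsto_smoothingPoint (h : RampedMetric O y₀ G t r B) (hφ : SmoothRamp φ θ ψ)
    {F : Filter (EuclideanSpace ℝ (Fin (m + 1)) × (ι → ℝ))} (hF : F ≤ smallScales ι y₀) (i : ι) :
    Filter.Tendsto (fun q => smoothingPoint t φ q.2 i q.1) F (𝓝[rampDomain O] (y₀, 0, 0)) := by
  have hy := tendsto_fst_smallScales hF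
  have hδ := tendsto_nhdsWithin_iff.1 (tendsto_snd_smallScales hF i)
  have ht : Filter.Tendsto (fun q => t i q.1) F (𝓝 0) := by
    rw [← h.t_eq_zero i h.mem h.coord_zero]
    exact ((h.contDiffOn_t i).continuousOn.continuousAt (h.isOpen.mem_nhds h.mem)).tendsto.comp hy
  have hα : Filter.Tendsto (fun q => q.2 i * φ (t i q.1 / q.2 i)) F (𝓝 0) := by
    refine squeeze_zero' (g := fun q => |t i q.1| + q.2 i) ?_ ?_ ?_
    · filter_upwards [hδ.2] with q (hq : 0 < q.2 i)
      exact mul_nonneg hq.le (hφ.nonneg _)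
    · filter_upwards [hδ.2] with q (hq : 0 < q.2 i)
      have := mul_le_mul_of_nonneg_left (hφ.le_abs_add_one (t i q.1 / q.2 i)) hq.le
      rwa [mul_add, abs_div, abs_of_pos hq, mul_div_cancel₀ _ hq.ne', mul_one] at this
    · simpa using ht.abs.add hδ.1
  refine tendsto_nhdsWithin_iff.2 ⟨hy.prodMk_nhds (hα.prodMk_nhds (by simpa using ht.sub hα)), ?_⟩
  filter_upwards [hδ.2, hy.eventually (h.isOpen.mem_nhds h.mem)] with q (hq : 0 < q.2 i) hqO
  exact (rampFunctions_smoothing hφ h.isOpen (h.contDiffOn_t i) hq).mapsTo subset_rfl hqO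

theorem tendsto_smoothedMetric (h : RampedMetric O y₀ G t r B) (hφ : SmoothRamp φ θ ψ) :
    Filter.Tendsto (fun q => smoothedMetric t r B φ q.2 q.1) (smallScales ι y₀) (𝓝 (G y₀)) := by
  rw [← h.totalJet₀_eq]
  exact tendsto_totalJet₀ h.isOpen h.mem h.contDiffOn_B h.contDiffOn_r
    (tendsto_fst_smallScales le_rfl) (h.tendsto_smoothingPoint hφ le_rfl)

theorem smoothMatrixOn_smoothedMetric (h : RampedMetric O y₀ G t r B) (hφ : SmoothRamp φ θ ψ)
    {δ : ι → ℝ} (hδ : ∀ i, 0 < δ i) : SmoothMatrixOn O (smoothedMetric t r B φ δ) := by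
  have h1 := fun i => rampFunctions_smoothing hφ h.isOpen (h.contDiffOn_t i) (hδ i)
  have h2 := smoothMatrixOn_ramp h.contDiffOn_B h.contDiffOn_r subset_rfl h1
  exact h2

theorem scalCoord_smoothedMetric (h : RampedMetric O y₀ G t r B) (hφ : SmoothRamp φ θ ψ)
    {δ : ι → ℝ} (hδ : ∀ i, 0 < δ i) {y : EuclideanSpace ℝ (Fin (m + 1))} (hy : y ∈ O)
    (hdet : (smoothedMetric t r B φ δ y).det ≠ 0) :
    scalCoord O (smoothedMetric t r B φ δ) y =
      scalJet (totalJet₀ r B y fun i => smoothingPoint t φ δ i y)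
        (totalJet₁ O t r B y (fun i => smoothingPoint t φ δ i y) fun i => θ (t i y / δ i))
        (totalJet₂ O t r B y (fun i => smoothingPoint t φ δ i y) fun i => θ (t i y / δ i))
      + ∑ i, (ψ (t i y / δ i) / δ i * r i y) *
        scalSymbol (totalJet₀ r B y fun i => smoothingPoint t φ δ i y)
          (fun l k => (pd l (t i) y * pd k (t i) y) •
            rampJump O (B i) (smoothingPoint t φ δ i y)) := by
  have h1 := fun i => rampFunctions_smoothing hφ h.isOpen (h.contDiffOn_t i) (hδ i)
  have h2 := scalCoord_ramp h.isOpen h.contDiffOn_B h.contDiffOn_r h.contDiffOn_t subset_rfl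
    h.isOpen.uniqueDiffOn h1 hy hdet
  exact h2

/-- Along an ultrafilter every slope converges in `[0, 1]`. If a slope of positive weight has its
limit strictly inside, the bump `ψ` is bounded below there and the corresponding term grows like
`1/δ`, beating the bounded rest. Otherwise all slopes that matter tend to `0`, or all to `1`, and
the bounded part tends to the scalar curvature of one side. The remaining terms are nonnegative by
`scalSymbol_pos`. -/
theorem eventually_lt_scalCoord_of_ultrafilter (h : RampedMetric O y₀ G t r B)
    (hφ : SmoothRamp φ θ ψ) {κ : ℝ} (hL : κ < scalCoord (lowerHalf m) G y₀)
    (hU : κ < scalCoord (upperHalf m) G y₀)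
    (hj : jumpTrace (lowerHalf m) (upperHalf m) G y₀ < 0)
    (F : Ultrafilter (EuclideanSpace ℝ (Fin (m + 1)) × (ι → ℝ))) (hF : ↑F ≤ smallScales ι y₀) :
    ∀ᶠ q : EuclideanSpace ℝ (Fin (m + 1)) × (ι → ℝ) in F, κ < scalCoord O (smoothedMetric t r B φ q.2) q.1 := by
  have hy := tendsto_fst_smallScales hF
  have hδ := fun i => tendsto_nhdsWithin_iff.1 (tendsto_snd_smallScales hF i)
  have hδpos : ∀ᶠ q : EuclideanSpace ℝ (Fin (m + 1)) × (ι → ℝ) in F, ∀ i, 0 < q.2 i := Filter.eventually_all.2 fun i => (hδ i).2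
  have hc := h.tendsto_smoothingPoint hφ hF
  have hdet₀ : (totalJet₀ r B y₀ fun _ => (y₀, 0, 0)).det ≠ 0 := by
    rw [h.totalJet₀_eq]; exact h.det_ne
  have hT₀ := (h.tendsto_smoothedMetric hφ).mono_left hF
  have hdet : ∀ᶠ q : EuclideanSpace ℝ (Fin (m + 1)) × (ι → ℝ) in F, (smoothedMetric t r B φ q.2 q.1).det ≠ 0 :=
    ((Continuous.matrix_det continuous_id).tendsto _ |>.comp hT₀).eventually_ne h.det_ne
  -- Compactness of `[0, 1]`.
  have hϑ : ∀ i, ∃ ϑ₀ ∈ Set.Icc (0 : ℝ) 1, Filter.Tendsto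
      (fun q : EuclideanSpace ℝ (Fin (m + 1)) × (ι → ℝ) => θ (t i q.1 / q.2 i)) F (𝓝 ϑ₀) := fun i =>
    isCompact_Icc.ultrafilter_le_nhds (F.map fun q : EuclideanSpace ℝ (Fin (m + 1)) × (ι → ℝ) => θ (t i q.1 / q.2 i))
      (Filter.tendsto_principal.2 (Filter.Eventually.of_forall fun q =>
        ⟨hφ.θ_nonneg _, hφ.θ_le_one _⟩))
  choose ϑ₀ hϑ₀ hϑ using hϑ
  have hS := tendsto_scalJet h.isOpen h.mem h.contDiffOn_B h.contDiffOn_r h.contDiffOn_t hy hc hϑ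
    hdet₀
  have hΛ := fun i => tendsto_symbol h.isOpen h.mem h.contDiffOn_B h.contDiffOn_r h.contDiffOn_t hy
    hc hdet₀ i
  have hΛ₀ := h.scalSymbol_pos hj
  have hr : ∀ i, Filter.Tendsto
      (fun q : EuclideanSpace ℝ (Fin (m + 1)) × (ι → ℝ) => r i q.1) F (𝓝 (r i y₀)) := fun i =>
    ((h.contDiffOn_r i).continuousOn.continuousAt (h.isOpen.mem_nhds h.mem)).tendsto.comp hy
  have hO := hy.eventually (h.isOpen.mem_nhds h.mem)
  have hΛpos := Filter.eventually_all.2 fun i => (hΛ i).eventually_const_lt (hΛ₀ i)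
  have hterm : ∀ᶠ q : EuclideanSpace ℝ (Fin (m + 1)) × (ι → ℝ) in F, ∀ i, 0 ≤ (ψ (t i q.1 / q.2 i) / q.2 i * r i q.1) *
      scalSymbol (totalJet₀ r B q.1 fun i => smoothingPoint t φ q.2 i q.1)
        (fun l k => (pd l (t i) q.1 * pd k (t i) q.1) •
          rampJump O (B i) (smoothingPoint t φ q.2 i q.1)) := by
    filter_upwards [hO, hδpos, hΛpos] with q hq hδq hΛq i
    exact mul_nonneg (mul_nonneg (div_nonneg (hφ.ψ_nonneg _) (hδq i).le) (h.r_nonneg i _ hq))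
      (hΛq i).le
  by_cases hA : ∃ i, 0 < r i y₀ ∧ 0 < ϑ₀ i ∧ ϑ₀ i < 1
  · obtain ⟨i, hri, h0, h1⟩ := hA
    -- The midpoints between the limit and `0` or `1` give an interval that eventually contains the
    -- slope.
    obtain ⟨c, hc0, hcψ⟩ := hφ.exists_le_ψ (a := ϑ₀ i / 2) (b := (1 + ϑ₀ i) / 2) (by linarith)
      (by linarith)
    set s₀ := scalJet (totalJet₀ r B y₀ fun _ => (y₀, 0, 0))
        (totalJet₁ O t r B y₀ (fun _ => (y₀, 0, 0)) ϑ₀)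
        (totalJet₂ O t r B y₀ (fun _ => (y₀, 0, 0)) ϑ₀) with hs₀
    set Λ := scalSymbol (totalJet₀ r B y₀ fun _ => (y₀, 0, 0))
      (fun l k => (pd l (t i) y₀ * pd k (t i) y₀) • rampJump O (B i) (y₀, 0, 0)) with hΛd
    have hinf : Filter.Tendsto (fun q : EuclideanSpace ℝ (Fin (m + 1)) × (ι → ℝ) =>
        (q.2 i)⁻¹ * (c * (r i y₀ / 2) * (Λ / 2))) F Filter.atTop :=
      ((tendsto_inv_nhdsGT_zero (𝕜 := ℝ)).comp (tendsto_snd_smallScales hF i)).atTop_mul_const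
        (mul_pos (mul_pos hc0 (half_pos hri)) (half_pos (hΛ₀ i)))
    filter_upwards [hO, hδpos, hterm, hdet, hinf.eventually_gt_atTop (κ - s₀ + 1),
      hS.eventually_const_lt (sub_one_lt s₀), (hΛ i).eventually_const_lt (half_lt_self (hΛ₀ i)),
      (hr i).eventually_const_lt (half_lt_self hri),
      (hϑ i).eventually_const_lt (half_lt_self h0),
      (hϑ i).eventually_lt_const (show ϑ₀ i < (1 + ϑ₀ i) / 2 by linarith)]
      with q hqO hqδ hqt hqdet hqinf hqS hqΛ hqr hqa hqb
    rw [h.scalCoord_smoothedMetric hφ hqδ hqO hqdet]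
    have hle := Finset.single_le_sum (fun i _ => hqt i) (Finset.mem_univ i)
    have hge : (q.2 i)⁻¹ * (c * (r i y₀ / 2) * (Λ / 2)) ≤ (ψ (t i q.1 / q.2 i) / q.2 i * r i q.1) *
      scalSymbol (totalJet₀ r B q.1 fun i => smoothingPoint t φ q.2 i q.1)
        (fun l k => (pd l (t i) q.1 * pd k (t i) q.1) •
          rampJump O (B i) (smoothingPoint t φ q.2 i q.1)) := by
      rw [div_mul_eq_mul_div, div_mul_eq_mul_div, div_eq_inv_mul _ (q.2 i)]
      refine mul_le_mul_of_nonneg_left ?_ (_root_.inv_pos.2 (hqδ i)).le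
      refine mul_le_mul (mul_le_mul (hcψ _ hqa.le hqb.le) hqr.le (half_pos hri).le
        (hφ.ψ_nonneg _)) hqΛ.le (half_pos (hΛ₀ i)).le
        (mul_nonneg (hφ.ψ_nonneg _) (h.r_nonneg i _ hqO))
    linarith
  · push Not at hA
    have h01 : ∀ i, 0 < r i y₀ → ϑ₀ i = 0 ∨ ϑ₀ i = 1 := fun i hi => by
      rcases (hϑ₀ i).1.eq_or_lt with h0 | h0
      · exact Or.inl h0.symm
      · exact Or.inr (le_antisymm (hϑ₀ i).2 (hA i hi h0))
    -- A slope below `θ 0` forces `t i < 0`, as `θ` is monotone. A limit `0` and a limit `1`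
    -- together would put the point on both sides of the seam.
    have hneg : ∀ i, ϑ₀ i = 0 → ∀ᶠ q : EuclideanSpace ℝ (Fin (m + 1)) × (ι → ℝ) in F, q.1 0 < 0 := fun i hi => by
      filter_upwards [hO, hδpos, (hϑ i).eventually_lt_const (by rw [hi]; exact hφ.θ_zero_mem.1)]
        with q hqO hqδ hq
      refine (h.t_neg i _ hqO).1 (not_le.1 fun hle => not_le.2 hq (hφ.θ_mono ?_))
      exact div_nonneg hle (hqδ i).le
    have hpos : ∀ i, ϑ₀ i = 1 → ∀ᶠ q : EuclideanSpace ℝ (Fin (m + 1)) × (ι → ℝ) in F, 0 < q.1 0 := fun i hi => by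
      filter_upwards [hO, hδpos, (hϑ i).eventually_const_lt (by rw [hi]; exact hφ.θ_zero_mem.2)]
        with q hqO hqδ hq
      refine (h.t_pos i _ hqO).1 (not_le.1 fun hle => not_le.2 hq (hφ.θ_mono ?_))
      exact div_nonpos_of_nonpos_of_nonneg hle (hqδ i).le
    have hlt : κ < scalJet (totalJet₀ r B y₀ fun _ => (y₀, 0, 0))
        (totalJet₁ O t r B y₀ (fun _ => (y₀, 0, 0)) ϑ₀)
        (totalJet₂ O t r B y₀ (fun _ => (y₀, 0, 0)) ϑ₀) := by
      by_cases hz : ∃ i, 0 < r i y₀ ∧ ϑ₀ i = 0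
      · obtain ⟨i, _, hi0⟩ := hz
        have hall : ∀ j, 0 < r j y₀ → ϑ₀ j = (fun _ => (0 : ℝ)) j := fun j hj' =>
          (h01 j hj').resolve_right fun hj1 => by
            obtain ⟨q, hq1, hq2⟩ := ((hneg i hi0).and (hpos j hj1)).exists
            exact lt_asymm hq1 hq2
        rw [h.totalJet₁_congr hall, h.totalJet₂_congr hall, h.scalJet_lower]
        exact hL
      · push Not at hz
        have hall : ∀ j, 0 < r j y₀ → ϑ₀ j = (fun _ => (1 : ℝ)) j := fun j hj' =>
          (h01 j hj').resolve_left (hz j hj')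
        rw [h.totalJet₁_congr hall, h.totalJet₂_congr hall, h.scalJet_upper]
        exact hU
    filter_upwards [hO, hδpos, hterm, hdet, hS.eventually_const_lt hlt] with q hqO hqδ hqt hqdet hqS
    rw [h.scalCoord_smoothedMetric hφ hqδ hqO hqdet]
    have := Finset.sum_nonneg fun i (_ : i ∈ Finset.univ) => hqt i
    linarith

theorem eventually_lt_scalCoord (h : RampedMetric O y₀ G t r B)
    (hφ : SmoothRamp φ θ ψ) {κ : ℝ} (hL : κ < scalCoord (lowerHalf m) G y₀)
    (hU : κ < scalCoord (upperHalf m) G y₀)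
    (hj : m = 0 ∨ jumpTrace (lowerHalf m) (upperHalf m) G y₀ < 0) :
    ∀ᶠ q in smallScales ι y₀, κ < scalCoord O (smoothedMetric t r B φ q.2) q.1 := by
  rcases hj with rfl | hj
  · refine Filter.Eventually.of_forall fun q => ?_
    rw [scalCoord_eq_zero_of_one] at hL ⊢
    exact hL
  · rw [Filter.eventually_iff, Filter.mem_iff_ultrafilter]
    exact fun F hF => h.eventually_lt_scalCoord_of_ultrafilter hφ hL hU hj F hF

end RampedMetric

end Gluing

namespace Gluing

/-! ### Small perturbations with finitely many parameters -/

section Perturbation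

variable {n : ℕ} {ι : Type*} [Fintype ι] {s : Set (EuclideanSpace ℝ (Fin n))}
  {y₀ : EuclideanSpace ℝ (Fin n)} {G : EuclideanSpace ℝ (Fin n) → Matrix (Fin n) (Fin n) ℝ}
  {H : ι → EuclideanSpace ℝ (Fin n) → Matrix (Fin n) (Fin n) ℝ}

theorem SmoothMatrixOn.add_smul_sum (hG : SmoothMatrixOn s G) (hH : ∀ i, SmoothMatrixOn s (H i))
    (η : ι → ℝ) : SmoothMatrixOn s (fun z => G z + ∑ i, η i • H i z) :=
  hG.add (SmoothMatrixOn.smul_sum (f := fun i _ => η i) (fun _ => contDiffOn_const) hH)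

theorem mpderiv_add_smul_sum (hs : UniqueDiffOn ℝ s) (hG : SmoothMatrixOn s G)
    (hH : ∀ i, SmoothMatrixOn s (H i)) (η : ι → ℝ) (k : Fin n) {y : EuclideanSpace ℝ (Fin n)}
    (hy : y ∈ s) : mpderiv s k (fun z => G z + ∑ i, η i • H i z) y =
      mpderiv s k G y + ∑ i, η i • mpderiv s k (H i) y := by
  have h1 := mpderiv_add hs hG
    (SmoothMatrixOn.smul_sum (f := fun i _ => η i) (fun _ => contDiffOn_const) hH) hy k
  have h2 := mpderiv_smul_sum hs (f := fun i _ => η i) (fun _ => contDiffOn_const) hH hy k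
  rw [h1, h2]
  simp [pderivWithin_const]

/-- The `2`-jet of the perturbed metric is jointly continuous in the point and the parameters, so
one bound on the parameters serves a whole neighbourhood. -/
theorem eventually_lt_scalCoord_add (hs : UniqueDiffOn ℝ s) (hG : SmoothMatrixOn s G)
    (hH : ∀ i, SmoothMatrixOn s (H i)) (hy₀ : y₀ ∈ s) (hdet : (G y₀).det ≠ 0) {κ : ℝ}
    (hκ : κ < scalCoord s G y₀) :
    ∀ᶠ q : EuclideanSpace ℝ (Fin n) × (ι → ℝ) in 𝓝[s] y₀ ×ˢ 𝓝 0,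
      κ < scalCoord s (fun z => G z + ∑ i, q.2 i • H i z) q.1 := by
  set F : Filter (EuclideanSpace ℝ (Fin n) × (ι → ℝ)) := 𝓝[s] y₀ ×ˢ 𝓝 0 with hF
  have hlim : ∀ {M : EuclideanSpace ℝ (Fin n) → Matrix (Fin n) (Fin n) ℝ}
      {N : ι → EuclideanSpace ℝ (Fin n) → Matrix (Fin n) (Fin n) ℝ}, SmoothMatrixOn s M →
      (∀ i, SmoothMatrixOn s (N i)) → Filter.Tendsto (fun q : EuclideanSpace ℝ (Fin n) × (ι → ℝ) =>
      M q.1 + ∑ i, q.2 i • N i q.1) F (𝓝 (M y₀)) := by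
    intro M N hM hN
    have hη : ∀ i, Filter.Tendsto (fun q : EuclideanSpace ℝ (Fin n) × (ι → ℝ) => q.2 i) F (𝓝 0) :=
      fun i => ((continuous_apply i).tendsto (0 : ι → ℝ)).comp Filter.tendsto_snd
    refine tendsto_pi_nhds.2 fun a => tendsto_pi_nhds.2 fun b => ?_
    have h1 : Filter.Tendsto (fun q : EuclideanSpace ℝ (Fin n) × (ι → ℝ) => M q.1 a b) F
        (𝓝 (M y₀ a b)) := ((hM a b).continuousOn y₀ hy₀).tendsto.comp Filter.tendsto_fst
    have h2 : ∀ i, Filter.Tendsto (fun q : EuclideanSpace ℝ (Fin n) × (ι → ℝ) => N i q.1 a b) F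
        (𝓝 (N i y₀ a b)) := fun i =>
      ((hN i a b).continuousOn y₀ hy₀).tendsto.comp Filter.tendsto_fst
    have h3 := h1.add (tendsto_finsetSum Finset.univ fun i _ => (hη i).mul (h2 i))
    simp only [zero_mul, Finset.sum_const_zero, add_zero] at h3
    simpa [Matrix.add_apply, Matrix.sum_apply] using h3
  have h0 := hlim hG hH
  have h1 : Filter.Tendsto (fun q : EuclideanSpace ℝ (Fin n) × (ι → ℝ) => fun k =>
      mpderiv s k G q.1 + ∑ i, q.2 i • mpderiv s k (H i) q.1) F (𝓝 fun k => mpderiv s k G y₀) :=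
    tendsto_pi_nhds.2 fun k => hlim (hG.mpderiv hs k) fun i => (hH i).mpderiv hs k
  have h2 : Filter.Tendsto (fun q : EuclideanSpace ℝ (Fin n) × (ι → ℝ) => fun l k =>
      mpderiv s l (mpderiv s k G) q.1 + ∑ i, q.2 i • mpderiv s l (mpderiv s k (H i)) q.1) F
      (𝓝 fun l k => mpderiv s l (mpderiv s k G) y₀) :=
    tendsto_pi_nhds.2 fun l => tendsto_pi_nhds.2 fun k =>
      hlim ((hG.mpderiv hs k).mpderiv hs l) fun i => ((hH i).mpderiv hs k).mpderiv hs l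
  have h3 := tendsto_scalJet_of_tendsto h0 h1 h2 hdet
  rw [scalCoord_eq_scalJet_of_det_ne hs hG hy₀ hdet] at hκ
  have hd : ∀ᶠ q : EuclideanSpace ℝ (Fin n) × (ι → ℝ) in F, (G q.1 + ∑ i, q.2 i • H i q.1).det ≠ 0 :=
    (((Continuous.matrix_det continuous_id).tendsto _).comp h0).eventually_ne hdet
  have hm : ∀ᶠ q : EuclideanSpace ℝ (Fin n) × (ι → ℝ) in F, q.1 ∈ s :=
    Filter.tendsto_fst.eventually self_mem_nhdsWithin
  filter_upwards [h3.eventually_const_lt hκ, hd, hm] with q hq hqd hqs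
  rw [scalCoord_eq_scalJet_of_det_ne hs (hG.add_smul_sum hH q.2) hqs hqd]
  have e1 : ∀ k, mpderiv s k (fun z => G z + ∑ i, q.2 i • H i z) q.1 =
      mpderiv s k G q.1 + ∑ i, q.2 i • mpderiv s k (H i) q.1 := fun k =>
    mpderiv_add_smul_sum hs hG hH q.2 k hqs
  have e2 : ∀ l k, mpderiv s l (mpderiv s k (fun z => G z + ∑ i, q.2 i • H i z)) q.1 =
      mpderiv s l (mpderiv s k G) q.1 + ∑ i, q.2 i • mpderiv s l (mpderiv s k (H i)) q.1 := by
    intro l k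
    rw [mpderiv_congr (fun z hz => mpderiv_add_smul_sum hs hG hH q.2 k hz) hqs]
    exact mpderiv_add_smul_sum hs (hG.mpderiv hs k) (fun i => (hH i).mpderiv hs k) q.2 l hqs
  simp only [e1, e2]
  exact hq

end Perturbation

end Gluing

namespace Gluing

/-! ### Fields of bilinear forms and their matrices along a parametrisation -/

section PullMat

attribute [local instance] chartedSpaceSelf

variable {n : ℕ} {H : Type*} [TopologicalSpace H]
  {I : ModelWithCorners ℝ (EuclideanSpace ℝ (Fin n)) H}
  {M : Type*} [TopologicalSpace M] [ChartedSpace H M]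

variable (I M) in
/-- Fields of bilinear forms on the tangent spaces. -/
abbrev FormField : Type _ := ∀ x : M, TangentSpace I x →L[ℝ] TangentSpace I x →L[ℝ] ℝ

/-- The matrix of the pull-back of the field `q` along `Φ`. -/
def pullMat (q : FormField I M) (Φ : EuclideanSpace ℝ (Fin n) → M)
    (s : Set (EuclideanSpace ℝ (Fin n))) (y : EuclideanSpace ℝ (Fin n)) : Matrix (Fin n) (Fin n) ℝ :=
  Matrix.of fun i j =>
    q (Φ y) (mfderivWithin 𝓘(ℝ, EuclideanSpace ℝ (Fin n)) I Φ s y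
        (EuclideanSpace.single i (1 : ℝ) : EuclideanSpace ℝ (Fin n)))
      (mfderivWithin 𝓘(ℝ, EuclideanSpace ℝ (Fin n)) I Φ s y
        (EuclideanSpace.single j (1 : ℝ) : EuclideanSpace ℝ (Fin n)))

variable {q : FormField I M} {Φ : EuclideanSpace ℝ (Fin n) → M}
  {s s' : Set (EuclideanSpace ℝ (Fin n))} {y : EuclideanSpace ℝ (Fin n)}

theorem clm_eq_sum_single {F : Type*} [AddCommGroup F] [Module ℝ F] [TopologicalSpace F]
    (L : EuclideanSpace ℝ (Fin n) →L[ℝ] F) (v : EuclideanSpace ℝ (Fin n)) :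
    L v = ∑ a, v a • L (EuclideanSpace.single a 1) := by
  conv_lhs => rw [← (EuclideanSpace.basisFun (Fin n) ℝ).sum_repr v]
  simp

theorem clm_bilinear_apply_eq_sum
    (b : EuclideanSpace ℝ (Fin n) →L[ℝ] EuclideanSpace ℝ (Fin n) →L[ℝ] ℝ)
    (L : EuclideanSpace ℝ (Fin n) →L[ℝ] EuclideanSpace ℝ (Fin n)) (v w : EuclideanSpace ℝ (Fin n)) :
    ∑ i, ∑ j, v i * w j * b (L (EuclideanSpace.single i 1)) (L (EuclideanSpace.single j 1)) =
      b (L v) (L w) := by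
  rw [clm_eq_sum_single L v, clm_eq_sum_single L w]
  simp only [map_sum, map_smul, smul_eq_mul, sum_apply, _root_.smul_apply, Finset.mul_sum]
  rw [Finset.sum_comm]
  refine Finset.sum_congr rfl fun i _ => Finset.sum_congr rfl fun j _ => by ring

theorem pullMat_apply_sum (v w : EuclideanSpace ℝ (Fin n)) :
    ∑ i, ∑ j, v i * w j * pullMat q Φ s y i j =
      q (Φ y) (mfderivWithin 𝓘(ℝ, EuclideanSpace ℝ (Fin n)) I Φ s y v)
        (mfderivWithin 𝓘(ℝ, EuclideanSpace ℝ (Fin n)) I Φ s y w) :=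
  clm_bilinear_apply_eq_sum (q (Φ y)) (mfderivWithin 𝓘(ℝ, EuclideanSpace ℝ (Fin n)) I Φ s y) v w

theorem pullMat_comp {ψ : EuclideanSpace ℝ (Fin n) → EuclideanSpace ℝ (Fin n)}
    (hs : UniqueDiffWithinAt ℝ s y) (hψ : DifferentiableWithinAt ℝ ψ s y)
    (hΦ : MDifferentiableWithinAt 𝓘(ℝ, EuclideanSpace ℝ (Fin n)) I Φ s' (ψ y))
    (hm : Set.MapsTo ψ s s') :
    pullMat q (Φ ∘ ψ) s y = (jacobian s ψ y)ᵀ * pullMat q Φ s' (ψ y) * jacobian s ψ y := by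
  have hd : mfderivWithin 𝓘(ℝ, EuclideanSpace ℝ (Fin n)) I (Φ ∘ ψ) s y =
      (mfderivWithin 𝓘(ℝ, EuclideanSpace ℝ (Fin n)) I Φ s' (ψ y)).comp (fderivWithin ℝ ψ s y) := by
    rw [mfderivWithin_comp (I' := 𝓘(ℝ, EuclideanSpace ℝ (Fin n))) (u := s') y hΦ
      hψ.mdifferentiableWithinAt hm hs.uniqueMDiffWithinAt, mfderivWithin_eq_fderivWithin]
    rfl
  ext i j
  have key := pullMat_apply_sum (q := q) (Φ := Φ) (s := s') (y := ψ y)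
    (fderivWithin ℝ ψ s y (EuclideanSpace.single i 1))
    (fderivWithin ℝ ψ s y (EuclideanSpace.single j 1))
  rw [pullMat, Matrix.of_apply, hd]
  refine key.symm.trans ?_
  simp only [Matrix.mul_apply, Matrix.transpose_apply, Finset.sum_mul,
    jacobian_apply_eq hs hψ]
  rw [Finset.sum_comm]
  refine Finset.sum_congr rfl fun a _ => Finset.sum_congr rfl fun b _ => by ring

theorem pullMat_congr {Ψ : EuclideanSpace ℝ (Fin n) → M} (h : Set.EqOn Φ Ψ s) (hy : y ∈ s) :
    pullMat q Φ s y = pullMat q Ψ s y := by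
  have h1 : mfderivWithin 𝓘(ℝ, EuclideanSpace ℝ (Fin n)) I Φ s y =
      mfderivWithin 𝓘(ℝ, EuclideanSpace ℝ (Fin n)) I Ψ s y := mfderivWithin_congr h (h hy)
  have h2 : ∀ (x x' : M) (_ : x = x') (v w : EuclideanSpace ℝ (Fin n)),
      (q x : EuclideanSpace ℝ (Fin n) →L[ℝ] EuclideanSpace ℝ (Fin n) →L[ℝ] ℝ) v w =
      (q x' : EuclideanSpace ℝ (Fin n) →L[ℝ] EuclideanSpace ℝ (Fin n) →L[ℝ] ℝ) v w := by
    rintro x _ rfl v w; rfl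
  ext i j
  simp only [pullMat, Matrix.of_apply]
  have h1' : ∀ v : EuclideanSpace ℝ (Fin n),
      (mfderivWithin 𝓘(ℝ, EuclideanSpace ℝ (Fin n)) I Φ s y v : EuclideanSpace ℝ (Fin n)) =
      (mfderivWithin 𝓘(ℝ, EuclideanSpace ℝ (Fin n)) I Ψ s y v : EuclideanSpace ℝ (Fin n)) :=
    fun v => DFunLike.congr_fun h1 v
  exact (h2 _ _ (h hy) _ _).trans (congrArg₂ (fun a b => (q (Ψ y) : EuclideanSpace ℝ (Fin n) →L[ℝ]
    EuclideanSpace ℝ (Fin n) →L[ℝ] ℝ) a b) (h1' _) (h1' _))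

theorem pullMat_subset (h : s ⊆ s') (hs : UniqueDiffWithinAt ℝ s y)
    (hΦ : MDifferentiableWithinAt 𝓘(ℝ, EuclideanSpace ℝ (Fin n)) I Φ s' y) :
    pullMat q Φ s y = pullMat q Φ s' y := by
  simp only [pullMat, mfderivWithin_subset h hs.uniqueMDiffWithinAt hΦ]

theorem pullMat_eq_univ (hs : UniqueDiffWithinAt ℝ s y)
    (hΦ : MDifferentiableAt 𝓘(ℝ, EuclideanSpace ℝ (Fin n)) I Φ y) :
    pullMat q Φ s y = pullMat q Φ Set.univ y :=
  pullMat_subset (Set.subset_univ _) hs hΦ.mdifferentiableWithinAt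

theorem pullMat_map {H' : Type*} [TopologicalSpace H']
    {I' : ModelWithCorners ℝ (EuclideanSpace ℝ (Fin n)) H'}
    {M' : Type*} [TopologicalSpace M'] [ChartedSpace H' M'] {q' : FormField I' M'} {f : M → M'}
    (hf : MDifferentiableAt I I' f (Φ y))
    (hq : ∀ v w : TangentSpace I (Φ y),
      q' (f (Φ y)) (mfderiv I I' f (Φ y) v) (mfderiv I I' f (Φ y) w) = q (Φ y) v w)
    (hs : UniqueDiffWithinAt ℝ s y)
    (hΦ : MDifferentiableWithinAt 𝓘(ℝ, EuclideanSpace ℝ (Fin n)) I Φ s y) :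
    pullMat q' (f ∘ Φ) s y = pullMat q Φ s y := by
  have hd := mfderiv_comp_mfderivWithin y hf hΦ hs.uniqueMDiffWithinAt
  ext i j
  rw [pullMat, pullMat, Matrix.of_apply, Matrix.of_apply, hd]
  exact hq _ _

theorem pullMat_symm (hq : ∀ x v w, q x v w = q x w v) :
    (pullMat q Φ s y)ᵀ = pullMat q Φ s y := by
  ext i j
  exact hq _ _ _

theorem pullMat_posDef (hsymm : ∀ x v w, q x v w = q x w v) (hpos : ∀ x v, v ≠ 0 → 0 < q x v v)
    (hinj : Function.Injective (mfderivWithin 𝓘(ℝ, EuclideanSpace ℝ (Fin n)) I Φ s y)) :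
    (pullMat q Φ s y).PosDef := by
  refine Matrix.PosDef.of_dotProduct_mulVec_pos (by
    rw [Matrix.IsHermitian, Matrix.conjTranspose_eq_transpose_of_trivial]
    exact pullMat_symm hsymm) fun x hx => ?_
  have h := pullMat_apply_sum (q := q) (Φ := Φ) (s := s) (y := y) (WithLp.toLp 2 x)
    (WithLp.toLp 2 x)
  have hne : (mfderivWithin 𝓘(ℝ, EuclideanSpace ℝ (Fin n)) I Φ s y)
      (WithLp.toLp 2 x : EuclideanSpace ℝ (Fin n)) ≠ 0 := by
    intro h0
    rw [← map_zero (mfderivWithin 𝓘(ℝ, EuclideanSpace ℝ (Fin n)) I Φ s y)] at h0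
    have := hinj h0
    exact hx ((WithLp.toLp_eq_zero 2).1 this)
  have hp := hpos _ _ hne
  rw [← h] at hp
  refine hp.trans_le (le_of_eq ?_)
  simp only [dotProduct, Matrix.mulVec, Finset.mul_sum, star_trivial]
  refine Finset.sum_congr rfl fun a _ => Finset.sum_congr rfl fun b _ => by ring

/-- The coordinate fields, pushed forward by the tangent map of `Φ`, are smooth along `Φ`; the
entries are their pairings under the smooth section `g`. -/
theorem smoothMatrixOn_pullMat [IsManifold I ∞ M] (g : SmoothMetric I M)
    (hΦ : ContMDiffOn 𝓘(ℝ, EuclideanSpace ℝ (Fin n)) I ∞ Φ s) (hs : UniqueDiffOn ℝ s) :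
    SmoothMatrixOn s (pullMat g.inner Φ s) := by
  have hT := hΦ.contMDiffOn_tangentMapWithin (m := ∞) (by simp) hs.uniqueMDiffOn
  have hv : ∀ i : Fin n, ContMDiffOn 𝓘(ℝ, EuclideanSpace ℝ (Fin n)) I.tangent ∞
      (fun y => (⟨Φ y, mfderivWithin 𝓘(ℝ, EuclideanSpace ℝ (Fin n)) I Φ s y
        (EuclideanSpace.single i (1 : ℝ) : EuclideanSpace ℝ (Fin n))⟩ : TangentBundle I M)) s := by
    intro i
    have hc : ContMDiff 𝓘(ℝ, EuclideanSpace ℝ (Fin n)) 𝓘(ℝ, EuclideanSpace ℝ (Fin n)).tangent ∞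
        (fun y => (⟨y, (EuclideanSpace.single i (1 : ℝ) : EuclideanSpace ℝ (Fin n))⟩ :
          TangentBundle 𝓘(ℝ, EuclideanSpace ℝ (Fin n)) (EuclideanSpace ℝ (Fin n)))) := by
      intro y
      refine Bundle.contMDiffAt_totalSpace.2 ⟨contMDiffAt_id, ?_⟩
      refine (contMDiffAt_const (c := (EuclideanSpace.single i (1 : ℝ) :
        EuclideanSpace ℝ (Fin n)))).congr_of_eventuallyEq (Filter.Eventually.of_forall fun z => ?_)
      simp
    exact hT.comp hc.contMDiffOn fun y hy => hy
  intro a b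
  have hg : ContMDiffOn 𝓘(ℝ, EuclideanSpace ℝ (Fin n)) (I.prod 𝓘(ℝ, EuclideanSpace ℝ (Fin n) →L[ℝ]
      EuclideanSpace ℝ (Fin n) →L[ℝ] ℝ)) ∞ (fun y => Bundle.TotalSpace.mk'
      (EuclideanSpace ℝ (Fin n) →L[ℝ] EuclideanSpace ℝ (Fin n) →L[ℝ] ℝ)
      (E := fun x : M => TangentSpace I x →L[ℝ] TangentSpace I x →L[ℝ] ℝ) (Φ y)
      (g.inner (Φ y))) s := g.contMDiff.comp_contMDiffOn hΦ
  have hall := ContMDiffOn.clm_bundle_apply₂ (F₃ := ℝ) (E₃ := fun _ : M => ℝ) hg (hv a) (hv b)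
  intro y hy
  have h2 := hall y hy
  rw [Bundle.contMDiffWithinAt_totalSpace] at h2
  have h3 := h2.2.contDiffWithinAt
  exact h3

end PullMat

end Gluing

namespace Gluing

/-! ### Coordinate matrices in charts of the glued manifold -/

section CoordMat

attribute [local instance] chartedSpaceSelf

variable {n : ℕ} {X : Type*} [TopologicalSpace X] [ChartedSpace (EuclideanSpace ℝ (Fin n)) X]
  {q : FormField (𝓡 n) X} {e e' : OpenPartialHomeomorph X (EuclideanSpace ℝ (Fin n))}
  {y : EuclideanSpace ℝ (Fin n)}

/-- The matrix of the field `q` in the chart `e`. -/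
def coordMat (e : OpenPartialHomeomorph X (EuclideanSpace ℝ (Fin n))) (q : FormField (𝓡 n) X) :
    EuclideanSpace ℝ (Fin n) → Matrix (Fin n) (Fin n) ℝ :=
  pullMat q e.symm Set.univ

theorem coordMat_symm (hq : ∀ x v w, q x v w = q x w v) : (coordMat e q y)ᵀ = coordMat e q y :=
  pullMat_symm hq

theorem mdifferentiableAt_chart (he : e ∈ IsManifold.maximalAtlas (𝓡 n) ∞ X) {x : X}
    (hx : x ∈ e.source) : MDifferentiableAt (𝓡 n) 𝓘(ℝ, EuclideanSpace ℝ (Fin n)) e x :=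
  ((contMDiffOn_of_mem_maximalAtlas he).contMDiffAt (e.open_source.mem_nhds hx)).mdifferentiableAt
    (by simp)

theorem mdifferentiableAt_chart_symm (he : e ∈ IsManifold.maximalAtlas (𝓡 n) ∞ X)
    (hy : y ∈ e.target) : MDifferentiableAt 𝓘(ℝ, EuclideanSpace ℝ (Fin n)) (𝓡 n) e.symm y :=
  ((contMDiffOn_symm_of_mem_maximalAtlas he).contMDiffAt
    (e.open_target.mem_nhds hy)).mdifferentiableAt (by simp)

theorem mfderiv_chart_comp_symm (he : e ∈ IsManifold.maximalAtlas (𝓡 n) ∞ X) (hy : y ∈ e.target) :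
    (mfderiv (𝓡 n) 𝓘(ℝ, EuclideanSpace ℝ (Fin n)) e (e.symm y)).comp
      (mfderiv 𝓘(ℝ, EuclideanSpace ℝ (Fin n)) (𝓡 n) e.symm y) =
      ContinuousLinearMap.id ℝ (EuclideanSpace ℝ (Fin n)) := by
  rw [← mfderiv_comp y (mdifferentiableAt_chart he (e.map_target hy))
    (mdifferentiableAt_chart_symm he hy)]
  have h : e ∘ e.symm =ᶠ[𝓝 y] id := by
    filter_upwards [e.open_target.mem_nhds hy] with z hz
    exact e.right_inv hz
  rw [h.mfderiv_eq]
  exact mfderiv_id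

theorem mfderiv_symm_comp_chart (he : e ∈ IsManifold.maximalAtlas (𝓡 n) ∞ X) {x : X}
    (hx : x ∈ e.source) :
    (mfderiv 𝓘(ℝ, EuclideanSpace ℝ (Fin n)) (𝓡 n) e.symm (e x)).comp
      (mfderiv (𝓡 n) 𝓘(ℝ, EuclideanSpace ℝ (Fin n)) e x) =
      ContinuousLinearMap.id ℝ (TangentSpace (𝓡 n) x) := by
  rw [← mfderiv_comp x (mdifferentiableAt_chart_symm he (e.map_source hx))
    (mdifferentiableAt_chart he hx)]
  have h : e.symm ∘ e =ᶠ[𝓝 x] id := by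
    filter_upwards [e.open_source.mem_nhds hx] with z hz
    exact e.left_inv hz
  rw [h.mfderiv_eq]
  exact mfderiv_id

theorem injective_mfderiv_chart_symm (he : e ∈ IsManifold.maximalAtlas (𝓡 n) ∞ X)
    (hy : y ∈ e.target) :
    Function.Injective (mfderiv 𝓘(ℝ, EuclideanSpace ℝ (Fin n)) (𝓡 n) e.symm y) := by
  intro v w hvw
  have h := fun v => DFunLike.congr_fun (mfderiv_chart_comp_symm he hy) v
  have e1 := h v
  have e2 := h w
  simp only [ContinuousLinearMap.comp_apply] at e1 e2
  rw [hvw] at e1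
  exact e1.symm.trans e2

theorem coordMat_posDef (he : e ∈ IsManifold.maximalAtlas (𝓡 n) ∞ X) (hy : y ∈ e.target)
    (hsymm : ∀ x v w, q x v w = q x w v) (hpos : ∀ x v, v ≠ 0 → 0 < q x v v) :
    (coordMat e q y).PosDef := by
  refine pullMat_posDef hsymm hpos ?_
  rw [mfderivWithin_univ]
  exact injective_mfderiv_chart_symm he hy

theorem contDiffOn_transition (he : e ∈ IsManifold.maximalAtlas (𝓡 n) ∞ X)
    (he' : e' ∈ IsManifold.maximalAtlas (𝓡 n) ∞ X) {V : Set (EuclideanSpace ℝ (Fin n))}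
    (hV : V ⊆ e.target) (hm : Set.MapsTo e.symm V e'.source) :
    ContDiffOn ℝ ∞ (e' ∘ e.symm) V :=
  ((contMDiffOn_of_mem_maximalAtlas he').comp ((contMDiffOn_symm_of_mem_maximalAtlas he).mono hV)
    hm).contDiffOn

theorem coordMat_transition (he : e ∈ IsManifold.maximalAtlas (𝓡 n) ∞ X)
    (he' : e' ∈ IsManifold.maximalAtlas (𝓡 n) ∞ X) {V : Set (EuclideanSpace ℝ (Fin n))}
    (hVo : IsOpen V) (hV : V ⊆ e.target) (hm : Set.MapsTo e.symm V e'.source) (hy : y ∈ V) :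
    coordMat e q y = (jacobian V (e' ∘ e.symm) y)ᵀ * coordMat e' q (e' (e.symm y)) *
      jacobian V (e' ∘ e.symm) y := by
  have h1 : pullMat q e.symm V y = coordMat e q y :=
    pullMat_eq_univ (hVo.uniqueDiffOn y hy) (mdifferentiableAt_chart_symm he (hV hy))
  rw [← h1, pullMat_congr (Ψ := e'.symm ∘ e' ∘ e.symm) (fun z hz => (e'.left_inv (hm hz)).symm) hy]
  exact pullMat_comp (hVo.uniqueDiffOn y hy)
    ((contDiffOn_transition he he' hV hm).differentiableOn (by simp) y hy)
    (mdifferentiableAt_chart_symm he' (e'.map_source (hm hy))).mdifferentiableWithinAt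
    (Set.mapsTo_univ _ _)

/-- That the Jacobian of the transition is invertible is read off from the metric, whose matrix is
positive definite in both charts. -/
theorem isMetricPullback_transition (he : e ∈ IsManifold.maximalAtlas (𝓡 n) ∞ X)
    (he' : e' ∈ IsManifold.maximalAtlas (𝓡 n) ∞ X)
    (hsymm : ∀ x v w, q x v w = q x w v) (hpos : ∀ x v, v ≠ 0 → 0 < q x v v)
    {V V' : Set (EuclideanSpace ℝ (Fin n))} (hVo : IsOpen V) (hVo' : IsOpen V') (hV : V ⊆ e.target)
    (hV' : V' ⊆ e'.target) (hm : Set.MapsTo e.symm V e'.source)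
    (hm' : Set.MapsTo (e' ∘ e.symm) V V') (hsm : SmoothMatrixOn V' (coordMat e' q)) :
    IsMetricPullback V V' (e' ∘ e.symm) (coordMat e q) (coordMat e' q) where
  uniqueDiffOn := hVo.uniqueDiffOn
  uniqueDiffOn' := hVo'.uniqueDiffOn
  subset_closure := by rw [hVo.interior_eq]; exact subset_closure
  contDiffOn := contDiffOn_transition he he' hV hm
  mapsTo := hm'
  smooth' := hsm
  symm' _ _ := coordMat_symm hsymm
  det_ne' z hz := (coordMat_posDef he' (hV' hz) hsymm hpos).det_pos.ne'
  det_jacobian_ne z hz h0 := by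
    have h1 := (coordMat_posDef he (hV hz) hsymm hpos).det_pos.ne'
    rw [coordMat_transition he he' hVo hV hm hz, Matrix.det_mul, h0, mul_zero] at h1
    exact h1 rfl
  eq z hz := coordMat_transition he he' hVo hV hm hz

/-- Near `p`, the field `q` is smooth and has scalar curvature larger than `κ` at `p`. -/
def GoodAt (κ : ℝ) (q : FormField (𝓡 n) X) (p : X) : Prop :=
  ∃ e ∈ IsManifold.maximalAtlas (𝓡 n) ∞ X, p ∈ e.source ∧ ∃ V, IsOpen V ∧ e p ∈ V ∧ V ⊆ e.target ∧
    SmoothMatrixOn V (coordMat e q) ∧ κ < scalCoord V (coordMat e q) (e p)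

/-- Needed to construct a Riemannian metric. Compactness of the unit sphere gives `c ‖v‖² ≤ b v v`.
-/
theorem isVonNBounded_of_pos (b : EuclideanSpace ℝ (Fin n) →L[ℝ] EuclideanSpace ℝ (Fin n) →L[ℝ] ℝ)
    (hb : ∀ v, v ≠ 0 → 0 < b v v) : Bornology.IsVonNBounded ℝ {v | b v v < 1} := by
  rw [NormedSpace.isVonNBounded_iff]
  obtain ⟨c, hc, hle⟩ : ∃ c > 0, ∀ v, c * ‖v‖ ^ 2 ≤ b v v := by
    rcases (Metric.sphere (0 : EuclideanSpace ℝ (Fin n)) 1).eq_empty_or_nonempty with h | h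
    · refine ⟨1, one_pos, fun v => ?_⟩
      rcases eq_or_ne v 0 with rfl | hv
      · simp
      · have : ‖v‖⁻¹ • v ∈ Metric.sphere (0 : EuclideanSpace ℝ (Fin n)) 1 := by
          simp [norm_smul, norm_ne_zero_iff.2 hv]
        rw [h] at this
        exact this.elim
    · obtain ⟨u, hu, hmin⟩ := (isCompact_sphere (0 : EuclideanSpace ℝ (Fin n)) 1).exists_isMinOn h
        (f := fun v => b v v) (by fun_prop)
      refine ⟨b u u, hb u (by rintro rfl; simp at hu), fun v => ?_⟩
      rcases eq_or_ne v 0 with rfl | hv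
      · simp
      · have hv' : ‖v‖ ≠ 0 := norm_ne_zero_iff.2 hv
        have : ‖v‖⁻¹ • v ∈ Metric.sphere (0 : EuclideanSpace ℝ (Fin n)) 1 := by
          simp [norm_smul, hv']
        have h2 := isMinOn_iff.1 hmin _ this
        simp only [map_smul, _root_.smul_apply, smul_eq_mul] at h2
        calc b u u * ‖v‖ ^ 2 ≤ ‖v‖⁻¹ * (‖v‖⁻¹ * b v v) * ‖v‖ ^ 2 := by gcongr
          _ = b v v := by field_simp
  refine (Metric.isBounded_ball (x := (0 : EuclideanSpace ℝ (Fin n)))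
    (r := 1 + 1 / c)).subset fun v (hv : b v v < 1) => ?_
  rw [mem_ball_zero_iff]
  have h1 : ‖v‖ ^ 2 < 1 / c := by
    rw [lt_div_iff₀ hc]; nlinarith [hle v]
  nlinarith [norm_nonneg v, sq_nonneg (‖v‖ - 1), one_div_pos.2 hc]

variable [IsManifold (𝓡 n) ∞ X]

theorem metricInChart_eq_coordMat (g : SmoothMetric (𝓡 n) X) (p : X) :
    metricInChart g p = coordMat (chartAt (EuclideanSpace ℝ (Fin n)) p) g.inner := by
  have h : Set.range (𝓡 n) = Set.univ := by simp
  funext x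
  unfold metricInChart coordMat
  rw [h]
  rfl

/-- Frees `scal` from the preferred chart at the point. -/
theorem scal_eq_of_mem_maximalAtlas (g : SmoothMetric (𝓡 n) X) {p : X}
    (he : e ∈ IsManifold.maximalAtlas (𝓡 n) ∞ X) (hp : p ∈ e.source)
    {V : Set (EuclideanSpace ℝ (Fin n))} (hVo : IsOpen V) (hpV : e p ∈ V) (hV : V ⊆ e.target)
    (hsm : SmoothMatrixOn V (coordMat e g.inner)) :
    scal g p = scalCoord V (coordMat e g.inner) (e p) := by
  set c := chartAt (EuclideanSpace ℝ (Fin n)) p with hc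
  have hcp : p ∈ c.source := mem_chart_source _ p
  set W : Set (EuclideanSpace ℝ (Fin n)) := c.target ∩ c.symm ⁻¹' (e.source ∩ e ⁻¹' V) with hW
  have hWo : IsOpen W :=
    c.symm.isOpen_inter_preimage (e.isOpen_inter_preimage hVo)
  have hpW : c p ∈ W := ⟨c.map_source hcp, by
    simp only [Set.mem_preimage, c.left_inv hcp]; exact ⟨hp, hpV⟩⟩
  have h := isMetricPullback_transition (IsManifold.chart_mem_maximalAtlas p) he g.symm g.pos hWo hVo
    Set.inter_subset_left hV (fun z hz => hz.2.1) (fun z hz => hz.2.2) hsm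
  have h1 := h.scalCoord_eq hpW
  rw [Function.comp_apply, c.left_inv hcp] at h1
  rw [← h1, scal, metricInChart_eq_coordMat, ← Set.univ_inter W,
    scalCoord_inter hWo hpW (Set.mem_univ _)]
  simp [hc]

theorem GoodAt.smoothMatrix_chartAt {κ : ℝ} {p : X} (h : GoodAt κ q p)
    (hsymm : ∀ x v w, q x v w = q x w v) (hpos : ∀ x v, v ≠ 0 → 0 < q x v v) :
    ∃ W, IsOpen W ∧ chartAt (EuclideanSpace ℝ (Fin n)) p p ∈ W ∧
      SmoothMatrixOn W (coordMat (chartAt (EuclideanSpace ℝ (Fin n)) p) q) := by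
  obtain ⟨e, he, hp, V, hVo, hpV, hV, hsm, -⟩ := h
  set c := chartAt (EuclideanSpace ℝ (Fin n)) p with hc
  have hcp : p ∈ c.source := mem_chart_source _ p
  refine ⟨c.target ∩ c.symm ⁻¹' (e.source ∩ e ⁻¹' V),
    c.symm.isOpen_inter_preimage (e.isOpen_inter_preimage hVo), ⟨c.map_source hcp, by
    simp only [Set.mem_preimage, c.left_inv hcp]; exact ⟨hp, hpV⟩⟩, ?_⟩
  exact (isMetricPullback_transition (IsManifold.chart_mem_maximalAtlas p) he hsymm hpos
    (c.symm.isOpen_inter_preimage (e.isOpen_inter_preimage hVo)) hVo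
    Set.inter_subset_left hV (fun z hz => hz.2.1) (fun z hz => hz.2.2) hsm).smooth

/-- The bilinear form `(v, w) ↦ vᵢ wⱼ`. -/
def coordForm (i j : Fin n) : EuclideanSpace ℝ (Fin n) →L[ℝ] EuclideanSpace ℝ (Fin n) →L[ℝ] ℝ :=
  (EuclideanSpace.proj i : EuclideanSpace ℝ (Fin n) →L[ℝ] ℝ).smulRight
    (EuclideanSpace.proj j : EuclideanSpace ℝ (Fin n) →L[ℝ] ℝ)

theorem coordForm_apply (i j : Fin n) (v w : EuclideanSpace ℝ (Fin n)) :
    coordForm i j v w = v i * w j := rfl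

theorem clm_bilinear_eq_sum
    (b : EuclideanSpace ℝ (Fin n) →L[ℝ] EuclideanSpace ℝ (Fin n) →L[ℝ] ℝ) :
    b = ∑ i, ∑ j, b (EuclideanSpace.single i 1) (EuclideanSpace.single j 1) •
      coordForm i j := by
  ext v w
  have h := clm_bilinear_apply_eq_sum b (ContinuousLinearMap.id ℝ _) v w
  simp only [ContinuousLinearMap.id_apply] at h
  rw [← h]
  simp only [sum_apply, _root_.smul_apply, coordForm_apply, smul_eq_mul]
  refine Finset.sum_congr rfl fun a _ => Finset.sum_congr rfl fun b _ => by ring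

end CoordMat

end Gluing

namespace Gluing

/-! ### From smooth coordinate matrices to smooth metrics -/

section SmoothMetrics

attribute [local instance] chartedSpaceSelf

variable {n : ℕ} {X : Type*} [TopologicalSpace X] [ChartedSpace (EuclideanSpace ℝ (Fin n)) X]
  {q : FormField (𝓡 n) X} [IsManifold (𝓡 n) ∞ X]

/-- The trivialisation of the tangent bundle at `p` is given by the derivative of the chart, so in
the induced trivialisation of the bundle of forms the section has the entries of `coordMat` as its
coordinates. -/
theorem contMDiffAt_of_smoothMatrixOn {p : X} {W : Set (EuclideanSpace ℝ (Fin n))} (hWo : IsOpen W)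
    (hpW : chartAt (EuclideanSpace ℝ (Fin n)) p p ∈ W)
    (hsm : SmoothMatrixOn W (coordMat (chartAt (EuclideanSpace ℝ (Fin n)) p) q)) :
    ContMDiffAt (𝓡 n) ((𝓡 n).prod 𝓘(ℝ, EuclideanSpace ℝ (Fin n) →L[ℝ]
      EuclideanSpace ℝ (Fin n) →L[ℝ] ℝ)) ∞ (fun x => Bundle.TotalSpace.mk'
      (EuclideanSpace ℝ (Fin n) →L[ℝ] EuclideanSpace ℝ (Fin n) →L[ℝ] ℝ)
      (E := fun x : X => TangentSpace (𝓡 n) x →L[ℝ] TangentSpace (𝓡 n) x →L[ℝ] ℝ) x (q x)) p := by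
  rw [Bundle.contMDiffAt_section]
  set c := chartAt (EuclideanSpace ℝ (Fin n)) p with hc
  have hcp : p ∈ c.source := mem_chart_source _ p
  have hcc : ContMDiffAt (𝓡 n) 𝓘(ℝ, EuclideanSpace ℝ (Fin n)) ∞ c p :=
    (contMDiffOn_of_mem_maximalAtlas (IsManifold.chart_mem_maximalAtlas p)).contMDiffAt
      (c.open_source.mem_nhds hcp)
  have hent : ∀ i j, ContMDiffAt (𝓡 n) 𝓘(ℝ, ℝ) ∞ (fun x => coordMat c q (c x) i j) p := fun i j =>
    ((hsm i j).contDiffAt (hWo.mem_nhds hpW)).contMDiffAt.comp p hcc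
  have hsum : ContMDiffAt (𝓡 n) 𝓘(ℝ, EuclideanSpace ℝ (Fin n) →L[ℝ]
      EuclideanSpace ℝ (Fin n) →L[ℝ] ℝ) ∞ (fun x => ∑ i, ∑ j, coordMat c q (c x) i j •
      coordForm i j) p :=
    contMDiffAt_finsetSum fun i _ => contMDiffAt_finsetSum fun j _ =>
      (hent i j).smul (contMDiffAt_const (c := coordForm i j))
  refine hsum.congr_of_eventuallyEq ?_
  filter_upwards [c.open_source.mem_nhds hcp] with x hx
  rw [hom_trivializationAt_apply]
  refine (clm_bilinear_eq_sum _).trans ?_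
  refine Finset.sum_congr rfl fun i _ => Finset.sum_congr rfl fun j _ => ?_
  congr 1
  have hb : x ∈ (trivializationAt (EuclideanSpace ℝ (Fin n)) (TangentSpace (𝓡 n)) p).baseSet := hx
  have hb' : x ∈ (trivializationAt (EuclideanSpace ℝ (Fin n) →L[ℝ] ℝ)
      (fun x => TangentSpace (𝓡 n) x →L[ℝ] ℝ) p).baseSet := by
    rw [hom_trivializationAt_baseSet]; exact ⟨hb, trivial⟩
  simp only [ContinuousLinearMap.inCoordinates, ContinuousLinearMap.comp_apply]
  rw [Bundle.Trivialization.continuousLinearMapAt_apply_of_mem ℝ _ hb', hom_trivializationAt_apply]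
  simp only [ContinuousLinearMap.inCoordinates, ContinuousLinearMap.comp_apply]
  rw [TangentBundle.symmL_trivializationAt (I := 𝓡 n) (x₀ := p) (x := x) hx]
  have h1 := Bundle.Trivialization.continuousLinearMapAt_apply_of_mem ℝ
    (trivializationAt ℝ (fun _ : X => ℝ) p) (b := x) (Set.mem_univ x)
  refine (h1 _).trans ?_
  have hr : Set.range (𝓡 n) = Set.univ := by simp
  rw [hr]
  have h2 : ∀ (x' : X) (_ : x' = x) (v w : EuclideanSpace ℝ (Fin n)),
      (q x : EuclideanSpace ℝ (Fin n) →L[ℝ] EuclideanSpace ℝ (Fin n) →L[ℝ] ℝ) v w =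
      (q x' : EuclideanSpace ℝ (Fin n) →L[ℝ] EuclideanSpace ℝ (Fin n) →L[ℝ] ℝ) v w := by
    rintro _ rfl v w; rfl
  exact h2 (c.symm (c x)) (c.left_inv hx) _ _

theorem exists_smoothMetric {κ : ℝ} (hsymm : ∀ x v w, q x v w = q x w v)
    (hpos : ∀ x v, v ≠ 0 → 0 < q x v v) (hgood : ∀ p, GoodAt κ q p) :
    ∃ g : SmoothMetric (𝓡 n) X, (∀ p, g.inner p = q p) ∧ ∀ p, κ < scal g p := by
  refine ⟨⟨q, hsymm, hpos, fun p => isVonNBounded_of_pos (q p) (hpos p), fun p => ?_⟩,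
    fun p => rfl, fun p => ?_⟩
  · obtain ⟨W, hWo, hpW, hsm⟩ := (hgood p).smoothMatrix_chartAt hsymm hpos
    exact contMDiffAt_of_smoothMatrixOn hWo hpW hsm
  · obtain ⟨e, he, hp, V, hVo, hpV, hV, hsm, hlt⟩ := hgood p
    rw [scal_eq_of_mem_maximalAtlas _ he hp hVo hpV hV hsm]
    exact hlt

end SmoothMetrics

end Gluing

namespace Gluing

/-! ### Dependence on germs only -/

section LocalCongr

variable {n : ℕ} {s : Set (EuclideanSpace ℝ (Fin n))} {y : EuclideanSpace ℝ (Fin n)}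
  {G G' : EuclideanSpace ℝ (Fin n) → Matrix (Fin n) (Fin n) ℝ}

theorem scalCoord_congr_of_eventually (h : ∀ᶠ z in 𝓝 y, z ∈ s → G z = G' z) (hy : y ∈ s) :
    scalCoord s G y = scalCoord s G' y := by
  obtain ⟨V, hV, hVo, hyV⟩ := eventually_nhds_iff.1 h
  rw [← scalCoord_inter hVo hyV hy, ← scalCoord_inter (G := G') hVo hyV hy]
  exact scalCoord_congr (fun z hz => hV z hz.2 hz.1) ⟨hy, hyV⟩

theorem pderivWithin_congr_of_eventually {f f' : EuclideanSpace ℝ (Fin n) → ℝ} {k : Fin n}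
    (h : ∀ᶠ z in 𝓝 y, z ∈ s → f z = f' z) (hy : y ∈ s) :
    pderivWithin s k f y = pderivWithin s k f' y := by
  obtain ⟨V, hV, hVo, hyV⟩ := eventually_nhds_iff.1 h
  rw [← pderivWithin_inter (hVo.mem_nhds hyV), ← pderivWithin_inter (f := f') (hVo.mem_nhds hyV)]
  exact pderivWithin_congr (fun z hz => hV z hz.2 hz.1) ⟨hy, hyV⟩

end LocalCongr

/-! ### Charts in which the seam is a hyperplane -/

section SeamCharts

attribute [local instance] chartedSpaceSelf

variable {m : ℕ} {X : Type*} [TopologicalSpace X] [ChartedSpace (EuclideanSpace ℝ (Fin (m + 1))) X]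
  {q q' : FormField (𝓡 (m + 1)) X}
  {e e' : OpenPartialHomeomorph X (EuclideanSpace ℝ (Fin (m + 1)))}
  {A B : Set X} {y : EuclideanSpace ℝ (Fin (m + 1))}

/-- A chart of `X` onto the whole of `ℝⁿ` for which `A` is the lower half-space and `B` is the
upper half-space. -/
structure IsSeamChart (A B : Set X)
    (e : OpenPartialHomeomorph X (EuclideanSpace ℝ (Fin (m + 1)))) : Prop where
  mem_maximalAtlas : e ∈ IsManifold.maximalAtlas (𝓡 (m + 1)) ∞ X
  target_eq : e.target = Set.univ
  mem_left : ∀ x ∈ e.source, x ∈ A ↔ e x 0 ≤ 0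
  mem_right : ∀ x ∈ e.source, x ∈ B ↔ 0 ≤ e x 0

theorem IsSeamChart.mem_target (h : IsSeamChart A B e) (y : EuclideanSpace ℝ (Fin (m + 1))) :
    y ∈ e.target := by rw [h.target_eq]; trivial

theorem IsSeamChart.symm_mem_left (h : IsSeamChart A B e) : e.symm y ∈ A ↔ y 0 ≤ 0 := by
  rw [h.mem_left _ (e.map_target (h.mem_target y)), e.right_inv (h.mem_target y)]

theorem IsSeamChart.symm_mem_right (h : IsSeamChart A B e) : e.symm y ∈ B ↔ 0 ≤ y 0 := by
  rw [h.mem_right _ (e.map_target (h.mem_target y)), e.right_inv (h.mem_target y)]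

theorem IsSeamChart.mem_seam (h : IsSeamChart A B e) {x : X} (hx : x ∈ e.source) :
    x ∈ A ∩ B ↔ e x 0 = 0 := by
  rw [Set.mem_inter_iff, h.mem_left x hx, h.mem_right x hx]
  exact ⟨fun h => le_antisymm h.1 h.2, fun h => ⟨h.le, h.ge⟩⟩

theorem IsSeamChart.continuous_symm (h : IsSeamChart A B e) : Continuous e.symm := by
  have := e.continuousOn_symm
  rwa [h.target_eq, continuousOn_univ] at this

theorem IsSeamChart.transition_pos (h : IsSeamChart A B e) (h' : IsSeamChart A B e')
    (hy : e.symm y ∈ e'.source) : 0 < e' (e.symm y) 0 ↔ 0 < y 0 := by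
  rw [← not_le, ← h'.mem_left _ hy, h.symm_mem_left, not_le]

theorem IsSeamChart.transition_neg (h : IsSeamChart A B e) (h' : IsSeamChart A B e')
    (hy : e.symm y ∈ e'.source) : e' (e.symm y) 0 < 0 ↔ y 0 < 0 := by
  rw [← not_le, ← h'.mem_right _ hy, h.symm_mem_right, not_le]

theorem IsSeamChart.transition_zero (h : IsSeamChart A B e) (h' : IsSeamChart A B e')
    (hy : e.symm y ∈ e'.source) (h0 : y 0 = 0) : e' (e.symm y) 0 = 0 := by
  have h1 := h.transition_pos h' hy
  have h2 := h.transition_neg h' hy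
  rw [h0] at h1 h2
  simp only [lt_irrefl, iff_false, not_lt] at h1 h2
  exact le_antisymm h1 h2

theorem IsSeamChart.isOpen_overlap (h : IsSeamChart A B e) : IsOpen (e.symm ⁻¹' e'.source) :=
  e'.open_source.preimage h.continuous_symm

theorem IsSeamChart.contDiffOn_transition (h : IsSeamChart A B e) (h' : IsSeamChart A B e') :
    ContDiffOn ℝ ∞ (e' ∘ e.symm) (e.symm ⁻¹' e'.source) :=
  Gluing.contDiffOn_transition h.mem_maximalAtlas h'.mem_maximalAtlas
    (by rw [h.target_eq]; exact Set.subset_univ _) (Set.mapsTo_preimage _ _)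

theorem IsSeamChart.contDiffOn_transition_zero (h : IsSeamChart A B e) (h' : IsSeamChart A B e') :
    ContDiffOn ℝ ∞ (fun z => e' (e.symm z) 0) (e.symm ⁻¹' e'.source) :=
  contDiffOn_coord (h.contDiffOn_transition h') 0

theorem IsSeamChart.coordMat_eq (h : IsSeamChart A B e) (h' : IsSeamChart A B e')
    (hy : e.symm y ∈ e'.source) :
    coordMat e q y = (jacobian (e.symm ⁻¹' e'.source) (e' ∘ e.symm) y)ᵀ *
      coordMat e' q (e' (e.symm y)) * jacobian (e.symm ⁻¹' e'.source) (e' ∘ e.symm) y :=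
  coordMat_transition h.mem_maximalAtlas h'.mem_maximalAtlas h.isOpen_overlap
    (by rw [h.target_eq]; exact Set.subset_univ _) (Set.mapsTo_preimage _ _) hy

/-- The derivative is `≥ 0` because the transition preserves the upper side. It is not `0`, for the
tangential derivatives vanish already and the Jacobian would have a zero row. -/
theorem IsSeamChart.transition_deriv_pos (h : IsSeamChart A B e) (h' : IsSeamChart A B e')
    (hsymm : ∀ x v w, q x v w = q x w v) (hpos : ∀ x v, v ≠ 0 → 0 < q x v v)
    (hy : e.symm y ∈ e'.source) (h0 : y 0 = 0) : 0 < pd 0 (fun z => e' (e.symm z) 0) y := by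
  set O := e.symm ⁻¹' e'.source with hO
  have hOo : IsOpen O := h.isOpen_overlap
  have hyO : y ∈ O := hy
  have ht := h.contDiffOn_transition_zero h'
  have hte : ∀ k, pderivWithin O k (fun z => e' (e.symm z) 0) y = pd k (fun z => e' (e.symm z) 0) y :=
    pderivWithin_eq_pd hOo ht hyO (hOo.uniqueDiffOn y hyO)
  have hge : 0 ≤ pd 0 (fun z => e' (e.symm z) 0) y := by
    have hd : HasFDerivAt (fun z => e' (e.symm z) 0) (fderiv ℝ (fun z => e' (e.symm z) 0) y) y :=
      ((ht.contDiffAt (hOo.mem_nhds hyO)).differentiableAt (by simp)).hasFDerivAt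
    have hl : HasDerivAt (fun τ : ℝ => y + τ • EuclideanSpace.single (0 : Fin (m + 1)) (1 : ℝ))
        (EuclideanSpace.single 0 1) 0 := by
      simpa using ((hasDerivAt_id (0 : ℝ)).smul_const
        (EuclideanSpace.single (0 : Fin (m + 1)) (1 : ℝ))).const_add y
    have hc := (show HasFDerivAt _ _ (y + (0 : ℝ) • EuclideanSpace.single (0 : Fin (m + 1)) (1 : ℝ))
      by simpa using hd).comp_hasDerivAt (0 : ℝ) hl
    have h2 := hc.hasDerivWithinAt (s := Set.Ici 0)
    have h3 : Filter.Tendsto _ (𝓝[>] (0 : ℝ)) _ :=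
      (hasDerivWithinAt_iff_tendsto_slope' Set.self_notMem_Ioi).1 (h2.mono Set.Ioi_subset_Ici_self)
    refine ge_of_tendsto h3 ?_
    have hcont : ContinuousAt (fun τ : ℝ => y + τ • EuclideanSpace.single (0 : Fin (m + 1)) (1 : ℝ))
        0 := hl.continuousAt
    have hmem : ∀ᶠ τ in 𝓝 (0 : ℝ), y + τ • EuclideanSpace.single (0 : Fin (m + 1)) (1 : ℝ) ∈ O :=
      hcont.eventually_mem (by simpa using hOo.mem_nhds hyO)
    filter_upwards [self_mem_nhdsWithin, hmem.filter_mono nhdsWithin_le_nhds] with τ (hτ : 0 < τ) hτO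
    rw [slope_def_field, sub_zero]
    refine div_nonneg ?_ hτ.le
    have hv : e' (e.symm (y + (0 : ℝ) • EuclideanSpace.single (0 : Fin (m + 1)) (1 : ℝ))) 0 = 0 := by
      rw [zero_smul, add_zero]; exact h.transition_zero h' hy h0
    simp only [Function.comp_apply, hv, sub_zero]
    exact ((h.transition_pos h' hτO).2 (by simpa [h0] using hτ)).le
  refine hge.lt_of_ne fun heq => ?_
  have hrow : ∀ k, jacobian O (e' ∘ e.symm) y 0 k = 0 := by
    intro k
    refine Fin.cases ?_ (fun j => ?_) k
    · exact (hte 0).trans heq.symm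
    · refine pderivWithin_succ_eq_zero (ht.differentiableOn (by simp) y hyO) ?_ h0
        (fun z hz hz0 => h.transition_zero h' hz hz0) j
      have := (tangentiallyOpenAt_lowerHalf h0).inter (hOo.mem_nhds hyO)
      exact fun i => (this i).mono fun _ hx => hx.2
  have hdet := (coordMat_posDef h.mem_maximalAtlas (h.mem_target y) hsymm hpos).det_pos.ne'
  rw [h.coordMat_eq h' hy, Matrix.det_mul, Matrix.det_eq_zero_of_row_eq_zero 0 hrow, mul_zero] at hdet
  exact hdet rfl

theorem coordMat_congr (h : q (e.symm y) = q' (e.symm y)) : coordMat e q y = coordMat e q' y := by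
  simp only [coordMat, pullMat, h]

theorem GoodAt.congr {κ : ℝ} {p : X} (h : GoodAt κ q p) (hq : ∀ᶠ x in 𝓝 p, q x = q' x) :
    GoodAt κ q' p := by
  obtain ⟨e, he, hp, V, hVo, hpV, hV, hsm, hlt⟩ := h
  obtain ⟨N, hN, hNo, hpN⟩ := eventually_nhds_iff.1 hq
  have hWo : IsOpen (e.target ∩ e.symm ⁻¹' N) := e.symm.isOpen_inter_preimage hNo
  have hpW : e p ∈ e.target ∩ e.symm ⁻¹' N := ⟨e.map_source hp, by
    rw [Set.mem_preimage, e.left_inv hp]; exact hpN⟩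
  have heq : Set.EqOn (coordMat e q') (coordMat e q) (V ∩ (e.target ∩ e.symm ⁻¹' N)) :=
    fun z hz => (coordMat_congr (hN _ hz.2.2)).symm
  refine ⟨e, he, hp, V ∩ (e.target ∩ e.symm ⁻¹' N), hVo.inter hWo, ⟨hpV, hpW⟩,
    fun z hz => hV hz.1, (hsm.mono Set.inter_subset_left).congr heq, ?_⟩
  rw [scalCoord_congr heq ⟨hpV, hpW⟩, scalCoord_inter hWo hpW hpV]
  exact hlt

variable {ι : Type*}

/-- Near the point `p` of the seam, in one of the charts `e`, both sides have scalar curvature larger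
than `κ`, and the jump of the normal derivative of the metric has property `P`. -/
def SeamAt (κ : ℝ) (P : ℝ → Prop)
    (e : ι → OpenPartialHomeomorph X (EuclideanSpace ℝ (Fin (m + 1))))
    (q : FormField (𝓡 (m + 1)) X) (p : X) : Prop :=
  ∃ k, p ∈ (e k).source ∧ κ < scalCoord (lowerHalf m) (coordMat (e k) q) (e k p) ∧
    κ < scalCoord (upperHalf m) (coordMat (e k) q) (e k p) ∧
    P (jumpTrace (lowerHalf m) (upperHalf m) (coordMat (e k) q) (e k p))

theorem SeamAt.congr {κ : ℝ} {P : ℝ → Prop}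
    {e : ι → OpenPartialHomeomorph X (EuclideanSpace ℝ (Fin (m + 1)))} {p : X}
    (h : SeamAt κ P e q p) (he : ∀ i, IsSeamChart A B (e i)) (hp : p ∈ A ∩ B)
    (hq : ∀ᶠ x in 𝓝 p, q x = q' x) : SeamAt κ P e q' p := by
  obtain ⟨k, hk, h1, h2, h3⟩ := h
  have h0 := ((he k).mem_seam hk).1 hp
  have hq' : ∀ᶠ z in 𝓝 (e k p), coordMat (e k) q z = coordMat (e k) q' z := by
    have : Filter.Tendsto (e k).symm (𝓝 (e k p)) (𝓝 p) := by
      have := (he k).continuous_symm.tendsto (e k p)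
      rwa [(e k).left_inv hk] at this
    filter_upwards [this.eventually hq] with z hz
    exact coordMat_congr hz
  refine ⟨k, hk, ?_, ?_, ?_⟩
  · rwa [← scalCoord_congr_of_eventually (hq'.mono fun z hz _ => hz) h0.le]
  · rwa [← scalCoord_congr_of_eventually (hq'.mono fun z hz _ => hz) h0.ge]
  · convert h3 using 1
    simp only [jumpTrace, hq'.self_of_nhds]
    refine Finset.sum_congr rfl fun i _ => Finset.sum_congr rfl fun j _ => ?_
    rw [pderivWithin_congr_of_eventually (s := upperHalf m)
      (hq'.mono fun z hz _ => congrFun (congrFun hz i.succ) j.succ) h0.ge,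
      pderivWithin_congr_of_eventually (s := lowerHalf m)
      (hq'.mono fun z hz _ => congrFun (congrFun hz i.succ) j.succ) h0.le]

end SeamCharts

end Gluing

namespace Gluing

/-! ### Choosing infinitely many scales at once -/

section Scales

variable {X ι : Type*} [TopologicalSpace X]

theorem exists_pos_of_eventually_prod {σ : Type*} [Fintype σ] {p : X} {P : X → (σ → ℝ) → Prop}
    (h : ∀ᶠ z : X × (σ → ℝ) in 𝓝 p ×ˢ 𝓝[{η | ∀ i, 0 < η i}] 0, P z.1 z.2) :
    ∃ r > 0, ∀ᶠ x in 𝓝 p, ∀ η : σ → ℝ, (∀ i, 0 < η i ∧ η i ≤ r) → P x η := by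
  obtain ⟨pa, ha, pb, hb, hab⟩ := Filter.eventually_prod_iff.1 h
  obtain ⟨ρ, hρ, hball⟩ := Metric.mem_nhdsWithin_iff.1 hb
  refine ⟨ρ / 2, half_pos hρ, ha.mono fun x hx η hη => hab hx (hball ⟨?_, fun i => (hη i).1⟩)⟩
  rw [Metric.mem_ball, dist_pi_lt_iff hρ]
  intro i
  rw [Pi.zero_apply, Real.dist_0_eq_abs, abs_of_pos (hη i).1]
  linarith [(hη i).2]

/-- Scales that are locally small enough for a local property can be chosen globally. -/
theorem exists_scales [NormalSpace X] [ParacompactSpace X] {K : ι → Set X}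
    (hK : ∀ i, IsCompact (K i)) {Q : (ι → ℝ) → X → Prop}
    (hloc : ∀ η η' x, (∀ i, x ∈ K i → η i = η' i) → Q η x → Q η' x)
    (h : ∀ p, ∃ s : Finset ι, ∀ᶠ z : X × (s → ℝ) in 𝓝 p ×ˢ 𝓝[{η | ∀ i, 0 < η i}] 0,
      ∀ η : ι → ℝ, (∀ i, 0 < η i) → (fun i : s => η i) = z.2 → Q η z.1) :
    ∃ η : ι → ℝ, (∀ i, 0 < η i) ∧ ∀ x, Q η x := by
  -- `R` is admissible at `x` if all scales work whose entries at the indices active at `x` are at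
  -- most `R`. Admissible values form an interval, so a partition of unity turns local constants
  -- into a continuous choice of `R`.
  let t : X → Set ℝ := fun x =>
    {R | 0 < R ∧ ∀ η : ι → ℝ, (∀ i, 0 < η i) → (∀ i, x ∈ K i → η i ≤ R) → Q η x}
  have ht : ∀ x, Convex ℝ (t x) := by
    intro x
    refine Set.OrdConnected.convex ⟨fun a ha b hb c hc => ⟨ha.1.trans_le hc.1, fun η hη hle =>
      hb.2 η hη fun i hi => (hle i hi).trans hc.2⟩⟩
  obtain ⟨R, hR⟩ := exists_continuous_forall_mem_convex_of_local_const ht fun p => by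
    obtain ⟨s, hs⟩ := h p
    obtain ⟨r, hr, hev⟩ := exists_pos_of_eventually_prod (P := fun x ζ => ∀ η : ι → ℝ,
      (∀ i, 0 < η i) → (fun i : s => η i) = ζ → Q η x) hs
    refine ⟨r, hev.mono fun x hx => ⟨hr, fun η hη hle => ?_⟩⟩
    -- Truncation at `r` makes all the scales small and changes none that is active at `x`.
    refine hloc (fun i => min (η i) r) η x (fun i hi => min_eq_left (hle i hi)) ?_
    exact hx (fun i => min (η i) r) (fun i => ⟨lt_min (hη i) hr, min_le_right _ _⟩) _
      (fun i => lt_min (hη i) hr) rfl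
  -- The scale `η i` must be at most `R` on all of `K i`; compactness provides a positive minimum.
  have hmin : ∀ i, ∃ c > 0, ∀ x ∈ K i, c ≤ R x := by
    intro i
    rcases (K i).eq_empty_or_nonempty with he | hne
    · exact ⟨1, one_pos, fun x hx => by simp [he] at hx⟩
    · obtain ⟨x, -, hx⟩ := (hK i).exists_isMinOn hne R.continuous.continuousOn
      exact ⟨R x, (hR x).1, fun y hy => hx hy⟩
  choose η hη hle using hmin
  exact ⟨η, hη, fun x => (hR x).2 η hη fun i hi => hle i x hi⟩

end Scales

/-! ### Cut-off functions along the seam -/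

section SeamAtlas

attribute [local instance] chartedSpaceSelf

variable {m : ℕ} {X : Type*} [TopologicalSpace X] [ChartedSpace (EuclideanSpace ℝ (Fin (m + 1))) X]
  {A B U : Set X} {ι : Type*} {e : ι → OpenPartialHomeomorph X (EuclideanSpace ℝ (Fin (m + 1)))}
  {ρ : ι → X → ℝ} {p : X}

/-- Charts that cover the common boundary of the closed sets `A` and `B`. -/
structure SeamAtlas (A B : Set X)
    (e : ι → OpenPartialHomeomorph X (EuclideanSpace ℝ (Fin (m + 1)))) : Prop where
  isClosed_left : IsClosed A
  isClosed_right : IsClosed B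
  union_eq : A ∪ B = Set.univ
  chart : ∀ i, IsSeamChart A B (e i)
  covers : ∀ x ∈ A ∩ B, ∃ i, x ∈ (e i).source ∧ e i x = 0

/-- A smooth partition of unity near `A ∩ B`, subordinate to the charts `e` and to `U`. -/
structure SeamCutoff (A B U : Set X)
    (e : ι → OpenPartialHomeomorph X (EuclideanSpace ℝ (Fin (m + 1)))) (ρ : ι → X → ℝ) : Prop where
  contMDiff : ∀ i, ContMDiff (𝓡 (m + 1)) 𝓘(ℝ, ℝ) ∞ (ρ i)
  nonneg : ∀ i x, 0 ≤ ρ i x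
  locallyFinite : LocallyFinite fun i => tsupport (ρ i)
  isCompact : ∀ i, IsCompact (tsupport (ρ i))
  subset_source : ∀ i, tsupport (ρ i) ⊆ (e i).source
  subset : ∀ i, tsupport (ρ i) ⊆ U
  sum_eq_one : ∀ p ∈ A ∩ B, ∀ᶠ x in 𝓝 p, ∑ᶠ i, ρ i x = 1

/-- Take a partition of unity subordinate to the unit balls of the charts, intersected with `U`, and
to the complement of the seam, and forget the last member: it vanishes near the seam. Unit balls are
used because their closures are compact in the charts. -/
theorem SeamAtlas.exists_cutoff [T2Space X] [SigmaCompactSpace X] [IsManifold (𝓡 (m + 1)) ∞ X]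
    (h : SeamAtlas A B e) (hU : IsOpen U) (hAB : A ∩ B ⊆ U) : ∃ ρ, SeamCutoff A B U e ρ := by
  let V : Option ι → Set X := fun o => o.elim (A ∩ B)ᶜ
    fun i => ((e i).source ∩ e i ⁻¹' Metric.ball 0 1) ∩ U
  have hVo : ∀ o, IsOpen (V o) := by
    rintro (_ | i)
    · exact (h.isClosed_left.inter h.isClosed_right).isOpen_compl
    · exact ((e i).isOpen_inter_preimage Metric.isOpen_ball).inter hU
  have hV : (Set.univ : Set X) ⊆ ⋃ o, V o := by
    intro x _
    by_cases hx : x ∈ A ∩ B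
    · obtain ⟨i, hi, h0⟩ := h.covers x hx
      exact Set.mem_iUnion.2 ⟨some i, ⟨hi, by simp [h0]⟩, hAB hx⟩
    · exact Set.mem_iUnion.2 ⟨none, hx⟩
  obtain ⟨f, hf⟩ := SmoothPartitionOfUnity.exists_isSubordinate (𝓡 (m + 1)) isClosed_univ V hVo hV
  refine ⟨fun i => f (some i), fun i => (f (some i)).contMDiff, fun i x => f.nonneg _ x,
    f.locallyFinite.closure.comp_injective (Option.some_injective ι), fun i => ?_,
    fun i x hx => (hf (some i) hx).1.1, fun i x hx => (hf (some i) hx).2, fun p hp => ?_⟩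
  · have hc : IsCompact ((e i).symm '' Metric.closedBall 0 1) :=
      (isCompact_closedBall _ _).image (h.chart i).continuous_symm
    refine hc.of_isClosed_subset (isClosed_tsupport _) fun x hx => ?_
    have hx' := (hf (some i) hx).1
    exact ⟨e i x, Metric.ball_subset_closedBall hx'.2, (e i).left_inv hx'.1⟩
  · have hn : p ∉ tsupport (f none) := fun hp' => hf none hp' hp
    filter_upwards [(isClosed_tsupport (f none)).isOpen_compl.mem_nhds hn] with x hx
    have hset : Set.range some ∩ Function.support (fun o => f o x) =
        Set.univ ∩ Function.support (fun o => f o x) := by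
      ext o
      simp only [Set.mem_inter_iff, Set.mem_univ, true_and, and_iff_right_iff_imp]
      rintro ho
      rcases o with _ | i
      · exact absurd (image_eq_zero_of_notMem_tsupport hx) (Function.mem_support.1 ho)
      · exact ⟨i, rfl⟩
    rw [← f.sum_eq_one (Set.mem_univ x), ← finsum_mem_univ (fun o => f o x),
      ← finsum_mem_range (f := fun o => f o x) (Option.some_injective ι),
      ← finsum_mem_inter_support _ (Set.range some), ← finsum_mem_inter_support _ Set.univ, hset]

/-- The indices of the cut-off functions that matter near `p`. -/
def SeamCutoff.active (h : SeamCutoff A B U e ρ) (p : X) : Finset ι :=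
  (h.locallyFinite.point_finite p).toFinset

theorem SeamCutoff.mem_active (h : SeamCutoff A B U e ρ) {i : ι} :
    i ∈ h.active p ↔ p ∈ tsupport (ρ i) := by
  simp [active]

theorem SeamCutoff.eventually_active (h : SeamCutoff A B U e ρ) (p : X) :
    ∀ᶠ x in 𝓝 p, ∀ i ∉ h.active p, x ∉ tsupport (ρ i) := by
  filter_upwards [h.locallyFinite.eventually_subset (fun i => isClosed_tsupport (ρ i)) p]
    with x hx i hi hxi
  exact hi (h.mem_active.2 (hx hxi))

theorem SeamCutoff.eventually_finsum (h : SeamCutoff A B U e ρ) (p : X) {F : Type*}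
    [AddCommMonoid F] :
    ∀ᶠ x in 𝓝 p, ∀ f : ι → F, (∀ i, x ∉ tsupport (ρ i) → f i = 0) →
      ∑ᶠ i, f i = ∑ i : h.active p, f i := by
  filter_upwards [h.eventually_active p] with x hx f hf
  rw [finsum_eq_sum_of_support_subset _ (s := h.active p), ← Finset.sum_coe_sort]
  intro i hi
  by_contra hn
  exact hi (hf i (hx i hn))

end SeamAtlas

end Gluing

namespace Gluing

/-! ### Effect of a fold on the jump -/

section JumpTrace

variable {m : ℕ} {y : EuclideanSpace ℝ (Fin (m + 1))}
  {G M : EuclideanSpace ℝ (Fin (m + 1)) → Matrix (Fin (m + 1)) (Fin (m + 1)) ℝ}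
  {F : EuclideanSpace ℝ (Fin (m + 1)) → ℝ}

theorem pderivWithin_smul_entry {s : Set (EuclideanSpace ℝ (Fin (m + 1)))} (hs : UniqueDiffOn ℝ s)
    (hy : y ∈ s) (hG : SmoothMatrixOn s G) (hF : DifferentiableAt ℝ F y) (hF0 : F y = 0) {c : ℝ}
    (hM : ∀ᶠ z in 𝓝 y, z ∈ s → M z = (1 + c * F z) • G z) (i j k : Fin (m + 1)) :
    pderivWithin s k (fun z => M z i j) y =
      pderivWithin s k (fun z => G z i j) y + c * pd k F y * G y i j := by
  have hd : DifferentiableAt ℝ (fun z => 1 + c * F z) y := (hF.const_mul c).const_add 1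
  have hM' : ∀ᶠ z in 𝓝 y, z ∈ s → M z i j = (1 + c * F z) * G z i j := hM.mono fun z hz hzs => by
    rw [hz hzs]; rfl
  rw [pderivWithin_congr_of_eventually hM' hy, pderivWithin_mul (hs y hy)
    hd.differentiableWithinAt (hG.diff i j hy), hF0, mul_zero, add_zero, one_mul]
  have : pderivWithin s k (fun z => 1 + c * F z) y = c * pd k F y := by
    rw [pderivWithin, hd.fderivWithin (hs y hy), fderiv_const_add, fderiv_const_mul hF, pd]
    rfl
  rw [this, add_comm]

/-- As `F` vanishes at `y`, the fold adds `∂₀F · G` to the normal derivative below and subtracts it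
above. The jump changes by `-2 ∂₀F · G`, and the trace of `G` over an `m`-dimensional hyperplane is
`m`. -/
theorem jumpTrace_fold (hL : SmoothMatrixOn (lowerHalf m) G) (hU : SmoothMatrixOn (upperHalf m) G)
    (hG : (G y).PosDef) (hF : DifferentiableAt ℝ F y) (hF0 : F y = 0) (hy : y 0 = 0)
    (hML : ∀ᶠ z in 𝓝 y, z ∈ lowerHalf m → M z = (1 + 1 * F z) • G z)
    (hMU : ∀ᶠ z in 𝓝 y, z ∈ upperHalf m → M z = (1 + (-1) * F z) • G z) :
    jumpTrace (lowerHalf m) (upperHalf m) M y =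
      jumpTrace (lowerHalf m) (upperHalf m) G y - 2 * m * pd 0 F y := by
  have hMy : M y = G y := by
    rw [hML.self_of_nhds hy.le, hF0]; simp
  set S : Matrix (Fin m) (Fin m) ℝ := (G y).submatrix Fin.succ Fin.succ with hS
  have hSp : S.PosDef := hG.submatrix (Fin.succ_injective m)
  have htr : ∑ i, ∑ j, S⁻¹ i j * S i j = m := by
    have h1 : S⁻¹ * S = 1 := Matrix.nonsing_inv_mul _ (isUnit_iff_ne_zero.2 hSp.det_pos.ne')
    have h2 : ∀ i j, S i j = S j i := fun i j => hSp.isHermitian.apply j i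
    calc ∑ i, ∑ j, S⁻¹ i j * S i j = ∑ i, (S⁻¹ * S) i i := by
          refine Finset.sum_congr rfl fun i _ => ?_
          rw [Matrix.mul_apply]
          exact Finset.sum_congr rfl fun j _ => by rw [h2 i j]
      _ = m := by rw [h1]; simp
  simp only [jumpTrace, hMy, ← hS,
    pderivWithin_smul_entry uniqueDiffOn_upperHalf hy.ge hU hF hF0 hMU,
    pderivWithin_smul_entry uniqueDiffOn_lowerHalf hy.le hL hF hF0 hML]
  rw [← htr, Finset.mul_sum, Finset.sum_mul, ← Finset.sum_sub_distrib]
  refine Finset.sum_congr rfl fun i _ => ?_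
  rw [Finset.mul_sum, Finset.sum_mul, ← Finset.sum_sub_distrib]
  refine Finset.sum_congr rfl fun j _ => ?_
  simp only [hS, Matrix.submatrix_apply]
  ring

end JumpTrace

/-! ### Small conformal changes -/

section ConformalScaling

attribute [local instance] chartedSpaceSelf

variable {n : ℕ} {X : Type*} [TopologicalSpace X] [ChartedSpace (EuclideanSpace ℝ (Fin n)) X]
  {q : FormField (𝓡 n) X} {σ : Type*} [Fintype σ] {w : σ → X → ℝ} {κ : ℝ} {p : X}

/-- The field `q`, multiplied by `1 + c ∑ ζᵢ wᵢ`. -/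
def conformalScale (q : FormField (𝓡 n) X) (w : σ → X → ℝ) (c : ℝ) (ζ : σ → ℝ) :
    FormField (𝓡 n) X := fun x => (1 + c * ∑ i, ζ i * w i x) • q x

variable {e : OpenPartialHomeomorph X (EuclideanSpace ℝ (Fin n))} {s : Set (EuclideanSpace ℝ (Fin n))}

theorem contDiffOn_comp_chart_symm (he : e ∈ IsManifold.maximalAtlas (𝓡 n) ∞ X) {f : X → ℝ}
    (hf : ContMDiff (𝓡 n) 𝓘(ℝ, ℝ) ∞ f) : ContDiffOn ℝ ∞ (fun z => f (e.symm z)) e.target :=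
  (hf.comp_contMDiffOn (contMDiffOn_symm_of_mem_maximalAtlas he)).contDiffOn

theorem coordMat_conformalScale (c : ℝ) (ζ : σ → ℝ) :
    coordMat e (conformalScale q w c ζ) = fun z =>
      coordMat e q z + ∑ i, ζ i • (c * w i (e.symm z)) • coordMat e q z := by
  funext z
  change (1 + c * ∑ i, ζ i * w i (e.symm z)) • coordMat e q z = _
  rw [add_smul, one_smul, Finset.mul_sum, Finset.sum_smul]
  congr 1
  refine Finset.sum_congr rfl fun i _ => ?_
  rw [smul_smul]; congr 1; ring

theorem smoothMatrixOn_conformalScale (he : e ∈ IsManifold.maximalAtlas (𝓡 n) ∞ X)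
    (hw : ∀ i, ContMDiff (𝓡 n) 𝓘(ℝ, ℝ) ∞ (w i)) (hs : s ⊆ e.target)
    (hG : SmoothMatrixOn s (coordMat e q)) (c : ℝ) (ζ : σ → ℝ) :
    SmoothMatrixOn s (coordMat e (conformalScale q w c ζ)) := by
  rw [coordMat_conformalScale]
  refine SmoothMatrixOn.add_smul_sum (H := fun i z => (c * w i (e.symm z)) • coordMat e q z) hG
    (fun i a b => ?_) ζ
  exact ((contDiffOn_const.mul (contDiffOn_comp_chart_symm he (hw i))).mono hs).smul (hG a b)

theorem eventually_lt_scalCoord_conformalScale (he : e ∈ IsManifold.maximalAtlas (𝓡 n) ∞ X)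
    (hsymm : ∀ x v w, q x v w = q x w v) (hpos : ∀ x v, v ≠ 0 → 0 < q x v v)
    (hw : ∀ i, ContMDiff (𝓡 n) 𝓘(ℝ, ℝ) ∞ (w i)) (hs : s ⊆ e.target) (hsu : UniqueDiffOn ℝ s)
    (hG : SmoothMatrixOn s (coordMat e q)) (hp : p ∈ e.source) (hps : e p ∈ s)
    (hκ : κ < scalCoord s (coordMat e q) (e p)) (c : ℝ) :
    ∀ᶠ z : X × (σ → ℝ) in 𝓝 p ×ˢ 𝓝 0, e z.1 ∈ s →
      κ < scalCoord s (coordMat e (conformalScale q w c z.2)) (e z.1) := by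
  have h := eventually_lt_scalCoord_add hsu hG
    (H := fun i z => (c * w i (e.symm z)) • coordMat e q z)
    (fun i a b => ((contDiffOn_const.mul (contDiffOn_comp_chart_symm he (hw i))).mono hs).smul
      (hG a b)) hps (coordMat_posDef he (e.map_source hp) hsymm hpos).det_pos.ne' hκ
  obtain ⟨pa, ha, pb, hb, hab⟩ := Filter.eventually_prod_iff.1 h
  refine Filter.eventually_prod_iff.2 ⟨fun x => e x ∈ s → pa (e x), ?_, pb, hb, ?_⟩
  · exact (e.continuousAt hp).eventually (eventually_nhdsWithin_iff.1 ha)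
  · intro x hx ζ hζ hxs
    rw [coordMat_conformalScale]
    exact hab (hx hxs) hζ

theorem GoodAt.eventually_conformalScale (h : GoodAt κ q p)
    (hsymm : ∀ x v w, q x v w = q x w v) (hpos : ∀ x v, v ≠ 0 → 0 < q x v v)
    (hw : ∀ i, ContMDiff (𝓡 n) 𝓘(ℝ, ℝ) ∞ (w i)) (c : ℝ) :
    ∀ᶠ z : X × (σ → ℝ) in 𝓝 p ×ˢ 𝓝 0, GoodAt κ (conformalScale q w c z.2) z.1 := by
  obtain ⟨e, he, hp, V, hVo, hpV, hV, hsm, hlt⟩ := h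
  have hev : ∀ᶠ x in 𝓝 p, x ∈ e.source ∧ e x ∈ V :=
    Filter.Eventually.and (p := fun x => x ∈ e.source) (e.open_source.mem_nhds hp)
      ((e.continuousAt hp).eventually (hVo.mem_nhds hpV))
  filter_upwards [eventually_lt_scalCoord_conformalScale he hsymm hpos hw hV hVo.uniqueDiffOn hsm
    hp hpV hlt c, hev.prod_inl (𝓝 0)] with z hz hz'
  exact ⟨e, he, hz'.1, V, hVo, hz'.2, hV, smoothMatrixOn_conformalScale he hw hV hsm c _, hz hz'.2⟩

theorem goodAt_of_subset (he : e ∈ IsManifold.maximalAtlas (𝓡 n) ∞ X) (hs : s ⊆ e.target)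
    {V : Set (EuclideanSpace ℝ (Fin n))} (hV : IsOpen V) (hVs : V ⊆ s)
    (hG : SmoothMatrixOn s (coordMat e q)) (hp : p ∈ e.source) (hpV : e p ∈ V)
    (hκ : κ < scalCoord s (coordMat e q) (e p)) : GoodAt κ q p := by
  refine ⟨e, he, hp, V, hV, hpV, hVs.trans hs, hG.mono hVs, ?_⟩
  have h := scalCoord_inter (G := coordMat e q) hV hpV (hVs hpV)
  rw [Set.inter_eq_right.2 hVs] at h
  rwa [h]

end ConformalScaling

end Gluing

namespace Gluing

/-! ### The fold function and the folded metric -/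

section MakeJumpNegative

attribute [local instance] chartedSpaceSelf

variable {m : ℕ} {X : Type*} [TopologicalSpace X] [ChartedSpace (EuclideanSpace ℝ (Fin (m + 1))) X]
  {A B U : Set X} {ι : Type*} {e : ι → OpenPartialHomeomorph X (EuclideanSpace ℝ (Fin (m + 1)))}
  {ρ : ι → X → ℝ} {p x : X} {κ : ℝ} {P : ℝ → Prop} {q : FormField (𝓡 (m + 1)) X} {η : ι → ℝ}

/-- `q` is a Riemannian metric on `X` that is smooth and of scalar curvature larger than `κ` on both
sides of `A ∩ B`, and the jump of its normal derivative has property `P`. -/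
structure PiecewiseMetric (κ : ℝ) (P : ℝ → Prop) (A B : Set X)
    (e : ι → OpenPartialHomeomorph X (EuclideanSpace ℝ (Fin (m + 1))))
    (q : FormField (𝓡 (m + 1)) X) : Prop where
  symm : ∀ x v w, q x v w = q x w v
  pos : ∀ x v, v ≠ 0 → 0 < q x v v
  good : ∀ p ∉ A ∩ B, GoodAt κ q p
  smooth_lower : ∀ i, SmoothMatrixOn (lowerHalf m) (coordMat (e i) q)
  smooth_upper : ∀ i, SmoothMatrixOn (upperHalf m) (coordMat (e i) q)
  seam : ∀ p ∈ A ∩ B, SeamAt κ P e q p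

/-- The coordinate transverse to the seam in the chart `e i`, cut off. -/
def cutCoord (ρ : ι → X → ℝ) (e : ι → OpenPartialHomeomorph X (EuclideanSpace ℝ (Fin (m + 1))))
    (i : ι) (x : X) : ℝ := ρ i x * e i x 0

/-- A function that is negative on one side of the seam and positive on the other. -/
def foldFunction (ρ : ι → X → ℝ) (e : ι → OpenPartialHomeomorph X (EuclideanSpace ℝ (Fin (m + 1))))
    (η : ι → ℝ) (x : X) : ℝ := ∑ᶠ i, η i * cutCoord ρ e i x

/-- The field `q`, scaled down by a factor with a fold along the seam. -/
def foldMetric (ρ : ι → X → ℝ) (e : ι → OpenPartialHomeomorph X (EuclideanSpace ℝ (Fin (m + 1))))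
    (q : FormField (𝓡 (m + 1)) X) (η : ι → ℝ) : FormField (𝓡 (m + 1)) X :=
  fun x => (1 - |foldFunction ρ e η x|) • q x

theorem cutCoord_eq_zero {i : ι} (hx : x ∉ tsupport (ρ i)) : cutCoord ρ e i x = 0 := by
  rw [cutCoord, image_eq_zero_of_notMem_tsupport hx, zero_mul]

namespace SeamCutoff

/-- The chart coordinate is smooth only on the source of the chart, which contains the support of
the cut-off. -/
theorem contMDiff_cutCoord (h : SeamCutoff A B U e ρ) (ha : SeamAtlas A B e) (i : ι) :
    ContMDiff (𝓡 (m + 1)) 𝓘(ℝ, ℝ) ∞ (cutCoord ρ e i) := by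
  refine contMDiff_of_tsupport fun x hx => ?_
  have hsupp : Function.support (cutCoord ρ e i) ⊆ Function.support (ρ i) := fun y hy h0 =>
    hy (by rw [cutCoord, h0, zero_mul])
  have hxi : x ∈ (e i).source := h.subset_source i (closure_mono hsupp hx)
  have he : ContMDiffAt (𝓡 (m + 1)) 𝓘(ℝ, EuclideanSpace ℝ (Fin (m + 1))) ∞ (e i) x :=
    (contMDiffOn_of_mem_maximalAtlas (ha.chart i).mem_maximalAtlas).contMDiffAt
      ((e i).open_source.mem_nhds hxi)
  have hc : ContDiff ℝ ∞ (fun y : EuclideanSpace ℝ (Fin (m + 1)) => y 0) :=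
    (EuclideanSpace.proj (𝕜 := ℝ) (0 : Fin (m + 1))).contDiff
  have h2 : ContMDiffAt (𝓡 (m + 1)) 𝓘(ℝ, ℝ) ∞ (fun x => e i x 0) x :=
    hc.contMDiff.contMDiffAt.comp x he
  exact (h.contMDiff i).contMDiffAt.smul h2

theorem cutCoord_nonpos (h : SeamCutoff A B U e ρ) (ha : SeamAtlas A B e) (i : ι) (hx : x ∈ A) :
    cutCoord ρ e i x ≤ 0 := by
  by_cases hxi : x ∈ tsupport (ρ i)
  · exact mul_nonpos_of_nonneg_of_nonpos (h.nonneg i x)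
      (((ha.chart i).mem_left x (h.subset_source i hxi)).1 hx)
  · rw [cutCoord_eq_zero hxi]

theorem cutCoord_nonneg (h : SeamCutoff A B U e ρ) (ha : SeamAtlas A B e) (i : ι) (hx : x ∈ B) :
    0 ≤ cutCoord ρ e i x := by
  by_cases hxi : x ∈ tsupport (ρ i)
  · exact mul_nonneg (h.nonneg i x) (((ha.chart i).mem_right x (h.subset_source i hxi)).1 hx)
  · rw [cutCoord_eq_zero hxi]

theorem contMDiff_foldFunction (h : SeamCutoff A B U e ρ) (ha : SeamAtlas A B e) (η : ι → ℝ) :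
    ContMDiff (𝓡 (m + 1)) 𝓘(ℝ, ℝ) ∞ (foldFunction ρ e η) := by
  have hc : ∀ i, ContMDiff (𝓡 (m + 1)) 𝓘(ℝ, ℝ) ∞ (fun x => η i * cutCoord ρ e i x) := fun i =>
    (contMDiff_const : ContMDiff (𝓡 (m + 1)) 𝓘(ℝ, ℝ) ∞ fun _ : X => η i).smul
      (h.contMDiff_cutCoord ha i)
  refine contMDiff_finsum hc ?_
  refine h.locallyFinite.subset fun i x hx => ?_
  by_contra hn
  exact hx (by simp [cutCoord_eq_zero hn])

theorem eventually_foldFunction_eq (h : SeamCutoff A B U e ρ) (p : X) :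
    ∀ᶠ x in 𝓝 p, ∀ η : ι → ℝ,
      foldFunction ρ e η x = ∑ i : h.active p, η i * cutCoord ρ e i x := by
  filter_upwards [h.eventually_finsum (F := ℝ) p] with x hx η
  exact hx _ fun i hi => by rw [cutCoord_eq_zero hi, mul_zero]

theorem foldFunction_nonpos (h : SeamCutoff A B U e ρ) (ha : SeamAtlas A B e)
    (hη : ∀ i, 0 < η i) (hx : x ∈ A) : foldFunction ρ e η x ≤ 0 := by
  rw [(h.eventually_foldFunction_eq x).self_of_nhds]
  exact Finset.sum_nonpos fun i _ =>
    mul_nonpos_of_nonneg_of_nonpos (hη i).le (h.cutCoord_nonpos ha i hx)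

theorem foldFunction_nonneg (h : SeamCutoff A B U e ρ) (ha : SeamAtlas A B e)
    (hη : ∀ i, 0 < η i) (hx : x ∈ B) : 0 ≤ foldFunction ρ e η x := by
  rw [(h.eventually_foldFunction_eq x).self_of_nhds]
  exact Finset.sum_nonneg fun i _ => mul_nonneg (hη i).le (h.cutCoord_nonneg ha i hx)

/-- `F` has a constant sign on each side, so there the fold is a smooth conformal change: the factor
is `1 + F` on `A` and `1 - F` on `B`. -/
theorem foldMetric_eq_left (h : SeamCutoff A B U e ρ) (ha : SeamAtlas A B e)
    (hη : ∀ i, 0 < η i) (hx : x ∈ A) :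
    foldMetric ρ e q η x = (1 + 1 * foldFunction ρ e η x) • q x := by
  rw [foldMetric, abs_of_nonpos (h.foldFunction_nonpos ha hη hx)]
  congr 1; ring

theorem foldMetric_eq_right (h : SeamCutoff A B U e ρ) (ha : SeamAtlas A B e)
    (hη : ∀ i, 0 < η i) (hx : x ∈ B) :
    foldMetric ρ e q η x = (1 + (-1) * foldFunction ρ e η x) • q x := by
  rw [foldMetric, abs_of_nonneg (h.foldFunction_nonneg ha hη hx)]
  congr 1; ring

theorem eventually_foldMetric_eq (h : SeamCutoff A B U e ρ) (ha : SeamAtlas A B e) (p : X) :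
    ∀ᶠ x in 𝓝 p, ∀ η : ι → ℝ, (∀ i, 0 < η i) →
      (x ∈ A → foldMetric ρ e q η x = conformalScale q
        (fun i : h.active p => cutCoord ρ e i) 1 (fun i => η i) x) ∧
      (x ∈ B → foldMetric ρ e q η x = conformalScale q
        (fun i : h.active p => cutCoord ρ e i) (-1) (fun i => η i) x) := by
  filter_upwards [h.eventually_foldFunction_eq p] with x hx η hη
  refine ⟨fun hA => ?_, fun hB => ?_⟩
  · rw [h.foldMetric_eq_left ha hη hA, hx]; rfl
  · rw [h.foldMetric_eq_right ha hη hB, hx]; rfl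

theorem foldFunction_congr (h : SeamCutoff A B U e ρ) {η' : ι → ℝ}
    (hη : ∀ i, p ∈ tsupport (ρ i) → η i = η' i) :
    ∀ᶠ x in 𝓝 p, foldFunction ρ e η x = foldFunction ρ e η' x := by
  filter_upwards [h.eventually_foldFunction_eq p] with x hx
  rw [hx, hx]
  exact Finset.sum_congr rfl fun i _ => by rw [hη i (h.mem_active.1 i.2)]

/-- The derivative of the cut-off does not contribute, as it is multiplied by a coordinate that
vanishes on the seam. -/
theorem pd_cutCoord (h : SeamCutoff A B U e ρ) (ha : SeamAtlas A B e)
    {y : EuclideanSpace ℝ (Fin (m + 1))} {k i : ι} (hi : (e k).symm y ∈ tsupport (ρ i))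
    (hy : y 0 = 0) :
    pd 0 (fun z => cutCoord ρ e i ((e k).symm z)) y =
      ρ i ((e k).symm y) * pd 0 (fun z => e i ((e k).symm z) 0) y := by
  have hO := (ha.chart k).isOpen_overlap (e' := e i)
  have hyO : y ∈ (e k).symm ⁻¹' (e i).source := h.subset_source i hi
  have ht : DifferentiableAt ℝ (fun z => e i ((e k).symm z) 0) y :=
    (((ha.chart k).contDiffOn_transition_zero (ha.chart i)).contDiffAt
      (hO.mem_nhds hyO)).differentiableAt (by simp)
  have hr : DifferentiableAt ℝ (fun z => ρ i ((e k).symm z)) y :=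
    ((contDiffOn_comp_chart_symm (ha.chart k).mem_maximalAtlas (h.contMDiff i)).contDiffAt
      ((e k).open_target.mem_nhds ((ha.chart k).mem_target y))).differentiableAt (by simp)
  have h0 : e i ((e k).symm y) 0 = 0 := (ha.chart k).transition_zero (ha.chart i) hyO hy
  simp only [pd, cutCoord]
  rw [fderiv_fun_mul hr ht, h0]
  simp

/-- The transverse derivative of `F` is a combination of positive transition derivatives with
coefficients `η i * ρ i`. It is positive, since the cut-offs sum to `1` on the seam and cannot all
vanish. -/
theorem jumpTrace_foldMetric_lt (h : SeamCutoff A B U e ρ) (ha : SeamAtlas A B e)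
    (hq : PiecewiseMetric κ P A B e q) (hη : ∀ i, 0 < η i) {y : EuclideanSpace ℝ (Fin (m + 1))}
    (hy : y 0 = 0) (k : ι) (hm : 0 < m) :
    jumpTrace (lowerHalf m) (upperHalf m) (coordMat (e k) (foldMetric ρ e q η)) y <
      jumpTrace (lowerHalf m) (upperHalf m) (coordMat (e k) q) y := by
  have hk := ha.chart k
  set x := (e k).symm y with hx
  have hxs : x ∈ A ∩ B := ⟨hk.symm_mem_left.2 hy.le, hk.symm_mem_right.2 hy.ge⟩
  have hF : DifferentiableAt ℝ (fun z => foldFunction ρ e η ((e k).symm z)) y :=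
    ((contDiffOn_comp_chart_symm hk.mem_maximalAtlas (h.contMDiff_foldFunction ha η)).contDiffAt
      ((e k).open_target.mem_nhds (hk.mem_target y))).differentiableAt (by simp)
  rw [jumpTrace_fold (hq.smooth_lower k) (hq.smooth_upper k)
    (coordMat_posDef hk.mem_maximalAtlas (hk.mem_target y) hq.symm hq.pos) hF
    (le_antisymm (h.foldFunction_nonpos ha hη hxs.1) (h.foldFunction_nonneg ha hη hxs.2)) hy
    (Filter.Eventually.of_forall fun z hz => ?_) (Filter.Eventually.of_forall fun z hz => ?_)]
  · have hpd : 0 < pd 0 (fun z => foldFunction ρ e η ((e k).symm z)) y := by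
      have hev : (fun z => foldFunction ρ e η ((e k).symm z)) =ᶠ[𝓝 y]
          fun z => ∑ i : h.active x, η i * cutCoord ρ e i ((e k).symm z) := by
        filter_upwards [hk.continuous_symm.continuousAt.eventually (h.eventually_foldFunction_eq x)]
          with z hz
        exact hz η
      have hd : ∀ i : h.active x, DifferentiableAt ℝ (fun z => cutCoord ρ e i ((e k).symm z)) y :=
        fun i => ((contDiffOn_comp_chart_symm hk.mem_maximalAtlas
          (h.contMDiff_cutCoord ha i)).contDiffAt
          ((e k).open_target.mem_nhds (hk.mem_target y))).differentiableAt (by simp)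
      have hsum : pd 0 (fun z => foldFunction ρ e η ((e k).symm z)) y = ∑ i : h.active x,
          η i * (ρ i x * pd 0 (fun z => e i ((e k).symm z) 0) y) := by
        rw [pd, hev.fderiv_eq, fderiv_fun_sum fun i _ => (hd i).const_mul _]
        simp only [sum_apply]
        refine Finset.sum_congr rfl fun i _ => ?_
        rw [fderiv_const_mul (hd i)]
        exact congrArg (η i * ·) (h.pd_cutCoord ha (h.mem_active.1 i.2) hy)
      have hone := (h.sum_eq_one x hxs).self_of_nhds
      rw [(h.eventually_finsum x).self_of_nhds (fun i => ρ i x)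
        fun i hi => image_eq_zero_of_notMem_tsupport hi] at hone
      have hpos : ∀ i : h.active x, 0 < pd 0 (fun z => e i ((e k).symm z) 0) y := fun i =>
        hk.transition_deriv_pos (ha.chart i) hq.symm hq.pos
          (h.subset_source i (h.mem_active.1 i.2)) hy
      rw [hsum]
      refine (Finset.sum_nonneg fun (i : h.active x) _ => mul_nonneg (hη i).le
        (mul_nonneg (h.nonneg i x) (hpos i).le)).lt_of_ne fun h0 => ?_
      rw [eq_comm, Finset.sum_eq_zero_iff_of_nonneg fun (i : h.active x) _ => mul_nonneg (hη i).le
        (mul_nonneg (h.nonneg i x) (hpos i).le)] at h0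
      rw [Finset.sum_eq_zero fun i hi => ?_] at hone
      · exact zero_ne_one hone
      · have := h0 i hi
        simpa [(hη i).ne', (hpos i).ne'] using this
    have hm' : (0 : ℝ) < m := by exact_mod_cast hm
    have := mul_pos hm' hpd
    linarith
  · exact (coordMat_congr (q' := fun x => (1 + 1 * foldFunction ρ e η x) • q x)
      (h.foldMetric_eq_left ha hη (hk.symm_mem_left.2 hz))).trans rfl
  · exact (coordMat_congr (q' := fun x => (1 + (-1) * foldFunction ρ e η x) • q x)
      (h.foldMetric_eq_right ha hη (hk.symm_mem_right.2 hz))).trans rfl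

end SeamCutoff

end MakeJumpNegative

end Gluing

namespace Gluing

/-! ### First perturbation: making the jump strictly negative -/

section MakeJumpNegative

attribute [local instance] chartedSpaceSelf

variable {m : ℕ} {X : Type*} [TopologicalSpace X] [ChartedSpace (EuclideanSpace ℝ (Fin (m + 1))) X]
  {A B U : Set X} {ι : Type*} {e : ι → OpenPartialHomeomorph X (EuclideanSpace ℝ (Fin (m + 1)))}
  {ρ : ι → X → ℝ} {p x : X} {κ : ℝ} {P : ℝ → Prop} {q q' : FormField (𝓡 (m + 1)) X} {η : ι → ℝ}

theorem SeamAtlas.isClosed_seam (ha : SeamAtlas A B e) : IsClosed (A ∩ B) :=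
  ha.isClosed_left.inter ha.isClosed_right

theorem SeamAtlas.mem_right_of_notMem (ha : SeamAtlas A B e) (hx : x ∉ A) : x ∈ B :=
  ((Set.ext_iff.1 ha.union_eq x).2 trivial).resolve_left hx

theorem SeamAtlas.mem_left_of_notMem (ha : SeamAtlas A B e) (hx : x ∉ B) : x ∈ A :=
  ((Set.ext_iff.1 ha.union_eq x).2 trivial).resolve_right hx

/-- What the modified metric has to satisfy at `x`. -/
def AdmissibleAt (κ : ℝ) (P : ℝ → Prop) (A B : Set X)
    (e : ι → OpenPartialHomeomorph X (EuclideanSpace ℝ (Fin (m + 1))))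
    (q : FormField (𝓡 (m + 1)) X) (x : X) : Prop :=
  (x ∉ A ∩ B → GoodAt κ q x) ∧ (x ∈ A ∩ B → SeamAt κ P e q x)

theorem AdmissibleAt.congr (h : AdmissibleAt κ P A B e q x) (ha : SeamAtlas A B e)
    (hq : ∀ᶠ x in 𝓝 x, q x = q' x) : AdmissibleAt κ P A B e q' x :=
  ⟨fun hx => (h.1 hx).congr hq, fun hx => (h.2 hx).congr ha.chart hx hq⟩

namespace SeamCutoff

/-- Near `p` finitely many parameters matter, and each side undergoes a conformal perturbation of
its own; scalar curvature `> κ` is preserved up to the seam on both. The jump needs no smallness: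
any positive parameters make it strictly smaller. -/
theorem admissibleAt_foldMetric_of_seam (h : SeamCutoff A B U e ρ) (ha : SeamAtlas A B e)
    (hq : PiecewiseMetric κ P A B e q)
    (hjump : ∀ k y, y 0 = 0 → jumpTrace (lowerHalf m) (upperHalf m) (coordMat (e k) q) y ≤ 0)
    (hp : p ∈ A ∩ B) :
    ∀ᶠ z : X × (h.active p → ℝ) in 𝓝 p ×ˢ 𝓝 0, ∀ η : ι → ℝ, (∀ i, 0 < η i) →
      (fun i : h.active p => η i) = z.2 →
      AdmissibleAt κ (fun j => m = 0 ∨ j < 0) A B e (foldMetric ρ e q η) z.1 := by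
  obtain ⟨k, hpk, hL, hU, -⟩ := hq.seam p hp
  have hk := ha.chart k
  have h0 := (hk.mem_seam hpk).1 hp
  set w : h.active p → X → ℝ := fun i => cutCoord ρ e i with hw
  have hws : ∀ i, ContMDiff (𝓡 (m + 1)) 𝓘(ℝ, ℝ) ∞ (w i) := fun i => h.contMDiff_cutCoord ha i
  have hLt : lowerHalf m ⊆ (e k).target := by rw [hk.target_eq]; exact Set.subset_univ _
  have hUt : upperHalf m ⊆ (e k).target := by rw [hk.target_eq]; exact Set.subset_univ _
  have hsrc : ∀ᶠ x in 𝓝 p, x ∈ (e k).source := (e k).open_source.mem_nhds hpk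
  filter_upwards [eventually_lt_scalCoord_conformalScale hk.mem_maximalAtlas hq.symm hq.pos hws hLt
      uniqueDiffOn_lowerHalf (hq.smooth_lower k) hpk h0.le hL 1,
    eventually_lt_scalCoord_conformalScale hk.mem_maximalAtlas hq.symm hq.pos hws hUt
      uniqueDiffOn_upperHalf (hq.smooth_upper k) hpk h0.ge hU (-1),
    ((h.eventually_foldMetric_eq (q := q) ha p).eventually_nhds).prod_inl (𝓝 0),
    hsrc.prod_inl (𝓝 0)] with z hzL hzU hzq hzs η hη hηz
  have hmL := (hk.mem_left z.1 hzs)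
  have hmU := (hk.mem_right z.1 hzs)
  rw [← hηz] at hzL hzU
  refine ⟨fun hn => ?_, fun hn => ?_⟩
  · by_cases hA : z.1 ∈ A
    · have hB : z.1 ∉ B := fun hB => hn ⟨hA, hB⟩
      have hg : GoodAt κ (conformalScale q w 1 fun i => η i) z.1 :=
        goodAt_of_subset hk.mem_maximalAtlas hLt isOpen_lower (fun y (hy : y 0 < 0) => hy.le)
          (smoothMatrixOn_conformalScale hk.mem_maximalAtlas hws hLt (hq.smooth_lower k) _ _) hzs
          (not_le.1 fun hle => hB (hmU.2 hle)) (hzL (hmL.1 hA))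
      refine hg.congr ?_
      filter_upwards [hzq, ha.isClosed_right.isOpen_compl.mem_nhds hB] with x hx hxB
      exact ((hx η hη).1 (ha.mem_left_of_notMem hxB)).symm
    · have hB := ha.mem_right_of_notMem hA
      have hg : GoodAt κ (conformalScale q w (-1) fun i => η i) z.1 :=
        goodAt_of_subset hk.mem_maximalAtlas hUt isOpen_upper (fun y (hy : 0 < y 0) => hy.le)
          (smoothMatrixOn_conformalScale hk.mem_maximalAtlas hws hUt (hq.smooth_upper k) _ _) hzs
          (not_le.1 fun hle => hA (hmL.2 hle)) (hzU (hmU.1 hB))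
      refine hg.congr ?_
      filter_upwards [hzq, ha.isClosed_left.isOpen_compl.mem_nhds hA] with x hx hxA
      exact ((hx η hη).2 (ha.mem_right_of_notMem hxA)).symm
  · have hz0 := (hk.mem_seam hzs).1 hn
    have hlim : Filter.Tendsto (e k).symm (𝓝 (e k z.1)) (𝓝 z.1) := by
      have := hk.continuous_symm.tendsto (e k z.1)
      rwa [(e k).left_inv hzs] at this
    refine ⟨k, hzs, ?_, ?_, ?_⟩
    · rw [scalCoord_congr_of_eventually (G' := coordMat (e k) (conformalScale q w 1 fun i => η i))
        ?_ (hmL.1 hn.1)]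
      · exact hzL (hmL.1 hn.1)
      · filter_upwards [hlim.eventually hzq] with y hy hyL
        exact coordMat_congr ((hy η hη).1 (hk.symm_mem_left.2 hyL))
    · rw [scalCoord_congr_of_eventually (G' := coordMat (e k) (conformalScale q w (-1) fun i => η i))
        ?_ (hmU.1 hn.2)]
      · exact hzU (hmU.1 hn.2)
      · filter_upwards [hlim.eventually hzq] with y hy hyU
        exact coordMat_congr ((hy η hη).2 (hk.symm_mem_right.2 hyU))
    · rcases Nat.eq_zero_or_pos m with hm | hm
      · exact Or.inl hm
      · exact Or.inr ((h.jumpTrace_foldMetric_lt ha hq hη hz0 k hm).trans_le (hjump k _ hz0))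

theorem admissibleAt_foldMetric_of_notMem (h : SeamCutoff A B U e ρ) (ha : SeamAtlas A B e)
    (hq : PiecewiseMetric κ P A B e q) (hp : p ∉ A ∩ B) :
    ∀ᶠ z : X × (h.active p → ℝ) in 𝓝 p ×ˢ 𝓝 0, ∀ η : ι → ℝ, (∀ i, 0 < η i) →
      (fun i : h.active p => η i) = z.2 →
      AdmissibleAt κ (fun j => m = 0 ∨ j < 0) A B e (foldMetric ρ e q η) z.1 := by
  set w : h.active p → X → ℝ := fun i => cutCoord ρ e i with hw
  have hws : ∀ i, ContMDiff (𝓡 (m + 1)) 𝓘(ℝ, ℝ) ∞ (w i) := fun i => h.contMDiff_cutCoord ha i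
  have hSo : ∀ᶠ x in 𝓝 p, x ∉ A ∩ B := ha.isClosed_seam.isOpen_compl.mem_nhds hp
  by_cases hA : p ∈ A
  · have hB : p ∉ B := fun hB => hp ⟨hA, hB⟩
    have hBo : ∀ᶠ x in 𝓝 p, x ∉ B := ha.isClosed_right.isOpen_compl.mem_nhds hB
    filter_upwards [(hq.good p hp).eventually_conformalScale hq.symm hq.pos hws 1,
      ((h.eventually_foldMetric_eq (q := q) ha p).eventually_nhds).prod_inl (𝓝 0),
      hBo.eventually_nhds.prod_inl (𝓝 0), hSo.prod_inl (𝓝 0)] with z hz hzq hzB hzS η hη hηz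
    rw [← hηz] at hz
    refine ⟨fun _ => hz.congr ?_, fun hn => absurd hn hzS⟩
    filter_upwards [hzq, hzB] with x hx hxB
    exact ((hx η hη).1 (ha.mem_left_of_notMem hxB)).symm
  · have hAo : ∀ᶠ x in 𝓝 p, x ∉ A := ha.isClosed_left.isOpen_compl.mem_nhds hA
    filter_upwards [(hq.good p hp).eventually_conformalScale hq.symm hq.pos hws (-1),
      ((h.eventually_foldMetric_eq (q := q) ha p).eventually_nhds).prod_inl (𝓝 0),
      hAo.eventually_nhds.prod_inl (𝓝 0), hSo.prod_inl (𝓝 0)] with z hz hzq hzA hzS η hη hηz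
    rw [← hηz] at hz
    refine ⟨fun _ => hz.congr ?_, fun hn => absurd hn hzS⟩
    filter_upwards [hzq, hzA] with x hx hxA
    exact ((hx η hη).2 (ha.mem_right_of_notMem hxA)).symm

theorem eventually_abs_foldFunction_le (h : SeamCutoff A B U e ρ) (ha : SeamAtlas A B e) (p : X)
    {ε : ℝ} (hε : 0 < ε) :
    ∀ᶠ z : X × (h.active p → ℝ) in 𝓝 p ×ˢ 𝓝 0, ∀ η : ι → ℝ,
      (fun i : h.active p => η i) = z.2 → |foldFunction ρ e η z.1| ≤ ε := by
  have hlim : Filter.Tendsto (fun z : X × (h.active p → ℝ) => |∑ i, z.2 i * cutCoord ρ e i z.1|)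
      (𝓝 p ×ˢ 𝓝 0) (𝓝 0) := by
    have hc : Continuous fun z : X × (h.active p → ℝ) => |∑ i, z.2 i * cutCoord ρ e i z.1| := by
      have hw : ∀ i, Continuous (cutCoord ρ e i) := fun i => (h.contMDiff_cutCoord ha i).continuous
      fun_prop
    have := hc.tendsto (p, 0)
    rw [nhds_prod_eq] at this
    simpa using this
  filter_upwards [hlim.eventually (gt_mem_nhds hε),
    (h.eventually_foldFunction_eq (e := e) p).prod_inl (𝓝 0)] with z hz hzF η hη
  rw [hzF η]
  have : (∑ i : h.active p, η i * cutCoord ρ e i z.1) = ∑ i, z.2 i * cutCoord ρ e i z.1 := by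
    rw [← hη]
  rw [this]
  exact hz.le

end SeamCutoff

/-- Replaces a jump `≤ 0` by a jump `< 0` unless `m = 0`, so that the smoothing has a definite sign
to work with. The bound on `F` gives positivity of the new form and its distance from `q` at the
same time. -/
theorem PiecewiseMetric.exists_neg_jump [T2Space X] [SigmaCompactSpace X]
    [IsManifold (𝓡 (m + 1)) ∞ X] (hq : PiecewiseMetric κ P A B e q) (ha : SeamAtlas A B e)
    (hjump : ∀ k y, y 0 = 0 → jumpTrace (lowerHalf m) (upperHalf m) (coordMat (e k) q) y ≤ 0)
    (hU : IsOpen U) (hAB : A ∩ B ⊆ U) {ε : ℝ} (hε : 0 < ε) (hε1 : ε < 1) :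
    ∃ q' : FormField (𝓡 (m + 1)) X, PiecewiseMetric κ (fun j => m = 0 ∨ j < 0) A B e q' ∧
      (∀ x ∉ U, q' x = q x) ∧ ∀ x v, |q' x v v - q x v v| ≤ ε * q x v v := by
  have : LocallyCompactSpace X :=
    ChartedSpace.locallyCompactSpace (EuclideanSpace ℝ (Fin (m + 1))) X
  obtain ⟨ρ, h⟩ := ha.exists_cutoff hU hAB
  obtain ⟨η, hη, hQ⟩ := exists_scales h.isCompact (Q := fun η x =>
    AdmissibleAt κ (fun j => m = 0 ∨ j < 0) A B e (foldMetric ρ e q η) x ∧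
      |foldFunction ρ e η x| ≤ ε) (fun η η' x hηη hx => by
        have hF := h.foldFunction_congr (e := e) hηη
        refine ⟨hx.1.congr ha (hF.mono fun z hz => ?_), ?_⟩
        · simp only [foldMetric, hz]
        · rw [← hF.self_of_nhds]; exact hx.2) (fun p => by
    refine ⟨h.active p, ?_⟩
    have h1 : ∀ᶠ z : X × (h.active p → ℝ) in 𝓝 p ×ˢ 𝓝 0, ∀ η : ι → ℝ, (∀ i, 0 < η i) →
        (fun i : h.active p => η i) = z.2 →
        AdmissibleAt κ (fun j => m = 0 ∨ j < 0) A B e (foldMetric ρ e q η) z.1 := by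
      by_cases hp : p ∈ A ∩ B
      · exact h.admissibleAt_foldMetric_of_seam ha hq hjump hp
      · exact h.admissibleAt_foldMetric_of_notMem ha hq hp
    refine Filter.Eventually.filter_mono (Filter.prod_mono le_rfl nhdsWithin_le_nhds) ?_
    filter_upwards [h1, h.eventually_abs_foldFunction_le ha p hε] with z hz1 hz2 η hη hηz
    exact ⟨hz1 η hη hηz, hz2 η hηz⟩)
  have hlow : ∀ x, 0 < 1 - |foldFunction ρ e η x| := fun x => by linarith [(hQ x).2]
  have hF := fun i => contDiffOn_comp_chart_symm (ha.chart i).mem_maximalAtlas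
    (h.contMDiff_foldFunction ha η)
  have hsub : ∀ i (s : Set (EuclideanSpace ℝ (Fin (m + 1)))), s ⊆ (e i).target := fun i s => by
    rw [(ha.chart i).target_eq]; exact Set.subset_univ _
  refine ⟨foldMetric ρ e q η, ⟨fun x v w => ?_, fun x v hv => mul_pos (hlow x) (hq.pos x v hv),
    fun p hp => (hQ p).1.1 hp, fun i a b => ?_, fun i a b => ?_, fun p hp => (hQ p).1.2 hp⟩,
    fun x hx => ?_, fun x v => ?_⟩
  · exact congrArg ((1 - |foldFunction ρ e η x|) * ·) (hq.symm x v w)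
  · refine (((contDiffOn_const (c := (1 : ℝ))).add (((contDiffOn_const (c := (1 : ℝ))).mul
      ((hF i).mono (hsub i _))))).mul (hq.smooth_lower i a b)).congr fun z hz => ?_
    exact congrFun (congrFun (coordMat_congr (q' := fun x => (1 + 1 * foldFunction ρ e η x) • q x)
      (h.foldMetric_eq_left ha hη ((ha.chart i).symm_mem_left.2 hz))) a) b
  · refine (((contDiffOn_const (c := (1 : ℝ))).add (((contDiffOn_const (c := (-1 : ℝ))).mul
      ((hF i).mono (hsub i _))))).mul (hq.smooth_upper i a b)).congr fun z hz => ?_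
    exact congrFun (congrFun (coordMat_congr (q' := fun x => (1 + (-1) * foldFunction ρ e η x) • q x)
      (h.foldMetric_eq_right ha hη ((ha.chart i).symm_mem_right.2 hz))) a) b
  · have h0 : foldFunction ρ e η x = 0 := finsum_eq_zero_of_forall_eq_zero fun i => by
      rw [cutCoord_eq_zero fun hi => hx (h.subset i hi), mul_zero]
    rw [foldMetric, h0]; simp
  · have hqv : 0 ≤ q x v v := by
      by_cases hv : v = 0
      · simp [hv]
      · exact (hq.pos x v hv).le
    have : foldMetric ρ e q η x v v - q x v v = -(|foldFunction ρ e η x| * q x v v) := by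
      change (1 - |foldFunction ρ e η x|) * q x v v - q x v v = _
      ring
    rw [this, abs_neg, abs_of_nonneg (mul_nonneg (abs_nonneg _) hqv)]
    exact mul_le_mul_of_nonneg_right (hQ x).2 hqv

end MakeJumpNegative

end Gluing

namespace Gluing

/-! ### Forms with prescribed matrices, and comparison of forms -/

section MatrixForms

attribute [local instance] chartedSpaceSelf

variable {n : ℕ} {X : Type*} [TopologicalSpace X] [ChartedSpace (EuclideanSpace ℝ (Fin n)) X]
  {q q' : FormField (𝓡 n) X} {κ ε : ℝ} {x : X}
  {e : OpenPartialHomeomorph X (EuclideanSpace ℝ (Fin n))}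
  {M : EuclideanSpace ℝ (Fin n) → Matrix (Fin n) (Fin n) ℝ} {y : EuclideanSpace ℝ (Fin n)}

/-- The derivative of the chart `e` at `x`, as an endomorphism of `ℝⁿ`. -/
def chartDeriv (e : OpenPartialHomeomorph X (EuclideanSpace ℝ (Fin n))) (x : X) :
    EuclideanSpace ℝ (Fin n) →L[ℝ] EuclideanSpace ℝ (Fin n) :=
  mfderiv (𝓡 n) 𝓘(ℝ, EuclideanSpace ℝ (Fin n)) e x

/-- The derivative of the inverse of the chart `e` at `y`, as an endomorphism of `ℝⁿ`. -/
def chartSymmDeriv (e : OpenPartialHomeomorph X (EuclideanSpace ℝ (Fin n)))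
    (y : EuclideanSpace ℝ (Fin n)) : EuclideanSpace ℝ (Fin n) →L[ℝ] EuclideanSpace ℝ (Fin n) :=
  mfderivWithin 𝓘(ℝ, EuclideanSpace ℝ (Fin n)) (𝓡 n) e.symm Set.univ y

theorem chartSymmDeriv_chartDeriv (he : e ∈ IsManifold.maximalAtlas (𝓡 n) ∞ X) (hx : x ∈ e.source)
    (u : EuclideanSpace ℝ (Fin n)) : chartSymmDeriv e (e x) (chartDeriv e x u) = u := by
  rw [chartSymmDeriv, mfderivWithin_univ]
  exact DFunLike.congr_fun (mfderiv_symm_comp_chart he hx) u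

theorem chartDeriv_chartSymmDeriv (he : e ∈ IsManifold.maximalAtlas (𝓡 n) ∞ X) (hy : y ∈ e.target)
    (u : EuclideanSpace ℝ (Fin n)) : chartDeriv e (e.symm y) (chartSymmDeriv e y u) = u := by
  rw [chartSymmDeriv, mfderivWithin_univ]
  exact DFunLike.congr_fun (mfderiv_chart_comp_symm he hy) u

theorem apply_eq_sum_coordMat (he : e ∈ IsManifold.maximalAtlas (𝓡 n) ∞ X) (hx : x ∈ e.source)
    (q : FormField (𝓡 n) X) (u v : EuclideanSpace ℝ (Fin n)) :
    (q x : EuclideanSpace ℝ (Fin n) →L[ℝ] EuclideanSpace ℝ (Fin n) →L[ℝ] ℝ) u v =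
      ∑ i, ∑ j, chartDeriv e x u i * chartDeriv e x v j * coordMat e q (e x) i j := by
  have h : (∑ i, ∑ j, chartDeriv e x u i * chartDeriv e x v j * coordMat e q (e x) i j) =
      (q (e.symm (e x)) : EuclideanSpace ℝ (Fin n) →L[ℝ] EuclideanSpace ℝ (Fin n) →L[ℝ] ℝ)
        (chartSymmDeriv e (e x) (chartDeriv e x u)) (chartSymmDeriv e (e x) (chartDeriv e x v)) :=
    pullMat_apply_sum (q := q) (Φ := e.symm) (s := Set.univ) (y := e x)
      (chartDeriv e x u) (chartDeriv e x v)
  rw [h, chartSymmDeriv_chartDeriv he hx, chartSymmDeriv_chartDeriv he hx]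
  have h2 : ∀ (x' : X) (_ : x' = x) (v w : EuclideanSpace ℝ (Fin n)),
      (q x : EuclideanSpace ℝ (Fin n) →L[ℝ] EuclideanSpace ℝ (Fin n) →L[ℝ] ℝ) v w =
      (q x' : EuclideanSpace ℝ (Fin n) →L[ℝ] EuclideanSpace ℝ (Fin n) →L[ℝ] ℝ) v w := by
    rintro _ rfl v w; rfl
  exact h2 _ (e.left_inv hx) u v

theorem eq_of_coordMat_eq (he : e ∈ IsManifold.maximalAtlas (𝓡 n) ∞ X) (hx : x ∈ e.source)
    (h : coordMat e q (e x) = coordMat e q' (e x)) : q x = q' x := by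
  refine ContinuousLinearMap.ext fun v => ContinuousLinearMap.ext fun w => ?_
  have h1 := apply_eq_sum_coordMat he hx q v w
  rw [h] at h1
  exact h1.trans (apply_eq_sum_coordMat he hx q' v w).symm

/-- The field of bilinear forms with matrix `M` in the chart `e`. -/
def formOfMat (e : OpenPartialHomeomorph X (EuclideanSpace ℝ (Fin n)))
    (M : EuclideanSpace ℝ (Fin n) → Matrix (Fin n) (Fin n) ℝ) : FormField (𝓡 n) X := fun x =>
  (∑ i, ∑ j, M (e x) i j • coordForm i j : EuclideanSpace ℝ (Fin n) →L[ℝ]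
    EuclideanSpace ℝ (Fin n) →L[ℝ] ℝ).bilinearComp (chartDeriv e x) (chartDeriv e x)

theorem formOfMat_apply (u v : EuclideanSpace ℝ (Fin n)) :
    (formOfMat e M x : EuclideanSpace ℝ (Fin n) →L[ℝ] EuclideanSpace ℝ (Fin n) →L[ℝ] ℝ) u v =
      ∑ i, ∑ j, M (e x) i j * (chartDeriv e x u i * chartDeriv e x v j) := by
  have h : ∀ b : EuclideanSpace ℝ (Fin n) →L[ℝ] EuclideanSpace ℝ (Fin n) →L[ℝ] ℝ,
      b.bilinearComp (chartDeriv e x) (chartDeriv e x) u v = b (chartDeriv e x u) (chartDeriv e x v) :=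
    fun b => rfl
  refine (h _).trans ?_
  simp only [sum_apply, _root_.smul_apply, coordForm_apply, smul_eq_mul]

theorem formOfMat_symm (hM : ∀ y, (M y)ᵀ = M y) (x : X) (v w : TangentSpace (𝓡 n) x) :
    formOfMat e M x v w = formOfMat e M x w v := by
  refine (formOfMat_apply v w).trans (Eq.trans ?_ (formOfMat_apply w v).symm)
  rw [Finset.sum_comm]
  refine Finset.sum_congr rfl fun i _ => Finset.sum_congr rfl fun j _ => ?_
  rw [← hM (e x), Matrix.transpose_apply, hM, mul_comm (chartDeriv e x v j)]

theorem coordMat_formOfMat (he : e ∈ IsManifold.maximalAtlas (𝓡 n) ∞ X) (hy : y ∈ e.target) :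
    coordMat e (formOfMat e M) y = M y := by
  ext i j
  refine (formOfMat_apply (e := e) (M := M) (x := e.symm y)
    (chartSymmDeriv e y (EuclideanSpace.single i 1))
    (chartSymmDeriv e y (EuclideanSpace.single j 1))).trans ?_
  rw [e.right_inv hy, chartDeriv_chartSymmDeriv he hy, chartDeriv_chartSymmDeriv he hy]
  simp

/-- On the unit sphere the inequality is strict at `(M₀, M₀)`, hence by compactness near it,
uniformly in the vector; both sides are homogeneous of degree two. -/
theorem Matrix.PosDef.eventually_abs_sub_le {M₀ : Matrix (Fin n) (Fin n) ℝ} (h : M₀.PosDef)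
    (hε : 0 < ε) :
    ∀ᶠ MN : Matrix (Fin n) (Fin n) ℝ × Matrix (Fin n) (Fin n) ℝ in 𝓝 (M₀, M₀),
      ∀ a : EuclideanSpace ℝ (Fin n),
        |∑ i, ∑ j, a i * a j * MN.1 i j - ∑ i, ∑ j, a i * a j * MN.2 i j| ≤
          ε * ∑ i, ∑ j, a i * a j * MN.2 i j := by
  have hc : Continuous fun z : (Matrix (Fin n) (Fin n) ℝ × Matrix (Fin n) (Fin n) ℝ) ×
      EuclideanSpace ℝ (Fin n) => ε * ∑ i, ∑ j, z.2 i * z.2 j * z.1.2 i j -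
        |∑ i, ∑ j, z.2 i * z.2 j * z.1.1 i j - ∑ i, ∑ j, z.2 i * z.2 j * z.1.2 i j| := by
    have h1 : ∀ i j, Continuous fun z : (Matrix (Fin n) (Fin n) ℝ × Matrix (Fin n) (Fin n) ℝ) ×
        EuclideanSpace ℝ (Fin n) => z.1.1 i j := fun i j =>
      (continuous_fst.fst).matrix_elem i j
    have h2 : ∀ i j, Continuous fun z : (Matrix (Fin n) (Fin n) ℝ × Matrix (Fin n) (Fin n) ℝ) ×
        EuclideanSpace ℝ (Fin n) => z.1.2 i j := fun i j =>
      (continuous_fst.snd).matrix_elem i j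
    fun_prop
  have hev : ∀ᶠ MN : Matrix (Fin n) (Fin n) ℝ × Matrix (Fin n) (Fin n) ℝ in 𝓝 (M₀, M₀),
      ∀ a ∈ Metric.sphere (0 : EuclideanSpace ℝ (Fin n)) 1,
        0 < ε * ∑ i, ∑ j, a i * a j * MN.2 i j -
          |∑ i, ∑ j, a i * a j * MN.1 i j - ∑ i, ∑ j, a i * a j * MN.2 i j| := by
    refine (isCompact_sphere _ _).eventually_forall_of_forall_eventually fun a ha => ?_
    refine hc.continuousAt.eventually (lt_mem_nhds ?_)
    simp only [sub_self, abs_zero, sub_zero]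
    refine mul_pos hε ?_
    have ha0 : (fun i => a i) ≠ 0 := by
      intro h0
      have : a = 0 := by ext i; exact congrFun h0 i
      simp [this] at ha
    have := h.dotProduct_mulVec_pos ha0
    refine this.trans_le (le_of_eq ?_)
    simp only [dotProduct, Matrix.mulVec, Finset.mul_sum, star_trivial]
    refine Finset.sum_congr rfl fun a _ => Finset.sum_congr rfl fun b _ => by ring
  refine hev.mono fun MN hMN a => ?_
  by_cases ha : a = 0
  · simp [ha]
  have hn : 0 < ‖a‖ := norm_pos_iff.2 ha
  have h1 := hMN (‖a‖⁻¹ • a) (by simp [norm_smul, hn.ne'])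
  have hs : ∀ N : Matrix (Fin n) (Fin n) ℝ, ∑ i, ∑ j, (‖a‖⁻¹ • a) i * (‖a‖⁻¹ • a) j * N i j =
      (‖a‖⁻¹ * ‖a‖⁻¹) * ∑ i, ∑ j, a i * a j * N i j := fun N => by
    simp only [Finset.mul_sum, PiLp.smul_apply, smul_eq_mul]
    refine Finset.sum_congr rfl fun i _ => Finset.sum_congr rfl fun j _ => by ring
  have hp : 0 < ‖a‖⁻¹ * ‖a‖⁻¹ := by positivity
  rw [hs, hs, ← mul_sub, abs_mul, abs_of_pos hp, mul_left_comm, ← mul_sub] at h1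
  linarith [(mul_pos_iff_of_pos_left hp).1 h1]

/-- The perturbation lemma for an empty set of parameters. -/
theorem GoodAt.eventually {p : X} (h : GoodAt κ q p) (hsymm : ∀ x v w, q x v w = q x w v)
    (hpos : ∀ x v, v ≠ 0 → 0 < q x v v) : ∀ᶠ x in 𝓝 p, GoodAt κ q x := by
  have h1 := (h.eventually_conformalScale hsymm hpos (w := fun i : Fin 0 => i.elim0)
    (fun i => i.elim0) 0)
  refine h1.curry.mono fun x hx => ?_
  have h2 := hx.self_of_nhds
  have h3 : conformalScale q (fun i : Fin 0 => (i.elim0 : X → ℝ)) 0 0 = q := by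
    funext x
    simp [conformalScale]
  rwa [h3] at h2

end MatrixForms

end Gluing

namespace Gluing

/-! ### Smoothing the edge in one chart -/

section SmoothEdge

variable {m : ℕ} {y : EuclideanSpace ℝ (Fin (m + 1))} {φ θ ψ : ℝ → ℝ} {δ : ℝ}
  {G : EuclideanSpace ℝ (Fin (m + 1)) → Matrix (Fin (m + 1)) (Fin (m + 1)) ℝ}

/-- The point `y`, with its coordinate `y 0` replaced by `a`. -/
def withHeight (y : EuclideanSpace ℝ (Fin (m + 1))) (a : ℝ) : EuclideanSpace ℝ (Fin (m + 1)) :=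
  y + (a - y 0) • EuclideanSpace.single 0 1

theorem withHeight_zero (a : ℝ) : withHeight y a 0 = a := by
  simp [withHeight]

theorem withHeight_self : withHeight y (y 0) = y := by
  simp [withHeight]

theorem withHeight_mem_upperHalf {a : ℝ} : withHeight y a ∈ upperHalf m ↔ 0 ≤ a := by
  rw [upperHalf, Set.mem_ofPred_eq, withHeight_zero]

theorem withHeight_mem_lowerHalf {a : ℝ} : withHeight y a ∈ lowerHalf m ↔ a ≤ 0 := by
  rw [lowerHalf, Set.mem_ofPred_eq, withHeight_zero]

theorem contDiff_withHeight :
    ContDiff ℝ ∞ fun z : EuclideanSpace ℝ (Fin (m + 1)) × ℝ => withHeight z.1 z.2 := by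
  have : ContDiff ℝ ∞ fun z : EuclideanSpace ℝ (Fin (m + 1)) × ℝ => z.1 0 :=
    (EuclideanSpace.proj (𝕜 := ℝ) (0 : Fin (m + 1))).contDiff.comp contDiff_fst
  exact contDiff_fst.add ((contDiff_snd.sub this).smul contDiff_const)

/-- The value at `y` of the metric that depends on `a` as `G` does on the upper side, and on `b` as
`G` does on the lower side. -/
def edgeMat (G : EuclideanSpace ℝ (Fin (m + 1)) → Matrix (Fin (m + 1)) (Fin (m + 1)) ℝ) (a b : ℝ)
    (y : EuclideanSpace ℝ (Fin (m + 1))) : Matrix (Fin (m + 1)) (Fin (m + 1)) ℝ :=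
  G (withHeight y a) + G (withHeight y b) - G (withHeight y 0)

theorem edgeMat_upper : edgeMat G (y 0) 0 y = G y := by
  rw [edgeMat, add_sub_cancel_right, withHeight_self]

theorem edgeMat_lower : edgeMat G 0 (y 0) y = G y := by
  rw [edgeMat, add_sub_cancel_left, withHeight_self]

theorem edgeMat_transpose (hG : ∀ y, (G y)ᵀ = G y) (a b : ℝ) : (edgeMat G a b y)ᵀ = edgeMat G a b y := by
  simp only [edgeMat, Matrix.transpose_sub, Matrix.transpose_add, hG]

/-- The metric `G`, with its edge along `{y₀ = 0}` smoothed on the scale `δ`. -/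
def smoothEdge (φ : ℝ → ℝ) (δ : ℝ)
    (G : EuclideanSpace ℝ (Fin (m + 1)) → Matrix (Fin (m + 1)) (Fin (m + 1)) ℝ)
    (y : EuclideanSpace ℝ (Fin (m + 1))) : Matrix (Fin (m + 1)) (Fin (m + 1)) ℝ :=
  edgeMat G (δ * φ (y 0 / δ)) (y 0 - δ * φ (y 0 / δ)) y

/-- Outside the layer the ramp is exactly `0` or the identity, so one of the heights is `0` and the
other is `y 0`. -/
theorem smoothEdge_eq (hφ : SmoothRamp φ θ ψ) (hδ : 0 < δ) (hy : δ ≤ |y 0|) :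
    smoothEdge φ δ G y = G y := by
  rcases le_abs'.1 hy with h | h
  · have h1 : φ (y 0 / δ) = 0 := hφ.eq_zero _ (by rw [div_le_iff₀ hδ]; linarith)
    rw [smoothEdge, h1, mul_zero, sub_zero, edgeMat_lower]
  · have h1 : φ (y 0 / δ) = y 0 / δ := hφ.eq_self _ (by rw [le_div_iff₀ hδ]; linarith)
    rw [smoothEdge, h1, mul_div_cancel₀ _ hδ.ne', sub_self, edgeMat_upper]

end SmoothEdge

/-! ### Averaging the smoothings of several charts -/

section SmoothAtSeam

attribute [local instance] chartedSpaceSelf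

variable {m : ℕ} {X : Type*} [TopologicalSpace X] [ChartedSpace (EuclideanSpace ℝ (Fin (m + 1))) X]
  {A B U : Set X} {ι : Type*} {e : ι → OpenPartialHomeomorph X (EuclideanSpace ℝ (Fin (m + 1)))}
  {ρ : ι → X → ℝ} {p x : X} {κ : ℝ} {P : ℝ → Prop} {q : FormField (𝓡 (m + 1)) X} {η : ι → ℝ}
  {φ θ ψ : ℝ → ℝ}

theorem smul_form_eq_zero {c : ℝ} (hc : c = 0) (b : EuclideanSpace ℝ (Fin (m + 1)) →L[ℝ]
    EuclideanSpace ℝ (Fin (m + 1)) →L[ℝ] ℝ) : c • b = 0 := by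
  refine ContinuousLinearMap.ext fun u => ContinuousLinearMap.ext fun v => ?_
  exact (congrArg (· * b u v) hc).trans (zero_mul _)

theorem smul_form_sub_eq_zero (c : ℝ) {b b' : EuclideanSpace ℝ (Fin (m + 1)) →L[ℝ]
    EuclideanSpace ℝ (Fin (m + 1)) →L[ℝ] ℝ} (h : b = b') : c • (b - b') = 0 := by
  refine ContinuousLinearMap.ext fun u => ContinuousLinearMap.ext fun v => ?_
  subst h
  exact (congrArg (c * ·) (sub_self (b u v))).trans (mul_zero c)

/-- The metric `q`, smoothed in the charts `e i` on the scales `η i`. -/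
def seamSmoothing (ρ : ι → X → ℝ)
    (e : ι → OpenPartialHomeomorph X (EuclideanSpace ℝ (Fin (m + 1))))
    (q : FormField (𝓡 (m + 1)) X) (φ : ℝ → ℝ) (η : ι → ℝ) : FormField (𝓡 (m + 1)) X := fun x =>
  q x + ∑ᶠ i, ρ i x • (formOfMat (e i) (smoothEdge φ (η i) (coordMat (e i) q)) x - q x)

theorem SeamCutoff.eventually_seamSmoothing_eq (h : SeamCutoff A B U e ρ) (p : X) :
    ∀ᶠ x in 𝓝 p, ∀ η : ι → ℝ, seamSmoothing ρ e q φ η x = q x + ∑ i : h.active p,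
      ρ i x • (formOfMat (e i) (smoothEdge φ (η i) (coordMat (e i) q)) x - q x) := by
  filter_upwards [h.eventually_active p] with x hx η
  rw [seamSmoothing]
  congr 1
  rw [finsum_eq_sum_of_support_subset _ (s := h.active p), ← Finset.sum_coe_sort]
  intro i hi
  by_contra hn
  exact hi (smul_form_eq_zero (image_eq_zero_of_notMem_tsupport (hx i hn)) _)

theorem SeamCutoff.seamSmoothing_congr (h : SeamCutoff A B U e ρ) {η' : ι → ℝ}
    (hη : ∀ i, p ∈ tsupport (ρ i) → η i = η' i) :
    ∀ᶠ x in 𝓝 p, seamSmoothing ρ e q φ η x = seamSmoothing ρ e q φ η' x := by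
  filter_upwards [h.eventually_seamSmoothing_eq (q := q) (φ := φ) p] with x hx
  rw [hx, hx]
  congr 1
  exact Finset.sum_congr rfl fun i _ => by rw [hη i (h.mem_active.1 i.2)]

/-- The interpolating metrics in the chart `e`, for the smoothing in the chart `e'`. -/
def transitionEdge (e e' : OpenPartialHomeomorph X (EuclideanSpace ℝ (Fin (m + 1))))
    (q : FormField (𝓡 (m + 1)) X) (z : EuclideanSpace ℝ (Fin (m + 1)) × ℝ × ℝ) :
    Matrix (Fin (m + 1)) (Fin (m + 1)) ℝ :=
  (jacobian (e.symm ⁻¹' e'.source) (e' ∘ e.symm) z.1)ᵀ *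
    edgeMat (coordMat e' q) z.2.1 z.2.2 (e' (e.symm z.1)) *
    jacobian (e.symm ⁻¹' e'.source) (e' ∘ e.symm) z.1

/-- On `rampDomain` the heights satisfy `a ≥ 0` and `b ≤ 0`, so the matrix is evaluated only on
sides where it is smooth up to the boundary. This holds for all points `z.1`, on either side of the
seam. -/
theorem contDiffOn_transitionEdge {e e' : OpenPartialHomeomorph X (EuclideanSpace ℝ (Fin (m + 1)))}
    (he : IsSeamChart A B e) (he' : IsSeamChart A B e')
    (hL : SmoothMatrixOn (lowerHalf m) (coordMat e' q))
    (hU : SmoothMatrixOn (upperHalf m) (coordMat e' q)) {O : Set (EuclideanSpace ℝ (Fin (m + 1)))}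
    (hO : O ⊆ e.symm ⁻¹' e'.source) (a b : Fin (m + 1)) :
    ContDiffOn ℝ ∞ (fun z => transitionEdge e e' q z a b) (rampDomain O) := by
  have hfst : Set.MapsTo (Prod.fst : EuclideanSpace ℝ (Fin (m + 1)) × ℝ × ℝ → _) (rampDomain O)
      (e.symm ⁻¹' e'.source) := fun z hz => hO hz.1
  have hT : ContDiffOn ℝ ∞ (fun z : EuclideanSpace ℝ (Fin (m + 1)) × ℝ × ℝ => e' (e.symm z.1))
      (rampDomain O) := (he.contDiffOn_transition he').comp contDiffOn_fst hfst
  have hJ : ∀ i j, ContDiffOn ℝ ∞ (fun z : EuclideanSpace ℝ (Fin (m + 1)) × ℝ × ℝ =>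
      jacobian (e.symm ⁻¹' e'.source) (e' ∘ e.symm) z.1 i j) (rampDomain O) := fun i j =>
    (smoothMatrixOn_jacobian he.isOpen_overlap.uniqueDiffOn (he.contDiffOn_transition he') i j).comp
      contDiffOn_fst hfst
  have hW : ∀ {f : EuclideanSpace ℝ (Fin (m + 1)) × ℝ × ℝ → ℝ}, ContDiff ℝ ∞ f →
      ContDiffOn ℝ ∞ (fun z => withHeight (e' (e.symm z.1)) (f z)) (rampDomain O) := fun hf =>
    contDiff_withHeight.comp_contDiffOn (hT.prodMk hf.contDiffOn)
  have hE : ∀ i j, ContDiffOn ℝ ∞ (fun z : EuclideanSpace ℝ (Fin (m + 1)) × ℝ × ℝ =>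
      edgeMat (coordMat e' q) z.2.1 z.2.2 (e' (e.symm z.1)) i j) (rampDomain O) := fun i j => by
    refine ((((hU i j).comp (hW (contDiff_fst.comp contDiff_snd)) ?_)).add
      ((hL i j).comp (hW (contDiff_snd.comp contDiff_snd)) ?_)).sub
      ((hL i j).comp (hW contDiff_const) ?_)
    · exact fun z hz => withHeight_mem_upperHalf.2 hz.2.1
    · exact fun z hz => withHeight_mem_lowerHalf.2 hz.2.2
    · exact fun z hz => withHeight_mem_lowerHalf.2 le_rfl
  simp only [transitionEdge, Matrix.mul_apply, Matrix.transpose_apply]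
  exact ContDiffOn.sum fun i _ => (ContDiffOn.sum fun j _ => (hJ _ _).mul (hE _ _)).mul (hJ _ _)

/-- Everything is seen in the single chart `e k`: the smoothing in `e i` is transported by the
Jacobian of the transition, and `t i` is the transverse coordinate of `e i`. Agreement with the
metric on both sides is the transformation law of its matrix. -/
theorem SeamCutoff.rampedMetric (h : SeamCutoff A B U e ρ) (ha : SeamAtlas A B e)
    (hq : PiecewiseMetric κ P A B e q) {k : ι} (hk : p ∈ (e k).source) (hp : p ∈ A ∩ B) {N : Set X}
    (hN : IsOpen N) (hpN : p ∈ N) (hNe : ∀ x ∈ N, ∀ i : h.active p, x ∈ (e i).source)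
    (hN1 : ∀ x ∈ N, ∑ i : h.active p, ρ i x = 1) :
    RampedMetric ((e k).symm ⁻¹' N) (e k p) (coordMat (e k) q)
      (fun (i : h.active p) y => e i ((e k).symm y) 0) (fun i y => ρ i ((e k).symm y))
      (fun i => transitionEdge (e k) (e i) q) := by
  have hc := ha.chart k
  have hd : (coordMat (e k) q (e k p)).PosDef :=
    coordMat_posDef hc.mem_maximalAtlas (hc.mem_target _) hq.symm hq.pos
  have h0 : e k p 0 = 0 := (hc.mem_seam hk).1 hp
  have hO : ∀ i : h.active p, (e k).symm ⁻¹' N ⊆ (e k).symm ⁻¹' (e i).source :=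
    fun i y hy => hNe _ hy i
  have hpp : (e k).symm (e k p) ∈ N := by rwa [(e k).left_inv hk]
  exact {
    isOpen := hN.preimage hc.continuous_symm
    mem := hpp
    coord_zero := h0
    contDiffOn_t := fun i => (hc.contDiffOn_transition_zero (ha.chart i)).mono (hO i)
    contDiffOn_r := fun i => (contDiffOn_comp_chart_symm hc.mem_maximalAtlas
      (h.contMDiff i)).mono (by rw [hc.target_eq]; exact Set.subset_univ _)
    contDiffOn_B := fun i => contDiffOn_transitionEdge hc (ha.chart i) (hq.smooth_lower i)
      (hq.smooth_upper i) (hO i)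
    t_pos := fun i y hy => hc.transition_pos (ha.chart i) (hO i hy)
    t_neg := fun i y hy => hc.transition_neg (ha.chart i) (hO i hy)
    t_deriv := fun i => hc.transition_deriv_pos (ha.chart i) hq.symm hq.pos (hO i hpp) h0
    r_nonneg := fun i y _ => h.nonneg i _
    r_sum := fun y hy => hN1 _ hy
    upper := fun i y hy _ => by
      simp only [transitionEdge]
      rw [edgeMat_upper, hc.coordMat_eq (ha.chart i) (hO i hy)]
    lower := fun i y hy _ => by
      simp only [transitionEdge]
      rw [edgeMat_lower, hc.coordMat_eq (ha.chart i) (hO i hy)]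
    symm := fun y _ => coordMat_symm hq.symm
    det_ne := hd.det_pos.ne'
    inv_pos := hd.inv.diag_pos }

theorem coordMat_add_sum {σ : Type*} [Fintype σ]
    {e : OpenPartialHomeomorph X (EuclideanSpace ℝ (Fin (m + 1)))} (c : σ → X → ℝ)
    (f : σ → FormField (𝓡 (m + 1)) X) (y : EuclideanSpace ℝ (Fin (m + 1))) :
    coordMat e (fun x => q x + ∑ i, c i x • (f i x - q x)) y =
      coordMat e q y + ∑ i, c i (e.symm y) • (coordMat e (f i) y - coordMat e q y) := by
  ext a b
  rw [Matrix.add_apply, Matrix.sum_apply]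
  have key : ∀ (b₀ : EuclideanSpace ℝ (Fin (m + 1)) →L[ℝ] EuclideanSpace ℝ (Fin (m + 1)) →L[ℝ] ℝ)
      (f₀ : σ → EuclideanSpace ℝ (Fin (m + 1)) →L[ℝ] EuclideanSpace ℝ (Fin (m + 1)) →L[ℝ] ℝ)
      (c₀ : σ → ℝ) (u v : EuclideanSpace ℝ (Fin (m + 1))),
      (b₀ + ∑ i, c₀ i • (f₀ i - b₀)) u v = b₀ u v + ∑ i, c₀ i * (f₀ i u v - b₀ u v) := by
    intro b₀ f₀ c₀ u v
    simp only [add_apply, sum_apply, _root_.smul_apply, sub_apply, smul_eq_mul]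
  exact key _ _ _ _ _

/-- Where the cut-offs sum to `1`, the corrections `ρ i • (f i - q)` added to `q` give the average
of the `f i`, and `q`, which is not smooth there, disappears. -/
theorem SeamCutoff.coordMat_seamSmoothing (h : SeamCutoff A B U e ρ) (ha : SeamAtlas A B e) {k : ι}
    {y : EuclideanSpace ℝ (Fin (m + 1))}
    (hN : seamSmoothing ρ e q φ η ((e k).symm y) = q ((e k).symm y) + ∑ i : h.active p,
      ρ i ((e k).symm y) • (formOfMat (e i) (smoothEdge φ (η i) (coordMat (e i) q)) ((e k).symm y)
        - q ((e k).symm y)))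
    (hNe : ∀ i : h.active p, (e k).symm y ∈ (e i).source)
    (hN1 : ∑ i : h.active p, ρ i ((e k).symm y) = 1) :
    coordMat (e k) (seamSmoothing ρ e q φ η) y =
      RampedMetric.smoothedMetric (fun (i : h.active p) y => e i ((e k).symm y) 0)
        (fun i y => ρ i ((e k).symm y)) (fun i => transitionEdge (e k) (e i) q) φ (fun i => η i) y := by
  have h1 := coordMat_add_sum (e := e k) (q := q) (fun i : h.active p => ρ i)
    (fun i => formOfMat (e i) (smoothEdge φ (η i) (coordMat (e i) q))) y
  refine (coordMat_congr (q' := fun x => q x + ∑ i : h.active p, ρ i x •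
    (formOfMat (e i) (smoothEdge φ (η i) (coordMat (e i) q)) x - q x)) hN).trans (h1.trans ?_)
  simp only [smul_sub, Finset.sum_sub_distrib, ← Finset.sum_smul, hN1, one_smul]
  rw [add_sub_cancel, RampedMetric.smoothedMetric]
  refine Finset.sum_congr rfl fun i _ => ?_
  congr 1
  rw [(ha.chart k).coordMat_eq (ha.chart i) (hNe i), coordMat_formOfMat (ha.chart i).mem_maximalAtlas
    ((ha.chart i).mem_target _)]
  rfl

end SmoothAtSeam

end Gluing

namespace Gluing

/-! ### Second perturbation: smoothing the folded metric -/

section SmoothAtSeam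

attribute [local instance] chartedSpaceSelf

variable {m : ℕ} {X : Type*} [TopologicalSpace X] [ChartedSpace (EuclideanSpace ℝ (Fin (m + 1))) X]
  {A B U : Set X} {ι : Type*} {e : ι → OpenPartialHomeomorph X (EuclideanSpace ℝ (Fin (m + 1)))}
  {ρ : ι → X → ℝ} {p x : X} {κ ε : ℝ} {P : ℝ → Prop} {q q' : FormField (𝓡 (m + 1)) X} {η : ι → ℝ}
  {φ θ ψ : ℝ → ℝ}

/-- The smoothed metric is good, and close to `q`, at `x`. -/
def ApproximatesAt (κ ε : ℝ) (q q' : FormField (𝓡 (m + 1)) X) (x : X) : Prop :=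
  GoodAt κ q' x ∧ ∀ v, |q' x v v - q x v v| ≤ ε * q x v v

theorem PiecewiseMetric.nonneg (hq : PiecewiseMetric κ P A B e q) (x : X)
    (v : TangentSpace (𝓡 (m + 1)) x) : 0 ≤ q x v v := by
  by_cases hv : v = 0
  · simp [hv]
  · exact (hq.pos x v hv).le

theorem PiecewiseMetric.continuousAt_coordMat (hq : PiecewiseMetric κ P A B e q) (k : ι)
    {y : EuclideanSpace ℝ (Fin (m + 1))} (hy : y 0 = 0) :
    ContinuousAt (coordMat (e k) q) y := by
  have hu : lowerHalf m ∪ upperHalf m = Set.univ :=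
    Set.eq_univ_of_forall fun z => le_total (z 0) 0
  rw [← continuousWithinAt_univ, ← hu]
  refine ContinuousWithinAt.union ?_ ?_
  · exact tendsto_pi_nhds.2 fun i => tendsto_pi_nhds.2 fun j =>
      (hq.smooth_lower k i j).continuousOn y hy.le
  · exact tendsto_pi_nhds.2 fun i => tendsto_pi_nhds.2 fun j =>
      (hq.smooth_upper k i j).continuousOn y hy.ge

namespace SeamCutoff

/-- The local analysis of `RampedMetric` read on `X`. The comparison with `q` uses that both the
smoothed matrix and the matrix of `q` tend to the matrix of `q` at `p`. -/
theorem approximatesAt_of_seam (h : SeamCutoff A B U e ρ) (ha : SeamAtlas A B e)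
    (hq : PiecewiseMetric κ (fun j => m = 0 ∨ j < 0) A B e q) (hφ : SmoothRamp φ θ ψ) (hε : 0 < ε)
    (hp : p ∈ A ∩ B) :
    ∀ᶠ z : X × (h.active p → ℝ) in 𝓝 p ×ˢ 𝓝[{η | ∀ i, 0 < η i}] 0, ∀ η : ι → ℝ, (∀ i, 0 < η i) →
      (fun i : h.active p => η i) = z.2 → ApproximatesAt κ ε q (seamSmoothing ρ e q φ η) z.1 := by
  obtain ⟨k, hpk, hL, hU, hj⟩ := hq.seam p hp
  have hk := ha.chart k
  have h0 := (hk.mem_seam hpk).1 hp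
  have hsrc : ∀ᶠ x in 𝓝 p, ∀ i : h.active p, x ∈ (e i).source := Filter.eventually_all.2 fun i =>
    (e i).open_source.mem_nhds (h.subset_source i (h.mem_active.1 i.2))
  have hone : ∀ᶠ x in 𝓝 p, ∑ i : h.active p, ρ i x = 1 := by
    filter_upwards [h.sum_eq_one p hp, h.eventually_finsum (F := ℝ) p] with x h1 h2
    rw [← h1, h2 (fun i => ρ i x) fun i hi => image_eq_zero_of_notMem_tsupport hi]
  obtain ⟨N, hN, hNo, hpN⟩ := eventually_nhds_iff.1
    ((hsrc.and hone).and (h.eventually_seamSmoothing_eq (e := e) (q := q) (φ := φ) p))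
  have hR := h.rampedMetric ha hq hpk hp hNo hpN (fun x hx => (hN x hx).1.1)
    (fun x hx => (hN x hx).1.2)
  have hO : IsOpen ((e k).symm ⁻¹' N) := hNo.preimage hk.continuous_symm
  have hmat : ∀ η : ι → ℝ, Set.EqOn (coordMat (e k) (seamSmoothing ρ e q φ η))
      (RampedMetric.smoothedMetric (fun (i : h.active p) y => e i ((e k).symm y) 0)
        (fun i y => ρ i ((e k).symm y)) (fun i => transitionEdge (e k) (e i) q) φ (fun i => η i))
      ((e k).symm ⁻¹' N) := fun η y hy =>
    h.coordMat_seamSmoothing ha ((hN _ hy).2 η) (hN _ hy).1.1 (hN _ hy).1.2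
  have hlim : Filter.Tendsto (fun z : X × (h.active p → ℝ) => (e k z.1, z.2))
      (𝓝 p ×ˢ 𝓝[{η | ∀ i, 0 < η i}] 0) (RampedMetric.smallScales (h.active p) (e k p)) :=
    Filter.Tendsto.prodMap ((e k).continuousAt hpk) Filter.tendsto_id
  have hclose : ∀ᶠ z in RampedMetric.smallScales (h.active p) (e k p),
      ∀ a : EuclideanSpace ℝ (Fin (m + 1)), |∑ i, ∑ j, a i * a j * RampedMetric.smoothedMetric
        (fun (i : h.active p) y => e i ((e k).symm y) 0) (fun i y => ρ i ((e k).symm y))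
        (fun i => transitionEdge (e k) (e i) q) φ z.2 z.1 i j -
          ∑ i, ∑ j, a i * a j * coordMat (e k) q z.1 i j| ≤
        ε * ∑ i, ∑ j, a i * a j * coordMat (e k) q z.1 i j :=
    ((hR.tendsto_smoothedMetric hφ).prodMk_nhds ((hq.continuousAt_coordMat k h0).tendsto.comp
      (RampedMetric.tendsto_fst_smallScales le_rfl))).eventually
      (Matrix.PosDef.eventually_abs_sub_le
        (coordMat_posDef hk.mem_maximalAtlas (hk.mem_target _) hq.symm hq.pos) hε)
  have hks : ∀ᶠ x in 𝓝 p, x ∈ (e k).source ∧ x ∈ N :=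
    Filter.Eventually.and ((e k).open_source.mem_nhds hpk) (hNo.mem_nhds hpN)
  filter_upwards [hlim.eventually (hR.eventually_lt_scalCoord hφ hL hU hj), hlim.eventually hclose,
    hks.prod_inl _] with z hz1 hz2 hz3 η hη hηz
  rw [← hηz] at hz1 hz2
  have hzO : e k z.1 ∈ (e k).symm ⁻¹' N := by
    rw [Set.mem_preimage, (e k).left_inv hz3.1]; exact hz3.2
  refine ⟨⟨e k, hk.mem_maximalAtlas, hz3.1, (e k).symm ⁻¹' N, hO, hzO,
    by rw [hk.target_eq]; exact Set.subset_univ _,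
    (hR.smoothMatrixOn_smoothedMetric hφ fun i => hη i).congr (hmat η), ?_⟩, fun v => ?_⟩
  · rw [scalCoord_congr (hmat η) hzO]
    exact hz1
  · have h1 := apply_eq_sum_coordMat hk.mem_maximalAtlas hz3.1 (seamSmoothing ρ e q φ η) v v
    have h2 := apply_eq_sum_coordMat hk.mem_maximalAtlas hz3.1 q v v
    rw [hmat η hzO] at h1
    have h3 := hz2 (chartDeriv (e k) z.1 v)
    rw [← h1, ← h2] at h3
    exact h3

/-- Away from the seam the transverse coordinates of the finitely many active charts are bounded
below, so for small scales the smoothing changes nothing near `p`. This includes points arbitrarily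
close to the seam, but how small the scales must be depends on `p`. -/
theorem approximatesAt_of_notMem (h : SeamCutoff A B U e ρ) (ha : SeamAtlas A B e)
    (hq : PiecewiseMetric κ P A B e q) (hφ : SmoothRamp φ θ ψ) (hε : 0 < ε)
    (hp : p ∉ A ∩ B) :
    ∀ᶠ z : X × (h.active p → ℝ) in 𝓝 p ×ˢ 𝓝[{η | ∀ i, 0 < η i}] 0, ∀ η : ι → ℝ, (∀ i, 0 < η i) →
      (fun i : h.active p => η i) = z.2 → ApproximatesAt κ ε q (seamSmoothing ρ e q φ η) z.1 := by
  have hact : ∀ᶠ z : X × (h.active p → ℝ) in 𝓝 p ×ˢ 𝓝[{η | ∀ i, 0 < η i}] 0, ∀ i : h.active p,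
      ∀ᶠ x in 𝓝 z.1, x ∈ (e i).source ∧ z.2 i ≤ |e i x 0| := by
    refine Filter.eventually_all.2 fun i => ?_
    have hps : p ∈ (e i).source := h.subset_source i (h.mem_active.1 i.2)
    have hne : 0 < |e i p 0| := abs_pos.2 fun h0 => hp (((ha.chart i).mem_seam hps).2 h0)
    have hc : ContinuousAt (fun x => |e i x 0|) p :=
      (continuous_coord_zero.continuousAt.comp ((e i).continuousAt hps)).abs
    have h1 : ∀ᶠ x in 𝓝 p, x ∈ (e i).source ∧ |e i p 0| / 2 < |e i x 0| :=
      Filter.Eventually.and ((e i).open_source.mem_nhds hps)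
        (hc.eventually (lt_mem_nhds (half_lt_self hne)))
    have h2 : ∀ᶠ η : h.active p → ℝ in 𝓝[{η | ∀ i, 0 < η i}] 0, η i < |e i p 0| / 2 := by
      refine Filter.Eventually.filter_mono nhdsWithin_le_nhds ?_
      exact (continuous_apply i).continuousAt.eventually (gt_mem_nhds (by simpa using half_pos hne))
    filter_upwards [h1.eventually_nhds.prod_inl _, h2.prod_inr _] with z hz1 hz2
    exact hz1.mono fun x hx => ⟨hx.1, (hz2.trans hx.2).le⟩
  filter_upwards [hact, ((hq.good p hp).eventually hq.symm hq.pos).prod_inl _,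
    (h.eventually_seamSmoothing_eq (e := e) (q := q) (φ := φ) p).eventually_nhds.prod_inl _]
    with z hz1 hz2 hz3 η hη hηz
  have heq : ∀ᶠ x in 𝓝 z.1, q x = seamSmoothing ρ e q φ η x := by
    filter_upwards [hz3, Filter.eventually_all.2 hz1] with x hx hx'
    rw [hx η, Finset.sum_eq_zero fun i _ => ?_, add_zero]
    have hi : formOfMat (e i) (smoothEdge φ (η i) (coordMat (e i) q)) x = q x := by
      refine eq_of_coordMat_eq (ha.chart i).mem_maximalAtlas (hx' i).1 ?_
      rw [coordMat_formOfMat (ha.chart i).mem_maximalAtlas ((ha.chart i).mem_target _)]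
      refine smoothEdge_eq hφ (hη i) ?_
      have := (hx' i).2
      rwa [← hηz] at this
    exact smul_form_sub_eq_zero _ hi
  refine ⟨hz2.congr heq, fun v => ?_⟩
  rw [← heq.self_of_nhds, sub_self, abs_zero]
  exact mul_nonneg hε.le (hq.nonneg _ v)

end SeamCutoff

theorem PiecewiseMetric.exists_smooth [T2Space X] [SigmaCompactSpace X]
    [IsManifold (𝓡 (m + 1)) ∞ X] (hq : PiecewiseMetric κ (fun j => m = 0 ∨ j < 0) A B e q)
    (ha : SeamAtlas A B e) (hU : IsOpen U) (hAB : A ∩ B ⊆ U) (hε : 0 < ε) (hε1 : ε < 1) :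
    ∃ g : SmoothMetric (𝓡 (m + 1)) X, (∀ x, κ < scal g x) ∧
      (∀ x ∉ U, g.inner x = q x) ∧ ∀ x v, |g.inner x v v - q x v v| ≤ ε * q x v v := by
  have : LocallyCompactSpace X :=
    ChartedSpace.locallyCompactSpace (EuclideanSpace ℝ (Fin (m + 1))) X
  obtain ⟨ρ, h⟩ := ha.exists_cutoff hU hAB
  obtain ⟨φ, θ, ψ, hφ⟩ := exists_smoothRamp
  obtain ⟨η, hη, hQ⟩ := exists_scales h.isCompact
    (Q := fun η x => ApproximatesAt κ ε q (seamSmoothing ρ e q φ η) x) (fun η η' x hηη hx => by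
      have hF := h.seamSmoothing_congr (e := e) (q := q) (φ := φ) hηη
      refine ⟨hx.1.congr hF, ?_⟩
      rw [← hF.self_of_nhds]; exact hx.2) (fun p => by
    refine ⟨h.active p, ?_⟩
    by_cases hp : p ∈ A ∩ B
    · exact h.approximatesAt_of_seam ha hq hφ hε hp
    · exact h.approximatesAt_of_notMem ha hq hφ hε hp)
  have hsymm : ∀ x v w, seamSmoothing ρ e q φ η x v w = seamSmoothing ρ e q φ η x w v := by
    intro x v w
    rw [(h.eventually_seamSmoothing_eq x).self_of_nhds]
    have key : ∀ (b₀ : EuclideanSpace ℝ (Fin (m + 1)) →L[ℝ] EuclideanSpace ℝ (Fin (m + 1)) →L[ℝ] ℝ)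
        (f₀ : h.active x → EuclideanSpace ℝ (Fin (m + 1)) →L[ℝ]
          EuclideanSpace ℝ (Fin (m + 1)) →L[ℝ] ℝ)
        (c₀ : h.active x → ℝ) (_ : ∀ u v, b₀ u v = b₀ v u) (_ : ∀ i u v, f₀ i u v = f₀ i v u)
        (u v : EuclideanSpace ℝ (Fin (m + 1))),
        (b₀ + ∑ i, c₀ i • (f₀ i - b₀)) u v = (b₀ + ∑ i, c₀ i • (f₀ i - b₀)) v u := by
      intro b₀ f₀ c₀ hb hf u v
      simp only [add_apply, sum_apply, _root_.smul_apply, sub_apply, smul_eq_mul]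
      rw [hb u v]
      simp only [hf _ u v]
    refine key (q x) (fun i => formOfMat (e i) (smoothEdge φ (η i) (coordMat (e i) q)) x)
      (fun i => ρ i x) (hq.symm x) (fun i u v => formOfMat_symm (fun y => ?_) x u v) v w
    exact edgeMat_transpose (fun y => coordMat_symm hq.symm) _ _
  have hpos : ∀ x v, v ≠ 0 → 0 < seamSmoothing ρ e q φ η x v v := by
    intro x v hv
    have h1 := (abs_le.1 ((hQ x).2 v)).1
    have h2 := hq.pos x v hv
    nlinarith
  obtain ⟨g, hg, hκ⟩ := exists_smoothMetric hsymm hpos fun p => (hQ p).1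
  refine ⟨g, hκ, fun x hx => ?_, fun x v => by rw [hg]; exact (hQ x).2 v⟩
  rw [hg, seamSmoothing]
  rw [finsum_eq_zero_of_forall_eq_zero fun i => ?_, add_zero]
  exact smul_form_eq_zero (image_eq_zero_of_notMem_tsupport fun hi => hx (h.subset i hi)) _

theorem PiecewiseMetric.exists_approximation [T2Space X] [SigmaCompactSpace X]
    [IsManifold (𝓡 (m + 1)) ∞ X] (hq : PiecewiseMetric κ P A B e q) (ha : SeamAtlas A B e)
    (hjump : ∀ k y, y 0 = 0 → jumpTrace (lowerHalf m) (upperHalf m) (coordMat (e k) q) y ≤ 0)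
    (hU : IsOpen U) (hAB : A ∩ B ⊆ U) (hε : 0 < ε) :
    ∃ g : SmoothMetric (𝓡 (m + 1)) X, (∀ x, κ < scal g x) ∧
      (∀ x ∉ U, g.inner x = q x) ∧ ∀ x v, |g.inner x v v - q x v v| ≤ ε * q x v v := by
  -- The two errors compose to `c + c (1 + c) = 2 c + c²`, which is at most `3 c ≤ ε`.
  set c : ℝ := min ε 1 / 4 with hc
  have hm : 0 < min ε 1 := lt_min hε one_pos
  have hc0 : 0 < c := by positivity
  have hcε : 4 * c ≤ ε := by rw [hc]; linarith [min_le_left ε 1]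
  have hc1 : 4 * c ≤ 1 := by rw [hc]; linarith [min_le_right ε 1]
  obtain ⟨q', hq', hU', hε'⟩ := hq.exists_neg_jump ha hjump hU hAB hc0 (by linarith)
  obtain ⟨g, hg, hgU, hgε⟩ := hq'.exists_smooth ha hU hAB hc0 (by linarith)
  refine ⟨g, hg, fun x hx => (hgU x hx).trans (hU' x hx), fun x v => ?_⟩
  have h0 := hq.nonneg x v
  have h1 := abs_le.1 (hε' x v)
  have h2 := abs_le.1 (hgε x v)
  rw [abs_le]
  constructor <;> nlinarith [mul_nonneg hc0.le h0, mul_le_mul_of_nonneg_right hcε h0,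
    mul_nonneg (mul_nonneg hc0.le hc0.le) h0, mul_le_mul_of_nonneg_right hc1 (mul_nonneg hc0.le h0)]

end SmoothAtSeam

end Gluing

namespace Gluing

/-! ### Smooth inverses up to the boundary -/

section LeftInverse

variable {E : Type*} [NormedAddCommGroup E] [NormedSpace ℝ E] [CompleteSpace E] {f g : E → E}
  {s t : Set E}

/-- The derivative of `g` is the inverse of the derivative of `f` along `g`, hence as smooth as `g`
itself, and smoothness follows by induction. Continuity of `g` is given, so the inverse function
theorem is not involved and boundary points are allowed. -/
theorem contDiffOn_of_leftInverse (hs : UniqueDiffOn ℝ s) (ht : UniqueDiffOn ℝ t)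
    (hf : ContDiffOn ℝ ∞ f t) (hinv : ∀ z ∈ t, (fderivWithin ℝ f t z).IsInvertible)
    (hg : ContinuousOn g s) (hm : Set.MapsTo g s t) (hfg : ∀ y ∈ s, f (g y) = y) :
    ContDiffOn ℝ ∞ g s := by
  have hd : ∀ y ∈ s, HasFDerivWithinAt g (fderivWithin ℝ f t (g y)).inverse s y := by
    intro y hy
    obtain ⟨L, hL⟩ := hinv (g y) (hm hy)
    have h1 : HasFDerivWithinAt f (L : E →L[ℝ] E) t (g y) := by
      rw [hL]
      exact (hf.differentiableOn (by simp) (g y) (hm hy)).hasFDerivWithinAt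
    rw [← hL, ContinuousLinearMap.inverse_equiv]
    exact HasFDerivWithinAt.of_local_left_inverse
      (tendsto_nhdsWithin_of_tendsto_nhds_of_eventually_within _ (hg y hy)
        (eventually_nhdsWithin_of_forall hm)) h1 hy (eventually_nhdsWithin_of_forall hfg)
  have hfd : ∀ k : ℕ, ContDiffOn ℝ k (fderivWithin ℝ f t) t := fun k =>
    (hf.fderivWithin ht (m := ∞) (by simp)).of_le (by exact_mod_cast le_top)
  refine contDiffOn_infty.2 fun k => ?_
  induction k with
  | zero => exact contDiffOn_zero.2 hg
  | succ k ih =>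
    rw [Nat.cast_add, Nat.cast_one, contDiffOn_succ_iff_fderivWithin hs]
    refine ⟨fun y hy => (hd y hy).differentiableWithinAt, fun h => absurd h (by simp), ?_⟩
    have h2 : ContDiffOn ℝ k (fun y => (fderivWithin ℝ f t (g y)).inverse) s := fun y hy =>
      ContDiffAt.comp_contDiffWithinAt (f := fun y => fderivWithin ℝ f t (g y)) y
        (hinv (g y) (hm hy)).contDiffAt_map_inverse ((hfd k).comp ih hm y hy)
    exact h2.congr fun y hy => (hd y hy).fderivWithin (hs y hy)

end LeftInverse

/-! ### One of the pieces, seen in a chart of the glued manifold -/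

section EmbeddedPiece

attribute [local instance] chartedSpaceSelf

variable {n : ℕ} {H : Type*} [TopologicalSpace H]
  {I : ModelWithCorners ℝ (EuclideanSpace ℝ (Fin n)) H}
  {M : Type*} [TopologicalSpace M] [ChartedSpace H M] [IsManifold I ∞ M]
  {X : Type*} [TopologicalSpace X] [ChartedSpace (EuclideanSpace ℝ (Fin n)) X]
  {e : OpenPartialHomeomorph X (EuclideanSpace ℝ (Fin n))}
  {ι : M → X} {x : M} {q : FormField (𝓡 n) X} {g : SmoothMetric I M}
  {N : Set (EuclideanSpace ℝ (Fin n))} {z : EuclideanSpace ℝ (Fin n)}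

variable (I) in
/-- The open set which cuts the domain of the map `ι`, in coordinates, out of the model space. -/
def pieceOpen (ι : M → X) (x : M) (e : OpenPartialHomeomorph X (EuclideanSpace ℝ (Fin n))) :
    Set (EuclideanSpace ℝ (Fin n)) :=
  I.symm ⁻¹' ((chartAt H x).target ∩ (chartAt H x).symm ⁻¹' (ι ⁻¹' e.source))

variable (I) in
/-- The domain of the map `ι` in coordinates. -/
def pieceDomain (ι : M → X) (x : M) (e : OpenPartialHomeomorph X (EuclideanSpace ℝ (Fin n))) :
    Set (EuclideanSpace ℝ (Fin n)) := Set.range I ∩ pieceOpen I ι x e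

variable (I) in
/-- The map `ι` in coordinates. -/
def pieceMap (ι : M → X) (x : M) (e : OpenPartialHomeomorph X (EuclideanSpace ℝ (Fin n))) :
    EuclideanSpace ℝ (Fin n) → EuclideanSpace ℝ (Fin n) := fun z => e (ι ((extChartAt I x).symm z))

theorem isOpen_pieceOpen (hι : Continuous ι) : IsOpen (pieceOpen I ι x e) :=
  ((chartAt H x).symm.isOpen_inter_preimage (e.open_source.preimage hι)).preimage I.continuous_symm

theorem mem_pieceDomain : z ∈ pieceDomain I ι x e ↔
    z ∈ (extChartAt I x).target ∧ ι ((extChartAt I x).symm z) ∈ e.source := by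
  rw [extChartAt_target]
  exact ⟨fun h => ⟨⟨h.2.1, h.1⟩, h.2.2⟩, fun h => ⟨h.1.2, h.1.1, h.2⟩⟩

theorem uniqueDiffOn_pieceDomain (hι : Continuous ι) : UniqueDiffOn ℝ (pieceDomain I ι x e) :=
  I.uniqueDiffOn.inter (isOpen_pieceOpen hι)

theorem inter_subset_closure_interior {O : Set (EuclideanSpace ℝ (Fin n))} (hO : IsOpen O) :
    Set.range I ∩ O ⊆ closure (interior (Set.range I ∩ O)) := by
  rw [interior_inter, hO.interior_eq]
  intro z hz
  rw [Set.inter_comm]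
  exact hO.inter_closure ⟨hz.2, I.range_subset_closure_interior hz.1⟩

theorem contDiffOn_pieceMap (he : e ∈ IsManifold.maximalAtlas (𝓡 n) ∞ X)
    (hι : ContMDiff I (𝓡 n) ∞ ι) : ContDiffOn ℝ ∞ (pieceMap I ι x e) (pieceDomain I ι x e) := by
  have h1 : ContMDiffOn 𝓘(ℝ, EuclideanSpace ℝ (Fin n)) I ∞ (extChartAt I x).symm
      (pieceDomain I ι x e) :=
    (contMDiffOn_extChartAt_symm x).mono fun z hz => (mem_pieceDomain.1 hz).1
  have h2 := (contMDiffOn_of_mem_maximalAtlas he).comp (hι.comp_contMDiffOn h1)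
    fun z hz => (mem_pieceDomain.1 hz).2
  exact h2.contDiffOn

theorem metricInChart_eq_pullMat (y : EuclideanSpace ℝ (Fin n)) :
    metricInChart g x y = pullMat g.inner (extChartAt I x).symm (Set.range I) y := rfl

theorem metricInChart_posDef (hz : z ∈ (extChartAt I x).target) : (metricInChart g x z).PosDef := by
  rw [metricInChart_eq_pullMat]
  have : IsManifold I 1 M := IsManifold.of_le (n := ∞) (by simp)
  refine pullMat_posDef g.symm g.pos ?_
  exact (isInvertible_mfderivWithin_extChartAt_symm hz).injective

theorem smoothMatrixOn_metricInChart {s : Set (EuclideanSpace ℝ (Fin n))}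
    (hs : s ⊆ (extChartAt I x).target) {O : Set (EuclideanSpace ℝ (Fin n))} (hO : IsOpen O)
    (hsO : s = Set.range I ∩ O) : SmoothMatrixOn s (metricInChart g x) := by
  have hsu : UniqueDiffOn ℝ s := by rw [hsO]; exact I.uniqueDiffOn.inter hO
  have hc : ContMDiffOn 𝓘(ℝ, EuclideanSpace ℝ (Fin n)) I ∞ (extChartAt I x).symm s :=
    (contMDiffOn_extChartAt_symm x).mono hs
  refine (smoothMatrixOn_pullMat g hc hsu).congr fun z hz => ?_
  rw [metricInChart_eq_pullMat]
  have hd : mfderivWithin 𝓘(ℝ, EuclideanSpace ℝ (Fin n)) I (extChartAt I x).symm s z =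
      mfderivWithin 𝓘(ℝ, EuclideanSpace ℝ (Fin n)) I (extChartAt I x).symm (Set.range I) z := by
    rw [hsO]
    exact mfderivWithin_inter (hO.mem_nhds (hsO ▸ hz).2)
  simp only [pullMat, hd]

/-- The map `ι` is an isometry onto its image with the metric `q`. -/
structure IsMetricEmbedding (g : SmoothMetric I M) (ι : M → X) (q : FormField (𝓡 n) X) : Prop where
  isEmbedding : Topology.IsEmbedding ι
  contMDiff : ContMDiff I (𝓡 n) ∞ ι
  symm : ∀ x v w, q x v w = q x w v
  pos : ∀ x v, v ≠ 0 → 0 < q x v v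
  eq : ∀ x v w, q (ι x) (mfderiv I (𝓡 n) ι x v) (mfderiv I (𝓡 n) ι x w) = g.inner x v w

namespace IsMetricEmbedding

theorem metricInChart_eq (h : IsMetricEmbedding g ι q)
    (he : e ∈ IsManifold.maximalAtlas (𝓡 n) ∞ X) (hz : z ∈ pieceDomain I ι x e) :
    metricInChart g x z = (jacobian (pieceDomain I ι x e) (pieceMap I ι x e) z)ᵀ *
      coordMat e q (pieceMap I ι x e z) * jacobian (pieceDomain I ι x e) (pieceMap I ι x e) z := by
  have hιc := h.contMDiff.continuous
  have hs := uniqueDiffOn_pieceDomain (I := I) (x := x) (e := e) hιc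
  have hc : ContMDiffOn 𝓘(ℝ, EuclideanSpace ℝ (Fin n)) I ∞ (extChartAt I x).symm
      (pieceDomain I ι x e) :=
    (contMDiffOn_extChartAt_symm x).mono fun z hz => (mem_pieceDomain.1 hz).1
  have hcz : MDifferentiableWithinAt 𝓘(ℝ, EuclideanSpace ℝ (Fin n)) I (extChartAt I x).symm
      (pieceDomain I ι x e) z := (hc z hz).mdifferentiableWithinAt (by simp)
  have h1 : metricInChart g x z =
      pullMat g.inner (extChartAt I x).symm (pieceDomain I ι x e) z := by
    have hd : mfderivWithin 𝓘(ℝ, EuclideanSpace ℝ (Fin n)) I (extChartAt I x).symm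
        (pieceDomain I ι x e) z =
        mfderivWithin 𝓘(ℝ, EuclideanSpace ℝ (Fin n)) I (extChartAt I x).symm (Set.range I) z :=
      mfderivWithin_inter ((isOpen_pieceOpen hιc).mem_nhds hz.2)
    rw [metricInChart_eq_pullMat]
    simp only [pullMat, hd]
  have h2 : pullMat g.inner (extChartAt I x).symm (pieceDomain I ι x e) z =
      pullMat q (ι ∘ (extChartAt I x).symm) (pieceDomain I ι x e) z :=
    (pullMat_map (h.contMDiff.mdifferentiableAt (by simp)) (h.eq _) (hs z hz) hcz).symm
  have h3 : pullMat q (ι ∘ (extChartAt I x).symm) (pieceDomain I ι x e) z =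
      pullMat q (e.symm ∘ pieceMap I ι x e) (pieceDomain I ι x e) z :=
    pullMat_congr (fun y hy => (e.left_inv (mem_pieceDomain.1 hy).2).symm) hz
  rw [h1, h2, h3]
  exact pullMat_comp (hs z hz) ((contDiffOn_pieceMap he h.contMDiff).differentiableOn (by simp) z hz)
    (mdifferentiableAt_chart_symm he (e.map_source
      (mem_pieceDomain.1 hz).2)).mdifferentiableWithinAt (Set.mapsTo_univ _ _)

/-- An isometric map is an immersion: the pulled-back matrix is positive definite, hence the
Jacobian is not singular. -/
theorem det_jacobian_ne (h : IsMetricEmbedding g ι q) (he : e ∈ IsManifold.maximalAtlas (𝓡 n) ∞ X)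
    (hz : z ∈ pieceDomain I ι x e) :
    (jacobian (pieceDomain I ι x e) (pieceMap I ι x e) z).det ≠ 0 := by
  intro h0
  have h1 := (metricInChart_posDef (g := g) (mem_pieceDomain.1 hz).1).det_pos.ne'
  rw [h.metricInChart_eq he hz, Matrix.det_mul, h0, mul_zero] at h1
  exact h1 rfl

theorem isInvertible_fderivWithin (h : IsMetricEmbedding g ι q)
    (he : e ∈ IsManifold.maximalAtlas (𝓡 n) ∞ X) (hz : z ∈ pieceDomain I ι x e) :
    (fderivWithin ℝ (pieceMap I ι x e) (pieceDomain I ι x e) z).IsInvertible := by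
  have hs := uniqueDiffOn_pieceDomain (I := I) (x := x) (e := e) h.contMDiff.continuous
  set L := fderivWithin ℝ (pieceMap I ι x e) (pieceDomain I ι x e) z with hL
  have hinj : Function.Injective (L : EuclideanSpace ℝ (Fin n) →ₗ[ℝ] EuclideanSpace ℝ (Fin n)) := by
    rw [← LinearMap.ker_eq_bot, LinearMap.ker_eq_bot']
    intro v hv
    have hv' : L v = 0 := hv
    have hmul : (jacobian (pieceDomain I ι x e) (pieceMap I ι x e) z).mulVec (fun i => v i) = 0 := by
      funext a
      have h1 := congrArg (fun w : EuclideanSpace ℝ (Fin n) => w a) (clm_eq_sum_single L v)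
      rw [hv'] at h1
      simp only [Matrix.mulVec, dotProduct, jacobian_apply_eq (hs z hz)
        ((contDiffOn_pieceMap he h.contMDiff).differentiableOn (by simp) z hz), Pi.zero_apply]
      simp only [PiLp.zero_apply, WithLp.ofLp_sum, Finset.sum_apply, PiLp.smul_apply,
        smul_eq_mul] at h1
      rw [h1]
      exact Finset.sum_congr rfl fun i _ => mul_comm _ _
    have h2 := Matrix.eq_zero_of_mulVec_eq_zero (h.det_jacobian_ne he hz) hmul
    ext i
    exact congrFun h2 i
  refine ⟨(LinearEquiv.ofInjectiveEndo _ hinj).toContinuousLinearEquiv, ?_⟩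
  ext1 v
  rfl

/-- The pull-back formula is solved for the matrix downstairs. This requires a smooth local inverse
of `ι` up to the boundary: it is continuous because `ι` is an embedding, and then smooth by
`contDiffOn_of_leftInverse`. -/
theorem smoothMatrixOn_coordMat (h : IsMetricEmbedding g ι q)
    (he : e ∈ IsManifold.maximalAtlas (𝓡 n) ∞ X) (hN : N ⊆ e.target)
    (hNι : ∀ y ∈ N, e.symm y ∈ Set.range ι) (hNu : UniqueDiffOn ℝ N) :
    SmoothMatrixOn N (coordMat e q) := by
  intro a b y₀ hy₀
  have : Nonempty M := ⟨(hNι y₀ hy₀).choose⟩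
  choose! Φ hΦ using hNι
  have hΦc : ContinuousOn Φ N := by
    rw [h.isEmbedding.isInducing.continuousOn_iff]
    exact (e.continuousOn_symm.mono hN).congr hΦ
  set x := Φ y₀ with hx
  obtain ⟨W, hWo, hW⟩ := continuousOn_iff'.1 hΦc _ (chartAt H x).open_source
  have hNW : ∀ y ∈ N ∩ W, Φ y ∈ (extChartAt I x).source := fun y hy => by
    rw [extChartAt_source]
    exact (hW.symm.subset ⟨hy.2, hy.1⟩ :).1
  have hy₀W : y₀ ∈ W := (hW.subset ⟨mem_chart_source H x, hy₀⟩).1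
  set φ : EuclideanSpace ℝ (Fin n) → EuclideanSpace ℝ (Fin n) := fun y => extChartAt I x (Φ y)
  have hφm : Set.MapsTo φ (N ∩ W) (pieceDomain I ι x e) := fun y hy => by
    refine mem_pieceDomain.2 ⟨(extChartAt I x).map_source (hNW y hy), ?_⟩
    rw [(extChartAt I x).left_inv (hNW y hy), hΦ y hy.1]
    exact e.map_target (hN hy.1)
  have hφi : ∀ y ∈ N ∩ W, pieceMap I ι x e (φ y) = y := fun y hy => by
    simp only [pieceMap, φ]
    rw [(extChartAt I x).left_inv (hNW y hy), hΦ y hy.1, e.right_inv (hN hy.1)]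
  have hι := h.contMDiff.continuous
  have hs := uniqueDiffOn_pieceDomain (I := I) (x := x) (e := e) hι
  have hψ := contDiffOn_pieceMap (x := x) he h.contMDiff
  have hφ : ContDiffOn ℝ ∞ φ (N ∩ W) := contDiffOn_of_leftInverse (hNu.inter hWo) hs hψ
    (fun z hz => h.isInvertible_fderivWithin he hz)
    ((continuousOn_extChartAt x).comp (hΦc.mono Set.inter_subset_left) hNW) hφm hφi
  have hJ := smoothMatrixOn_jacobian hs hψ
  have hJi := hJ.inv fun z hz => h.det_jacobian_ne he hz
  have hG : SmoothMatrixOn (pieceDomain I ι x e) (metricInChart g x) :=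
    smoothMatrixOn_metricInChart (fun z hz => (mem_pieceDomain.1 hz).1) (isOpen_pieceOpen hι) rfl
  have hsm : SmoothMatrixOn (N ∩ W) (coordMat e q) := by
    refine (((hJi.transpose.mul hG).mul hJi).comp hφ hφm).congr fun y hy => ?_
    have hu : IsUnit (jacobian (pieceDomain I ι x e) (pieceMap I ι x e) (φ y)).det :=
      isUnit_iff_ne_zero.2 (h.det_jacobian_ne he (hφm hy))
    have h1 := h.metricInChart_eq he (hφm hy)
    rw [hφi y hy] at h1
    simp only [h1]
    set J := jacobian (pieceDomain I ι x e) (pieceMap I ι x e) (φ y)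
    have hJJ : J * J⁻¹ = 1 := Matrix.mul_nonsing_inv _ hu
    have hJT : (J⁻¹)ᵀ * Jᵀ = 1 := by rw [← Matrix.transpose_mul, hJJ, Matrix.transpose_one]
    rw [Matrix.mul_assoc, Matrix.mul_assoc, hJJ, Matrix.mul_one, ← Matrix.mul_assoc, hJT,
      Matrix.one_mul]
  exact (contDiffWithinAt_inter (hWo.mem_nhds hy₀W)).1 (hsm a b y₀ ⟨hy₀, hy₀W⟩)

theorem isMetricPullback (h : IsMetricEmbedding g ι q) (he : e ∈ IsManifold.maximalAtlas (𝓡 n) ∞ X)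
    (hN : N ⊆ e.target) (hNι : ∀ y ∈ N, e.symm y ∈ Set.range ι) (hNu : UniqueDiffOn ℝ N)
    {O : Set (EuclideanSpace ℝ (Fin n))} (hO : IsOpen O)
    (hm : Set.MapsTo (pieceMap I ι x e) (pieceDomain I ι x e ∩ O) N) :
    IsMetricPullback (pieceDomain I ι x e ∩ O) N (pieceMap I ι x e) (metricInChart g x)
      (coordMat e q) where
  uniqueDiffOn := (uniqueDiffOn_pieceDomain h.contMDiff.continuous).inter hO
  uniqueDiffOn' := hNu
  subset_closure := by
    rw [pieceDomain, Set.inter_assoc]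
    exact inter_subset_closure_interior ((isOpen_pieceOpen h.contMDiff.continuous).inter hO)
  contDiffOn := (contDiffOn_pieceMap he h.contMDiff).mono Set.inter_subset_left
  mapsTo := hm
  smooth' := h.smoothMatrixOn_coordMat he hN hNι hNu
  symm' _ _ := coordMat_symm h.symm
  det_ne' z hz := (coordMat_posDef he (hN hz) h.symm h.pos).det_pos.ne'
  det_jacobian_ne z hz := by
    have h1 := h.det_jacobian_ne he hz.1
    have h2 : jacobian (pieceDomain I ι x e ∩ O) (pieceMap I ι x e) z =
        jacobian (pieceDomain I ι x e) (pieceMap I ι x e) z := by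
      ext a b
      exact pderivWithin_inter (hO.mem_nhds hz.2)
    rwa [h2]
  eq z hz := by
    have h2 : jacobian (pieceDomain I ι x e ∩ O) (pieceMap I ι x e) z =
        jacobian (pieceDomain I ι x e) (pieceMap I ι x e) z := by
      ext a b
      exact pderivWithin_inter (hO.mem_nhds hz.2)
    simp only [h2]
    exact h.metricInChart_eq he hz.1

end IsMetricEmbedding

end EmbeddedPiece

end Gluing

namespace Gluing

/-! ### Scalar curvature of a piece -/

section EmbeddedPiece

attribute [local instance] chartedSpaceSelf

variable {n : ℕ} {H : Type*} [TopologicalSpace H]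
  {I : ModelWithCorners ℝ (EuclideanSpace ℝ (Fin n)) H}
  {M : Type*} [TopologicalSpace M] [ChartedSpace H M] [IsManifold I ∞ M]
  {X : Type*} [TopologicalSpace X] [ChartedSpace (EuclideanSpace ℝ (Fin n)) X]
  {e : OpenPartialHomeomorph X (EuclideanSpace ℝ (Fin n))}
  {ι : M → X} {x : M} {q : FormField (𝓡 n) X} {g : SmoothMetric I M}
  {V : Set (EuclideanSpace ℝ (Fin n))} {κ : ℝ}

theorem extChartAt_mem_pieceDomain (hx : ι x ∈ e.source) :
    extChartAt I x x ∈ pieceDomain I ι x e := by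
  refine mem_pieceDomain.2 ⟨mem_extChartAt_target x, ?_⟩
  rwa [extChartAt_to_inv]

theorem pieceMap_extChartAt : pieceMap I ι x e (extChartAt I x x) = e (ι x) := by
  rw [pieceMap, extChartAt_to_inv]

theorem IsMetricEmbedding.scal_eq (h : IsMetricEmbedding g ι q)
    (he : e ∈ IsManifold.maximalAtlas (𝓡 n) ∞ X) (hV : IsOpen V) (hVt : V ⊆ e.target)
    (hx : ι x ∈ e.source) (hxV : e (ι x) ∈ V)
    (hu : UniqueDiffOn ℝ (V ∩ e.symm ⁻¹' Set.range ι)) :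
    scal g x = scalCoord (V ∩ e.symm ⁻¹' Set.range ι) (coordMat e q) (e (ι x)) := by
  have hι := h.contMDiff.continuous
  have hxs := extChartAt_mem_pieceDomain (I := I) hx
  obtain ⟨O, hO, hOV⟩ := continuousOn_iff'.1
    (contDiffOn_pieceMap (x := x) he h.contMDiff).continuousOn V hV
  have hxO : extChartAt I x x ∈ O :=
    (hOV.subset ⟨by rwa [Set.mem_preimage, pieceMap_extChartAt], hxs⟩).1
  have hP := h.isMetricPullback (x := x) he (N := V ∩ e.symm ⁻¹' Set.range ι)
    (fun y hy => hVt hy.1) (fun y hy => hy.2) hu hO (fun z hz => by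
      refine ⟨(hOV.symm.subset ⟨hz.2, hz.1⟩ :).1, ?_⟩
      rw [Set.mem_preimage, pieceMap, e.left_inv (mem_pieceDomain.1 hz.1).2]
      exact ⟨_, rfl⟩)
  have h1 := hP.scalCoord_eq ⟨hxs, hxO⟩
  rw [pieceMap_extChartAt, scalCoord_inter hO hxO hxs, pieceDomain,
    scalCoord_inter (isOpen_pieceOpen hι) hxs.2 hxs.1] at h1
  exact h1

theorem IsMetricEmbedding.goodAt (h : IsMetricEmbedding g ι q) [IsManifold (𝓡 n) ∞ X]
    (hκ : κ < scal g x) (hx : Set.range ι ∈ 𝓝 (ι x)) : GoodAt κ q (ι x) := by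
  obtain ⟨W, hW, hWo, hxW⟩ := mem_nhds_iff.1 hx
  set e := chartAt (EuclideanSpace ℝ (Fin n)) (ι x) with he
  have hem : e ∈ IsManifold.maximalAtlas (𝓡 n) ∞ X := IsManifold.chart_mem_maximalAtlas _
  have hxe : ι x ∈ e.source := mem_chart_source _ _
  have hV : IsOpen (e.target ∩ e.symm ⁻¹' W) := e.symm.isOpen_inter_preimage hWo
  have hxV : e (ι x) ∈ e.target ∩ e.symm ⁻¹' W :=
    ⟨e.map_source hxe, by rwa [Set.mem_preimage, e.left_inv hxe]⟩
  have hN : e.target ∩ e.symm ⁻¹' W ∩ e.symm ⁻¹' Set.range ι = e.target ∩ e.symm ⁻¹' W :=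
    Set.inter_eq_left.2 fun y hy => hW hy.2
  refine ⟨e, hem, hxe, _, hV, hxV, Set.inter_subset_left, ?_, ?_⟩
  · exact h.smoothMatrixOn_coordMat hem Set.inter_subset_left (fun y hy => hW hy.2) hV.uniqueDiffOn
  · rw [h.scal_eq hem hV Set.inter_subset_left hxe hxV (by rw [hN]; exact hV.uniqueDiffOn), hN] at hκ
    exact hκ

end EmbeddedPiece

/-! ### Mean curvature of the boundary of a piece -/

section BoundaryOfPiece

attribute [local instance] chartedSpaceSelf

variable {m : ℕ} {M : Type*} [TopologicalSpace M] [ChartedSpace (EuclideanHalfSpace (m + 1)) M]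
  [IsManifold (𝓡∂ (m + 1)) ∞ M]
  {X : Type*} [TopologicalSpace X] [ChartedSpace (EuclideanSpace ℝ (Fin (m + 1))) X]
  {e : OpenPartialHomeomorph X (EuclideanSpace ℝ (Fin (m + 1)))}
  {ι : M → X} {x : M} {q : FormField (𝓡 (m + 1)) X} {g : SmoothMetric (𝓡∂ (m + 1)) M}
  {z : EuclideanSpace ℝ (Fin (m + 1))}

theorem range_halfSpace : Set.range (𝓡∂ (m + 1)) = upperHalf m :=
  range_modelWithCornersEuclideanHalfSpace (m + 1)

theorem mem_frontier_halfSpace : z ∈ frontier (Set.range (𝓡∂ (m + 1))) ↔ z 0 = 0 := by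
  rw [frontier_range_modelWithCornersEuclideanHalfSpace]
  exact eq_comm

/-- Being a boundary point can be tested in any chart, so it is visible in the chart at a
neighbouring point `x`. -/
theorem isBoundaryPoint_symm_iff (hz : z ∈ (extChartAt (𝓡∂ (m + 1)) x).target) :
    (𝓡∂ (m + 1)).IsBoundaryPoint ((extChartAt (𝓡∂ (m + 1)) x).symm z) ↔ z 0 = 0 := by
  rw [ModelWithCorners.isBoundaryPoint_iff_of_mem_atlas (n := ∞) (by simp)
    (chart_mem_atlas (EuclideanHalfSpace (m + 1)) x)
    (by rw [← extChartAt_source (𝓡∂ (m + 1))]; exact (extChartAt (𝓡∂ (m + 1)) x).map_target hz),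
    ← mem_frontier_halfSpace]
  have h : (chartAt (EuclideanHalfSpace (m + 1)) x).extend (𝓡∂ (m + 1))
      ((extChartAt (𝓡∂ (m + 1)) x).symm z) = z := (extChartAt (𝓡∂ (m + 1)) x).right_inv hz
  have hz' : z ∈ (𝓡∂ (m + 1)).symm ⁻¹' (chartAt (EuclideanHalfSpace (m + 1)) x).target ∩
      Set.range (𝓡∂ (m + 1)) := by rwa [← OpenPartialHomeomorph.extend_target]
  rw [h, ← not_iff_not, OpenPartialHomeomorph.extend_target, ← mem_interior_iff_notMem_frontier hz',
    ← mem_interior_iff_notMem_frontier hz'.2, interior_inter, ((chartAt _ x).open_target.preimage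
      (𝓡∂ (m + 1)).continuous_symm).interior_eq]
  exact ⟨fun h => h.2, fun h => ⟨hz'.1, h⟩⟩

theorem isBoundaryPoint_iff_coord :
    (𝓡∂ (m + 1)).IsBoundaryPoint x ↔ extChartAt (𝓡∂ (m + 1)) x x 0 = 0 := by
  rw [ModelWithCorners.isBoundaryPoint_iff, mem_frontier_halfSpace]

theorem pderivWithin_zero_nonneg {s : Set (EuclideanSpace ℝ (Fin (m + 1)))}
    {f : EuclideanSpace ℝ (Fin (m + 1)) → ℝ} {y : EuclideanSpace ℝ (Fin (m + 1))}
    (hf : DifferentiableWithinAt ℝ f s y)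
    (hs : ∀ᶠ τ in 𝓝[>] (0 : ℝ), y + τ • EuclideanSpace.single 0 (1 : ℝ) ∈ s)
    (hy : f y = 0) (hpos : ∀ z ∈ s, 0 ≤ f z) : 0 ≤ pderivWithin s 0 f y := by
  have hl : HasDerivAt (fun τ : ℝ => y + τ • EuclideanSpace.single (0 : Fin (m + 1)) (1 : ℝ))
      (EuclideanSpace.single 0 1) 0 := by
    simpa using ((hasDerivAt_id (0 : ℝ)).smul_const
      (EuclideanSpace.single (0 : Fin (m + 1)) (1 : ℝ))).const_add y
  set S : Set ℝ := {τ | 0 < τ ∧ y + τ • EuclideanSpace.single (0 : Fin (m + 1)) (1 : ℝ) ∈ s} with hS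
  have hSm : S ∈ 𝓝[>] (0 : ℝ) := Filter.inter_mem self_mem_nhdsWithin hs
  have hc := HasFDerivWithinAt.comp_hasDerivWithinAt (t := s) (0 : ℝ)
    (show HasFDerivWithinAt f _ s (y + (0 : ℝ) • EuclideanSpace.single (0 : Fin (m + 1)) (1 : ℝ)) by
      simpa using hf.hasFDerivWithinAt) (hl.hasDerivWithinAt (s := S)) (fun τ hτ => hτ.2)
  have h3 := (hasDerivWithinAt_iff_tendsto_slope' (fun h : (0 : ℝ) ∈ S => lt_irrefl _ h.1)).1 hc
  have hne : (𝓝[S] (0 : ℝ)).NeBot := by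
    have : 𝓝[>] (0 : ℝ) ≤ 𝓝[S] 0 := le_inf nhdsWithin_le_nhds (Filter.le_principal_iff.2 hSm)
    exact Filter.NeBot.mono inferInstance this
  refine ge_of_tendsto h3 ?_
  filter_upwards [self_mem_nhdsWithin] with τ hτ
  rw [slope_def_field, sub_zero]
  simp only [Function.comp_apply, zero_smul, add_zero, hy, sub_zero]
  exact div_nonneg (hpos _ hτ.2) hτ.1.le

/-- The sign `σ` tells on which side of the hyperplane the piece lies. It is also the sign of the
transverse derivative of `ι`, hence of the change of co-orientation between the piece and the
half-space convention of `meanCurvCoord`. -/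
theorem IsMetricEmbedding.meanCurv_eq (h : IsMetricEmbedding g ι q)
    (he : e ∈ IsManifold.maximalAtlas (𝓡 (m + 1)) ∞ X) (het : e.target = Set.univ)
    (hu : UniqueDiffOn ℝ (e.symm ⁻¹' Set.range ι))
    (hb : ∀ x, (𝓡∂ (m + 1)).IsBoundaryPoint x → ι x ∈ e.source → e (ι x) 0 = 0)
    {σ : ℝ} (hσ : σ = 1 ∨ σ = -1) (hside : ∀ x, ι x ∈ e.source → 0 ≤ σ * e (ι x) 0)
    (hx : ι x ∈ e.source) (hxb : (𝓡∂ (m + 1)).IsBoundaryPoint x) :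
    meanCurv g x = σ * meanCurvCoord (e.symm ⁻¹' Set.range ι) (coordMat e q) (e (ι x)) := by
  set I := 𝓡∂ (m + 1) with hI
  have hι := h.contMDiff.continuous
  set y := extChartAt I x x with hy
  have hy0 : y 0 = 0 := isBoundaryPoint_iff_coord.1 hxb
  set s := pieceDomain I ι x e with hs
  set ψ := pieceMap I ι x e with hψ
  have hys : y ∈ s := extChartAt_mem_pieceDomain hx
  have hP := h.isMetricPullback (x := x) he (N := e.symm ⁻¹' Set.range ι)
    (by rw [het]; exact Set.subset_univ _) (fun y hy => hy) hu isOpen_univ (fun z hz => by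
      rw [Set.mem_preimage, pieceMap, e.left_inv (mem_pieceDomain.1 hz.1).2]
      exact ⟨_, rfl⟩)
  rw [Set.inter_univ] at hP
  have hsI : s = upperHalf m ∩ pieceOpen I ι x e := by rw [hs, pieceDomain, hI, range_halfSpace]
  have hOo : IsOpen (pieceOpen I ι x e) := isOpen_pieceOpen hι
  have htan : ∀ z ∈ s, z 0 = 0 → TangentiallyOpenAt s z := fun z hz hz0 => by
    rw [hsI]
    exact (tangentiallyOpenAt_upperHalf hz0).inter (hOo.mem_nhds hz.2)
  have hψ0 : ∀ z ∈ s, z 0 = 0 → ψ z 0 = 0 := fun z hz hz0 =>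
    hb _ ((isBoundaryPoint_symm_iff (mem_pieceDomain.1 hz).1).2 hz0) (mem_pieceDomain.1 hz).2
  have hmain := hP.meanCurvCoord_eq hys hy0 htan hψ0
  have hmc : meanCurvCoord s (metricInChart g x) y = meanCurv g x := by
    simp only [meanCurv, meanCurvCoord, hs, pieceDomain, christoffel_inter (hOo.mem_nhds hys.2)]
    rfl
  rw [hmc, pieceMap_extChartAt] at hmain
  have hd : DifferentiableWithinAt ℝ (fun z => ψ z 0) s y :=
    (contDiffOn_coord hP.contDiffOn 0).differentiableOn (by simp) y hys
  have hJ0 : ∀ i : Fin m, jacobian s ψ y 0 i.succ = 0 := fun i =>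
    pderivWithin_succ_eq_zero hd (htan y hys hy0) hy0 hψ0 i
  have hJne : jacobian s ψ y 0 0 ≠ 0 := fun h0 => hP.det_jacobian_ne y hys
    (Matrix.det_eq_zero_of_row_eq_zero 0 fun k => Fin.cases h0 hJ0 k)
  have hray : ∀ᶠ τ in 𝓝[>] (0 : ℝ), y + τ • EuclideanSpace.single 0 (1 : ℝ) ∈ s := by
    have hc : ContinuousAt (fun τ : ℝ => y + τ • EuclideanSpace.single (0 : Fin (m + 1)) (1 : ℝ))
        0 := by fun_prop
    have hmem : ∀ᶠ τ in 𝓝 (0 : ℝ), y + τ • EuclideanSpace.single (0 : Fin (m + 1)) (1 : ℝ) ∈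
        pieceOpen I ι x e := hc.eventually_mem (by simpa using hOo.mem_nhds hys.2)
    filter_upwards [self_mem_nhdsWithin, hmem.filter_mono nhdsWithin_le_nhds] with τ (hτ : 0 < τ) hτO
    rw [hsI]
    refine ⟨?_, hτO⟩
    change 0 ≤ (y + τ • EuclideanSpace.single (0 : Fin (m + 1)) (1 : ℝ)) 0
    simpa [hy0] using hτ.le
  -- Moving inwards from the boundary keeps the point in the piece, and therefore on the side `σ`.
  have hge : 0 ≤ σ * jacobian s ψ y 0 0 := by
    have h1 := pderivWithin_zero_nonneg (f := fun z => σ * ψ z 0) (hd.const_mul σ) hray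
      (by rw [hψ0 y hys hy0, mul_zero]) fun z hz => hside _ (mem_pieceDomain.1 hz).2
    rwa [pderivWithin_const_mul σ (hP.uniqueDiffOn y hys) hd] at h1
  have habs : 0 < |jacobian s ψ y 0 0| := abs_pos.2 hJne
  refine mul_right_cancel₀ habs.ne' (hmain.trans ?_)
  rcases hσ with rfl | rfl
  · rw [abs_of_nonneg (by linarith)]; ring
  · rw [abs_of_nonpos (by linarith)]; ring

end BoundaryOfPiece

end Gluing

namespace Gluing

/-! ### Topology of the glued space -/

section ClosedImage

variable {Z W X : Type*} [TopologicalSpace Z] [TopologicalSpace W] [TopologicalSpace X] {f : Z → X}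
  {g : W → X}

/-- Separate the preimages in both pieces, and remove from `X` the images of the complements of the
separating open sets; these images are closed. -/
theorem normalSpace_of_isClosedMap [NormalSpace Z] [NormalSpace W] (hf : Continuous f)
    (hfc : IsClosedMap f) (hg : Continuous g) (hgc : IsClosedMap g)
    (hs : Set.range f ∪ Set.range g = Set.univ) : NormalSpace X where
  normal C D hC hD hCD := by
    obtain ⟨U, V, hU, hV, hCU, hDV, hUV⟩ :=
      normal_separation (hC.preimage hf) (hD.preimage hf) (hCD.preimage f)
    obtain ⟨U', V', hU', hV', hCU', hDV', hUV'⟩ :=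
      normal_separation (hC.preimage hg) (hD.preimage hg) (hCD.preimage g)
    refine ⟨(f '' Uᶜ ∪ g '' U'ᶜ)ᶜ, (f '' Vᶜ ∪ g '' V'ᶜ)ᶜ,
      ((hfc _ hU.isClosed_compl).union (hgc _ hU'.isClosed_compl)).isOpen_compl,
      ((hfc _ hV.isClosed_compl).union (hgc _ hV'.isClosed_compl)).isOpen_compl, ?_, ?_, ?_⟩
    · rintro x hx (⟨z, hz, rfl⟩ | ⟨z, hz, rfl⟩)
      exacts [hz (hCU hx), hz (hCU' hx)]
    · rintro x hx (⟨z, hz, rfl⟩ | ⟨z, hz, rfl⟩)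
      exacts [hz (hDV hx), hz (hDV' hx)]
    · refine Set.disjoint_left.2 fun x hx hx' => ?_
      rcases hs.symm.subset (Set.mem_univ x) with ⟨z, rfl⟩ | ⟨z, rfl⟩
      · exact Set.disjoint_left.1 hUV (by_contra fun h => hx (Or.inl ⟨z, h, rfl⟩))
          (by_contra fun h => hx' (Or.inl ⟨z, h, rfl⟩))
      · exact Set.disjoint_left.1 hUV' (by_contra fun h => hx (Or.inr ⟨z, h, rfl⟩))
          (by_contra fun h => hx' (Or.inr ⟨z, h, rfl⟩))

theorem t2Space_of_isClosedMap [NormalSpace Z] [T1Space Z] [NormalSpace W] [T1Space W]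
    (hf : Continuous f) (hfc : IsClosedMap f) (hg : Continuous g) (hgc : IsClosedMap g)
    (hs : Set.range f ∪ Set.range g = Set.univ) : T2Space X := by
  have := normalSpace_of_isClosedMap hf hfc hg hgc hs
  have : T1Space X := ⟨fun x => by
    rcases hs.symm.subset (Set.mem_univ x) with ⟨z, rfl⟩ | ⟨z, rfl⟩
    · exact Set.image_singleton ▸ hfc _ isClosed_singleton
    · exact Set.image_singleton ▸ hgc _ isClosed_singleton⟩
  infer_instance

end ClosedImage

namespace Glued

variable {Y₁ Y₂ X₁ X₂ : Type*} {j₁ : Y₁ → X₁} {j₂ : Y₂ → X₂} {γ : Y₁ → Y₂}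

/-- To extract information from an equality in the quotient, a proposition-valued function that
respects the gluing relation is descended to it and evaluated at both representatives; the two
injectivity lemmas below use the same device. -/
theorem inl_eq_inr_iff (hj₁ : j₁.Injective)
    {a : X₁} {b : X₂} : inl j₁ j₂ γ a = inr j₁ j₂ γ b ↔ ∃ y, j₁ y = a ∧ j₂ (γ y) = b := by
  constructor
  · intro h
    let F : Glued j₁ j₂ γ → Prop := Quot.lift
      (Sum.elim (fun a' => ∃ y, j₁ y = a' ∧ j₂ (γ y) = b) fun b' => b' = b) (by
        rintro _ _ ⟨y⟩
        refine propext ⟨?_, fun h => ⟨y, rfl, h⟩⟩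
        rintro ⟨y', h1, h2⟩
        rw [← hj₁ h1]
        exact h2)
    have h2 : F (inl j₁ j₂ γ a) = F (inr j₁ j₂ γ b) := congrArg F h
    exact h2.mpr rfl
  · rintro ⟨y, rfl, rfl⟩
    exact Quot.sound (GlueRel.glue y)

theorem inl_injective (hj₂ : j₂.Injective) (hγ : γ.Injective) :
    (inl j₁ j₂ γ).Injective := by
  intro a b h
  let F : Glued j₁ j₂ γ → Prop := Quot.lift
    (Sum.elim (fun a' => a' = b) fun b' => ∃ y, j₁ y = b ∧ j₂ (γ y) = b') (by
      rintro _ _ ⟨y⟩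
      refine propext ⟨fun h => ⟨y, h, rfl⟩, ?_⟩
      rintro ⟨y', h1, h2⟩
      rw [← hγ (hj₂ h2)]
      exact h1)
  have h2 : F (inl j₁ j₂ γ a) = F (inl j₁ j₂ γ b) := congrArg F h
  exact h2.mpr rfl

theorem inr_injective (hj₁ : j₁.Injective) :
    (inr j₁ j₂ γ).Injective := by
  intro a b h
  let F : Glued j₁ j₂ γ → Prop := Quot.lift
    (Sum.elim (fun a' => ∃ y, j₁ y = a' ∧ j₂ (γ y) = b) fun b' => b' = b) (by
      rintro _ _ ⟨y⟩
      refine propext ⟨?_, fun h => ⟨y, rfl, h⟩⟩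
      rintro ⟨y', h1, h2⟩
      rw [← hj₁ h1]
      exact h2)
  have h2 : F (inr j₁ j₂ γ a) = F (inr j₁ j₂ γ b) := congrArg F h
  exact h2.mpr rfl

theorem range_union : Set.range (inl j₁ j₂ γ) ∪ Set.range (inr j₁ j₂ γ) = Set.univ := by
  refine Set.eq_univ_of_forall fun p => ?_
  obtain ⟨a | b, rfl⟩ := Quot.exists_rep p
  exacts [Or.inl ⟨a, rfl⟩, Or.inr ⟨b, rfl⟩]

theorem range_inter (hj₁ : j₁.Injective) :
    Set.range (inl j₁ j₂ γ) ∩ Set.range (inr j₁ j₂ γ) = seam j₁ j₂ γ := by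
  ext p
  constructor
  · rintro ⟨⟨a, rfl⟩, b, h⟩
    obtain ⟨y, rfl, -⟩ := (inl_eq_inr_iff hj₁).1 h.symm
    exact ⟨y, rfl⟩
  · rintro ⟨y, rfl⟩
    exact ⟨⟨_, rfl⟩, _, ((inl_eq_inr_iff hj₁).2 ⟨y, rfl, rfl⟩).symm⟩

variable [TopologicalSpace X₁] [TopologicalSpace X₂]

theorem isClosed_iff {C : Set (Glued j₁ j₂ γ)} :
    IsClosed C ↔ IsClosed (inl j₁ j₂ γ ⁻¹' C) ∧ IsClosed (inr j₁ j₂ γ ⁻¹' C) := by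
  have h : Topology.IsQuotientMap (Quot.mk (GlueRel j₁ j₂ γ)) := isQuotientMap_quot_mk
  exact h.isClosed_preimage.symm.trans isClosed_sum_iff

theorem continuous_inl : Continuous (inl j₁ j₂ γ) :=
  continuous_iff_isClosed.2 fun _ hC => (isClosed_iff.1 hC).1

theorem continuous_inr : Continuous (inr j₁ j₂ γ) :=
  continuous_iff_isClosed.2 fun _ hC => (isClosed_iff.1 hC).2

theorem sigmaCompactSpace [SigmaCompactSpace X₁] [SigmaCompactSpace X₂] :
    SigmaCompactSpace (Glued j₁ j₂ γ) := by
  rw [← isSigmaCompact_univ_iff, ← range_union, ← Set.Sum.elim_range]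
  exact isSigmaCompact_range (continuous_inl.sumElim continuous_inr)

variable [TopologicalSpace Y₁] [TopologicalSpace Y₂]

/-- The part of the image of `C` that lies in `X₂` is `j₂ (γ (j₁⁻¹ C))`, which is closed. -/
theorem isClosedEmbedding_inl (hj₁ : Topology.IsClosedEmbedding j₁)
    (hj₂ : Topology.IsClosedEmbedding j₂) (hγ : IsHomeomorph γ) :
    Topology.IsClosedEmbedding (inl j₁ j₂ γ) := by
  have hinj : (inl j₁ j₂ γ).Injective := inl_injective hj₂.injective hγ.injective
  refine .of_continuous_injective_isClosedMap continuous_inl hinj fun C hC => isClosed_iff.2 ⟨?_, ?_⟩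
  · rwa [Set.preimage_image_eq _ hinj]
  · convert hj₂.isClosedMap _ (hγ.isClosedMap _ (hC.preimage hj₁.continuous)) using 1
    ext b
    constructor
    · rintro ⟨a, ha, hab⟩
      obtain ⟨y, rfl, rfl⟩ := (inl_eq_inr_iff hj₁.injective).1 hab
      exact ⟨_, ⟨y, ha, rfl⟩, rfl⟩
    · rintro ⟨_, ⟨y, hy, rfl⟩, rfl⟩
      exact ⟨_, hy, (inl_eq_inr_iff hj₁.injective).2 ⟨y, rfl, rfl⟩⟩

theorem isClosedEmbedding_inr (hj₁ : Topology.IsClosedEmbedding j₁)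
    (hj₂ : Topology.IsClosedEmbedding j₂) (hγ : IsHomeomorph γ) :
    Topology.IsClosedEmbedding (inr j₁ j₂ γ) := by
  have hinj : (inr j₁ j₂ γ).Injective := inr_injective hj₁.injective
  refine .of_continuous_injective_isClosedMap continuous_inr hinj fun C hC => isClosed_iff.2 ⟨?_, ?_⟩
  · convert hj₁.isClosedMap _ ((hC.preimage hj₂.continuous).preimage hγ.continuous) using 1
    ext a
    constructor
    · rintro ⟨b, hb, hab⟩
      obtain ⟨y, rfl, rfl⟩ := (inl_eq_inr_iff hj₁.injective).1 hab.symm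
      exact ⟨y, hb, rfl⟩
    · rintro ⟨y, hy, rfl⟩
      exact ⟨_, hy, ((inl_eq_inr_iff hj₁.injective).2
        ⟨y, rfl, rfl⟩).symm⟩
  · rwa [Set.preimage_image_eq _ hinj]

theorem t2Space [NormalSpace X₁] [T1Space X₁] [NormalSpace X₂] [T1Space X₂]
    (hj₁ : Topology.IsClosedEmbedding j₁) (hj₂ : Topology.IsClosedEmbedding j₂)
    (hγ : IsHomeomorph γ) : T2Space (Glued j₁ j₂ γ) :=
  t2Space_of_isClosedMap continuous_inl (isClosedEmbedding_inl hj₁ hj₂ hγ).isClosedMap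
    continuous_inr (isClosedEmbedding_inr hj₁ hj₂ hγ).isClosedMap range_union

end Glued

end Gluing

namespace Gluing

/-! ### Local diffeomorphisms -/

section LocalDiffeomorphism

variable {E : Type*} [NormedAddCommGroup E] [NormedSpace ℝ E] [CompleteSpace E] {F : E → E}
  {O : Set E} {a : E}

/-- The inverse function theorem, restricted to points with invertible derivative, so that the
inverse is smooth on the whole target and not only at the image of `a`. -/
theorem exists_openPartialHomeomorph (hO : O ∈ 𝓝 a) (hF : ContDiffOn ℝ ∞ F O)
    (hinv : (fderiv ℝ F a).IsInvertible) :
    ∃ Φ : OpenPartialHomeomorph E E, a ∈ Φ.source ∧ (Φ : E → E) = F ∧ Φ.source ⊆ O ∧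
      ContDiffOn ℝ ∞ Φ Φ.source ∧ ContDiffOn ℝ ∞ Φ.symm Φ.target := by
  obtain ⟨L, hL⟩ := hinv
  have hFa : ContDiffAt ℝ ∞ F a := hF.contDiffAt hO
  have hd : HasFDerivAt F (L : E →L[ℝ] E) a := hL ▸ (hFa.differentiableAt (by simp)).hasFDerivAt
  set Φ₀ := hFa.toOpenPartialHomeomorph F hd (by simp)
  have hcont : ContinuousAt (fderiv ℝ F) a :=
    (hFa.fderiv_right (m := ∞) (by simp)).continuousAt
  have hN : ∀ᶠ z in 𝓝 a, z ∈ O ∧ (fderiv ℝ F z).IsInvertible :=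
    Filter.inter_mem hO
      (hcont (by rw [← hL]; exact ContinuousLinearEquiv.nhds L))
  obtain ⟨V, hV, hVo, haV⟩ := mem_nhds_iff.1 hN
  have hsrc : (Φ₀.restr V).source ⊆ V := fun z hz => by
    rw [OpenPartialHomeomorph.restr_source, hVo.interior_eq] at hz
    exact hz.2
  have hcoe : (Φ₀.restr V : E → E) = F := rfl
  refine ⟨Φ₀.restr V, ?_, hcoe, fun z hz => (hV (hsrc hz)).1, ?_, ?_⟩
  · rw [OpenPartialHomeomorph.restr_source, hVo.interior_eq]
    exact ⟨hFa.mem_toOpenPartialHomeomorph_source hd (by simp), haV⟩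
  · exact hF.mono fun z hz => (hV (hsrc hz)).1
  · refine contDiffOn_of_leftInverse (t := (Φ₀.restr V).source) (f := F)
      (Φ₀.restr V).open_target.uniqueDiffOn
      (Φ₀.restr V).open_source.uniqueDiffOn (hF.mono fun z hz => (hV (hsrc hz)).1) (fun z hz => ?_)
      (Φ₀.restr V).continuousOn_symm (fun y hy => (Φ₀.restr V).map_target hy)
      fun y hy => (Φ₀.restr V).right_inv hy
    rw [fderivWithin_of_isOpen (Φ₀.restr V).open_source hz]
    exact (hV (hsrc hz)).2

end LocalDiffeomorphism

/-! ### Charts onto the whole of `ℝⁿ` -/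

section AdaptedChart

attribute [local instance] chartedSpaceSelf

/-- The diffeomorphism of `ℝⁿ` with a ball is a radial rescaling, so it preserves the sign of each
coordinate and in particular the hyperplane. -/
theorem univBall_apply_eq_smul {E : Type*} [NormedAddCommGroup E] [NormedSpace ℝ E] {r : ℝ}
    (hr : 0 < r) (y : E) :
    ∃ c : ℝ, 0 < c ∧ OpenPartialHomeomorph.univBall (0 : E) r y = c • y := by
  refine ⟨r * (√(1 + ‖y‖ ^ 2))⁻¹, by positivity, ?_⟩
  rw [OpenPartialHomeomorph.univBall, dif_pos hr, mul_smul]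
  exact add_zero _

variable {n : ℕ} {X : Type*} [TopologicalSpace X] [ChartedSpace (EuclideanSpace ℝ (Fin n)) X]
  [IsManifold (𝓡 n) ∞ X] {e₀ : OpenPartialHomeomorph X (EuclideanSpace ℝ (Fin n))}
  {Φ : OpenPartialHomeomorph (EuclideanSpace ℝ (Fin n)) (EuclideanSpace ℝ (Fin n))} {p : X}
  {T : Set (EuclideanSpace ℝ (Fin n))}

theorem trans_mem_maximalAtlas (he : e₀ ∈ IsManifold.maximalAtlas (𝓡 n) ∞ X)
    (h : ContDiffOn ℝ ∞ Φ Φ.source) (h' : ContDiffOn ℝ ∞ Φ.symm Φ.target) :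
    e₀.trans Φ ∈ IsManifold.maximalAtlas (𝓡 n) ∞ X := by
  refine OpenPartialHomeomorph.mem_maximalAtlas_of_contMDiffOn _ ?_ ?_
  · exact h.contMDiffOn.comp ((contMDiffOn_of_mem_maximalAtlas he).mono
      fun x hx => ((e₀.trans_source Φ).subset hx).1) fun x hx => ((e₀.trans_source Φ).subset hx).2
  · exact (contMDiffOn_symm_of_mem_maximalAtlas he).comp (h'.contMDiffOn.mono
      fun x hx => ((e₀.trans_target Φ).subset hx).1) fun x hx => ((e₀.trans_target Φ).subset hx).2

/-- Near `p`, a local diffeomorphism of `ℝⁿ` with value `e₀ p` at `0` gives a chart of `X` onto the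
whole of `ℝⁿ`, up to radial rescaling. -/
theorem exists_chart_of_local_diffeomorphism (he : e₀ ∈ IsManifold.maximalAtlas (𝓡 n) ∞ X)
    (hp : p ∈ e₀.source) (h0 : 0 ∈ Φ.source) (hΦ0 : Φ 0 = e₀ p)
    (h : ContDiffOn ℝ ∞ Φ Φ.source) (h' : ContDiffOn ℝ ∞ Φ.symm Φ.target) (hT : T ∈ 𝓝 0) :
    ∃ e ∈ IsManifold.maximalAtlas (𝓡 n) ∞ X, e.target = Set.univ ∧ p ∈ e.source ∧ e p = 0 ∧
      ∀ y, ∃ c : ℝ, 0 < c ∧ c • y ∈ T ∩ Φ.source ∧ Φ (c • y) ∈ e₀.target ∧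
        e.symm y = e₀.symm (Φ (c • y)) := by
  have hmem : T ∩ (Φ.source ∩ Φ ⁻¹' e₀.target) ∈ 𝓝 0 := Filter.inter_mem hT
    ((Φ.isOpen_inter_preimage e₀.open_target).mem_nhds ⟨h0, by
      rw [Set.mem_preimage, hΦ0]; exact e₀.map_source hp⟩)
  obtain ⟨r, hr, hball⟩ := Metric.mem_nhds_iff.1 hmem
  set b := OpenPartialHomeomorph.univBall (0 : EuclideanSpace ℝ (Fin n)) r with hb
  have hbm : ∀ y, b y ∈ T ∩ (Φ.source ∩ Φ ⁻¹' e₀.target) := fun y => hball (by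
    rw [← OpenPartialHomeomorph.univBall_target _ hr]
    exact b.map_source (by rw [hb, OpenPartialHomeomorph.univBall_source]; trivial))
  have hbt : b.target = Metric.ball 0 r := OpenPartialHomeomorph.univBall_target _ hr
  have hb0 : b 0 = 0 := OpenPartialHomeomorph.univBall_apply_zero _ _
  set Θ := b.trans Φ with hΘ
  have hΘs : Θ.source = Set.univ := by
    rw [hΘ, OpenPartialHomeomorph.trans_source, hb, OpenPartialHomeomorph.univBall_source,
      Set.univ_inter]
    exact Set.eq_univ_of_forall fun y => (hbm y).2.1
  have hs : ContDiffOn ℝ ∞ Θ Θ.source := h.comp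
    OpenPartialHomeomorph.contDiff_univBall.contDiffOn fun y _ => (hbm y).2.1
  have ht : ContDiffOn ℝ ∞ Θ.symm Θ.target := by
    have hbs : ContDiffOn ℝ ∞ b.symm (Metric.ball 0 r) :=
      OpenPartialHomeomorph.contDiffOn_univBall_symm
    refine hbs.comp (f := Φ.symm)
      (h'.mono fun y hy => ((b.trans_target Φ).subset hy).1) fun y hy => ?_
    rw [← hbt]
    exact ((b.trans_target Φ).subset hy).2
  have hΘ0 : Θ 0 = e₀ p := by
    change Φ (b 0) = e₀ p
    rw [hb0, hΦ0]
  have h0s : (0 : EuclideanSpace ℝ (Fin n)) ∈ Θ.source := hΘs ▸ Set.mem_univ _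
  refine ⟨e₀.trans Θ.symm, trans_mem_maximalAtlas he ht hs, ?_, ?_, ?_, fun y => ?_⟩
  · rw [OpenPartialHomeomorph.trans_target]
    refine Set.eq_univ_of_forall fun y => ⟨?_, (hbm y).2.2⟩
    change y ∈ Θ.source
    exact hΘs ▸ Set.mem_univ y
  · rw [OpenPartialHomeomorph.trans_source]
    refine ⟨hp, ?_⟩
    rw [Set.mem_preimage, ← hΘ0]
    exact Θ.map_source h0s
  · change Θ.symm (e₀ p) = 0
    rw [← hΘ0, Θ.left_inv h0s]
  · obtain ⟨c, hc, hcy⟩ := univBall_apply_eq_smul hr y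
    have hy := hbm y
    rw [hb, hcy] at hy
    refine ⟨c, hc, ⟨hy.1, hy.2.1⟩, hy.2.2, ?_⟩
    rw [← hcy]
    rfl

end AdaptedChart

/-! ### The two sides of the seam in a chart -/

section Sides

attribute [local instance] chartedSpaceSelf

variable {m : ℕ} {X : Type*} [TopologicalSpace X] [ChartedSpace (EuclideanSpace ℝ (Fin (m + 1))) X]
  [IsManifold (𝓡 (m + 1)) ∞ X] {A B : Set X}
  {e : OpenPartialHomeomorph X (EuclideanSpace ℝ (Fin (m + 1)))} {p : X}

/-- The reflection `y ↦ -y` exchanges the sides. -/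
theorem IsSeamChart.trans_neg (h : IsSeamChart B A e) :
    IsSeamChart A B
      (e.trans (Homeomorph.neg (EuclideanSpace ℝ (Fin (m + 1)))).toOpenPartialHomeomorph) where
  mem_maximalAtlas := trans_mem_maximalAtlas h.mem_maximalAtlas contDiff_neg.contDiffOn
    contDiff_neg.contDiffOn
  target_eq := by
    rw [OpenPartialHomeomorph.trans_target, h.target_eq, Set.preimage_univ, Set.inter_univ]
    rfl
  mem_left x hx := by
    have hx' : x ∈ e.source := ((e.trans_source _).subset hx).1
    rw [h.mem_right x hx']
    change _ ↔ -(e x 0) ≤ 0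
    rw [neg_nonpos]
  mem_right x hx := by
    have hx' : x ∈ e.source := ((e.trans_source _).subset hx).1
    rw [h.mem_left x hx']
    change _ ↔ 0 ≤ -(e x 0)
    rw [neg_nonneg]

/-- A chart in which the seam is a hyperplane has `A` on one side and `B` on the other. -/
theorem exists_isSeamChart (he : e ∈ IsManifold.maximalAtlas (𝓡 (m + 1)) ∞ X)
    (het : e.target = Set.univ) (hA : IsClosed A) (hB : IsClosed B) (hAB : A ∪ B = Set.univ)
    (hS : ∀ y, e.symm y ∈ A ∩ B ↔ y 0 = 0) (hp : p ∈ e.source) (hp0 : e p = 0)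
    (hpA : p ∈ closure Aᶜ) (hpB : p ∈ closure Bᶜ) :
    ∃ e' : OpenPartialHomeomorph X (EuclideanSpace ℝ (Fin (m + 1))),
      IsSeamChart A B e' ∧ p ∈ e'.source ∧ e' p = 0 := by
  have hmt : ∀ y, y ∈ e.target := fun y => het ▸ Set.mem_univ y
  have hc : Continuous e.symm := by
    have := e.continuousOn_symm
    rwa [het, continuousOn_univ] at this
  have hcov : ∀ x, x ∈ A ∨ x ∈ B := fun x => hAB.symm.subset (Set.mem_univ x)
  have hproj : IsLinearMap ℝ fun y : EuclideanSpace ℝ (Fin (m + 1)) => y 0 :=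
    ⟨fun _ _ => rfl, fun _ _ => rfl⟩
  -- A convex set off the hyperplane is connected and avoids the seam, so it lies in the complement
  -- of `A` or in that of `B`.
  have hside : ∀ C : Set (EuclideanSpace ℝ (Fin (m + 1))), Convex ℝ C → (∀ y ∈ C, y 0 ≠ 0) →
      (∀ y ∈ C, e.symm y ∉ B) ∨ ∀ y ∈ C, e.symm y ∉ A := by
    intro C hC hC0
    have hpre := hC.isPreconnected
    have h1 := hpre.subset_or_subset (hB.isOpen_compl.preimage hc) (hA.isOpen_compl.preimage hc)
      (Set.disjoint_left.2 fun y hyB hyA => (hcov (e.symm y)).elim hyA hyB) (fun y hy => by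
        by_contra hne
        rw [Set.mem_union, not_or] at hne
        exact hC0 y hy ((hS y).1 ⟨not_not.1 hne.2, not_not.1 hne.1⟩))
    exact h1
  have hposC : Convex ℝ {y : EuclideanSpace ℝ (Fin (m + 1)) | 0 < y 0} :=
    convex_halfSpace_gt hproj 0
  have hnegC : Convex ℝ {y : EuclideanSpace ℝ (Fin (m + 1)) | y 0 < 0} :=
    convex_halfSpace_lt hproj 0
  have hacc : ∀ D : Set X, p ∈ closure Dᶜ → ∃ y, e.symm y ∉ D := by
    intro D hD
    obtain ⟨x, hx, hxD⟩ := mem_closure_iff.1 hD e.source e.open_source hp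
    exact ⟨e x, by rwa [e.left_inv hx]⟩
  have hmk : ∀ A' B' : Set X, (∀ y, e.symm y ∈ A' ∧ e.symm y ∈ B' ↔ y 0 = 0) →
      (∀ x, x ∈ A' ∨ x ∈ B') →
      (∀ y ∈ {y : EuclideanSpace ℝ (Fin (m + 1)) | 0 < y 0}, e.symm y ∉ A') →
      (∀ y ∈ {y : EuclideanSpace ℝ (Fin (m + 1)) | y 0 < 0}, e.symm y ∉ B') →
      IsSeamChart A' B' e := by
    intro A' B' hS' hcov' h1 h2
    refine ⟨he, het, fun x hx => ?_, fun x hx => ?_⟩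
    · have h3 := hS' (e x)
      have h4 := h1 (e x)
      have h5 := h2 (e x)
      rw [e.left_inv hx] at h3 h4 h5
      refine ⟨fun h => not_lt.1 fun hlt => h4 hlt h, fun h => ?_⟩
      rcases h.lt_or_eq with h | h
      · exact (hcov' x).resolve_right (h5 h)
      · exact (h3.2 h).1
    · have h3 := hS' (e x)
      have h4 := h1 (e x)
      have h5 := h2 (e x)
      rw [e.left_inv hx] at h3 h4 h5
      refine ⟨fun h => not_lt.1 fun hlt => h5 hlt h, fun h => ?_⟩
      rcases h.lt_or_eq with h | h
      · exact (hcov' x).resolve_left (h4 h)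
      · exact (h3.2 h.symm).2
  -- Both open half-spaces cannot belong to the same piece, since points outside that piece
  -- accumulate at `p`.
  have hnot : ∀ D : Set X, p ∈ closure Dᶜ → (∀ y, y 0 = 0 → e.symm y ∈ D) →
      (∀ y ∈ {y : EuclideanSpace ℝ (Fin (m + 1)) | 0 < y 0}, e.symm y ∈ D) →
      ¬ ∀ y ∈ {y : EuclideanSpace ℝ (Fin (m + 1)) | y 0 < 0}, e.symm y ∈ D := by
    intro D hD h0 h1 h2
    obtain ⟨y, hy⟩ := hacc D hD
    rcases lt_trichotomy (y 0) 0 with h | h | h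
    exacts [hy (h2 y h), hy (h0 y h), hy (h1 y h)]
  rcases hside _ hposC (fun y hy => ne_of_gt hy) with h1 | h1 <;>
  rcases hside _ hnegC (fun y hy => ne_of_lt hy) with h2 | h2
  · exact absurd (fun y hy => (hcov (e.symm y)).resolve_right (h2 y hy)) (hnot A hpA
      (fun y hy => ((hS y).2 hy).1) fun y hy => (hcov (e.symm y)).resolve_right (h1 y hy))
  · have h3 := hmk B A (fun y => and_comm.trans (hS y)) (fun x => (hcov x).symm) h1 h2
    refine ⟨_, h3.trans_neg, ?_, ?_⟩
    · rw [OpenPartialHomeomorph.trans_source]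
      exact ⟨hp, trivial⟩
    · change -(e p) = 0
      rw [hp0, neg_zero]
  · exact ⟨e, hmk A B hS hcov h1 h2, hp, hp0⟩
  · exact absurd (fun y hy => (hcov (e.symm y)).resolve_left (h2 y hy)) (hnot B hpB
      (fun y hy => ((hS y).2 hy).2) fun y hy => (hcov (e.symm y)).resolve_left (h1 y hy))

end Sides

end Gluing

namespace Gluing

/-! ### Straightening the seam -/

section Straightening

attribute [local instance] chartedSpaceSelf

variable {m : ℕ} {M : Type*} [TopologicalSpace M] [ChartedSpace (EuclideanHalfSpace (m + 1)) M]
  [IsManifold (𝓡∂ (m + 1)) ∞ M]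
  {X : Type*} [TopologicalSpace X] [ChartedSpace (EuclideanSpace ℝ (Fin (m + 1))) X]
  {e₀ : OpenPartialHomeomorph X (EuclideanSpace ℝ (Fin (m + 1)))}
  {ι : M → X} {x : M} {q : FormField (𝓡 (m + 1)) X} {g : SmoothMetric (𝓡∂ (m + 1)) M}

/-- Interior points of the piece accumulate at every point of it, including boundary points; so both
pieces really appear near each point of the seam. -/
theorem mem_closure_interior (x : M) : x ∈ closure {x' | ¬ (𝓡∂ (m + 1)).IsBoundaryPoint x'} := by
  have h1 := (𝓡∂ (m + 1)).range_subset_closure_interior (mem_extChartAt_target (I := 𝓡∂ (m + 1)) x |>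
    (extChartAt_target_subset_range x ·))
  have h2 := continuousAt_extChartAt_symm (I := 𝓡∂ (m + 1)) x
  have h3 : Filter.Tendsto (extChartAt (𝓡∂ (m + 1)) x).symm
      (𝓝[interior (Set.range (𝓡∂ (m + 1)))] (extChartAt (𝓡∂ (m + 1)) x x)) (𝓝 x) := by
    have := h2.tendsto.mono_left (nhdsWithin_le_nhds
      (s := interior (Set.range (𝓡∂ (m + 1)))))
    rwa [extChartAt_to_inv] at this
  have : (𝓝[interior (Set.range (𝓡∂ (m + 1)))] (extChartAt (𝓡∂ (m + 1)) x x)).NeBot :=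
    mem_closure_iff_nhdsWithin_neBot.1 h1
  refine mem_closure_of_tendsto h3 ?_
  have h4 : ∀ᶠ z in 𝓝[Set.range (𝓡∂ (m + 1))] (extChartAt (𝓡∂ (m + 1)) x x),
      z ∈ (extChartAt (𝓡∂ (m + 1)) x).target := extChartAt_target_mem_nhdsWithin x
  filter_upwards [self_mem_nhdsWithin, h4.filter_mono (nhdsWithin_mono _ interior_subset)]
    with z hz hzt
  rw [isBoundaryPoint_symm_iff hzt, ← mem_frontier_halfSpace]
  exact fun h => h.2 hz

/-- `ι` in coordinates is defined only on a half-space. A map is built on a full neighbourhood out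
of its boundary values alone, extended affinely in the normal direction with the normal derivative
at the base point. It has the same derivative there, so it is a local diffeomorphism, and it takes
the hyperplane to the seam. -/
theorem IsMetricEmbedding.exists_straightening (h : IsMetricEmbedding g ι q)
    (he : e₀ ∈ IsManifold.maximalAtlas (𝓡 (m + 1)) ∞ X) (hx : ι x ∈ e₀.source)
    (hxb : (𝓡∂ (m + 1)).IsBoundaryPoint x) :
    ∃ Φ : OpenPartialHomeomorph (EuclideanSpace ℝ (Fin (m + 1))) (EuclideanSpace ℝ (Fin (m + 1))),
      0 ∈ Φ.source ∧ Φ 0 = e₀ (ι x) ∧ ContDiffOn ℝ ∞ Φ Φ.source ∧ ContDiffOn ℝ ∞ Φ.symm Φ.target ∧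
      ∀ v ∈ Φ.source, v 0 = 0 → extChartAt (𝓡∂ (m + 1)) x x + v ∈ pieceDomain (𝓡∂ (m + 1)) ι x e₀ ∧
        Φ v = pieceMap (𝓡∂ (m + 1)) ι x e₀ (extChartAt (𝓡∂ (m + 1)) x x + v) := by
  set I := 𝓡∂ (m + 1) with hI
  set z₀ := extChartAt I x x with hz₀
  set s := pieceDomain I ι x e₀ with hs
  set ψ := pieceMap I ι x e₀ with hψ
  have hz₀0 : z₀ 0 = 0 := isBoundaryPoint_iff_coord.1 hxb
  have hz₀s : z₀ ∈ s := extChartAt_mem_pieceDomain hx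
  have hψs : ContDiffOn ℝ ∞ ψ s := contDiffOn_pieceMap he h.contMDiff
  set D := fderivWithin ℝ ψ s z₀ with hD
  set e1 : EuclideanSpace ℝ (Fin (m + 1)) := EuclideanSpace.single 0 1
  set π : EuclideanSpace ℝ (Fin (m + 1)) →L[ℝ] ℝ := EuclideanSpace.proj 0 with hπ
  set P : EuclideanSpace ℝ (Fin (m + 1)) →L[ℝ] EuclideanSpace ℝ (Fin (m + 1)) :=
    ContinuousLinearMap.id ℝ _ - π.smulRight e1 with hP
  have hP0 : ∀ v, P v 0 = 0 := fun v => by simp [hP, hπ, e1]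
  have hPv : ∀ v : EuclideanSpace ℝ (Fin (m + 1)), v 0 = 0 → P v = v := fun v hv => by
    simp [hP, hπ, hv]
  -- `P` projects onto the hyperplane along `e1`, so `ψ` is evaluated at boundary points only.
  set F : EuclideanSpace ℝ (Fin (m + 1)) → EuclideanSpace ℝ (Fin (m + 1)) :=
    fun v => ψ (z₀ + P v) + π v • D e1 with hF
  set O := (fun v => z₀ + P v) ⁻¹' pieceOpen I ι x e₀ with hO
  have hOo : IsOpen O := (isOpen_pieceOpen h.contMDiff.continuous).preimage (by fun_prop)
  have hmaps : Set.MapsTo (fun v => z₀ + P v) O s := fun v hv => by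
    refine ⟨?_, hv⟩
    rw [hI, range_halfSpace]
    change 0 ≤ z₀ 0 + P v 0
    rw [hz₀0, hP0, add_zero]
  have h0O : (0 : EuclideanSpace ℝ (Fin (m + 1))) ∈ O := by
    change z₀ + P 0 ∈ pieceOpen I ι x e₀
    rw [map_zero, add_zero]
    exact hz₀s.2
  have hFs : ContDiffOn ℝ ∞ F O :=
    (hψs.comp (f := fun v => z₀ + P v) (by fun_prop) hmaps).add (by fun_prop)
  have hFd : HasFDerivAt F D 0 := by
    have h1 : HasFDerivWithinAt ψ D s (z₀ + P 0) := by
      rw [map_zero, add_zero]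
      exact (hψs.differentiableOn (by simp) z₀ hz₀s).hasFDerivWithinAt
    have h2 : HasFDerivAt (fun v => z₀ + P v) P 0 := P.hasFDerivAt.const_add z₀
    have h3 : HasFDerivAt (fun v => ψ (z₀ + P v)) (D.comp P) 0 :=
      (HasFDerivWithinAt.comp (g := ψ) (0 : EuclideanSpace ℝ (Fin (m + 1))) h1 h2.hasFDerivWithinAt hmaps).hasFDerivAt
        (hOo.mem_nhds h0O)
    have h4 := h3.add ((π.smulRight (D e1)).hasFDerivAt (x := 0))
    convert! h4 using 1
    ext1 v
    simp [hP]
  have hinv : (fderiv ℝ F 0).IsInvertible := by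
    rw [hFd.fderiv]
    exact h.isInvertible_fderivWithin he hz₀s
  obtain ⟨Φ, h0, hΦF, hΦO, hΦ, hΦ'⟩ := exists_openPartialHomeomorph (hOo.mem_nhds h0O) hFs hinv
  refine ⟨Φ, h0, ?_, hΦ, hΦ', fun v hv hv0 => ?_⟩
  · rw [hΦF]
    simp only [hF, map_zero, add_zero, zero_smul]
    exact pieceMap_extChartAt
  · have h1 := hmaps (hΦO hv)
    have hπv : π v = 0 := hv0
    rw [hΦF]
    simp only [hF, hπv, zero_smul, add_zero]
    simp only [hPv v hv0] at h1 ⊢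
    exact ⟨h1, trivial⟩

end Straightening

/-! ### Existence of seam charts -/

section SeamCharts

attribute [local instance] chartedSpaceSelf

variable {m : ℕ} {M N : Type*}
  [TopologicalSpace M] [ChartedSpace (EuclideanHalfSpace (m + 1)) M] [IsManifold (𝓡∂ (m + 1)) ∞ M]
  [TopologicalSpace N] [ChartedSpace (EuclideanHalfSpace (m + 1)) N] [IsManifold (𝓡∂ (m + 1)) ∞ N]
  {X : Type*} [TopologicalSpace X] [ChartedSpace (EuclideanSpace ℝ (Fin (m + 1))) X]
  {ι : M → X} {ι' : N → X} {x : M} {x' : N} {q : FormField (𝓡 (m + 1)) X}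
  {g : SmoothMetric (𝓡∂ (m + 1)) M} {g' : SmoothMetric (𝓡∂ (m + 1)) N}

variable (m) in
/-- `X` is the union of the images of `ι` and `ι'`, which meet along the boundaries. -/
structure IsBoundaryUnion (ι : M → X) (ι' : N → X) : Prop where
  isClosed_left : IsClosed (Set.range ι)
  isClosed_right : IsClosed (Set.range ι')
  union_eq : Set.range ι ∪ Set.range ι' = Set.univ
  mem_right_iff : ∀ x, ι x ∈ Set.range ι' ↔ (𝓡∂ (m + 1)).IsBoundaryPoint x
  mem_left_iff : ∀ x, ι' x ∈ Set.range ι ↔ (𝓡∂ (m + 1)).IsBoundaryPoint x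

theorem mem_closure_compl_range (hι' : Continuous ι')
    (h : ∀ x, ι' x ∈ Set.range ι ↔ (𝓡∂ (m + 1)).IsBoundaryPoint x) :
    ι' x' ∈ closure (Set.range ι)ᶜ := by
  refine closure_mono ?_ (image_closure_subset_closure_image hι' ⟨x', mem_closure_interior (m := m) x', rfl⟩)
  rintro _ ⟨y, hy, rfl⟩
  exact fun hy' => hy ((h y).1 hy')

/-- The straightened hyperplane lies in the seam by construction. Conversely every nearby point of
the seam is the image of a boundary point near `x`, because `ι` is an embedding, and injectivity of
`Φ` puts it on the hyperplane. -/
theorem IsBoundaryUnion.exists_isSeamChart [IsManifold (𝓡 (m + 1)) ∞ X] (hu : IsBoundaryUnion m ι ι')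
    (h : IsMetricEmbedding g ι q) (h' : Continuous ι') {p : X}
    (hp : p ∈ Set.range ι ∩ Set.range ι') :
    ∃ e : OpenPartialHomeomorph X (EuclideanSpace ℝ (Fin (m + 1))),
      IsSeamChart (Set.range ι) (Set.range ι') e ∧ p ∈ e.source ∧ e p = 0 := by
  obtain ⟨⟨x, rfl⟩, hp'⟩ := hp
  have hxb := (hu.mem_right_iff x).1 hp'
  set e₀ := chartAt (EuclideanSpace ℝ (Fin (m + 1))) (ι x) with he₀
  have hem : e₀ ∈ IsManifold.maximalAtlas (𝓡 (m + 1)) ∞ X := IsManifold.chart_mem_maximalAtlas _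
  have hxe : ι x ∈ e₀.source := mem_chart_source _ _
  obtain ⟨Φ, h0, hΦ0, hΦs, hΦs', hΦ⟩ := h.exists_straightening hem hxe hxb
  set z₀ := extChartAt (𝓡∂ (m + 1)) x x with hz₀
  have hz₀0 : z₀ 0 = 0 := isBoundaryPoint_iff_coord.1 hxb
  have hnear : ∀ᶠ x' in 𝓝 x, x' ∈ (extChartAt (𝓡∂ (m + 1)) x).source ∧
      extChartAt (𝓡∂ (m + 1)) x x' - z₀ ∈ Φ.source := by
    refine Filter.Eventually.and (extChartAt_source_mem_nhds x) ?_
    have hc : ContinuousAt (fun x' => extChartAt (𝓡∂ (m + 1)) x x' - z₀) x :=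
      (continuousAt_extChartAt x).sub continuousAt_const
    exact hc.eventually_mem (by rw [← hz₀, sub_self]; exact Φ.open_source.mem_nhds h0)
  -- A neighbourhood `W` of `ι x` whose preimage is small: it excludes seam points coming from a
  -- distant part of the boundary.
  rw [h.isEmbedding.isInducing.nhds_eq_comap] at hnear
  obtain ⟨W, hW, hWx⟩ := Filter.mem_comap.1 hnear
  have hT : (fun v => e₀.symm (Φ v)) ⁻¹' W ∈ 𝓝 0 := by
    have hc : ContinuousAt (fun v => e₀.symm (Φ v)) 0 :=
      ContinuousAt.comp (g := e₀.symm) (by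
        rw [hΦ0]; exact e₀.continuousAt_symm (e₀.map_source hxe)) (Φ.continuousAt h0)
    refine hc.preimage_mem_nhds ?_
    rwa [hΦ0, e₀.left_inv hxe]
  obtain ⟨e, he, het, hpe, hp0, hey⟩ :=
    exists_chart_of_local_diffeomorphism hem hxe h0 hΦ0 hΦs hΦs' hT
  refine Gluing.exists_isSeamChart he het hu.isClosed_left hu.isClosed_right hu.union_eq
    (fun y => ?_) hpe hp0 ?_ (mem_closure_compl_range h.contMDiff.continuous hu.mem_right_iff)
  · obtain ⟨c, hc, ⟨hcT, hcs⟩, hct, hce⟩ := hey y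
    rw [hce]
    constructor
    · rintro ⟨⟨x', hx'⟩, hr⟩
      rw [← hx'] at hr
      have hb' := (hu.mem_right_iff x').1 hr
      obtain ⟨hx's, hx'v⟩ := hWx (show ι x' ∈ W by rw [hx']; exact hcT)
      have hcoord : extChartAt (𝓡∂ (m + 1)) x x' 0 = 0 := by
        rw [← isBoundaryPoint_symm_iff ((extChartAt (𝓡∂ (m + 1)) x).map_source hx's),
          (extChartAt (𝓡∂ (m + 1)) x).left_inv hx's]
        exact hb'
      obtain ⟨-, h2⟩ := hΦ _ hx'v (by
        change extChartAt (𝓡∂ (m + 1)) x x' 0 - z₀ 0 = 0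
        rw [hcoord, hz₀0, sub_self])
      rw [add_sub_cancel, pieceMap, (extChartAt (𝓡∂ (m + 1)) x).left_inv hx's, hx',
        e₀.right_inv hct] at h2
      have h3 := Φ.injOn hx'v hcs h2
      have h4 : (c • y) 0 = 0 := by
        rw [← h3]
        change extChartAt (𝓡∂ (m + 1)) x x' 0 - z₀ 0 = 0
        rw [hcoord, hz₀0, sub_self]
      exact (mul_eq_zero.1 h4).resolve_left hc.ne'
    · intro hy
      obtain ⟨h1, h2⟩ := hΦ _ hcs (by
        change c * y 0 = 0
        rw [hy, mul_zero])
      obtain ⟨h3, h4⟩ := mem_pieceDomain.1 h1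
      rw [h2, pieceMap, e₀.left_inv h4]
      refine ⟨⟨_, rfl⟩, (hu.mem_right_iff _).2 ((isBoundaryPoint_symm_iff h3).2 ?_)⟩
      change z₀ 0 + c * y 0 = 0
      rw [hz₀0, hy, mul_zero, add_zero]
  · obtain ⟨x', hx'⟩ := hp'
    rw [← hx']
    exact mem_closure_compl_range h' hu.mem_left_iff

end SeamCharts

end Gluing

namespace Gluing

/-! ### The mean curvature condition and the union of two pieces -/

section Union

attribute [local instance] chartedSpaceSelf

variable {m : ℕ} {M N : Type*}
  [TopologicalSpace M] [ChartedSpace (EuclideanHalfSpace (m + 1)) M] [IsManifold (𝓡∂ (m + 1)) ∞ M]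
  [TopologicalSpace N] [ChartedSpace (EuclideanHalfSpace (m + 1)) N] [IsManifold (𝓡∂ (m + 1)) ∞ N]
  {X : Type*} [TopologicalSpace X] [ChartedSpace (EuclideanSpace ℝ (Fin (m + 1))) X]
  {ι : M → X} {ι' : N → X} {x : M} {x' : N} {q : FormField (𝓡 (m + 1)) X}
  {g : SmoothMetric (𝓡∂ (m + 1)) M} {g' : SmoothMetric (𝓡∂ (m + 1)) N}
  {e : OpenPartialHomeomorph X (EuclideanSpace ℝ (Fin (m + 1)))} {A B U : Set X} {κ ε : ℝ}

theorem IsSeamChart.preimage_left (h : IsSeamChart A B e) : e.symm ⁻¹' A = lowerHalf m :=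
  Set.ext fun _ => h.symm_mem_left

theorem IsSeamChart.preimage_right (h : IsSeamChart A B e) : e.symm ⁻¹' B = upperHalf m :=
  Set.ext fun _ => h.symm_mem_right

theorem IsMetricEmbedding.scal_eq_of_target_eq (h : IsMetricEmbedding g ι q)
    (he : e ∈ IsManifold.maximalAtlas (𝓡 (m + 1)) ∞ X) (het : e.target = Set.univ)
    (hx : ι x ∈ e.source) (hu : UniqueDiffOn ℝ (e.symm ⁻¹' Set.range ι)) :
    scal g x = scalCoord (e.symm ⁻¹' Set.range ι) (coordMat e q) (e (ι x)) := by
  have h1 := h.scal_eq he isOpen_univ (by rw [het]) hx trivial (by rwa [Set.univ_inter])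
  rwa [Set.univ_inter] at h1

theorem IsMetricEmbedding.smoothMatrixOn_of_target_eq (h : IsMetricEmbedding g ι q)
    (he : e ∈ IsManifold.maximalAtlas (𝓡 (m + 1)) ∞ X) (het : e.target = Set.univ)
    (hu : UniqueDiffOn ℝ (e.symm ⁻¹' Set.range ι)) :
    SmoothMatrixOn (e.symm ⁻¹' Set.range ι) (coordMat e q) :=
  h.smoothMatrixOn_coordMat he (by rw [het]; exact Set.subset_univ _) (fun _ hy => hy) hu

/-- The sign of the jump of the normal derivative is opposite to the sign of the sum of the mean
curvatures. -/
theorem IsBoundaryUnion.jumpTrace_nonpos (hu : IsBoundaryUnion m ι ι')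
    (h : IsMetricEmbedding g ι q) (h' : IsMetricEmbedding g' ι' q)
    (hmean : ∀ x x', ι x = ι' x' → 0 ≤ meanCurv g x + meanCurv g' x')
    (he : IsSeamChart (Set.range ι) (Set.range ι') e) {y : EuclideanSpace ℝ (Fin (m + 1))}
    (hy : y 0 = 0) : jumpTrace (lowerHalf m) (upperHalf m) (coordMat e q) y ≤ 0 := by
  have hyt := he.mem_target y
  have hys := e.map_target hyt
  obtain ⟨x, hx⟩ := he.symm_mem_left.2 hy.le
  obtain ⟨x', hx'⟩ := he.symm_mem_right.2 hy.ge
  have hxx : ι x = ι' x' := hx.trans hx'.symm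
  have hbd : ∀ z, (𝓡∂ (m + 1)).IsBoundaryPoint z → ι z ∈ e.source → e (ι z) 0 = 0 := fun z hz hzs =>
    (he.mem_seam hzs).1 ⟨⟨z, rfl⟩, (hu.mem_right_iff z).2 hz⟩
  have hbd' : ∀ z, (𝓡∂ (m + 1)).IsBoundaryPoint z → ι' z ∈ e.source → e (ι' z) 0 = 0 :=
    fun z hz hzs => (he.mem_seam hzs).1 ⟨(hu.mem_left_iff z).2 hz, ⟨z, rfl⟩⟩
  -- The first piece is the lower side, whose outward normal is opposite to the convention of
  -- `meanCurvCoord`; the second is the upper side.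
  have h1 := h.meanCurv_eq (x := x) he.mem_maximalAtlas he.target_eq
    (by rw [he.preimage_left]; exact uniqueDiffOn_lowerHalf) hbd (σ := -1) (Or.inr rfl)
    (fun z hz => by have := (he.mem_left _ hz).1 ⟨z, rfl⟩; linarith) (by rwa [hx])
    ((hu.mem_right_iff x).1 ⟨x', hxx.symm⟩)
  have h2 := h'.meanCurv_eq (x := x') he.mem_maximalAtlas he.target_eq
    (by rw [he.preimage_right]; exact uniqueDiffOn_upperHalf) hbd' (σ := 1) (Or.inl rfl)
    (fun z hz => by have := (he.mem_right _ hz).1 ⟨z, rfl⟩; linarith) (by rwa [hx'])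
    ((hu.mem_left_iff x').1 ⟨x, hxx⟩)
  rw [he.preimage_left, hx, e.right_inv hyt] at h1
  rw [he.preimage_right, hx', e.right_inv hyt] at h2
  have h0 : 0 < (coordMat e q y)⁻¹ 0 0 :=
    (coordMat_posDef he.mem_maximalAtlas hyt h.symm h.pos).inv.diag_pos
  have hsl : SmoothMatrixOn (lowerHalf m) (coordMat e q) := by
    have := h.smoothMatrixOn_of_target_eq he.mem_maximalAtlas he.target_eq
      (by rw [he.preimage_left]; exact uniqueDiffOn_lowerHalf)
    rwa [he.preimage_left] at this
  have hsu : SmoothMatrixOn (upperHalf m) (coordMat e q) := by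
    have := h'.smoothMatrixOn_of_target_eq he.mem_maximalAtlas he.target_eq
      (by rw [he.preimage_right]; exact uniqueDiffOn_upperHalf)
    rwa [he.preimage_right] at this
  -- With these signs, the sum of the mean curvatures is `-½ √g⁰⁰` times the trace of the jump.
  have h3 := meanCurvCoord_sub (tangentiallyOpenAt_lowerHalf hy) (tangentiallyOpenAt_upperHalf hy)
    hsl hsu hy.le hy.ge h0
  have h4 := hmean x x' hxx
  have h5 : 0 < √((coordMat e q y)⁻¹ 0 0) := Real.sqrt_pos.2 h0
  by_contra hpos
  rw [not_le] at hpos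
  have h6 := mul_pos h5 hpos
  nlinarith

theorem IsBoundaryUnion.goodAt (hu : IsBoundaryUnion m ι ι') [IsManifold (𝓡 (m + 1)) ∞ X]
    (h : IsMetricEmbedding g ι q) (h' : IsMetricEmbedding g' ι' q) (hκ : ∀ x, κ < scal g x)
    (hκ' : ∀ x, κ < scal g' x) {p : X} (hp : p ∉ Set.range ι ∩ Set.range ι') : GoodAt κ q p := by
  have hcov : ∀ z, z ∈ Set.range ι ∨ z ∈ Set.range ι' := fun z =>
    hu.union_eq.symm.subset (Set.mem_univ z)
  rcases hcov p with ⟨x, rfl⟩ | ⟨x, rfl⟩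
  · refine h.goodAt (hκ x) (Filter.mem_of_superset
      (hu.isClosed_right.isOpen_compl.mem_nhds fun hr => hp ⟨⟨x, rfl⟩, hr⟩) fun z hz => ?_)
    exact (hcov z).resolve_right hz
  · refine h'.goodAt (hκ' x) (Filter.mem_of_superset
      (hu.isClosed_left.isOpen_compl.mem_nhds fun hr => hp ⟨hr, ⟨x, rfl⟩⟩) fun z hz => ?_)
    exact (hcov z).resolve_left hz

/-- One seam chart is chosen for each point of the seam; the cut-offs later make the family locally
finite. On each side, smoothness and scalar curvature of `q` in these charts come from the isometric
piece. -/
theorem IsBoundaryUnion.exists_approximation [T2Space X] [SigmaCompactSpace X]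
    [IsManifold (𝓡 (m + 1)) ∞ X] (hu : IsBoundaryUnion m ι ι')
    (h : IsMetricEmbedding g ι q) (h' : IsMetricEmbedding g' ι' q)
    (hκ : ∀ x, κ < scal g x) (hκ' : ∀ x, κ < scal g' x)
    (hmean : ∀ x x', ι x = ι' x' → 0 ≤ meanCurv g x + meanCurv g' x')
    (hU : IsOpen U) (hS : Set.range ι ∩ Set.range ι' ⊆ U) (hε : 0 < ε) :
    ∃ G : SmoothMetric (𝓡 (m + 1)) X, (∀ x, κ < scal G x) ∧
      (∀ x ∉ U, G.inner x = q x) ∧ ∀ x v, |G.inner x v v - q x v v| ≤ ε * q x v v := by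
  choose e he hps hp0 using fun p : ↥(Set.range ι ∩ Set.range ι') =>
    hu.exists_isSeamChart h h'.contMDiff.continuous p.2
  have hl : ∀ i, UniqueDiffOn ℝ ((e i).symm ⁻¹' Set.range ι) := fun i => by
    rw [(he i).preimage_left]; exact uniqueDiffOn_lowerHalf
  have hr : ∀ i, UniqueDiffOn ℝ ((e i).symm ⁻¹' Set.range ι') := fun i => by
    rw [(he i).preimage_right]; exact uniqueDiffOn_upperHalf
  have ha : SeamAtlas (Set.range ι) (Set.range ι') e :=
    ⟨hu.isClosed_left, hu.isClosed_right, hu.union_eq, he,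
      fun x hx => ⟨⟨x, hx⟩, hps ⟨x, hx⟩, hp0 ⟨x, hx⟩⟩⟩
  have hq : PiecewiseMetric κ (fun _ => True) (Set.range ι) (Set.range ι') e q := by
    refine ⟨h.symm, h.pos, fun p hp => hu.goodAt h h' hκ hκ' hp, fun i => ?_, fun i => ?_,
      fun p hp => ⟨⟨p, hp⟩, hps ⟨p, hp⟩, ?_, ?_, trivial⟩⟩
    · rw [← (he i).preimage_left]
      exact h.smoothMatrixOn_of_target_eq (he i).mem_maximalAtlas (he i).target_eq (hl i)
    · rw [← (he i).preimage_right]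
      exact h'.smoothMatrixOn_of_target_eq (he i).mem_maximalAtlas (he i).target_eq (hr i)
    · obtain ⟨x, hx⟩ := hp.1
      have hs := hps ⟨p, hp⟩
      have h1 := h.scal_eq_of_target_eq (x := x) (he ⟨p, hp⟩).mem_maximalAtlas
        (he ⟨p, hp⟩).target_eq (by rwa [hx]) (hl _)
      rw [hx, (he ⟨p, hp⟩).preimage_left] at h1
      exact h1 ▸ hκ x
    · obtain ⟨x, hx⟩ := hp.2
      have hs := hps ⟨p, hp⟩
      have h1 := h'.scal_eq_of_target_eq (x := x) (he ⟨p, hp⟩).mem_maximalAtlas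
        (he ⟨p, hp⟩).target_eq (by rwa [hx]) (hr _)
      rw [hx, (he ⟨p, hp⟩).preimage_right] at h1
      exact h1 ▸ hκ' x
  exact hq.exists_approximation ha
    (fun k y hy => hu.jumpTrace_nonpos h h' hmean (he k) hy) hU hS hε

end Union

theorem IsBoundaryInclusion.isClosedEmbedding {m : ℕ} {Y M : Type*} [TopologicalSpace Y]
    [ChartedSpace (EuclideanSpace ℝ (Fin m)) Y] [TopologicalSpace M]
    [ChartedSpace (EuclideanHalfSpace (m + 1)) M] [IsManifold (𝓡∂ (m + 1)) ∞ M] {j : Y → M}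
    (h : IsBoundaryInclusion m j) : Topology.IsClosedEmbedding j where
  toIsEmbedding := h.isSmoothEmbedding.isEmbedding
  isClosed_range := by
    rw [h.range_eq]
    exact ModelWithCorners.isClosed_boundary (n := ∞) (by simp)

theorem IsBoundaryInclusion.mem_range_iff {m : ℕ} {Y M : Type*} [TopologicalSpace Y]
    [ChartedSpace (EuclideanSpace ℝ (Fin m)) Y] [TopologicalSpace M]
    [ChartedSpace (EuclideanHalfSpace (m + 1)) M] {j : Y → M}
    (h : IsBoundaryInclusion m j) {x : M} :
    (∃ y, j y = x) ↔ (𝓡∂ (m + 1)).IsBoundaryPoint x := by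
  change x ∈ Set.range j ↔ x ∈ (𝓡∂ (m + 1)).boundary M
  rw [h.range_eq]

end Gluing

end

theorem mainTheorem8 {m : ℕ} (κ : ℝ)
    {X₁ X₂ Y₁ Y₂ : Type*}
    -- two smooth manifolds with boundary, of dimension m + 1
    [TopologicalSpace X₁] [T2Space X₁] [SecondCountableTopology X₁]
    [ChartedSpace (EuclideanHalfSpace (m + 1)) X₁] [IsManifold (𝓡∂ (m + 1)) ∞ X₁]
    [TopologicalSpace X₂] [T2Space X₂] [SecondCountableTopology X₂]
    [ChartedSpace (EuclideanHalfSpace (m + 1)) X₂] [IsManifold (𝓡∂ (m + 1)) ∞ X₂]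
    -- their boundaries, as smooth manifolds of dimension m
    [TopologicalSpace Y₁] [ChartedSpace (EuclideanSpace ℝ (Fin m)) Y₁] [IsManifold (𝓡 m) ∞ Y₁]
    [TopologicalSpace Y₂] [ChartedSpace (EuclideanSpace ℝ (Fin m)) Y₂] [IsManifold (𝓡 m) ∞ Y₂]
    (j₁ : Y₁ → X₁) (hj₁ : Gluing.IsBoundaryInclusion m j₁)
    (j₂ : Y₂ → X₂) (hj₂ : Gluing.IsBoundaryInclusion m j₂)
    -- the Riemannian metrics and the isometry between the boundaries
    (g₁ : Gluing.SmoothMetric (𝓡∂ (m + 1)) X₁) (g₂ : Gluing.SmoothMetric (𝓡∂ (m + 1)) X₂)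
    (γ : Diffeomorph (𝓡 m) (𝓡 m) Y₁ Y₂ ∞) (hγ : Gluing.IsBoundaryIsometry g₁ g₂ j₁ j₂ γ)
    -- the curvature assumptions
    (hscal₁ : ∀ x, κ < Gluing.scal g₁ x) (hscal₂ : ∀ x, κ < Gluing.scal g₂ x)
    (hmean : ∀ y : Y₁, 0 ≤ Gluing.meanCurv g₁ (j₁ y) + Gluing.meanCurv g₂ (j₂ (γ y)))
    -- the smooth structure of the glued manifold, and the glued continuous metric on it
    [ChartedSpace (EuclideanSpace ℝ (Fin (m + 1))) (Gluing.Glued j₁ j₂ γ)]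
    [IsManifold (𝓡 (m + 1)) ∞ (Gluing.Glued j₁ j₂ γ)]
    (hι₁ : ContMDiff (𝓡∂ (m + 1)) (𝓡 (m + 1)) ∞ (Gluing.Glued.inl j₁ j₂ γ))
    (hι₂ : ContMDiff (𝓡∂ (m + 1)) (𝓡 (m + 1)) ∞ (Gluing.Glued.inr j₁ j₂ γ))
    (g : Gluing.ContinuousMetric (𝓡 (m + 1)) (Gluing.Glued j₁ j₂ γ))
    (hg₁ : Gluing.RestrictsTo g (Gluing.Glued.inl j₁ j₂ γ) g₁)
    (hg₂ : Gluing.RestrictsTo g (Gluing.Glued.inr j₁ j₂ γ) g₂)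
    -- an arbitrarily small neighbourhood of the seam, and an arbitrarily small tolerance
    (U : Set (Gluing.Glued j₁ j₂ γ)) (hU : IsOpen U) (hseam : Gluing.Glued.seam j₁ j₂ γ ⊆ U)
    (ε : ℝ) (hε : 0 < ε) :
    ∃ gapp : Gluing.SmoothMetric (𝓡 (m + 1)) (Gluing.Glued j₁ j₂ γ),
      (∀ p, κ < Gluing.scal gapp p) ∧
      (∀ p, p ∉ U → gapp.inner p = g.inner p) ∧
      (∀ (p : Gluing.Glued j₁ j₂ γ) (v : TangentSpace (𝓡 (m + 1)) p),
        |gapp.inner p v v - g.inner p v v| ≤ ε * g.inner p v v) := by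
  have hc₁ := hj₁.isClosedEmbedding
  have hc₂ := hj₂.isClosedEmbedding
  have hγh : IsHomeomorph γ := γ.toHomeomorph.isHomeomorph
  have : LocallyCompactSpace X₁ := Manifold.locallyCompact_of_finiteDimensional (𝓡∂ (m + 1))
  have : LocallyCompactSpace X₂ := Manifold.locallyCompact_of_finiteDimensional (𝓡∂ (m + 1))
  -- The pieces are locally compact, Hausdorff and second countable, hence normal, and the quotient
  -- inherits the separation needed for partitions of unity.
  have : T2Space (Gluing.Glued j₁ j₂ γ) := Gluing.Glued.t2Space hc₁ hc₂ hγh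
  have : SigmaCompactSpace (Gluing.Glued j₁ j₂ γ) := Gluing.Glued.sigmaCompactSpace
  have hl := Gluing.Glued.isClosedEmbedding_inl hc₁ hc₂ hγh
  have hr := Gluing.Glued.isClosedEmbedding_inr hc₁ hc₂ hγh
  have hu : Gluing.IsBoundaryUnion m (Gluing.Glued.inl j₁ j₂ γ) (Gluing.Glued.inr j₁ j₂ γ) := by
    refine ⟨hl.isClosed_range, hr.isClosed_range, Gluing.Glued.range_union, fun x => ?_, fun x => ?_⟩
    · rw [← hj₁.mem_range_iff]
      constructor
      · rintro ⟨b, hb⟩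
        obtain ⟨y, hy, -⟩ := (Gluing.Glued.inl_eq_inr_iff hc₁.injective).1 hb.symm
        exact ⟨y, hy⟩
      · rintro ⟨y, rfl⟩
        exact ⟨_, ((Gluing.Glued.inl_eq_inr_iff hc₁.injective).2 ⟨y, rfl, rfl⟩).symm⟩
    · rw [← hj₂.mem_range_iff]
      constructor
      · rintro ⟨a, ha⟩
        obtain ⟨y, -, hy⟩ := (Gluing.Glued.inl_eq_inr_iff hc₁.injective).1 ha
        exact ⟨_, hy⟩
      · rintro ⟨y, rfl⟩
        obtain ⟨y, rfl⟩ := hγh.surjective y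
        exact ⟨_, (Gluing.Glued.inl_eq_inr_iff hc₁.injective).2 ⟨y, rfl, rfl⟩⟩
  have h₁ : Gluing.IsMetricEmbedding g₁ (Gluing.Glued.inl j₁ j₂ γ) g.inner :=
    ⟨hl.isEmbedding, hι₁, g.symm, g.pos, hg₁⟩
  have h₂ : Gluing.IsMetricEmbedding g₂ (Gluing.Glued.inr j₁ j₂ γ) g.inner :=
    ⟨hr.isEmbedding, hι₂, g.symm, g.pos, hg₂⟩
  refine hu.exists_approximation h₁ h₂ hscal₁ hscal₂ (fun x x' hxx => ?_) hU ?_ hε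
  · obtain ⟨y, rfl, rfl⟩ := (Gluing.Glued.inl_eq_inr_iff hc₁.injective).1 hxx
    exact hmean y
  · rwa [Gluing.Glued.range_inter hc₁.injective]
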